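/- Let $M$ be a nearly Kähler six-manifold: a compact Riemannian spin manifold of dimension six without boundary, with real spinor bundle $SM$ (Clifford convention $v\cdot v=-|v|^2$), together with a spinor $\psi$ of unit length satisfying $\nabla_X\psi=\tfrac12 X\cdot\psi$ for all tangent vectors $X$, where $\nabla$ is the Levi-Civita connection. Let $P$ be the three-form $P(X,Y,Z)=(\psi,\,X\cdot Y\cdot Z\cdot\psi)$, for orthogonal $X,Y,Z$, and for $t\in\mathbb{R}$ let $\nabla^t_X\eta=\nabla_X\eta+\tfrac t4(\iota_XP)\cdot\eta$ be the associated connection on $SM$. Let $\mathcal{P}\to M$ be a smooth principal bundle whose structure group $K$ is a Lie group with semisimple Lie algebra $\mathfrak{k}$ which admits an $\mathrm{Ad}(K)$-invariant inner product (automatic for compact $K$), and let $\mathrm{Ad}_{\mathcal P}$ be the adjoint bundle with fibre $\mathfrak k$. Let $A$ be a connection on $\mathcal P$ with curvature $F$ which is an instanton, i.e. $F\cdot\psi=0$, and which is irreducible, i.e. its holonomy group equals $K$. The space of infinitesimal deformations of $A$ is $$\{\varepsilon\in\Omega^1(\mathrm{Ad}_{\mathcal P}) : d^A\varepsilon\cdot\psi=0,\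 (d^A)^*\varepsilon=0\}.$$ Let $D^{t,A}=\sum_j e_j\cdot\nabla^{t,A}_{e_j}$ be the Dirac operator on $\Gamma(SM\otimes\mathrm{Ad}_{\mathcal P})$ constructed from $\nabla^t$ and $A$. Then $D^{1/3,A}-2:\Gamma(SM\otimes\mathrm{Ad}_{\mathcal P})\to\Gamma(SM\otimes\mathrm{Ad}_{\mathcal P})$ is an elliptic differential operator of first order, and the map $\varepsilon\mapsto\varepsilon\cdot\psi$ is a linear isomorphism from the space of infinitesimal deformations of $A$ onto the kernel of $D^{1/3,A}-2$. -/

import Mathlib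

open Bundle Manifold ContDiff TensorProduct

noncomputable section

namespace NearlyKahler

/-- The model space of a six-manifold. -/
abbrev R6 := EuclideanSpace ℝ (Fin 6)

/-- The model fibre of the real spinor bundle in dimension six. -/
abbrev R8 := EuclideanSpace ℝ (Fin 8)

instance instFiniteDimensionalTangentSpace {E : Type*} [NormedAddCommGroup E] [NormedSpace ℝ E]
    [FiniteDimensional ℝ E] {H : Type*} [TopologicalSpace H] (I : ModelWithCorners ℝ E H)
    {M : Type*} [TopologicalSpace M] [ChartedSpace H M] (x : M) :
    FiniteDimensional ℝ (TangentSpace I x) :=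
  inferInstanceAs (FiniteDimensional ℝ E)

instance instLieGroupMinSmoothness {E : Type*} [NormedAddCommGroup E] [NormedSpace ℝ E]
    {K : Type*} [TopologicalSpace K] [Group K] [ChartedSpace E K] [LieGroup 𝓘(ℝ, E) ∞ K] :
    LieGroup 𝓘(ℝ, E) (minSmoothness ℝ 3) K := by
  rw [minSmoothness_of_isRCLikeNormedField]
  infer_instance

/-! ## Spin geometry -/

section Spin

variable {M : Type*} [TopologicalSpace M] [ChartedSpace R6 M] [IsManifold (𝓡 6) ∞ M]
  [RiemannianBundle (fun x : M ↦ TangentSpace (𝓡 6) x)]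

/-- The Levi-Civita connection: the metric and torsion-free covariant derivative on `TM`.
(In Mathlib's convention `nabla Y x v` is `∇_v Y` at `x`.) -/
structure IsLeviCivita
    (nabla : CovariantDerivative (𝓡 6) R6 (fun x : M ↦ TangentSpace (𝓡 6) x)) : Prop where
  metric : ∀ (x : M) (X Y : Π y : M, TangentSpace (𝓡 6) y),
    MDifferentiableAt (𝓡 6) ((𝓡 6).prod 𝓘(ℝ, R6)) (fun y ↦ TotalSpace.mk' R6 y (X y)) x →
    MDifferentiableAt (𝓡 6) ((𝓡 6).prod 𝓘(ℝ, R6)) (fun y ↦ TotalSpace.mk' R6 y (Y y)) x →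
    ∀ v : TangentSpace (𝓡 6) x,
      mvfderiv (𝓡 6) (fun y ↦ inner ℝ (X y) (Y y)) x v =
        inner ℝ (nabla X x v) (Y x) + inner ℝ (X x) (nabla Y x v)
  torsion_eq_zero : nabla.torsion = 0

variable (M) in
/-- A spin structure on the Riemannian six-manifold `M`, given by its real spinor bundle `S`: a
Riemannian vector bundle of rank eight with a Clifford multiplication. Since the Clifford algebra
of a six-dimensional Euclidean space (with `v² = -|v|²`) is the algebra of real `8 × 8` matrices,
each fibre is the irreducible real Clifford module.

The orientation is recorded by the Clifford action `vol` of the volume form.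

The Levi-Civita connection `LC` of `M` and the spin connection `nabla` which it induces on `S`
are uniquely determined by the conditions below: `nabla` is the metric connection on `S` for which
Clifford multiplication is parallel. -/
structure SpinStructure (S : M → Type*) [TopologicalSpace (TotalSpace R8 S)]
    [∀ x, NormedAddCommGroup (S x)] [∀ x, InnerProductSpace ℝ (S x)] [FiberBundle R8 S]
    [VectorBundle ℝ R8 S] [ContMDiffVectorBundle ∞ R8 S (𝓡 6)]
    [IsContMDiffRiemannianBundle (𝓡 6) ∞ R8 S] where
  /-- Clifford multiplication `v · s`. -/
  cliff : Π x : M, TangentSpace (𝓡 6) x →L[ℝ] S x →L[ℝ] S x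
  contMDiff_cliff : ContMDiff (𝓡 6) ((𝓡 6).prod 𝓘(ℝ, R6 →L[ℝ] R8 →L[ℝ] R8)) ∞
    (fun x ↦ TotalSpace.mk' (R6 →L[ℝ] R8 →L[ℝ] R8)
      (E := fun x ↦ TangentSpace (𝓡 6) x →L[ℝ] S x →L[ℝ] S x) x (cliff x))
  cliff_cliff : ∀ (x : M) (v : TangentSpace (𝓡 6) x) (s : S x),
    cliff x v (cliff x v s) = -(inner ℝ v v : ℝ) • s
  cliff_skew : ∀ (x : M) (v : TangentSpace (𝓡 6) x) (s s' : S x),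
    inner ℝ (cliff x v s) s' = -(inner ℝ s (cliff x v s') : ℝ)
  /-- The Clifford action of the volume form of the orientation. -/
  vol : Π x : M, S x →L[ℝ] S x
  contMDiff_vol : ContMDiff (𝓡 6) ((𝓡 6).prod 𝓘(ℝ, R8 →L[ℝ] R8)) ∞
    (fun x ↦ TotalSpace.mk' (R8 →L[ℝ] R8) (E := fun x ↦ S x →L[ℝ] S x) x (vol x))
  vol_eq : ∀ x : M, ∃ e : OrthonormalBasis (Fin 6) ℝ (TangentSpace (𝓡 6) x),
    vol x = cliff x (e 0) ∘L cliff x (e 1) ∘L cliff x (e 2) ∘L cliff x (e 3) ∘L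
      cliff x (e 4) ∘L cliff x (e 5)
  /-- The Levi-Civita connection of `M`. -/
  LC : CovariantDerivative (𝓡 6) R6 (fun x : M ↦ TangentSpace (𝓡 6) x)
  isLeviCivita : IsLeviCivita LC
  contMDiff_LC : LC.ContMDiffCovariantDerivative ∞
  /-- The spin connection. -/
  nabla : CovariantDerivative (𝓡 6) R8 S
  contMDiff_nabla : nabla.ContMDiffCovariantDerivative ∞
  metric_nabla : nabla.IsMetricCompatible
  nabla_cliff : ∀ (x : M) (X : Π y : M, TangentSpace (𝓡 6) y) (s : Π y : M, S y),
    MDifferentiableAt (𝓡 6) ((𝓡 6).prod 𝓘(ℝ, R6)) (fun y ↦ TotalSpace.mk' R6 y (X y)) x →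
    MDifferentiableAt (𝓡 6) ((𝓡 6).prod 𝓘(ℝ, R8)) (fun y ↦ TotalSpace.mk' R8 y (s y)) x →
    ∀ v : TangentSpace (𝓡 6) x,
      nabla (fun y ↦ cliff y (X y) (s y)) x v =
        cliff x (LC X x v) (s x) + cliff x (X x) (nabla s x v)

variable {S : M → Type*} [TopologicalSpace (TotalSpace R8 S)]
    [∀ x, NormedAddCommGroup (S x)] [∀ x, InnerProductSpace ℝ (S x)] [FiberBundle R8 S]
    [VectorBundle ℝ R8 S] [ContMDiffVectorBundle ∞ R8 S (𝓡 6)]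
    [IsContMDiffRiemannianBundle (𝓡 6) ∞ R8 S]

variable (M) in
/-- A nearly Kähler structure: a unit-length real Killing spinor `ψ` with `∇_X ψ = ½ X · ψ`. -/
structure NearlyKahlerStructure (S : M → Type*) [TopologicalSpace (TotalSpace R8 S)]
    [∀ x, NormedAddCommGroup (S x)] [∀ x, InnerProductSpace ℝ (S x)] [FiberBundle R8 S]
    [VectorBundle ℝ R8 S] [ContMDiffVectorBundle ∞ R8 S (𝓡 6)]
    [IsContMDiffRiemannianBundle (𝓡 6) ∞ R8 S] extends SpinStructure M S where
  /-- The Killing spinor. -/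
  psi : Π x : M, S x
  contMDiff_psi : ContMDiff (𝓡 6) ((𝓡 6).prod 𝓘(ℝ, R8)) ∞ (fun x ↦ TotalSpace.mk' R8 x (psi x))
  norm_psi : ∀ x : M, ‖psi x‖ = 1
  killing : ∀ (x : M) (v : TangentSpace (𝓡 6) x), nabla psi x v = (1 / 2 : ℝ) • cliff x v (psi x)

variable (M) in
/-- An orthonormal basis of `T_x M`, used to write traces and contractions. -/
def frame (x : M) :
    OrthonormalBasis (Fin (Module.finrank ℝ (TangentSpace (𝓡 6) x))) ℝ (TangentSpace (𝓡 6) x) :=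
  stdOrthonormalBasis ℝ (TangentSpace (𝓡 6) x)

namespace NearlyKahlerStructure

variable (N : NearlyKahlerStructure M S)

/-- The three-form `P`, i.e. the part of degree three of `8 ψ ⊗ ψᵀ = 1 + P - Q` under the
identification of the Clifford algebra `End S` with the exterior algebra. The coefficient of
`e_a e_b e_c` (`a < b < c`) in an endomorphism `T` is `⅛ Tr (e_a e_b e_c T)`, which for
`T = 8 ψ ⊗ ψᵀ` is `(ψ, e_a e_b e_c ψ)`. -/
def P (x : M) (u v w : TangentSpace (𝓡 6) x) : ℝ :=
  inner ℝ (N.psi x) (N.cliff x u (N.cliff x v (N.cliff x w (N.psi x))))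

/-- Clifford multiplication by the two-form `i_v P`. -/
def contractP (x : M) (v : TangentSpace (𝓡 6) x) (s : S x) : S x :=
  (1 / 2 : ℝ) • ∑ j, ∑ k, N.P x v (frame M x j) (frame M x k) •
    N.cliff x (frame M x j) (N.cliff x (frame M x k) s)

/-- The connection `∇ᵗ` on spinors, `∇ᵗ_v s = ∇_v s + (t/4) (i_v P) · s`, which is induced by the
connection with torsion `tP` on the tangent bundle. -/
def nablaT (t : ℝ) (s : Π x : M, S x) (x : M) (v : TangentSpace (𝓡 6) x) : S x :=
  N.nabla s x v + (t / 4) • N.contractP x v (s x)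

end NearlyKahlerStructure

end Spin

/-! ## Principal bundles and connections -/

section Principal

/-- The Lie algebra of the structure group. -/
abbrev LieAlg (EK : Type*) [NormedAddCommGroup EK] [NormedSpace ℝ EK] (K : Type*)
    [TopologicalSpace K] [Group K] [ChartedSpace EK K] :=
  GroupLieAlgebra 𝓘(ℝ, EK) K

variable {EK : Type*} [NormedAddCommGroup EK] [NormedSpace ℝ EK]
  {K : Type*} [TopologicalSpace K] [Group K] [ChartedSpace EK K]

/-- The adjoint action of a Lie group on its Lie algebra: the derivative of conjugation. -/
def Ad (g : K) : LieAlg EK K →L[ℝ] LieAlg EK K :=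
  mfderiv 𝓘(ℝ, EK) 𝓘(ℝ, EK) (fun h : K ↦ g * h * g⁻¹) 1

variable (M : Type*) [TopologicalSpace M] [ChartedSpace R6 M]
  (EK K)
  (EP : Type*) [NormedAddCommGroup EP] [NormedSpace ℝ EP]
  (P : Type*) [TopologicalSpace P] [ChartedSpace EP P] [IsManifold 𝓘(ℝ, EP) ∞ P]

/-- A smooth principal `K`-bundle `P → M`: a smooth right action of `K` on `P` preserving the
smooth projection to `M`, such that over small open sets `U ⊆ M` there is a smooth section `s`, for
which `(y, g) ↦ s(y) g` is a diffeomorphism of `U × K` onto the preimage of `U` (with inverse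
`p ↦ (proj p, τ p)`). -/
structure PrincipalBundle where
  proj : P → M
  contMDiff_proj : ContMDiff 𝓘(ℝ, EP) (𝓡 6) ∞ proj
  act : P → K → P
  contMDiff_act : ContMDiff (𝓘(ℝ, EP).prod 𝓘(ℝ, EK)) 𝓘(ℝ, EP) ∞ (fun q : P × K ↦ act q.1 q.2)
  act_one : ∀ p, act p 1 = p
  act_mul : ∀ p g h, act p (g * h) = act (act p g) h
  proj_act : ∀ p g, proj (act p g) = proj p
  locallyTrivial : ∀ x : M, ∃ U : Set M, IsOpen U ∧ x ∈ U ∧ ∃ s : M → P,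
    ContMDiffOn (𝓡 6) 𝓘(ℝ, EP) ∞ s U ∧ (∀ y ∈ U, proj (s y) = y) ∧ ∃ τ : P → K,
      ContMDiffOn 𝓘(ℝ, EP) 𝓘(ℝ, EK) ∞ τ (proj ⁻¹' U) ∧
      (∀ p ∈ proj ⁻¹' U, act (s (proj p)) (τ p) = p) ∧
      (∀ y ∈ U, ∀ g : K, τ (act (s y) g) = g)

variable {M EK K EP P}

namespace PrincipalBundle

variable (B : PrincipalBundle EK K M EP P)

/-- The fibre of the principal bundle over `x`. -/
def Fib (x : M) := {p : P // B.proj p = x}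

/-- The right action of the structure group on a fibre. -/
def fibAct {x : M} (p : B.Fib x) (g : K) : B.Fib x :=
  ⟨B.act p.1 g, (B.proj_act p.1 g).trans p.2⟩

/-- `s` is a local gauge over `U`, i.e. a smooth section of the principal bundle over the open
set `U`. -/
structure IsGauge (s : M → P) (U : Set M) : Prop where
  isOpen : IsOpen U
  contMDiffOn : ContMDiffOn (𝓡 6) 𝓘(ℝ, EP) ∞ s U
  proj_eq : ∀ y ∈ U, B.proj (s y) = y

open Classical in
/-- The local expression, in a gauge `s`, of a section of an associated bundle. An element of the
fibre over `x` of a bundle associated to `P` is an equivariant map on the fibre of `P`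
over `x`, and its expression in the gauge `s` is the value of this map at `s(x)`. -/
def inGauge {W : M → Type*} [∀ x, Zero (W x)] (η : Π x : M, B.Fib x → W x) (s : M → P) (x : M) :
    W x :=
  if h : B.proj (s x) = x then η x ⟨s x, h⟩ else 0

theorem inGauge_add {W : M → Type*} [∀ x, AddCommMonoid (W x)] (η η' : Π x : M, B.Fib x → W x)
    (s : M → P) : B.inGauge (η + η') s = B.inGauge η s + B.inGauge η' s := by
  ext x
  by_cases h : B.proj (s x) = x
  · simp only [inGauge, h, dif_pos, Pi.add_apply]
    rfl
  · simp [inGauge, h]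

theorem inGauge_smul {W : M → Type*} [∀ x, AddCommMonoid (W x)] [∀ x, Module ℝ (W x)] (c : ℝ)
    (η : Π x : M, B.Fib x → W x) (s : M → P) : B.inGauge (c • η) s = c • B.inGauge η s := by
  ext x
  by_cases h : B.proj (s x) = x
  · simp only [inGauge, h, dif_pos, Pi.smul_apply]
    rfl
  · simp [inGauge, h]

theorem inGauge_zero {W : M → Type*} [∀ x, AddCommMonoid (W x)] (s : M → P) :
    B.inGauge (0 : Π x : M, B.Fib x → W x) s = 0 := by
  ext x
  by_cases h : B.proj (s x) = x
  · simp only [inGauge, h, dif_pos, Pi.zero_apply]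
    rfl
  · simp [inGauge, h]

/-- A connection on a principal bundle, as a Lie algebra valued one-form on the total space. -/
structure Connection where
  form : Π p : P, TangentSpace 𝓘(ℝ, EP) p →L[ℝ] LieAlg EK K
  contMDiff_form : ContMDiff 𝓘(ℝ, EP) (𝓘(ℝ, EP).prod 𝓘(ℝ, EP →L[ℝ] EK)) ∞
    (fun p ↦ TotalSpace.mk' (EP →L[ℝ] EK)
      (E := fun p : P ↦ TangentSpace 𝓘(ℝ, EP) p →L[ℝ] Bundle.Trivial P EK p) p (form p))
  vertical : ∀ (p : P) (ξ : LieAlg EK K),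
    form (B.act p 1) (mfderiv 𝓘(ℝ, EK) 𝓘(ℝ, EP) (fun g : K ↦ B.act p g) 1 ξ) = ξ
  equivariant : ∀ (p : P) (g : K) (v : TangentSpace 𝓘(ℝ, EP) p),
    form (B.act p g) (mfderiv 𝓘(ℝ, EP) 𝓘(ℝ, EP) (fun q : P ↦ B.act q g) p v) = Ad g⁻¹ (form p v)

namespace Connection

variable {B} (A : B.Connection)

/-- The local connection one-form `s^* A` in a gauge `s`. -/
def gaugeForm (s : M → P) (x : M) : TangentSpace (𝓡 6) x →L[ℝ] LieAlg EK K :=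
  A.form (s x) ∘L mfderiv (𝓡 6) 𝓘(ℝ, EP) s x

/-- Two points of `P` are the end points of a smooth horizontal curve. -/
def HorizontalStep (p q : P) : Prop :=
  ∃ γ : ℝ → P, ContMDiffOn 𝓘(ℝ, ℝ) 𝓘(ℝ, EP) ∞ γ (Set.Icc 0 1) ∧ γ 0 = p ∧ γ 1 = q ∧
    ∀ t ∈ Set.Icc (0 : ℝ) 1,
      A.form (γ t) (mfderivWithin 𝓘(ℝ, ℝ) 𝓘(ℝ, EP) γ (Set.Icc 0 1) t (1 : ℝ)) = 0

/-- The holonomy group at `p`: all `g` such that `p` and `p g` are joined by a piecewise smooth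
horizontal curve. -/
def holonomy (p : P) : Set K :=
  {g | Relation.ReflTransGen A.HorizontalStep p (B.act p g)}

/-- A connection is irreducible if its holonomy group is the whole structure group. -/
def IsIrreducible : Prop := ∀ p : P, A.holonomy p = Set.univ

end Connection

end PrincipalBundle

end Principal

/-! ## Lie algebra valued forms and spinors in a local gauge -/

section Gauge

variable {M : Type*} [TopologicalSpace M] [ChartedSpace R6 M] [IsManifold (𝓡 6) ∞ M]
  {EK : Type*} [NormedAddCommGroup EK] [NormedSpace ℝ EK] [FiniteDimensional ℝ EK]
  {K : Type*} [TopologicalSpace K] [Group K] [ChartedSpace EK K] [LieGroup 𝓘(ℝ, EK) ∞ K]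

/-- The derivative at `x`, in the direction `v`, of a Lie algebra valued function. -/
def lieDiff (f : M → LieAlg EK K) (x : M) (v : TangentSpace (𝓡 6) x) : LieAlg EK K :=
  mvfderiv (𝓡 6) (F := EK) f x v

/-- The exterior derivative of a Lie algebra valued one-form `α`,
`dα(X, Y) = X(α(Y)) - Y(α(X)) - α([X, Y])`. -/
def extD (α : Π x : M, TangentSpace (𝓡 6) x →L[ℝ] LieAlg EK K) (x : M)
    (v w : TangentSpace (𝓡 6) x) : LieAlg EK K :=
  lieDiff (fun y ↦ α y (FiberBundle.extend R6 w y)) x v -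
    lieDiff (fun y ↦ α y (FiberBundle.extend R6 v y)) x w -
    α x (VectorField.mlieBracket (𝓡 6) (FiberBundle.extend R6 v) (FiberBundle.extend R6 w) x)

/-- The curvature `F = da + ½ [a ∧ a]` of a local connection one-form. -/
def curvature (a : Π x : M, TangentSpace (𝓡 6) x →L[ℝ] LieAlg EK K) (x : M)
    (v w : TangentSpace (𝓡 6) x) : LieAlg EK K :=
  extD a x v w + ⁅a x v, a x w⁆

/-- The covariant exterior derivative `dε + [a ∧ ε]` of a Lie algebra valued one-form `ε`. -/
def covExtD (a ε : Π x : M, TangentSpace (𝓡 6) x →L[ℝ] LieAlg EK K) (x : M)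
    (v w : TangentSpace (𝓡 6) x) : LieAlg EK K :=
  extD ε x v w + ⁅a x v, ε x w⁆ - ⁅a x w, ε x v⁆

variable [RiemannianBundle (fun x : M ↦ TangentSpace (𝓡 6) x)]

/-- The covariant codifferential `-∑ⱼ (∇_{eⱼ} ε)(eⱼ)` of a Lie algebra valued one-form `ε`, where
`∇` is the covariant derivative built from the Levi-Civita connection and `a`. -/
def covCodiff (LC : CovariantDerivative (𝓡 6) R6 (fun x : M ↦ TangentSpace (𝓡 6) x))
    (a ε : Π x : M, TangentSpace (𝓡 6) x →L[ℝ] LieAlg EK K) (x : M) : LieAlg EK K :=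
  -∑ j, (lieDiff (fun y ↦ ε y (FiberBundle.extend R6 (frame M x j) y)) x (frame M x j)
    - ε x (LC (FiberBundle.extend R6 (frame M x j)) x (frame M x j))
    + ⁅a x (frame M x j), ε x (frame M x j)⁆)

variable {S : M → Type*} [TopologicalSpace (TotalSpace R8 S)]
    [∀ x, NormedAddCommGroup (S x)] [∀ x, InnerProductSpace ℝ (S x)] [FiberBundle R8 S]
    [VectorBundle ℝ R8 S] [ContMDiffVectorBundle ∞ R8 S (𝓡 6)]
    [IsContMDiffRiemannianBundle (𝓡 6) ∞ R8 S]

/-- Contraction of an element of `S_x ⊗ 𝔨` with a functional on `𝔨`. -/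
def contr {x : M} (l : Module.Dual ℝ (LieAlg EK K)) : S x ⊗[ℝ] LieAlg EK K →ₗ[ℝ] S x :=
  (TensorProduct.rid ℝ (S x)).toLinearMap ∘ₗ LinearMap.lTensor (S x) l

/-- The covariant derivative of an `S ⊗ 𝔨`-valued field built from a connection `D` on `S` and a
local connection one-form `a`; in terms of a basis `bᵢ` of `𝔨` and `ξ = ∑ᵢ ξⁱ ⊗ bᵢ` it is
`∑ᵢ (D_v ξⁱ) ⊗ bᵢ + (1 ⊗ ad (a v)) ξ`. -/
def gaugeCov (D : (Π x : M, S x) → Π x : M, TangentSpace (𝓡 6) x → S x)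
    (a : Π x : M, TangentSpace (𝓡 6) x →L[ℝ] LieAlg EK K) (ξ : Π x : M, S x ⊗[ℝ] LieAlg EK K)
    (x : M) (v : TangentSpace (𝓡 6) x) : S x ⊗[ℝ] LieAlg EK K :=
  (∑ i, D (fun y ↦ contr ((Module.finBasis ℝ (LieAlg EK K)).coord i) (ξ y)) x v
    ⊗ₜ[ℝ] (Module.finBasis ℝ (LieAlg EK K) i)) +
    LinearMap.lTensor (S x) (LieAlgebra.ad ℝ (LieAlg EK K) (a x v)) (ξ x)

namespace NearlyKahlerStructure

variable (N : NearlyKahlerStructure M S)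

/-- The element `β · ψ` of `S_x ⊗ 𝔨` for a two-form `β` on `T_x M` with values in `𝔨`. -/
def twoFormPsi (x : M) (β : TangentSpace (𝓡 6) x → TangentSpace (𝓡 6) x → LieAlg EK K) :
    S x ⊗[ℝ] LieAlg EK K :=
  (1 / 2 : ℝ) • ∑ j, ∑ k, N.cliff x (frame M x j) (N.cliff x (frame M x k) (N.psi x)) ⊗ₜ[ℝ]
    β (frame M x j) (frame M x k)

theorem twoFormPsi_add (x : M)
    (β β' : TangentSpace (𝓡 6) x → TangentSpace (𝓡 6) x → LieAlg EK K) :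
    N.twoFormPsi x (fun v w ↦ β v w + β' v w) = N.twoFormPsi x β + N.twoFormPsi x β' := by
  simp only [twoFormPsi, TensorProduct.tmul_add, Finset.sum_add_distrib, smul_add]

theorem twoFormPsi_smul (x : M) (c : ℝ)
    (β : TangentSpace (𝓡 6) x → TangentSpace (𝓡 6) x → LieAlg EK K) :
    N.twoFormPsi x (fun v w ↦ c • β v w) = c • N.twoFormPsi x β := by
  simp only [twoFormPsi, TensorProduct.tmul_smul, ← Finset.smul_sum]
  rw [smul_smul, smul_smul, mul_comm]

/-- The element `ε · ψ` of `S_x ⊗ 𝔨` for a one-form `ε` on `T_x M` with values in `𝔨`. -/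
def oneFormPsi (x : M) (ε : TangentSpace (𝓡 6) x →L[ℝ] LieAlg EK K) : S x ⊗[ℝ] LieAlg EK K :=
  ∑ j, N.cliff x (frame M x j) (N.psi x) ⊗ₜ[ℝ] ε (frame M x j)

/-- The Dirac operator `∑ⱼ eⱼ · ∇_{eⱼ}` built from `∇ᵗ` and the local connection one-form `a`. -/
def gaugeDirac (t : ℝ) (a : Π x : M, TangentSpace (𝓡 6) x →L[ℝ] LieAlg EK K)
    (ξ : Π x : M, S x ⊗[ℝ] LieAlg EK K) (x : M) : S x ⊗[ℝ] LieAlg EK K :=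
  ∑ j, LinearMap.rTensor (LieAlg EK K) (N.cliff x (frame M x j)).toLinearMap
    (gaugeCov (N.nablaT t) a ξ x (frame M x j))

end NearlyKahlerStructure

end Gauge

/-! ## Sections of the bundles associated to the adjoint representation -/

section Sections

variable {M : Type*} [TopologicalSpace M] [ChartedSpace R6 M] [IsManifold (𝓡 6) ∞ M]
  {EK : Type*} [NormedAddCommGroup EK] [NormedSpace ℝ EK] [FiniteDimensional ℝ EK]
  {K : Type*} [TopologicalSpace K] [Group K] [ChartedSpace EK K] [LieGroup 𝓘(ℝ, EK) ∞ K]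
  {EP : Type*} [NormedAddCommGroup EP] [NormedSpace ℝ EP]
  {P : Type*} [TopologicalSpace P] [ChartedSpace EP P] [IsManifold 𝓘(ℝ, EP) ∞ P]

namespace PrincipalBundle

variable (B : PrincipalBundle EK K M EP P)

/-- The space `Ω¹(Ad_P)` of smooth sections of `T^*M ⊗ Ad_P`. -/
def adOneForms : Submodule ℝ (Π x : M, B.Fib x → TangentSpace (𝓡 6) x →L[ℝ] LieAlg EK K) where
  carrier := {ε | (∀ (x : M) (p : B.Fib x) (g : K), ε x (B.fibAct p g) = Ad g⁻¹ ∘L ε x p) ∧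
    ∀ (s : M → P) (U : Set M), B.IsGauge s U →
      ContMDiffOn (𝓡 6) ((𝓡 6).prod 𝓘(ℝ, R6 →L[ℝ] EK)) ∞
        (fun x ↦ TotalSpace.mk' (R6 →L[ℝ] EK)
          (E := fun x : M ↦ TangentSpace (𝓡 6) x →L[ℝ] Bundle.Trivial M EK x) x
          (B.inGauge ε s x)) U}
  add_mem' := by
    rintro ε ε' ⟨h, hs⟩ ⟨h', hs'⟩
    refine ⟨fun x p g ↦ ?_, fun s U hsU ↦ ?_⟩
    · simp [h, h', ContinuousLinearMap.comp_add]
    · rw [inGauge_add]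
      exact (hs s U hsU).add_section (hs' s U hsU)
  zero_mem' := by
    refine ⟨fun x p g ↦ by simp, fun s U _ ↦ ?_⟩
    rw [inGauge_zero]
    exact (contMDiff_zeroSection ℝ _).contMDiffOn
  smul_mem' := by
    rintro c ε ⟨h, hs⟩
    refine ⟨fun x p g ↦ ?_, fun s U hsU ↦ ?_⟩
    · simp [h]
    · rw [inGauge_smul]
      exact (hs s U hsU).const_smul_section

variable (S : M → Type*) [TopologicalSpace (TotalSpace R8 S)]
    [∀ x, NormedAddCommGroup (S x)] [∀ x, InnerProductSpace ℝ (S x)] [FiberBundle R8 S]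
    [VectorBundle ℝ R8 S]

/-- The space `Γ(SM ⊗ Ad_P)` of smooth sections. -/
def adSpinors : Submodule ℝ (Π x : M, B.Fib x → S x ⊗[ℝ] LieAlg EK K) where
  carrier := {η | (∀ (x : M) (p : B.Fib x) (g : K),
      η x (B.fibAct p g) = LinearMap.lTensor (S x) (Ad g⁻¹).toLinearMap (η x p)) ∧
    ∀ (s : M → P) (U : Set M), B.IsGauge s U → ∀ l : Module.Dual ℝ (LieAlg EK K),
      ContMDiffOn (𝓡 6) ((𝓡 6).prod 𝓘(ℝ, R8)) ∞
        (fun x ↦ TotalSpace.mk' R8 x (contr l (B.inGauge η s x))) U}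
  add_mem' := by
    rintro η η' ⟨h, hs⟩ ⟨h', hs'⟩
    refine ⟨fun x p g ↦ ?_, fun s U hsU l ↦ ?_⟩
    · simp [h, h']
    · simp only [inGauge_add, Pi.add_apply, map_add]
      exact (hs s U hsU l).add_section (hs' s U hsU l)
  zero_mem' := by
    refine ⟨fun x p g ↦ by simp, fun s U _ l ↦ ?_⟩
    simp only [inGauge_zero, Pi.zero_apply, map_zero]
    exact (contMDiff_zeroSection ℝ _).contMDiffOn
  smul_mem' := by
    rintro c η ⟨h, hs⟩
    refine ⟨fun x p g ↦ ?_, fun s U hsU l ↦ ?_⟩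
    · simp [h]
    · simp only [inGauge_smul, Pi.smul_apply, map_smul]
      exact (hs s U hsU l).const_smul_section

end PrincipalBundle

section Linearity

variable {ε ε' : Π x : M, TangentSpace (𝓡 6) x →L[ℝ] LieAlg EK K} {x : M}

/-- Differentiability at `x` of a Lie algebra valued one-form. -/
def FormDiffAt (ε : Π x : M, TangentSpace (𝓡 6) x →L[ℝ] LieAlg EK K) (x : M) : Prop :=
  MDifferentiableAt (𝓡 6) ((𝓡 6).prod 𝓘(ℝ, R6 →L[ℝ] EK))
    (fun y ↦ TotalSpace.mk' (R6 →L[ℝ] EK)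
      (E := fun y : M ↦ TangentSpace (𝓡 6) y →L[ℝ] Bundle.Trivial M EK y) y (ε y)) x

theorem FormDiffAt.apply_extend (h : FormDiffAt ε x) (w : TangentSpace (𝓡 6) x) :
    MDifferentiableAt (M' := EK) (𝓡 6) 𝓘(ℝ, EK)
      (fun y ↦ ε y (FiberBundle.extend R6 w y)) x := by
  have h1 := MDifferentiableAt.clm_bundle_apply (F₁ := R6) (F₂ := EK)
    (E₁ := fun y : M ↦ TangentSpace (𝓡 6) y) (E₂ := Bundle.Trivial M EK)
    (b := id) (IB := 𝓡 6) h (FiberBundle.mdifferentiableAt_extend (𝓡 6) R6 w)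
  exact ((mdifferentiableAt_section (𝓡 6) _).1 h1)

theorem lieDiff_add {f f' : M → LieAlg EK K}
    (h : MDifferentiableAt (M' := EK) (𝓡 6) 𝓘(ℝ, EK) f x)
    (h' : MDifferentiableAt (M' := EK) (𝓡 6) 𝓘(ℝ, EK) f' x) (v : TangentSpace (𝓡 6) x) :
    lieDiff (fun y ↦ f y + f' y) x v = lieDiff f x v + lieDiff f' x v :=
  congrArg (fun L ↦ L v) (mvfderiv_add (F := EK) (g := f) (g' := f') h h')

theorem lieDiff_smul_aux (c : ℝ) {f : M → EK} (h : MDifferentiableAt (𝓡 6) 𝓘(ℝ, EK) f x)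
    (v : TangentSpace (𝓡 6) x) :
    mvfderiv (𝓡 6) (fun y ↦ c • f y) x v = c • mvfderiv (𝓡 6) f x v := by
  have h1 := mvfderiv_smul (I := 𝓡 6) (a := fun _ : M ↦ c) (g := f) mdifferentiableAt_const h
  have h2 := congrArg (fun L ↦ L v) h1
  simp [mvfderiv_const] at h2
  exact h2

theorem lieDiff_smul (c : ℝ) {f : M → LieAlg EK K}
    (h : MDifferentiableAt (M' := EK) (𝓡 6) 𝓘(ℝ, EK) f x) (v : TangentSpace (𝓡 6) x) :
    lieDiff (fun y ↦ c • f y) x v = c • lieDiff f x v :=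
  lieDiff_smul_aux (EK := EK) (f := f) c h v

theorem covExtD_add (a : Π x : M, TangentSpace (𝓡 6) x →L[ℝ] LieAlg EK K)
    (h : FormDiffAt ε x) (h' : FormDiffAt ε' x) (v w : TangentSpace (𝓡 6) x) :
    covExtD a (ε + ε') x v w = covExtD a ε x v w + covExtD a ε' x v w := by
  have key : ∀ u u' : TangentSpace (𝓡 6) x,
      lieDiff (fun y ↦ ε y (FiberBundle.extend R6 u y) + ε' y (FiberBundle.extend R6 u y)) x u' =
        lieDiff (fun y ↦ ε y (FiberBundle.extend R6 u y)) x u' +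
        lieDiff (fun y ↦ ε' y (FiberBundle.extend R6 u y)) x u' := fun u u' ↦
    lieDiff_add (h.apply_extend u) (h'.apply_extend u) u'
  simp only [covExtD, extD, key, Pi.add_apply, _root_.add_apply, lie_add]
  abel

theorem covExtD_smul (a : Π x : M, TangentSpace (𝓡 6) x →L[ℝ] LieAlg EK K) (c : ℝ)
    (h : FormDiffAt ε x) (v w : TangentSpace (𝓡 6) x) :
    covExtD a (c • ε) x v w = c • covExtD a ε x v w := by
  have key : ∀ u u' : TangentSpace (𝓡 6) x,
      lieDiff (fun y ↦ c • ε y (FiberBundle.extend R6 u y)) x u' =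
        c • lieDiff (fun y ↦ ε y (FiberBundle.extend R6 u y)) x u' := fun u u' ↦
    lieDiff_smul c (h.apply_extend u) u'
  simp only [covExtD, extD, key, Pi.smul_apply, _root_.smul_apply, lie_smul]
  module

variable [RiemannianBundle (fun x : M ↦ TangentSpace (𝓡 6) x)]

theorem covCodiff_add (LC : CovariantDerivative (𝓡 6) R6 (fun x : M ↦ TangentSpace (𝓡 6) x))
    (a : Π x : M, TangentSpace (𝓡 6) x →L[ℝ] LieAlg EK K)
    (h : FormDiffAt ε x) (h' : FormDiffAt ε' x) :
    covCodiff LC a (ε + ε') x = covCodiff LC a ε x + covCodiff LC a ε' x := by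
  have key : ∀ u u' : TangentSpace (𝓡 6) x,
      lieDiff (fun y ↦ ε y (FiberBundle.extend R6 u y) + ε' y (FiberBundle.extend R6 u y)) x u' =
        lieDiff (fun y ↦ ε y (FiberBundle.extend R6 u y)) x u' +
        lieDiff (fun y ↦ ε' y (FiberBundle.extend R6 u y)) x u' := fun u u' ↦
    lieDiff_add (h.apply_extend u) (h'.apply_extend u) u'
  simp only [covCodiff, key, Pi.add_apply, _root_.add_apply, lie_add]
  rw [← neg_add, ← Finset.sum_add_distrib]
  congr 1
  refine Finset.sum_congr rfl fun j _ ↦ ?_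
  abel

theorem covCodiff_smul (LC : CovariantDerivative (𝓡 6) R6 (fun x : M ↦ TangentSpace (𝓡 6) x))
    (a : Π x : M, TangentSpace (𝓡 6) x →L[ℝ] LieAlg EK K) (c : ℝ) (h : FormDiffAt ε x) :
    covCodiff LC a (c • ε) x = c • covCodiff LC a ε x := by
  have key : ∀ u u' : TangentSpace (𝓡 6) x,
      lieDiff (fun y ↦ c • ε y (FiberBundle.extend R6 u y)) x u' =
        c • lieDiff (fun y ↦ ε y (FiberBundle.extend R6 u y)) x u' := fun u u' ↦
    lieDiff_smul c (h.apply_extend u) u'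
  simp only [covCodiff, key, Pi.smul_apply, _root_.smul_apply, lie_smul]
  rw [smul_neg, Finset.smul_sum]
  congr 1
  refine Finset.sum_congr rfl fun j _ ↦ ?_
  module

end Linearity

/-! ## Instantons, deformations and the Dirac operator -/

variable [RiemannianBundle (fun x : M ↦ TangentSpace (𝓡 6) x)]
  {S : M → Type*} [TopologicalSpace (TotalSpace R8 S)]
  [∀ x, NormedAddCommGroup (S x)] [∀ x, InnerProductSpace ℝ (S x)] [FiberBundle R8 S]
  [VectorBundle ℝ R8 S] [ContMDiffVectorBundle ∞ R8 S (𝓡 6)]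
  [IsContMDiffRiemannianBundle (𝓡 6) ∞ R8 S]

namespace NearlyKahlerStructure

variable (N : NearlyKahlerStructure M S) {B : PrincipalBundle EK K M EP P} (A : B.Connection)

/-- The instanton equation `F · ψ = 0`. -/
def IsInstanton : Prop :=
  ∀ (s : M → P) (U : Set M), B.IsGauge s U → ∀ x ∈ U,
    N.twoFormPsi x (curvature (A.gaugeForm s) x) = 0

/-- The space of infinitesimal deformations of the instanton `A`: the solutions `ε ∈ Ω¹(Ad_P)` of
the linearised instanton equation `d^A ε · ψ = 0` with the gauge fixing condition
`(d^A)^* ε = 0`. -/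
def deformations : Submodule ℝ B.adOneForms where
  carrier := {ε | ∀ (s : M → P) (U : Set M), B.IsGauge s U → ∀ x ∈ U,
    N.twoFormPsi x (covExtD (A.gaugeForm s) (B.inGauge ε.1 s) x) = 0 ∧
      covCodiff N.LC (A.gaugeForm s) (B.inGauge ε.1 s) x = 0}
  add_mem' := by
    intro ε ε' h h' s U hs x hx
    have d : FormDiffAt (B.inGauge ε.1 s) x :=
      ((ε.2.2 s U hs).contMDiffAt (hs.isOpen.mem_nhds hx)).mdifferentiableAt (by simp)
    have d' : FormDiffAt (B.inGauge ε'.1 s) x :=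
      ((ε'.2.2 s U hs).contMDiffAt (hs.isOpen.mem_nhds hx)).mdifferentiableAt (by simp)
    obtain ⟨h1, h2⟩ := h s U hs x hx
    obtain ⟨h1', h2'⟩ := h' s U hs x hx
    constructor
    · rw [Submodule.coe_add, B.inGauge_add]
      have e := N.twoFormPsi_add x (covExtD (A.gaugeForm s) (B.inGauge ε.1 s) x)
        (covExtD (A.gaugeForm s) (B.inGauge ε'.1 s) x)
      rw [h1, h1', add_zero] at e
      rw [← e]
      exact congrArg _ (funext₂ fun v w ↦ covExtD_add _ d d' v w)
    · rw [Submodule.coe_add, B.inGauge_add, covCodiff_add _ _ d d', h2, h2', add_zero]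
  zero_mem' := by
    intro s U hs x hx
    have d : FormDiffAt (B.inGauge (0 : B.adOneForms).1 s) x :=
      (((0 : B.adOneForms).2.2 s U hs).contMDiffAt (hs.isOpen.mem_nhds hx)).mdifferentiableAt
        (by simp)
    have e : (0 : ℝ) • B.inGauge (0 : B.adOneForms).1 s = B.inGauge (0 : B.adOneForms).1 s := by
      rw [← B.inGauge_smul, zero_smul]
      rfl
    constructor
    · have e' := N.twoFormPsi_smul x 0
        (covExtD (A.gaugeForm s) (B.inGauge (0 : B.adOneForms).1 s) x)
      rw [zero_smul] at e'
      rw [← e', ← e]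
      refine congrArg _ (funext₂ fun v w ↦ ?_)
      rw [covExtD_smul _ _ d]
      simp only [zero_smul]
    · rw [← e, covCodiff_smul _ _ _ d, zero_smul]
  smul_mem' := by
    intro c ε h s U hs x hx
    have d : FormDiffAt (B.inGauge ε.1 s) x :=
      ((ε.2.2 s U hs).contMDiffAt (hs.isOpen.mem_nhds hx)).mdifferentiableAt (by simp)
    obtain ⟨h1, h2⟩ := h s U hs x hx
    constructor
    · rw [Submodule.coe_smul, B.inGauge_smul]
      have e := N.twoFormPsi_smul x c (covExtD (A.gaugeForm s) (B.inGauge ε.1 s) x)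
      rw [h1, smul_zero] at e
      rw [← e]
      exact congrArg _ (funext₂ fun v w ↦ covExtD_smul _ c d v w)
    · rw [Submodule.coe_smul, B.inGauge_smul, covCodiff_smul _ _ _ d, h2, smul_zero]

/-- `D` is the Dirac operator `D^{t,A}` on `Γ(SM ⊗ Ad_P)` constructed from the connections `∇ᵗ`
and `A`: in every gauge it is given by `∑ⱼ eⱼ · ∇^{t,A}_{eⱼ}`. Since the bundle has local gauges
everywhere, there is at most one such `D`. -/
def IsDiracOperator (t : ℝ) (D : B.adSpinors S →ₗ[ℝ] B.adSpinors S) : Prop :=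
  ∀ (η : B.adSpinors S) (s : M → P) (U : Set M), B.IsGauge s U → ∀ x ∈ U,
    B.inGauge (D η).1 s x = N.gaugeDirac t (A.gaugeForm s) (B.inGauge η.1 s) x

end NearlyKahlerStructure

/-- A linear operator `L` on `Γ(SM ⊗ Ad_P)` is an elliptic differential operator of order one:
for every smooth function `f` the commutator `[L, f]` acts at each point as an endomorphism of the
fibre (this is the principal symbol of `L` at the covector `df`), which is invertible wherever
`df ≠ 0`. A point `p` of `P` over `x` identifies the fibre of `SM ⊗ Ad_P` at `x` with
`S_x ⊗ 𝔨`. -/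
def IsEllipticFirstOrder {B : PrincipalBundle EK K M EP P}
    (L : B.adSpinors S →ₗ[ℝ] B.adSpinors S) : Prop :=
  ∀ (f : M → ℝ), ContMDiff (𝓡 6) 𝓘(ℝ, ℝ) ∞ f → ∀ (x : M) (p : B.Fib x),
    ∃ σ : S x ⊗[ℝ] LieAlg EK K →ₗ[ℝ] S x ⊗[ℝ] LieAlg EK K,
      (∀ η fη : B.adSpinors S, (∀ y q, fη.1 y q = f y • η.1 y q) →
        (L fη).1 x p - f x • (L η).1 x p = σ (η.1 x p)) ∧
      (mfderiv (𝓡 6) 𝓘(ℝ, ℝ) f x ≠ 0 → Function.Bijective σ)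

end Sections

end NearlyKahler

end

/-!
Clifford multiplication by the three-form `P` is, up to a factor, the difference of the projections
onto the lines of `ψ` and of `vol ψ` (`IsSpinFibre.three_form`). For `t = 1/3` this turns the Dirac
operator into `D^{1/3,A} η = D^A η + (ψ, η) ψ - (vol ψ, η) vol ψ`, where `D^A` is built from the
Levi-Civita connection (`gaugeDirac_third`). On spinors of the form `ε · ψ` the extra terms vanish,
and the Killing equation gives `D^A (ε · ψ) = 2 ε · ψ + d^A ε · ψ + ((d^A)* ε) ψ`
(`dirac_oneFormPsi`). As `d^A ε · ψ` is orthogonal to `ψ`, the spinor `ε · ψ` lies in the kernel of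
`D^{1/3,A} - 2` if and only if `ε` is an infinitesimal deformation (`isEigen_psiSection_iff`).

The spinors `ψ`, `vol ψ` and `v · ψ` span each fibre (`IsSpinFibre.expand`), so that `ε ↦ ε · ψ` is
injective, and it remains to show that the components of a section `η` of the kernel along `ψ` and
`vol ψ` vanish (`IsEigen.pair_eq_zero`). Both spinors satisfy a Killing equation, with constants
`1/2` and `-1/2`. The Dirac equation for `η` expresses the gradient of the component as the
divergence of a bivector plus a multiple of a vector field whose divergence is known. The double
divergence of the bivector is the contraction with the curvature, which vanishes by the instanton
equation, and the second term contributes nothing at the eigenvalue `2`. The component is therefore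
a harmonic section of the adjoint bundle (`harmonic_pair`).

By the Bochner formula the squared norm of a harmonic section is subharmonic, and by the strong
maximum principle of Hopf it is locally constant on a compact manifold, so that the section is
parallel (`strong_maximum_principle`, `IsAdSection.parallel_of_isHarmonic`); the maximum principle
takes the place of integration over the manifold. A parallel section is constant along horizontal
paths. As the holonomy group is `K`, its values are fixed by `Ad K`, hence central in the Lie
algebra, because the derivative of `Ad` is the bracket; a semisimple Lie algebra has trivial centre
(`IsAdSection.eq_zero_of_parallel`).

The operator is constructed from its expressions in the gauges of the principal bundle, which agree
by gauge covariance (`gaugeDirac_gauge`). Its principal symbol is Clifford multiplication, which is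
invertible for nonzero covectors (`isEllipticFirstOrder_diracOp`).

Divergences are computed in a frame `E_i` of coordinate fields with dual frame `E^i`; the volume
density enters through its logarithmic derivatives `θ_l = ½ g^{ij} ∂_l g_{ij}` (`logVol`).
-/

set_option linter.unusedSectionVars false

open Filter Topology

noncomputable section

namespace NearlyKahler

/-- The topology of the tangent bundle, recorded to shorten instance search. -/
local instance instTopologicalSpaceTangent {M : Type*} [TopologicalSpace M] [ChartedSpace R6 M]
    [IsManifold (𝓡 6) ∞ M] :
    TopologicalSpace (TotalSpace R6 fun x : M ↦ TangentSpace (𝓡 6) x) := inferInstance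

/-! ### Clifford multiplication on the spinors in dimension six -/

section Clifford

variable {V : Type*} [NormedAddCommGroup V] [InnerProductSpace ℝ V]
  {S : Type*} [NormedAddCommGroup S] [InnerProductSpace ℝ S]

/-- A Clifford multiplication with `v · v = -|v|²` by skew-adjoint endomorphisms. -/
structure IsClifford (c : V →L[ℝ] S →L[ℝ] S) : Prop where
  sq : ∀ v s, c v (c v s) = -(inner ℝ v v : ℝ) • s
  skew : ∀ v s s', inner ℝ (c v s) s' = -(inner ℝ s (c v s') : ℝ)

namespace IsClifford

variable {c : V →L[ℝ] S →L[ℝ] S} (hc : IsClifford c)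

include hc in
theorem anticomm (v w : V) (s : S) :
    c v (c w s) = -c w (c v s) - (2 * inner ℝ v w : ℝ) • s := by
  have h := hc.sq (v + w) s
  simp only [map_add, _root_.add_apply, hc.sq, inner_add_left, inner_add_right,
    real_inner_comm v w] at h
  have h' : c v (c w s) + c w (c v s) + (2 * inner ℝ v w : ℝ) • s = 0 := by
    rw [← sub_eq_zero] at h
    rw [← h]
    module
  rw [← sub_eq_zero, ← h']
  module

include hc in
theorem inner_mul_mul (v w : V) (s : S) (hs : inner ℝ s s = (1 : ℝ)) :
    inner ℝ (c v s) (c w s) = (inner ℝ v w : ℝ) := by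
  have h1 := hc.skew v s (c w s)
  have h2 := hc.skew w s (c v s)
  rw [hc.anticomm w v, inner_sub_right, inner_neg_right, inner_smul_right, hs,
    real_inner_comm (c v s)] at h2
  rw [real_inner_comm v w] at h2
  linarith

include hc in
theorem inner_mul_self (v : V) (s : S) : inner ℝ (c v s) s = (0 : ℝ) := by
  have h := hc.skew v s s
  rw [real_inner_comm s] at h
  rw [real_inner_comm]
  linarith

include hc in
theorem mul_injective {v : V} (hv : v ≠ 0) : Function.Injective (c v) := by
  intro s s' h
  have h1 : inner ℝ v v ≠ (0 : ℝ) := inner_self_ne_zero.2 hv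
  have h2 := congrArg (c v) h
  rw [hc.sq, hc.sq] at h2
  exact smul_right_injective S (neg_ne_zero.2 h1) h2

/-- The volume element `e₀ ⋯ e₅`. -/
def volOf (c : V →L[ℝ] S →L[ℝ] S) (e : Fin 6 → V) : S →L[ℝ] S :=
  c (e 0) ∘L c (e 1) ∘L c (e 2) ∘L c (e 3) ∘L c (e 4) ∘L c (e 5)

section Vol

variable (e : OrthonormalBasis (Fin 6) ℝ V)

include hc in
theorem onb_sq (i : Fin 6) (s : S) : c (e i) (c (e i) s) = -s := by
  rw [hc.sq, real_inner_self_eq_norm_sq, e.orthonormal.1 i]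
  simp

include hc in
theorem onb_anticomm {i j : Fin 6} (hij : i ≠ j) (s : S) :
    c (e i) (c (e j) s) = -c (e j) (c (e i) s) := by
  rw [hc.anticomm, e.orthonormal.2 hij]
  simp

include hc in
theorem vol_sq (s : S) : volOf c e (volOf c e s) = -s := by
  -- moving equal factors next to each other takes 15 transpositions; the six squares
  -- contribute `(-1)⁶`
  simp only [volOf, ContinuousLinearMap.comp_apply,
    hc.onb_anticomm e (show (5 : Fin 6) ≠ 0 by decide),
    hc.onb_anticomm e (show (4 : Fin 6) ≠ 0 by decide),
    hc.onb_anticomm e (show (3 : Fin 6) ≠ 0 by decide),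
    hc.onb_anticomm e (show (2 : Fin 6) ≠ 0 by decide),
    hc.onb_anticomm e (show (1 : Fin 6) ≠ 0 by decide),
    hc.onb_anticomm e (show (5 : Fin 6) ≠ 1 by decide),
    hc.onb_anticomm e (show (4 : Fin 6) ≠ 1 by decide),
    hc.onb_anticomm e (show (3 : Fin 6) ≠ 1 by decide),
    hc.onb_anticomm e (show (2 : Fin 6) ≠ 1 by decide),
    hc.onb_anticomm e (show (5 : Fin 6) ≠ 2 by decide),
    hc.onb_anticomm e (show (4 : Fin 6) ≠ 2 by decide),
    hc.onb_anticomm e (show (3 : Fin 6) ≠ 2 by decide),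
    hc.onb_anticomm e (show (5 : Fin 6) ≠ 3 by decide),
    hc.onb_anticomm e (show (4 : Fin 6) ≠ 3 by decide),
    hc.onb_anticomm e (show (5 : Fin 6) ≠ 4 by decide), hc.onb_sq, map_neg, neg_neg]

include hc in
theorem vol_onb (i : Fin 6) (s : S) : volOf c e (c (e i) s) = -c (e i) (volOf c e s) := by
  -- `eᵢ` commutes with one factor of the volume element and anticommutes with the other five
  fin_cases i <;>
  simp only [volOf, ContinuousLinearMap.comp_apply, Fin.zero_eta, Fin.mk_one, Fin.reduceFinMk,
    hc.onb_anticomm e (show (5 : Fin 6) ≠ 0 by decide),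
    hc.onb_anticomm e (show (4 : Fin 6) ≠ 0 by decide),
    hc.onb_anticomm e (show (3 : Fin 6) ≠ 0 by decide),
    hc.onb_anticomm e (show (2 : Fin 6) ≠ 0 by decide),
    hc.onb_anticomm e (show (1 : Fin 6) ≠ 0 by decide),
    hc.onb_anticomm e (show (5 : Fin 6) ≠ 1 by decide),
    hc.onb_anticomm e (show (4 : Fin 6) ≠ 1 by decide),
    hc.onb_anticomm e (show (3 : Fin 6) ≠ 1 by decide),
    hc.onb_anticomm e (show (2 : Fin 6) ≠ 1 by decide),
    hc.onb_anticomm e (show (5 : Fin 6) ≠ 2 by decide),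
    hc.onb_anticomm e (show (4 : Fin 6) ≠ 2 by decide),
    hc.onb_anticomm e (show (3 : Fin 6) ≠ 2 by decide),
    hc.onb_anticomm e (show (5 : Fin 6) ≠ 3 by decide),
    hc.onb_anticomm e (show (4 : Fin 6) ≠ 3 by decide),
    hc.onb_anticomm e (show (5 : Fin 6) ≠ 4 by decide), hc.onb_sq, map_neg, neg_neg]

include hc in
theorem vol_mul (v : V) (s : S) : volOf c e (c v s) = -c v (volOf c e s) := by
  rw [← e.sum_repr v]
  simp only [map_sum, map_smul, _root_.sum_apply, _root_.smul_apply, hc.vol_onb e, smul_neg,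
    Finset.sum_neg_distrib]

include hc in
theorem inner_vol_vol (s s' : S) : inner ℝ (volOf c e s) (volOf c e s') = (inner ℝ s s' : ℝ) := by
  have h : ∀ i (s s' : S), inner ℝ (c (e i) s) (c (e i) s') = (inner ℝ s s' : ℝ) := fun i s s' ↦ by
    rw [hc.skew, hc.onb_sq e, inner_neg_right, neg_neg]
  simp only [volOf, ContinuousLinearMap.comp_apply, h]

include hc in
theorem vol_skew (s s' : S) : inner ℝ (volOf c e s) s' = -(inner ℝ s (volOf c e s') : ℝ) := by
  rw [← hc.inner_vol_vol e s (volOf c e s'), hc.vol_sq, inner_neg_right, neg_neg]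

end Vol

end IsClifford

/-- A Clifford module together with a skew-adjoint complex structure `ν` which anticommutes with
the Clifford multiplication by vectors, and a unit spinor `ψ`. In dimension six, `ν` is the
Clifford action of the volume form. -/
structure IsSpinFibre (c : V →L[ℝ] S →L[ℝ] S) (ν : S →L[ℝ] S) (ψ : S) : Prop
    extends IsClifford c where
  vol_sq : ∀ s, ν (ν s) = -s
  vol_mul : ∀ v s, ν (c v s) = -c v (ν s)
  vol_skew : ∀ s s', inner ℝ (ν s) s' = -(inner ℝ s (ν s') : ℝ)
  unit : inner ℝ ψ ψ = (1 : ℝ)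

namespace IsSpinFibre

variable {c : V →L[ℝ] S →L[ℝ] S} {ν : S →L[ℝ] S} {ψ : S} (h : IsSpinFibre c ν ψ)

include h

theorem inner_vol_unit : inner ℝ (ν ψ) (ν ψ) = (1 : ℝ) := by
  rw [h.vol_skew, h.vol_sq, inner_neg_right, neg_neg, h.unit]

theorem inner_psi_vol : inner ℝ ψ (ν ψ) = (0 : ℝ) := by
  have h1 := h.vol_skew ψ ψ
  rw [real_inner_comm] at h1
  linarith

theorem inner_mul_psi (v : V) : inner ℝ (c v ψ) ψ = (0 : ℝ) := h.toIsClifford.inner_mul_self v ψ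

theorem inner_mul_psi_vol (v : V) : inner ℝ (c v ψ) (ν ψ) = (0 : ℝ) := by
  have h1 := h.vol_skew (c v ψ) ψ
  rw [h.vol_mul, inner_neg_left, h.skew, neg_neg, real_inner_comm] at h1
  have h2 := h.skew v ψ (ν ψ)
  rw [real_inner_comm] at h2
  rw [h.skew, real_inner_comm] at h1 ⊢
  linarith

theorem inner_mul_vol_psi (v : V) : inner ℝ (c v (ν ψ)) ψ = (0 : ℝ) := by
  rw [h.skew, real_inner_comm, h.inner_mul_psi_vol, neg_zero]

theorem inner_mul_vol_vol (v : V) : inner ℝ (c v (ν ψ)) (ν ψ) = (0 : ℝ) :=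
  h.toIsClifford.inner_mul_self v _

variable {ι : Type*} [Fintype ι] (e : OrthonormalBasis ι ℝ V)

/-- For `dim S = dim V + 2`, the spinors `ψ`, `ν ψ` and `eⱼ ψ` form an orthonormal basis. -/
theorem expand (hdim : Module.finrank ℝ S = Fintype.card ι + 2) (s : S) :
    s = (inner ℝ ψ s : ℝ) • ψ + (inner ℝ (ν ψ) s : ℝ) • ν ψ +
      ∑ j, (inner ℝ (c (e j) ψ) s : ℝ) • c (e j) ψ := by
  classical
  let b : Option (Option ι) → S := fun o ↦ match o with
    | none => ψ
    | some none => ν ψ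
    | some (some j) => c (e j) ψ
  have ho : Orthonormal ℝ b := by
    rw [orthonormal_iff_ite]
    rintro (_ | _ | i) (_ | _ | j)
    · simpa [b] using h.unit
    · simp [b, h.inner_psi_vol]
    · simpa [b] using (real_inner_comm _ _).trans (h.inner_mul_psi (e j))
    · simp [b, real_inner_comm, h.inner_psi_vol]
    · simpa [b] using h.inner_vol_unit
    · simpa [b] using (real_inner_comm _ _).trans (h.inner_mul_psi_vol (e j))
    · simp [b, h.inner_mul_psi]
    · simp [b, h.inner_mul_psi_vol]
    · simp [b, h.toIsClifford.inner_mul_mul _ _ ψ h.unit, orthonormal_iff_ite.1 e.orthonormal]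
  have hcard : Fintype.card (Option (Option ι)) = Module.finrank ℝ S := by
    rw [hdim, Fintype.card_option, Fintype.card_option]
  have : FiniteDimensional ℝ S := FiniteDimensional.of_finrank_pos (by omega)
  have hsp : ⊤ ≤ Submodule.span ℝ (Set.range b) :=
    (ho.linearIndependent.span_eq_top_of_card_eq_finrank' hcard).ge
  have hs := (OrthonormalBasis.mk ho hsp).sum_repr s
  simp only [OrthonormalBasis.repr_apply_apply, OrthonormalBasis.coe_mk, Fintype.sum_option] at hs
  rw [← add_assoc] at hs
  exact hs.symm

include e in
theorem ext_inner (hdim : Module.finrank ℝ S = Fintype.card ι + 2) {s s' : S}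
    (h1 : inner ℝ ψ s = (inner ℝ ψ s' : ℝ)) (h2 : inner ℝ (ν ψ) s = (inner ℝ (ν ψ) s' : ℝ))
    (h3 : ∀ v, inner ℝ (c v ψ) s = (inner ℝ (c v ψ) s' : ℝ)) : s = s' := by
  rw [h.expand e hdim s, h.expand e hdim s']
  simp only [h1, h2, h3]

theorem sum_sq (s : S) : ∑ j, c (e j) (c (e j) s) = -(Fintype.card ι : ℝ) • s := by
  have : ∀ j, c (e j) (c (e j) s) = -s := fun j ↦ by
    rw [h.sq, real_inner_self_eq_norm_sq, e.orthonormal.1 j]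
    simp
  simp only [this, Finset.sum_const, Finset.card_univ, smul_neg]
  rw [← Nat.cast_smul_eq_nsmul ℝ]
  module

/-- Clifford multiplication of `ν ψ` by a vector is Clifford multiplication of `ψ` by a vector. -/
theorem mul_vol (hdim : Module.finrank ℝ S = Fintype.card ι + 2) (v : V) :
    c v (ν ψ) = ∑ j, (inner ℝ (c (e j) ψ) (c v (ν ψ)) : ℝ) • c (e j) ψ := by
  conv_lhs => rw [h.expand e hdim (c v (ν ψ))]
  rw [real_inner_comm, h.inner_mul_vol_psi, real_inner_comm, h.inner_mul_vol_vol]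
  simp

/-- In terms of the endomorphism `J` of `V` with `v · ν ψ = J v · ψ`, this is `J² = -1`. -/
theorem sum_inner_mul_vol (hdim : Module.finrank ℝ S = Fintype.card ι + 2) (v : V) :
    ∑ j, (inner ℝ (c (e j) ψ) (c v (ν ψ)) : ℝ) • c (e j) (ν ψ) = -c v ψ := by
  have h1 := congrArg ν (h.mul_vol e hdim v)
  rw [h.vol_mul, h.vol_sq] at h1
  simp only [map_sum, map_smul, h.vol_mul, map_neg, neg_neg, smul_neg,
    Finset.sum_neg_distrib] at h1
  rw [h1, neg_neg]

/-- The endomorphism `J` with `v · ν ψ = J v · ψ` is skew-adjoint. -/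
theorem inner_mul_vol_mul (v w : V) :
    inner ℝ (c w (ν ψ)) (c v ψ) = -(inner ℝ (c w ψ) (c v (ν ψ)) : ℝ) := by
  have h1 : c w (ν ψ) = -ν (c w ψ) := by rw [h.vol_mul, neg_neg]
  rw [h1, inner_neg_left, h.vol_skew, h.vol_mul, inner_neg_right, neg_neg]

theorem sum_inner_mul_vol' (hdim : Module.finrank ℝ S = Fintype.card ι + 2) (v : V) :
    ∑ k, (inner ℝ (c (e k) (ν ψ)) (c v ψ) : ℝ) • c (e k) (ν ψ) = c v ψ := by
  simp only [h.inner_mul_vol_mul, neg_smul, Finset.sum_neg_distrib]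
  rw [h.sum_inner_mul_vol e hdim, neg_neg]

theorem three_form_swap_left (u v w : V) :
    inner ℝ ψ (c u (c v (c w ψ))) = -(inner ℝ ψ (c v (c u (c w ψ))) : ℝ) := by
  rw [h.toIsClifford.anticomm u v, inner_sub_right, inner_smul_right, real_inner_comm (c w ψ),
    h.inner_mul_psi, inner_neg_right]
  simp

theorem three_form_swap_right (u v w : V) :
    inner ℝ ψ (c u (c v (c w ψ))) = -(inner ℝ ψ (c u (c w (c v ψ))) : ℝ) := by
  rw [h.toIsClifford.anticomm v w, map_sub, map_neg, map_smul, inner_sub_right, inner_smul_right,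
    real_inner_comm (c u ψ), h.inner_mul_psi, inner_neg_right]
  simp

/-- The contraction of the three-form `(ψ, u v w ψ)` with two vectors, as a vector acting on `ψ`. -/
theorem sum_three_form (hdim : Module.finrank ℝ S = Fintype.card ι + 2) (u v : V) :
    ∑ l, (inner ℝ ψ (c u (c v (c (e l) ψ))) : ℝ) • c (e l) ψ =
      c v (c u ψ) + (inner ℝ u v : ℝ) • ψ + (inner ℝ (c v (ν ψ)) (c u ψ) : ℝ) • ν ψ := by
  have h1 : ∀ l, inner ℝ ψ (c u (c v (c (e l) ψ))) = (inner ℝ (c (e l) ψ) (c v (c u ψ)) : ℝ) := by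
    intro l
    rw [real_inner_comm, h.skew, h.skew, neg_neg]
  have h2 : inner ℝ ψ (c v (c u ψ)) = -(inner ℝ u v : ℝ) := by
    rw [real_inner_comm, h.skew, h.toIsClifford.inner_mul_mul _ _ _ h.unit]
  have h3 : inner ℝ (ν ψ) (c v (c u ψ)) = -(inner ℝ (c v (ν ψ)) (c u ψ) : ℝ) := by
    rw [h.skew, neg_neg]
  simp only [h1]
  conv_rhs => rw [h.expand e hdim (c v (c u ψ)), h2, h3]
  module

/-- Six times the three-form `(u, v, w) ↦ (ψ, u v w ψ)`, as an element of the Clifford algebra, has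
`ψ` as an eigenvector with eigenvalue `24`. -/
theorem three_form_psi (hι : Fintype.card ι = 6) (hdim : Module.finrank ℝ S = 8) :
    ∑ j, ∑ k, ∑ l, (inner ℝ ψ (c (e j) (c (e k) (c (e l) ψ))) : ℝ) •
      c (e j) (c (e k) (c (e l) ψ)) = (24 : ℝ) • ψ := by
  classical
  have hdim' : Module.finrank ℝ S = Fintype.card ι + 2 := by rw [hdim, hι]
  have h1 : ∀ j k, ∑ l, (inner ℝ ψ (c (e j) (c (e k) (c (e l) ψ))) : ℝ) •
      c (e j) (c (e k) (c (e l) ψ)) = ψ + (inner ℝ (e j) (e k) : ℝ) • c (e j) (c (e k) ψ) +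
        c (e j) ((inner ℝ (c (e k) (ν ψ)) (c (e j) ψ) : ℝ) • c (e k) (ν ψ)) := by
    intro j k
    have := congrArg (fun s ↦ c (e j) (c (e k) s)) (h.sum_three_form e hdim' (e j) (e k))
    simp only [map_sum, map_smul, map_add] at this
    rw [this, h.sq (e k), map_smul, h.sq (e j)]
    simp only [real_inner_self_eq_norm_sq, e.orthonormal.1, map_smul]
    module
  have h2 := fun j ↦ h.sum_inner_mul_vol' e hdim' (e j)
  simp only [h1, Finset.sum_add_distrib, ← map_sum, h2]
  simp only [orthonormal_iff_ite.1 e.orthonormal, ite_smul, one_smul, zero_smul,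
    Finset.sum_ite_eq, Finset.mem_univ, if_true, h.sum_sq e, Finset.sum_const,
    Finset.card_univ, hι]
  module

/-- The three-form anticommutes with `ν`, so `ν ψ` has the opposite eigenvalue. -/
theorem three_form_vol (hι : Fintype.card ι = 6) (hdim : Module.finrank ℝ S = 8) :
    ∑ j, ∑ k, ∑ l, (inner ℝ ψ (c (e j) (c (e k) (c (e l) ψ))) : ℝ) •
      c (e j) (c (e k) (c (e l) (ν ψ))) = -(24 : ℝ) • ν ψ := by
  have h1 := congrArg ν (h.three_form_psi e hι hdim)
  simp only [map_sum, map_smul, h.vol_mul, map_neg, neg_neg, smul_neg,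
    Finset.sum_neg_distrib] at h1
  rw [neg_smul, ← h1, neg_neg]

/-- The three-form annihilates the spinors `v ψ`. -/
theorem three_form_mul (hι : Fintype.card ι = 6) (hdim : Module.finrank ℝ S = 8) (m : ι) :
    ∑ j, ∑ k, ∑ l, (inner ℝ ψ (c (e j) (c (e k) (c (e l) ψ))) : ℝ) •
      c (e j) (c (e k) (c (e l) (c (e m) ψ))) = 0 := by
  classical
  have hdim' : Module.finrank ℝ S = Fintype.card ι + 2 := by rw [hdim, hι]
  have ho : ∀ i j, inner ℝ (e i) (e j) = if i = j then (1 : ℝ) else 0 :=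
    orthonormal_iff_ite.1 e.orthonormal
  -- move `e_m` to the left; the three contractions contribute `8`, and the product `-24`
  have h0 : ∀ j k l, c (e j) (c (e k) (c (e l) (c (e m) ψ))) =
      -c (e m) (c (e j) (c (e k) (c (e l) ψ))) -
        (2 * if l = m then 1 else 0 : ℝ) • c (e j) (c (e k) ψ) +
        (2 * if k = m then 1 else 0 : ℝ) • c (e j) (c (e l) ψ) -
        (2 * if j = m then 1 else 0 : ℝ) • c (e k) (c (e l) ψ) := by
    intro j k l
    rw [h.toIsClifford.anticomm (e l) (e m), map_sub, map_sub, map_neg, map_neg,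
      h.toIsClifford.anticomm (e k) (e m), map_sub, map_neg,
      h.toIsClifford.anticomm (e j) (e m)]
    simp only [map_smul, ho]
    module
  have hC : ∑ k, ∑ l, (inner ℝ ψ (c (e m) (c (e k) (c (e l) ψ))) : ℝ) • c (e k) (c (e l) ψ) =
      -(4 : ℝ) • c (e m) ψ := by
    have : ∀ k, ∑ l, (inner ℝ ψ (c (e m) (c (e k) (c (e l) ψ))) : ℝ) • c (e k) (c (e l) ψ) =
        c (e k) (c (e k) (c (e m) ψ)) + (if m = k then 1 else 0 : ℝ) • c (e k) ψ +
          (inner ℝ (c (e k) (ν ψ)) (c (e m) ψ) : ℝ) • c (e k) (ν ψ) := by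
      intro k
      have := congrArg (c (e k)) (h.sum_three_form e hdim' (e m) (e k))
      simp only [map_sum, map_smul, map_add] at this
      rw [this, ho]
    simp only [this, Finset.sum_add_distrib, h.sum_inner_mul_vol' e hdim', h.sum_sq e, hι,
      ite_smul, one_smul, zero_smul, Finset.sum_ite_eq, Finset.mem_univ, if_true]
    module
  have hA : ∀ j k, inner ℝ ψ (c (e j) (c (e k) (c (e m) ψ))) =
      (inner ℝ ψ (c (e m) (c (e j) (c (e k) ψ))) : ℝ) := fun j k ↦ by
    rw [h.three_form_swap_right, h.three_form_swap_left, neg_neg]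
  have e1 : ∑ j, ∑ k, ∑ l, (inner ℝ ψ (c (e j) (c (e k) (c (e l) ψ))) : ℝ) •
      -c (e m) (c (e j) (c (e k) (c (e l) ψ))) = -(24 : ℝ) • c (e m) ψ := by
    have := congrArg (fun s ↦ -c (e m) s) (h.three_form_psi e hι hdim)
    simp only [map_sum, map_smul] at this
    simp only [smul_neg, Finset.sum_neg_distrib, this]
    module
  have e2 : ∑ j, ∑ k, ∑ l, (inner ℝ ψ (c (e j) (c (e k) (c (e l) ψ))) : ℝ) •
      (2 * if l = m then 1 else 0 : ℝ) • c (e j) (c (e k) ψ) = -(8 : ℝ) • c (e m) ψ := by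
    simp only [mul_ite, mul_one, mul_zero, ite_smul, zero_smul, smul_ite, smul_zero,
      Finset.sum_ite_eq', Finset.mem_univ, if_true, hA, smul_comm _ (2 : ℝ), ← Finset.smul_sum, hC]
    module
  have e3 : ∑ j, ∑ k, ∑ l, (inner ℝ ψ (c (e j) (c (e k) (c (e l) ψ))) : ℝ) •
      (2 * if k = m then 1 else 0 : ℝ) • c (e j) (c (e l) ψ) = (8 : ℝ) • c (e m) ψ := by
    have : ∀ j, ∑ k, ∑ l, (inner ℝ ψ (c (e j) (c (e k) (c (e l) ψ))) : ℝ) •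
      (2 * if k = m then 1 else 0 : ℝ) • c (e j) (c (e l) ψ) =
        -((2 : ℝ) • ∑ l, (inner ℝ ψ (c (e m) (c (e j) (c (e l) ψ))) : ℝ) •
          c (e j) (c (e l) ψ)) := by
      intro j
      rw [Finset.sum_comm]
      simp only [mul_ite, mul_one, mul_zero, ite_smul, zero_smul, smul_ite, smul_zero,
        Finset.sum_ite_eq', Finset.mem_univ, if_true, smul_comm _ (2 : ℝ), ← Finset.smul_sum]
      rw [← smul_neg, ← Finset.sum_neg_distrib]
      congr 1
      refine Finset.sum_congr rfl fun l _ ↦ ?_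
      rw [h.three_form_swap_left, neg_smul]
    simp only [this, Finset.sum_neg_distrib, ← Finset.smul_sum, hC]
    module
  have e4 : ∑ j, ∑ k, ∑ l, (inner ℝ ψ (c (e j) (c (e k) (c (e l) ψ))) : ℝ) •
      (2 * if j = m then 1 else 0 : ℝ) • c (e k) (c (e l) ψ) = -(8 : ℝ) • c (e m) ψ := by
    have : ∀ j, ∑ k, ∑ l, (inner ℝ ψ (c (e j) (c (e k) (c (e l) ψ))) : ℝ) •
      (2 * if j = m then 1 else 0 : ℝ) • c (e k) (c (e l) ψ) =
        if j = m then (2 : ℝ) • ∑ k, ∑ l, (inner ℝ ψ (c (e m) (c (e k) (c (e l) ψ))) : ℝ) •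
          c (e k) (c (e l) ψ) else 0 := by
      intro j
      split_ifs with hj
      · simp only [hj, mul_one, smul_comm _ (2 : ℝ), ← Finset.smul_sum]
      · simp
    simp only [this, Finset.sum_ite_eq', Finset.mem_univ, if_true, hC]
    module
  simp only [h0, smul_sub, smul_add, Finset.sum_sub_distrib, Finset.sum_add_distrib, e1, e2, e3, e4]
  module

/-- Six times the three-form acts as `24` times the difference of the projections onto `ψ` and
`ν ψ`. -/
theorem three_form (hι : Fintype.card ι = 6) (hdim : Module.finrank ℝ S = 8) (s : S) :
    ∑ j, ∑ k, ∑ l, (inner ℝ ψ (c (e j) (c (e k) (c (e l) ψ))) : ℝ) •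
      c (e j) (c (e k) (c (e l) s)) =
      (24 : ℝ) • ((inner ℝ ψ s : ℝ) • ψ - (inner ℝ (ν ψ) s : ℝ) • ν ψ) := by
  let T : S →ₗ[ℝ] S := ∑ j, ∑ k, ∑ l, (inner ℝ ψ (c (e j) (c (e k) (c (e l) ψ))) : ℝ) •
    ((c (e j)) ∘L (c (e k)) ∘L (c (e l))).toLinearMap
  have hT : ∀ s, T s = ∑ j, ∑ k, ∑ l, (inner ℝ ψ (c (e j) (c (e k) (c (e l) ψ))) : ℝ) •
      c (e j) (c (e k) (c (e l) s)) := by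
    intro s
    simp only [T, LinearMap.sum_apply, LinearMap.smul_apply, ContinuousLinearMap.coe_coe,
      ContinuousLinearMap.comp_apply]
  rw [← hT]
  conv_lhs => rw [h.expand e (by rw [hdim, hι]) s]
  simp only [map_add, map_sum, map_smul]
  simp only [hT, h.three_form_psi e hι hdim, h.three_form_vol e hι hdim,
    h.three_form_mul e hι hdim]
  simp only [smul_zero, Finset.sum_const_zero]
  module

end IsSpinFibre

end Clifford

/-! ### Derivatives of vector valued functions on a manifold -/

section Calculus

variable {E : Type*} [NormedAddCommGroup E] [NormedSpace ℝ E]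
  {M : Type*} [TopologicalSpace M] [ChartedSpace E M]
  {F : Type*} [NormedAddCommGroup F] [NormedSpace ℝ F]
  {F' : Type*} [NormedAddCommGroup F'] [NormedSpace ℝ F']
  {F'' : Type*} [NormedAddCommGroup F''] [NormedSpace ℝ F'']

theorem mvfderiv_clm_apply (L : F →L[ℝ] F') {f : M → F} {x : M}
    (hf : MDifferentiableAt 𝓘(ℝ, E) 𝓘(ℝ, F) f x) (v : TangentSpace 𝓘(ℝ, E) x) :
    mvfderiv 𝓘(ℝ, E) (fun y ↦ L (f y)) x v = L (mvfderiv 𝓘(ℝ, E) f x v) := by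
  have h : HasMFDerivAt 𝓘(ℝ, E) 𝓘(ℝ, F') (fun y ↦ L (f y)) x _ :=
    HasMFDerivAt.comp x L.hasMFDerivAt hf.hasMFDerivAt
  exact congrArg (fun T ↦ T v) h.mfderiv

theorem HasMFDerivAt.prodMk_vector {f : M → F} {g : M → F'} {x : M}
    {f' : TangentSpace 𝓘(ℝ, E) x →L[ℝ] F} {g' : TangentSpace 𝓘(ℝ, E) x →L[ℝ] F'}
    (hf : HasMFDerivAt 𝓘(ℝ, E) 𝓘(ℝ, F) f x f') (hg : HasMFDerivAt 𝓘(ℝ, E) 𝓘(ℝ, F') g x g') :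
    HasMFDerivAt 𝓘(ℝ, E) 𝓘(ℝ, F × F') (fun y ↦ (f y, g y)) x (f'.prod g') :=
  ⟨hf.1.prodMk hg.1, HasFDerivWithinAt.prodMk hf.2 hg.2⟩

theorem mvfderiv_bilin (B : F →L[ℝ] F' →L[ℝ] F'') {f : M → F} {g : M → F'} {x : M}
    (hf : MDifferentiableAt 𝓘(ℝ, E) 𝓘(ℝ, F) f x) (hg : MDifferentiableAt 𝓘(ℝ, E) 𝓘(ℝ, F') g x)
    (v : TangentSpace 𝓘(ℝ, E) x) :
    mvfderiv 𝓘(ℝ, E) (fun y ↦ B (f y) (g y)) x v =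
      B (mvfderiv 𝓘(ℝ, E) f x v) (g x) + B (f x) (mvfderiv 𝓘(ℝ, E) g x v) := by
  have h1 : HasMFDerivAt 𝓘(ℝ, E) 𝓘(ℝ, F × F') (fun y ↦ (f y, g y)) x _ :=
    HasMFDerivAt.prodMk_vector hf.hasMFDerivAt hg.hasMFDerivAt
  have h2 : HasMFDerivAt 𝓘(ℝ, F × F') 𝓘(ℝ, F'') (fun p : F × F' ↦ B p.1 p.2) (f x, g x) _ :=
    (B.isBoundedBilinearMap.hasFDerivAt (f x, g x)).hasMFDerivAt
  have h : HasMFDerivAt 𝓘(ℝ, E) 𝓘(ℝ, F'') (fun y ↦ B (f y) (g y)) x _ := HasMFDerivAt.comp x h2 h1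
  have := congrArg (fun T ↦ T v) h.mfderiv
  refine this.trans ?_
  exact add_comm _ _

theorem MDifferentiableAt.bilin (B : F →L[ℝ] F' →L[ℝ] F'') {f : M → F} {g : M → F'} {x : M}
    (hf : MDifferentiableAt 𝓘(ℝ, E) 𝓘(ℝ, F) f x) (hg : MDifferentiableAt 𝓘(ℝ, E) 𝓘(ℝ, F') g x) :
    MDifferentiableAt 𝓘(ℝ, E) 𝓘(ℝ, F'') (fun y ↦ B (f y) (g y)) x :=
  (B.isBoundedBilinearMap.differentiableAt (f x, g x)).mdifferentiableAt.comp x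
    (hf.prodMk_space hg)

theorem ContMDiffAt.bilin {n : ℕ∞ω} (B : F →L[ℝ] F' →L[ℝ] F'') {f : M → F} {g : M → F'} {x : M}
    (hf : ContMDiffAt 𝓘(ℝ, E) 𝓘(ℝ, F) n f x) (hg : ContMDiffAt 𝓘(ℝ, E) 𝓘(ℝ, F') n g x) :
    ContMDiffAt 𝓘(ℝ, E) 𝓘(ℝ, F'') n (fun y ↦ B (f y) (g y)) x :=
  (B.isBoundedBilinearMap.contDiff.contMDiff.contMDiffAt (x := (f x, g x))).comp x
    (hf.prodMk_space hg)

theorem ContMDiffAt.clm {n : ℕ∞ω} (L : F →L[ℝ] F') {f : M → F} {x : M}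
    (hf : ContMDiffAt 𝓘(ℝ, E) 𝓘(ℝ, F) n f x) :
    ContMDiffAt 𝓘(ℝ, E) 𝓘(ℝ, F') n (fun y ↦ L (f y)) x :=
  (L.contDiff.contMDiff.contMDiffAt (x := f x)).comp x hf

theorem mvfderiv_congr {f g : M → F} {x : M} (h : f =ᶠ[𝓝 x] g) :
    mvfderiv 𝓘(ℝ, E) f x = mvfderiv 𝓘(ℝ, E) g x := by
  unfold mvfderiv
  have h1 := h.mfderiv_eq (I := 𝓘(ℝ, E)) (I' := 𝓘(ℝ, F))
  ext v
  exact congrArg (fun T : E →L[ℝ] F ↦ T v) h1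

variable [IsManifold 𝓘(ℝ, E) ∞ M]

/-- A directional derivative computed in the chart at `x₀`. -/
theorem mvfderiv_eq_fderiv_chart {f : M → F} {x₀ x : M} (hx : x ∈ (chartAt E x₀).source)
    (hf : MDifferentiableAt 𝓘(ℝ, E) 𝓘(ℝ, F) f x) (v : TangentSpace 𝓘(ℝ, E) x) :
    mvfderiv 𝓘(ℝ, E) f x v =
      fderiv ℝ (f ∘ (extChartAt 𝓘(ℝ, E) x₀).symm) (extChartAt 𝓘(ℝ, E) x₀ x)
        (mfderiv 𝓘(ℝ, E) 𝓘(ℝ, E) (extChartAt 𝓘(ℝ, E) x₀) x v) := by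
  have hx' : x ∈ (extChartAt 𝓘(ℝ, E) x₀).source := by rwa [extChartAt_source]
  have e : (extChartAt 𝓘(ℝ, E) x₀).symm (extChartAt 𝓘(ℝ, E) x₀ x) = x :=
    (extChartAt 𝓘(ℝ, E) x₀).left_inv hx'
  have hs : MDifferentiableAt 𝓘(ℝ, E) 𝓘(ℝ, E) (extChartAt 𝓘(ℝ, E) x₀).symm
      (extChartAt 𝓘(ℝ, E) x₀ x) :=
    (contMDiffOn_extChartAt_symm (I := 𝓘(ℝ, E)) (n := ∞) x₀).contMDiffAt
      ((isOpen_extChartAt_target x₀).mem_nhds ((extChartAt 𝓘(ℝ, E) x₀).map_source hx'))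
      |>.mdifferentiableAt (by simp)
  have h1 : MDifferentiableAt 𝓘(ℝ, E) 𝓘(ℝ, F) (f ∘ (extChartAt 𝓘(ℝ, E) x₀).symm)
      (extChartAt 𝓘(ℝ, E) x₀ x) := MDifferentiableAt.comp _ (by rwa [e]) hs
  have h2 : HasMFDerivAt 𝓘(ℝ, E) 𝓘(ℝ, F)
      ((f ∘ (extChartAt 𝓘(ℝ, E) x₀).symm) ∘ extChartAt 𝓘(ℝ, E) x₀) x _ :=
    h1.hasMFDerivAt.comp x (mdifferentiableAt_extChartAt hx).hasMFDerivAt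
  have h3 : f =ᶠ[𝓝 x] (f ∘ (extChartAt 𝓘(ℝ, E) x₀).symm) ∘ extChartAt 𝓘(ℝ, E) x₀ := by
    filter_upwards [(isOpen_extChartAt_source (I := 𝓘(ℝ, E)) x₀).mem_nhds hx'] with y hy
    rw [Function.comp_apply, Function.comp_apply, (extChartAt 𝓘(ℝ, E) x₀).left_inv hy]
  have h4 := (h2.congr_of_eventuallyEq h3).mfderiv
  rw [mfderiv_eq_fderiv] at h4
  exact congrArg (fun T : E →L[ℝ] F ↦ T v) h4

theorem ContMDiffAt.mvfderiv_apply {m : ℕ∞ω} (hm : m ≤ ∞) {f : M → F}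
    {X : Π x : M, TangentSpace 𝓘(ℝ, E) x} {x : M} (hf : ContMDiffAt 𝓘(ℝ, E) 𝓘(ℝ, F) ∞ f x)
    (hX : ContMDiffAt 𝓘(ℝ, E) (𝓘(ℝ, E).prod 𝓘(ℝ, E)) m (fun y ↦ TotalSpace.mk' E y (X y)) x) :
    ContMDiffAt 𝓘(ℝ, E) 𝓘(ℝ, F) m (fun y ↦ mvfderiv 𝓘(ℝ, E) f y (X y)) x := by
  have h := hf.mfderiv_const (m := m) (by exact (add_le_add_left hm 1).trans (by simp))
  have h2 : ContMDiffAt 𝓘(ℝ, E) (𝓘(ℝ, F).prod 𝓘(ℝ, F)) m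
      (fun y ↦ (TotalSpace.mk' F (f y) (mfderiv 𝓘(ℝ, E) 𝓘(ℝ, F) f y (X y)) :
        TotalSpace F (TangentSpace 𝓘(ℝ, F) : F → Type _))) x :=
    ContMDiffAt.clm_apply_of_inCoordinates (b₁ := id) h hX (hf.of_le hm)
  exact (contMDiff_snd_tangentBundle_modelSpace F 𝓘(ℝ, F)).contMDiffAt.comp x h2

/-- The commutator of two directional derivatives is the derivative along the Lie bracket. -/
theorem mvfderiv_mlieBracket [CompleteSpace E] {f : M → F}
    {X Y : Π x : M, TangentSpace 𝓘(ℝ, E) x} {x : M}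
    (hf : ContMDiffAt 𝓘(ℝ, E) 𝓘(ℝ, F) ∞ f x)
    (hX : ContMDiffAt 𝓘(ℝ, E) (𝓘(ℝ, E).prod 𝓘(ℝ, E)) 1 (fun y ↦ TotalSpace.mk' E y (X y)) x)
    (hY : ContMDiffAt 𝓘(ℝ, E) (𝓘(ℝ, E).prod 𝓘(ℝ, E)) 1 (fun y ↦ TotalSpace.mk' E y (Y y)) x) :
    mvfderiv 𝓘(ℝ, E) f x (VectorField.mlieBracket 𝓘(ℝ, E) X Y x) =
      mvfderiv 𝓘(ℝ, E) (fun y ↦ mvfderiv 𝓘(ℝ, E) f y (Y y)) x (X x) -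
      mvfderiv 𝓘(ℝ, E) (fun y ↦ mvfderiv 𝓘(ℝ, E) f y (X y)) x (Y x) := by
  set φ := extChartAt 𝓘(ℝ, E) x with hφ
  have hxs : x ∈ (chartAt E x).source := mem_chart_source E x
  have hxs' : x ∈ φ.source := mem_extChartAt_source x
  have e : φ.symm (φ x) = x := φ.left_inv hxs'
  -- the bracket on the manifold is defined with the inverse of the derivative of `φ.symm`
  have key : ∀ z ∈ φ.target, (mfderivWithin 𝓘(ℝ, E) 𝓘(ℝ, E) φ.symm (Set.range 𝓘(ℝ, E)) z).inverse =
      mfderiv 𝓘(ℝ, E) 𝓘(ℝ, E) φ (φ.symm z) := fun z hz ↦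
    ContinuousLinearMap.inverse_eq
      (mfderivWithin_extChartAt_symm_comp_mfderiv_extChartAt (I := 𝓘(ℝ, E)) hz)
      (mfderiv_extChartAt_comp_mfderivWithin_extChartAt_symm (I := 𝓘(ℝ, E)) hz)
  have ht : φ.target ∈ 𝓝 (φ x) := (isOpen_extChartAt_target x).mem_nhds (φ.map_source hxs')
  have hS : (φ.symm ⁻¹' Set.univ ∩ Set.range 𝓘(ℝ, E) : Set E) = Set.univ := by simp
  -- the representatives of the vector fields and of the function in the chart
  have aux : ∀ Z : Π x : M, TangentSpace 𝓘(ℝ, E) x,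
      ContMDiffAt 𝓘(ℝ, E) (𝓘(ℝ, E).prod 𝓘(ℝ, E)) 1 (fun y ↦ TotalSpace.mk' E y (Z y)) x →
      ∃ Z' : E → E, VectorField.mpullbackWithin 𝓘(ℝ, E) 𝓘(ℝ, E) φ.symm Z (Set.range 𝓘(ℝ, E)) = Z' ∧
        DifferentiableAt ℝ Z' (φ x) ∧
        Z' (φ x) = mfderiv 𝓘(ℝ, E) 𝓘(ℝ, E) φ x (Z x) ∧
        ∀ z ∈ φ.target, Z' z = mfderiv 𝓘(ℝ, E) 𝓘(ℝ, E) φ (φ.symm z) (Z (φ.symm z)) := by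
    intro Z hZ
    have h4 : ∀ z ∈ φ.target, VectorField.mpullbackWithin 𝓘(ℝ, E) 𝓘(ℝ, E) φ.symm Z
        (Set.range 𝓘(ℝ, E)) z = mfderiv 𝓘(ℝ, E) 𝓘(ℝ, E) φ (φ.symm z) (Z (φ.symm z)) := by
      intro z hz
      rw [VectorField.mpullbackWithin_apply, key z hz]
      rfl
    refine ⟨_, rfl, ?_, ?_, h4⟩
    · have h := (hZ.mdifferentiableAt
        (by simp)).mdifferentiableWithinAt.differentiableWithinAt_mpullbackWithin_vectorField
        (s := Set.univ)
      rw [hS] at h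
      exact differentiableWithinAt_univ.1 h
    · have h := h4 (φ x) (φ.map_source hxs')
      rw [h]
      exact congrArg (fun y ↦ (mfderiv 𝓘(ℝ, E) 𝓘(ℝ, E) φ y (Z y) : E)) e
  obtain ⟨X', hX', dX', eX', tX'⟩ := aux X hX
  obtain ⟨Y', hY', dY', eY', tY'⟩ := aux Y hY
  set f' : E → F := f ∘ φ.symm with hf'
  have hsymm : ContMDiffAt 𝓘(ℝ, E) 𝓘(ℝ, E) ∞ φ.symm (φ x) :=
    (contMDiffOn_extChartAt_symm (I := 𝓘(ℝ, E)) (n := ∞) x).contMDiffAt ht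
  have cf' : ContDiffAt ℝ ∞ f' (φ x) := by
    rw [← contMDiffAt_iff_contDiffAt]
    exact ContMDiffAt.comp (φ x) (by rwa [e]) hsymm
  have df' : DifferentiableAt ℝ (fderiv ℝ f') (φ x) :=
    (cf'.fderiv_right (m := 1) (by norm_cast)).differentiableAt (by simp)
  -- an iterated directional derivative in the chart: apart from the second derivative of `f'`, it
  -- contains the derivative of the representative of the second field
  have main : ∀ (Z W : Π x : M, TangentSpace 𝓘(ℝ, E) x) (W' : E → E)
      (_ : ContMDiffAt 𝓘(ℝ, E) (𝓘(ℝ, E).prod 𝓘(ℝ, E)) 1 (fun y ↦ TotalSpace.mk' E y (W y)) x)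
      (_ : DifferentiableAt ℝ W' (φ x))
      (_ : ∀ z ∈ φ.target, W' z = mfderiv 𝓘(ℝ, E) 𝓘(ℝ, E) φ (φ.symm z) (W (φ.symm z))),
      mvfderiv 𝓘(ℝ, E) (fun y ↦ mvfderiv 𝓘(ℝ, E) f y (W y)) x (Z x) =
        fderiv ℝ f' (φ x) (fderiv ℝ W' (φ x) (mfderiv 𝓘(ℝ, E) 𝓘(ℝ, E) φ x (Z x))) +
        fderiv ℝ (fderiv ℝ f') (φ x) (mfderiv 𝓘(ℝ, E) 𝓘(ℝ, E) φ x (Z x)) (W' (φ x)) := by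
    intro Z W W' hW dW tW
    rw [mvfderiv_eq_fderiv_chart hxs
      ((ContMDiffAt.mvfderiv_apply (by norm_cast) hf hW).mdifferentiableAt (by simp))]
    have h1 : (fun y ↦ mvfderiv 𝓘(ℝ, E) f y (W y)) ∘ φ.symm =ᶠ[𝓝 (φ x)]
        fun z ↦ fderiv ℝ f' z (W' z) := by
      have h0 : ∀ᶠ y in 𝓝 x, MDifferentiableAt 𝓘(ℝ, E) 𝓘(ℝ, F) f y :=
        (contMDiffAt_iff_contMDiffAt_nhds (n := 1) (by simp)
          |>.1 (hf.of_le (by norm_cast))).mono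
          fun y hy ↦ hy.mdifferentiableAt (by simp)
      have hc : Tendsto φ.symm (𝓝 (φ x)) (𝓝 x) := by
        have := hsymm.continuousAt.tendsto
        rwa [e] at this
      filter_upwards [ht, hc.eventually h0] with z hz hz'
      have hzs : φ.symm z ∈ (chartAt E x).source := by
        have := φ.map_target hz
        rwa [hφ, extChartAt_source] at this
      rw [Function.comp_apply, mvfderiv_eq_fderiv_chart hzs hz', tW z hz, ← hφ, φ.right_inv hz]
    rw [h1.fderiv_eq, fderiv_clm_apply df' dW]
    rfl
  rw [main X Y Y' hY dY' tY', main Y X X' hX dX' tX', ← eX', ← eY']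
  -- the second derivatives cancel by symmetry
  have sym : fderiv ℝ (fderiv ℝ f') (φ x) (X' (φ x)) (Y' (φ x)) =
      fderiv ℝ (fderiv ℝ f') (φ x) (Y' (φ x)) (X' (φ x)) :=
    (cf'.isSymmSndFDerivAt (by simp; norm_cast)).eq _ _
  rw [sym, add_sub_add_right_eq_sub, ← map_sub,
    mvfderiv_eq_fderiv_chart hxs (hf.mdifferentiableAt (by simp))]
  congr 1
  rw [← VectorField.mlieBracketWithin_univ, VectorField.mlieBracketWithin_apply, ← hφ, hX', hY',
    hS, VectorField.lieBracketWithin, fderivWithin_univ, fderivWithin_univ]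
  have hinv : (mfderiv 𝓘(ℝ, E) 𝓘(ℝ, E) φ x).IsInvertible := isInvertible_mfderiv_extChartAt hxs'
  obtain ⟨T, hT⟩ := hinv
  rw [← hT, ContinuousLinearMap.inverse_equiv]
  exact T.apply_symm_apply _

end Calculus

/-! ### The adjoint representation -/

section Adjoint

variable {EK : Type*} [NormedAddCommGroup EK] [NormedSpace ℝ EK]
  {K : Type*} [TopologicalSpace K] [Group K] [ChartedSpace EK K] [LieGroup 𝓘(ℝ, EK) ∞ K]

theorem contMDiff_conj (g : K) : ContMDiff 𝓘(ℝ, EK) 𝓘(ℝ, EK) ∞ (fun h : K ↦ g * h * g⁻¹) :=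
  (contMDiff_const.mul contMDiff_id).mul contMDiff_const

theorem Ad_one : Ad (1 : K) = ContinuousLinearMap.id ℝ (LieAlg EK K) := by
  have h : (fun h : K ↦ 1 * h * 1⁻¹) = id := by ext; simp
  have h2 : HasMFDerivAt 𝓘(ℝ, EK) 𝓘(ℝ, EK) (fun h : K ↦ 1 * h * 1⁻¹) 1
      (ContinuousLinearMap.id ℝ (TangentSpace 𝓘(ℝ, EK) (1 : K))) := by
    rw [h]
    exact hasMFDerivAt_id 1
  exact h2.mfderiv

theorem hasMFDerivAt_conj (g : K) :
    HasMFDerivAt 𝓘(ℝ, EK) 𝓘(ℝ, EK) (fun h : K ↦ g * h * g⁻¹) 1 (Ad g) :=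
  ((contMDiff_conj g).mdifferentiable (by simp) 1).hasMFDerivAt

theorem Ad_mul (g h : K) : Ad (g * h) = Ad (EK := EK) g ∘L Ad h := by
  have h1 : HasMFDerivAt 𝓘(ℝ, EK) 𝓘(ℝ, EK) (fun k : K ↦ g * k * g⁻¹) (h * 1 * h⁻¹) (Ad g) := by
    have : h * 1 * h⁻¹ = 1 := by group
    rw [this]
    exact hasMFDerivAt_conj g
  have h2 := HasMFDerivAt.comp (1 : K) h1 (hasMFDerivAt_conj h)
  have h3 : (fun k : K ↦ g * k * g⁻¹) ∘ (fun k : K ↦ h * k * h⁻¹) =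
      fun k : K ↦ (g * h) * k * (g * h)⁻¹ := by
    ext k
    simp [mul_assoc]
  rw [h3] at h2
  exact h2.mfderiv

theorem Ad_inv_apply_Ad (g : K) (v : LieAlg EK K) : Ad g⁻¹ (Ad g v) = v := by
  have := Ad_mul (EK := EK) g⁻¹ g
  rw [inv_mul_cancel, Ad_one] at this
  exact (congrArg (fun T ↦ T v) this).symm

theorem Ad_apply_Ad_inv (g : K) (v : LieAlg EK K) : Ad g (Ad g⁻¹ v) = v := by
  have := Ad_mul (EK := EK) g g⁻¹
  rw [mul_inv_cancel, Ad_one] at this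
  exact (congrArg (fun T ↦ T v) this).symm

variable (EK) in
/-- The adjoint representation as a map into the endomorphisms of the model space of the group, on
which the smoothness of functions with values in the Lie algebra is defined. -/
def adE (g : K) : EK →L[ℝ] EK := Ad g

/-- Smoothness of the adjoint representation. The derivative at `1` of conjugation is known to
depend smoothly on parameters only in tangent coordinates; these are trivial at the point `1`. -/
theorem contMDiff_adE : ContMDiff 𝓘(ℝ, EK) 𝓘(ℝ, EK →L[ℝ] EK) ∞ (adE EK : K → EK →L[ℝ] EK) := by
  intro g₀
  have h := ContMDiffAt.mfderiv (I := 𝓘(ℝ, EK)) (I' := 𝓘(ℝ, EK)) (J := 𝓘(ℝ, EK)) (n := ∞) (m := ∞)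
    (x₀ := g₀) (fun g h : K ↦ g * h * g⁻¹) (fun _ ↦ (1 : K))
    (by
      have : ContMDiff (𝓘(ℝ, EK).prod 𝓘(ℝ, EK)) 𝓘(ℝ, EK) ∞ (fun p : K × K ↦ p.1 * p.2 * p.1⁻¹) :=
        (contMDiff_fst.mul contMDiff_snd).mul contMDiff_fst.inv
      exact this _) contMDiffAt_const (by simp)
  refine h.congr_of_eventuallyEq (Eventually.of_forall fun g ↦ ?_)
  have e : ∀ g : K, g * 1 * g⁻¹ = 1 := fun g ↦ by group
  have e2 := inTangentCoordinates_eq (I := 𝓘(ℝ, EK)) (I' := 𝓘(ℝ, EK)) (fun _ : K ↦ (1 : K))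
    (fun g : K ↦ g * 1 * g⁻¹) (fun g ↦ adE EK g) (x₀ := g₀) (x := g) (mem_chart_source EK (1 : K))
    (by rw [e g, e g₀]; exact mem_chart_source EK (1 : K))
  refine Eq.trans ?_ e2.symm
  ext v
  simp only [e, ContinuousLinearMap.comp_apply]
  have key : ∀ w : EK, (tangentBundleCore 𝓘(ℝ, EK) K).coordChange (achart EK (1 : K))
      (achart EK (1 : K)) 1 w = w := fun w ↦
    (tangentBundleCore 𝓘(ℝ, EK) K).coordChange_self (achart EK (1 : K)) 1
      (mem_chart_source EK (1 : K)) w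
  refine Eq.trans ?_ (key _).symm
  exact congrArg (adE EK g) (key v).symm

theorem mvfderiv_eq_fderiv_chart_one {F : Type*} [NormedAddCommGroup F] [NormedSpace ℝ F]
    {f : K → F} (hf : MDifferentiableAt 𝓘(ℝ, EK) 𝓘(ℝ, F) f 1) (v : LieAlg EK K) :
    mvfderiv 𝓘(ℝ, EK) f 1 v = fderiv ℝ (f ∘ (extChartAt 𝓘(ℝ, EK) (1 : K)).symm)
      (extChartAt 𝓘(ℝ, EK) (1 : K) 1) v := by
  have hM : IsManifold 𝓘(ℝ, EK) ∞ K := LieGroup.toContMDiffMul.toIsManifold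
  rw [mvfderiv_eq_fderiv_chart (mem_chart_source EK (1 : K)) hf, mfderiv_extChartAt_self]
  rfl

theorem mvfderiv_comp_chart_one {F : Type*} [NormedAddCommGroup F] [NormedSpace ℝ F]
    {f : EK → F} (hf : DifferentiableAt ℝ f (extChartAt 𝓘(ℝ, EK) (1 : K) 1)) (v : LieAlg EK K) :
    mvfderiv 𝓘(ℝ, EK) (fun g : K ↦ f (extChartAt 𝓘(ℝ, EK) (1 : K) g)) 1 v =
      fderiv ℝ f (extChartAt 𝓘(ℝ, EK) (1 : K) 1) v := by
  have h1s : (1 : K) ∈ (extChartAt 𝓘(ℝ, EK) (1 : K)).source := mem_extChartAt_source 1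
  refine (mvfderiv_eq_fderiv_chart_one (f := fun g : K ↦ f (extChartAt 𝓘(ℝ, EK) (1 : K) g))
    (hf.mdifferentiableAt.comp (1 : K)
      (mdifferentiableAt_extChartAt (mem_chart_source EK (1 : K)))) v).trans ?_
  have : (fun g : K ↦ f (extChartAt 𝓘(ℝ, EK) (1 : K) g)) ∘ (extChartAt 𝓘(ℝ, EK) (1 : K)).symm
      =ᶠ[𝓝 (extChartAt 𝓘(ℝ, EK) (1 : K) 1)] f := by
    filter_upwards [(isOpen_extChartAt_target (1 : K)).mem_nhds
      ((extChartAt 𝓘(ℝ, EK) (1 : K)).map_source h1s)] with z hz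
    rw [Function.comp_apply, (extChartAt 𝓘(ℝ, EK) (1 : K)).right_inv hz]
  rw [this.fderiv_eq]

/-- Let `φ` be the chart at the identity. The derivatives of `h ↦ φ (h g)` and of `h ↦ φ (g h)` at
the identity, here `G g` and `v ↦ q v g`, have as functions of `g` the same derivative at the
identity, up to exchanging the two directions: both are the mixed second derivative of the
multiplication. They are related by the adjoint action. -/
theorem mixed_derivative_mul (v w : LieAlg EK K) :
    ∃ G : K → EK →L[ℝ] EK, ∃ q : LieAlg EK K → K → EK,
      MDifferentiableAt 𝓘(ℝ, EK) 𝓘(ℝ, EK →L[ℝ] EK) G 1 ∧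
      G 1 = ContinuousLinearMap.id ℝ EK ∧
      (∀ v, ∀ᶠ g in 𝓝 (1 : K), q v g =
        mvfderiv 𝓘(ℝ, EK) (extChartAt 𝓘(ℝ, EK) (1 : K)) g (mulInvariantVectorField v g)) ∧
      (∀ v, ∀ᶠ g in 𝓝 (1 : K), q v g = G g (Ad g v)) ∧
      mvfderiv 𝓘(ℝ, EK) (fun g ↦ G g w) 1 v = mvfderiv 𝓘(ℝ, EK) (q v) 1 w := by
  set φ := extChartAt 𝓘(ℝ, EK) (1 : K) with hφ
  have h1s : (1 : K) ∈ φ.source := mem_extChartAt_source 1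
  set e := φ 1 with he
  have e1 : φ.symm e = 1 := φ.left_inv h1s
  -- the multiplication in the chart
  let μ : EK × EK → EK := fun z ↦ φ (φ.symm z.1 * φ.symm z.2)
  have hsymm : ContMDiffAt 𝓘(ℝ, EK) 𝓘(ℝ, EK) ∞ φ.symm e :=
    (contMDiffOn_extChartAt_symm (I := 𝓘(ℝ, EK)) (n := ∞) (1 : K)).contMDiffAt
      ((isOpen_extChartAt_target _).mem_nhds (φ.map_source h1s))
  have cμ : ContDiffAt ℝ ∞ μ (e, e) := by
    rw [← contMDiffAt_iff_contDiffAt]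
    have h1 : ContMDiffAt 𝓘(ℝ, EK × EK) 𝓘(ℝ, EK) ∞ (fun z : EK × EK ↦ φ.symm z.1) (e, e) :=
      ContMDiffAt.comp (e, e) (f := Prod.fst) hsymm contDiffAt_fst.contMDiffAt
    have h2 : ContMDiffAt 𝓘(ℝ, EK × EK) 𝓘(ℝ, EK) ∞ (fun z : EK × EK ↦ φ.symm z.2) (e, e) :=
      ContMDiffAt.comp (e, e) (f := Prod.snd) hsymm contDiffAt_snd.contMDiffAt
    refine ContMDiffAt.comp (e, e) (I' := 𝓘(ℝ, EK)) (g := φ)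
      (f := fun z : EK × EK ↦ φ.symm z.1 * φ.symm z.2) ?_ (h1.mul h2)
    rw [e1, mul_one]
    exact contMDiffAt_extChartAt
  have dμ : ∀ᶠ z in 𝓝 (e, e), DifferentiableAt ℝ μ z :=
    ((cμ.of_le (m := 1) (by norm_cast)).eventually (by simp)).mono
      fun z hz ↦ hz.differentiableAt (by simp)
  have ddμ : DifferentiableAt ℝ (fderiv ℝ μ) (e, e) :=
    (cμ.fderiv_right (m := 1) (by norm_cast)).differentiableAt (by simp)
  have hφc : ContinuousAt φ (1 : K) := continuousAt_extChartAt 1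
  have evl : ∀ᶠ g in 𝓝 (1 : K), DifferentiableAt ℝ μ (φ g, e) :=
    (hφc.prodMk continuousAt_const).eventually dμ
  have evr : ∀ᶠ g in 𝓝 (1 : K), DifferentiableAt ℝ μ (e, φ g) :=
    (ContinuousAt.prodMk continuousAt_const hφc).eventually dμ
  have evs : ∀ᶠ g in 𝓝 (1 : K), g ∈ φ.source :=
    (isOpen_extChartAt_source (1 : K)).mem_nhds h1s
  have hφd : ∀ g ∈ φ.source, MDifferentiableAt 𝓘(ℝ, EK) 𝓘(ℝ, EK) φ g := fun g hg ↦
    mdifferentiableAt_extChartAt (by rwa [hφ, extChartAt_source] at hg)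
  have hmul : ∀ g : K, MDifferentiableAt 𝓘(ℝ, EK) 𝓘(ℝ, EK) (fun h : K ↦ g * h) 1 := fun g ↦
    (contMDiff_mul_left (I := 𝓘(ℝ, EK)) (n := ∞) (a := g)).mdifferentiable (by simp) 1
  have hmulr : ∀ g : K, MDifferentiableAt 𝓘(ℝ, EK) 𝓘(ℝ, EK) (fun h : K ↦ h * g) 1 := fun g ↦
    (contMDiff_mul_right (I := 𝓘(ℝ, EK)) (n := ∞) (a := g)).mdifferentiable (by simp) 1
  -- the derivatives of left and right translation in terms of partial derivatives of `μ`
  have left : ∀ g ∈ φ.source, DifferentiableAt ℝ μ (φ g, e) → ∀ v : LieAlg EK K,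
      mvfderiv 𝓘(ℝ, EK) (fun h : K ↦ φ (g * h)) 1 v = fderiv ℝ μ (φ g, e) (0, v) := by
    intro g hg hd v
    refine (mvfderiv_eq_fderiv_chart_one (f := fun h : K ↦ φ (g * h))
      (MDifferentiableAt.comp (1 : K) (by rw [mul_one]; exact hφd g hg) (hmul g)) v).trans ?_
    have : (fun h : K ↦ φ (g * h)) ∘ (extChartAt 𝓘(ℝ, EK) (1 : K)).symm =
        μ ∘ fun y ↦ (φ g, y) := by
      ext y
      simp only [μ, Function.comp_apply, φ.left_inv hg]
      rfl
    rw [this]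
    have hc : HasFDerivAt (μ ∘ fun y ↦ (φ g, y)) _ e :=
      HasFDerivAt.comp e hd.hasFDerivAt (hasFDerivAt_prodMk_right (φ g) e)
    exact congrArg (fun T ↦ T v) hc.fderiv
  have right : ∀ g ∈ φ.source, DifferentiableAt ℝ μ (e, φ g) → ∀ v : LieAlg EK K,
      mvfderiv 𝓘(ℝ, EK) (fun h : K ↦ φ (h * g)) 1 v = fderiv ℝ μ (e, φ g) (v, 0) := by
    intro g hg hd v
    refine (mvfderiv_eq_fderiv_chart_one (f := fun h : K ↦ φ (h * g))
      (MDifferentiableAt.comp (1 : K) (by rw [one_mul]; exact hφd g hg) (hmulr g)) v).trans ?_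
    have : (fun h : K ↦ φ (h * g)) ∘ (extChartAt 𝓘(ℝ, EK) (1 : K)).symm =
        μ ∘ fun y ↦ (y, φ g) := by
      ext y
      simp only [μ, Function.comp_apply, φ.left_inv hg]
      rfl
    rw [this]
    have hc : HasFDerivAt (μ ∘ fun y ↦ (y, φ g)) _ e :=
      HasFDerivAt.comp e hd.hasFDerivAt (hasFDerivAt_prodMk_left e (φ g))
    exact congrArg (fun T ↦ T v) hc.fderiv
  have dG : DifferentiableAt ℝ (fun y ↦ fderiv ℝ μ (e, y)) e :=
    DifferentiableAt.comp e ddμ (by fun_prop)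
  have dG' : DifferentiableAt ℝ (fun y ↦ fderiv ℝ μ (y, e)) e :=
    DifferentiableAt.comp e (f := fun y : EK ↦ (y, e)) ddμ (by fun_prop)
  -- `G g` is the derivative of right translation by `g`, and `q v g` is the left invariant field of
  -- `v` at `g`, both in the chart
  refine ⟨fun g ↦ fderiv ℝ μ (e, φ g) ∘L ContinuousLinearMap.inl ℝ EK EK,
    fun v g ↦ fderiv ℝ μ (φ g, e) (0, v), ?_, ?_, ?_, ?_, ?_⟩
  · have h : DifferentiableAt ℝ
        (fun y ↦ fderiv ℝ μ (e, y) ∘L ContinuousLinearMap.inl ℝ EK EK) e :=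
      dG.clm_comp (differentiableAt_const _)
    exact h.mdifferentiableAt.comp (1 : K) (hφd 1 h1s)
  · have hid : (fun y ↦ μ (y, e)) =ᶠ[𝓝 e] id := by
      filter_upwards [(isOpen_extChartAt_target (1 : K)).mem_nhds (φ.map_source h1s)] with y hy
      simp only [μ, e1, mul_one, id]
      exact φ.right_inv hy
    have hc : HasFDerivAt (μ ∘ fun y ↦ (y, e)) _ e :=
      HasFDerivAt.comp e dμ.self_of_nhds.hasFDerivAt (hasFDerivAt_prodMk_left e e)
    refine hc.fderiv.symm.trans ?_
    exact (hid.fderiv_eq (𝕜 := ℝ)).trans fderiv_id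
  · intro v
    filter_upwards [evl, evs] with g hg hgs
    rw [← left g hgs hg v]
    have h2 : HasMFDerivAt 𝓘(ℝ, EK) 𝓘(ℝ, EK) (fun h : K ↦ φ (g * h)) 1 _ :=
      HasMFDerivAt.comp (1 : K) (I' := 𝓘(ℝ, EK)) (g := φ)
        (g' := mfderiv 𝓘(ℝ, EK) 𝓘(ℝ, EK) φ g) (by
          rw [mul_one]
          exact (hφd g hgs).hasMFDerivAt) (hmul g).hasMFDerivAt
    exact congrArg (fun T ↦ T v) h2.mfderiv
  · intro v
    filter_upwards [evl, evr, evs] with g hg hgr hgs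
    rw [← left g hgs hg v]
    refine Eq.trans ?_ (right g hgs hgr (Ad g v))
    have e2 : (fun h : K ↦ φ (g * h)) = (fun h : K ↦ φ (h * g)) ∘ fun h ↦ g * h * g⁻¹ := by
      ext h
      simp
    have h3 : MDifferentiableAt 𝓘(ℝ, EK) 𝓘(ℝ, EK) (fun h : K ↦ φ (h * g)) 1 :=
      MDifferentiableAt.comp (1 : K) (by rw [one_mul]; exact hφd g hgs) (hmulr g)
    have h2 : HasMFDerivAt 𝓘(ℝ, EK) 𝓘(ℝ, EK) ((fun h : K ↦ φ (h * g)) ∘ fun h ↦ g * h * g⁻¹) 1 _ :=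
      HasMFDerivAt.comp (1 : K) (I' := 𝓘(ℝ, EK)) (g := fun h : K ↦ φ (h * g))
        (g' := mfderiv 𝓘(ℝ, EK) 𝓘(ℝ, EK) (fun h : K ↦ φ (h * g)) 1) (by
          have e3 : g * 1 * g⁻¹ = 1 := by group
          rw [e3]
          exact h3.hasMFDerivAt) (hasMFDerivAt_conj g)
    rw [e2]
    exact congrArg (fun T ↦ T v) h2.mfderiv
  · have hw : DifferentiableAt ℝ (fun y ↦ fderiv ℝ μ (e, y) ((w : EK), (0 : EK))) e :=
      dG.clm_apply (differentiableAt_const _)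
    have hv : DifferentiableAt ℝ (fun y ↦ fderiv ℝ μ (y, e) ((0 : EK), (v : EK))) e :=
      dG'.clm_apply (differentiableAt_const _)
    refine (mvfderiv_comp_chart_one hw v).trans ?_
    refine Eq.trans ?_ (mvfderiv_comp_chart_one hv w).symm
    have h1 : HasFDerivAt (fun y ↦ fderiv ℝ μ (e, y)) _ e :=
      HasFDerivAt.comp e ddμ.hasFDerivAt (hasFDerivAt_prodMk_right e e)
    have h2 : HasFDerivAt (fun y ↦ fderiv ℝ μ (y, e)) _ e :=
      HasFDerivAt.comp e (f := fun y : EK ↦ (y, e)) ddμ.hasFDerivAt (hasFDerivAt_prodMk_left e e)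
    have aux : ∀ (H : EK → EK × EK →L[ℝ] EK) (H' : EK →L[ℝ] EK × EK →L[ℝ] EK) (z : EK × EK)
        (u : EK), HasFDerivAt H H' e → fderiv ℝ (fun y ↦ H y z) e u = H' u z := by
      intro H H' z u hH
      have := ((ContinuousLinearMap.apply ℝ EK z).hasFDerivAt.comp e hH).fderiv
      exact congrArg (fun T : EK →L[ℝ] EK ↦ T u) this
    -- both sides are the mixed second derivative of the multiplication
    have h1' := aux _ _ ((w : EK), (0 : EK)) v h1
    have h2' := aux _ _ ((0 : EK), (v : EK)) w h2
    refine h1'.trans (Eq.trans ?_ h2'.symm)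
    exact (cμ.isSymmSndFDerivAt (by simp; norm_cast)).eq _ _

/-- The derivative of the adjoint representation at the identity is the Lie bracket. -/
theorem mvfderiv_adE [FiniteDimensional ℝ EK] (v w : LieAlg EK K) :
    mvfderiv 𝓘(ℝ, EK) (fun g : K ↦ adE EK g w) 1 v = ⁅v, w⁆ := by
  have hM : IsManifold 𝓘(ℝ, EK) ∞ K := LieGroup.toContMDiffMul.toIsManifold
  let w' : EK := w
  obtain ⟨G, q, dG, G1, hq, hqG, mixed⟩ := mixed_derivative_mul v w
  have hsm : ∀ u : LieAlg EK K, ContMDiffAt 𝓘(ℝ, EK) (𝓘(ℝ, EK).prod 𝓘(ℝ, EK)) 1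
      (fun g ↦ TotalSpace.mk' EK g (mulInvariantVectorField u g)) (1 : K) := fun u ↦
    (contMDiffAt_mulInvariantVectorField (I := 𝓘(ℝ, EK)) u (g := (1 : K))).of_le
      (by rw [minSmoothness_of_isRCLikeNormedField]; norm_cast)
  have h := mvfderiv_mlieBracket (contMDiffAt_extChartAt (I := 𝓘(ℝ, EK)) (n := ∞) (x := (1 : K)))
    (hsm v) (hsm w)
  have hval : ∀ u : LieAlg EK K, mulInvariantVectorField u (1 : K) = u := by
    intro u
    have h1 : (fun h : K ↦ 1 * h) = id := by ext; simp
    have h2 : HasMFDerivAt 𝓘(ℝ, EK) 𝓘(ℝ, EK) (fun h : K ↦ 1 * h) 1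
        (ContinuousLinearMap.id ℝ (TangentSpace 𝓘(ℝ, EK) (1 : K))) := by
      rw [h1]
      exact hasMFDerivAt_id 1
    exact congrArg (fun T ↦ T u) h2.mfderiv
  have hself : ∀ u : LieAlg EK K, mvfderiv 𝓘(ℝ, EK) (extChartAt 𝓘(ℝ, EK) (1 : K)) 1 u = u := by
    intro u
    have h2 := mfderiv_extChartAt_self (I := 𝓘(ℝ, EK)) (x := (1 : K))
    exact congrArg (fun T : EK →L[ℝ] EK ↦ T u) h2
  rw [hself, hval, hval, mvfderiv_congr ((hq w).mono fun g hg ↦ hg.symm),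
    mvfderiv_congr ((hq v).mono fun g hg ↦ hg.symm), mvfderiv_congr (hqG w)] at h
  have dA : MDifferentiableAt 𝓘(ℝ, EK) 𝓘(ℝ, EK) (fun g : K ↦ adE EK g w) 1 :=
    (ContMDiffAt.clm (ContinuousLinearMap.apply ℝ EK w')
      (contMDiff_adE.contMDiffAt (x := (1 : K)))).mdifferentiableAt (by simp)
  have h2 := mvfderiv_bilin (ContinuousLinearMap.id ℝ (EK →L[ℝ] EK)) dG dA v
  have h3 := mvfderiv_clm_apply (ContinuousLinearMap.apply ℝ EK w') dG v
  have e1 : adE EK (1 : K) w = w := congrArg (fun T ↦ T w) (Ad_one (EK := EK) (K := K))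
  rw [e1, G1] at h2
  -- the bracket of two left invariant fields, with the field of `w` written as `g ↦ G g (Ad g w)`
  have h4 : ⁅v, w⁆ = mvfderiv 𝓘(ℝ, EK) (fun g ↦ G g w) 1 v +
      mvfderiv 𝓘(ℝ, EK) (fun g : K ↦ adE EK g w) 1 v - mvfderiv 𝓘(ℝ, EK) (q v) 1 w := by
    refine h.trans ?_
    refine congrArg (· - _) ?_
    refine h2.trans ?_
    refine congrArg (· + _) ?_
    exact h3.symm
  rw [mixed] at h4
  exact (h4.trans (add_sub_cancel_left _ _)).symm

end Adjoint

section Adjoint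

variable {EK : Type*} [NormedAddCommGroup EK] [NormedSpace ℝ EK]
  {K : Type*} [TopologicalSpace K] [Group K] [ChartedSpace EK K] [LieGroup 𝓘(ℝ, EK) ∞ K]

variable [FiniteDimensional ℝ EK]

variable (EK K) in
/-- The Lie bracket as a continuous bilinear map on the model space of the group. -/
def lieE : EK →L[ℝ] EK →L[ℝ] EK :=
  let L : LieAlg EK K →ₗ[ℝ] LieAlg EK K →ₗ[ℝ] LieAlg EK K :=
    LinearMap.mk₂ ℝ (fun v w ↦ ⁅v, w⁆) add_lie smul_lie lie_add lie_smul
  LinearMap.toContinuousBilinearMap (show EK →ₗ[ℝ] EK →ₗ[ℝ] EK from L)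

theorem contMDiff_adE_apply (w : EK) :
    ContMDiff 𝓘(ℝ, EK) 𝓘(ℝ, EK) ∞ (fun g : K ↦ adE EK g w) := fun g ↦
  ContMDiffAt.clm (ContinuousLinearMap.apply ℝ EK w) (contMDiff_adE.contMDiffAt (x := g))

section Comp

variable {E : Type*} [NormedAddCommGroup E] [NormedSpace ℝ E]
  {M : Type*} [TopologicalSpace M] [ChartedSpace E M] {k : M → K} {x : M}
  {k' : TangentSpace 𝓘(ℝ, E) x →L[ℝ] EK}

/-- The derivative of `y ↦ Ad (k y) w` where `k` passes through the identity. -/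
theorem hasMFDerivAt_adE_comp (hk : HasMFDerivAt 𝓘(ℝ, E) 𝓘(ℝ, EK) k x k') (hx : k x = 1) (w : EK) :
    HasMFDerivAt 𝓘(ℝ, E) 𝓘(ℝ, EK) (fun y ↦ adE EK (k y) w) x
      (((lieE EK K).flip w : EK →L[ℝ] EK) ∘L k') := by
  have h1 : HasMFDerivAt 𝓘(ℝ, EK) 𝓘(ℝ, EK) (fun g : K ↦ adE EK g w) (k x)
      ((lieE EK K).flip w : EK →L[ℝ] EK) := by
    rw [hx]
    have h := ((contMDiff_adE_apply (K := K) w).mdifferentiable (by simp) 1).hasMFDerivAt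
    have e : ((lieE EK K).flip w : EK →L[ℝ] EK) =
        mfderiv 𝓘(ℝ, EK) 𝓘(ℝ, EK) (fun g : K ↦ adE EK g w) 1 := by
      refine ContinuousLinearMap.ext fun v ↦ ?_
      exact (mvfderiv_adE (K := K) v w).symm
    exact e ▸ h
  exact HasMFDerivAt.comp x h1 hk

theorem mvfderiv_adE_inv_comp (hk : HasMFDerivAt 𝓘(ℝ, E) 𝓘(ℝ, EK) k x k') (hx : k x = 1) (w : EK)
    (v : TangentSpace 𝓘(ℝ, E) x) :
    mvfderiv 𝓘(ℝ, E) (fun y ↦ adE EK (k y)⁻¹ w) x v = -lieE EK K (k' v) w := by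
  have hinv : ∀ u : EK, MDifferentiableAt 𝓘(ℝ, E) 𝓘(ℝ, EK) (fun y ↦ adE EK (k y)⁻¹ u) x := fun u ↦
    MDifferentiableAt.comp x (I' := 𝓘(ℝ, EK)) (g := fun g : K ↦ adE EK g⁻¹ u)
      (((contMDiff_adE_apply u).comp (contMDiff_inv 𝓘(ℝ, EK) ∞)).mdifferentiable (by simp) _)
      hk.mdifferentiableAt
  have hA : MDifferentiableAt 𝓘(ℝ, E) 𝓘(ℝ, EK →L[ℝ] EK) (fun y ↦ adE EK (k y)) x :=
    MDifferentiableAt.comp x (I' := 𝓘(ℝ, EK)) (contMDiff_adE.mdifferentiable (by simp) _)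
      hk.mdifferentiableAt
  have h := mvfderiv_bilin (ContinuousLinearMap.id ℝ (EK →L[ℝ] EK)) hA (hinv w) v
  -- differentiate `Ad (k y) (Ad (k y)⁻¹ w) = w`
  have h0 : (fun y ↦ (ContinuousLinearMap.id ℝ (EK →L[ℝ] EK)) (adE EK (k y)) (adE EK (k y)⁻¹ w)) =
      fun _ ↦ w := by
    ext y
    exact Ad_apply_Ad_inv (k y) w
  have h1 := mvfderiv_clm_apply (ContinuousLinearMap.apply ℝ EK w) hA v
  have h2 := congrArg (fun T : TangentSpace 𝓘(ℝ, E) x →L[ℝ] EK ↦ T v)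
    (hasMFDerivAt_adE_comp hk hx w).mfderiv
  have e1 : ∀ u : EK, adE EK (1 : K) u = u := fun u ↦
    congrArg (fun T : EK →L[ℝ] EK ↦ T u) (Ad_one (EK := EK))
  rw [h0, mvfderiv_const, hx, inv_one, e1] at h
  simp only [ContinuousLinearMap.id_apply, zero_apply, e1] at h
  have h3 : (mvfderiv 𝓘(ℝ, E) (fun y ↦ adE EK (k y)) x v) w = lieE EK K (k' v) w :=
    h1.symm.trans h2
  rw [h3] at h
  exact (neg_eq_of_add_eq_zero_right h.symm).symm

/-- The derivative of `y ↦ Ad (h y)⁻¹ w` in terms of the left logarithmic derivative of `h`. -/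
theorem mvfderiv_adE_inv_comp_logDeriv {h : M → K}
    (hk : HasMFDerivAt 𝓘(ℝ, E) 𝓘(ℝ, EK) (fun y ↦ (h x)⁻¹ * h y) x k') (w : EK)
    (v : TangentSpace 𝓘(ℝ, E) x) :
    mvfderiv 𝓘(ℝ, E) (fun y ↦ adE EK (h y)⁻¹ w) x v =
      -lieE EK K (k' v) (adE EK (h x)⁻¹ w) := by
  rw [← mvfderiv_adE_inv_comp hk (by simp)]
  refine congrArg (fun f : M → EK ↦ mvfderiv 𝓘(ℝ, E) f x v) ?_
  ext y
  -- translate by `(h x)⁻¹`, so that the group valued function passes through the identity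
  have h1 : (h y)⁻¹ = ((h x)⁻¹ * h y)⁻¹ * (h x)⁻¹ := by group
  refine (congrArg (fun g ↦ adE EK g w) h1).trans ?_
  exact congrArg (fun T : EK →L[ℝ] EK ↦ T w) (Ad_mul (EK := EK) ((h x)⁻¹ * h y)⁻¹ (h x)⁻¹)

end Comp

theorem Ad_lie (g : K) (v w : LieAlg EK K) : Ad g ⁅v, w⁆ = ⁅Ad g v, Ad g w⁆ := by
  have h := congrArg (fun T : EK →L[ℝ] EK ↦ T v)
    (hasMFDerivAt_adE_comp (EK := EK) (hasMFDerivAt_conj g) (by group) (Ad g w)).mfderiv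
  have h2 := mvfderiv_clm_apply (F := EK) (F' := EK) (adE EK g)
    ((contMDiff_adE_apply (EK := EK) (K := K) w).mdifferentiable (by simp) 1) v
  have h3 := (congrArg (fun u ↦ Ad g u) (mvfderiv_adE (K := K) v w)).symm.trans h2.symm
  -- differentiate `Ad (g h g⁻¹) (Ad g w) = Ad g (Ad h w)` in `h`
  have e : (fun h : K ↦ adE EK (g * h * g⁻¹) (Ad g w)) = fun h ↦ adE EK g (adE EK h w) := by
    ext h
    have h1 : Ad (EK := EK) (g * h * g⁻¹) = Ad g ∘L Ad h ∘L Ad g⁻¹ := by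
      rw [Ad_mul, Ad_mul, ContinuousLinearMap.comp_assoc]
    exact (congrArg (fun T : EK →L[ℝ] EK ↦ T (Ad g w)) h1).trans
      (congrArg (fun u ↦ Ad g (Ad h u)) (Ad_inv_apply_Ad g w))
  rw [e] at h
  exact h3.trans h

/-- A vector fixed by the adjoint representation is central in the Lie algebra. -/
theorem lie_eq_zero_of_Ad_eq {w : LieAlg EK K} (hw : ∀ g : K, Ad g w = w) (v : LieAlg EK K) :
    ⁅v, w⁆ = 0 := by
  rw [← mvfderiv_adE]
  have e : (fun h : K ↦ adE EK h w) = fun _ ↦ w := by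
    ext h
    exact hw h
  rw [e]
  exact congrArg (fun T : EK →L[ℝ] EK ↦ T v) (mvfderiv_const (I := 𝓘(ℝ, EK)) (M := K) (F := EK) w)

/-- Infinitesimal invariance of an invariant bilinear form. -/
theorem form_lie_of_Ad_invariant (b : EK →L[ℝ] EK →L[ℝ] ℝ)
    (hb : ∀ (g : K) v w, b (adE EK g v) (adE EK g w) = b v w) (u v w : EK) :
    b (lieE EK K u v) w + b v (lieE EK K u w) = 0 := by
  have e1 : ∀ u : EK, adE EK (1 : K) u = u := fun u ↦
    congrArg (fun T : EK →L[ℝ] EK ↦ T u) (Ad_one (EK := EK))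
  have h := mvfderiv_bilin b ((contMDiff_adE_apply (K := K) v).mdifferentiable (by simp) 1)
    ((contMDiff_adE_apply (K := K) w).mdifferentiable (by simp) 1) (u : LieAlg EK K)
  simp only [hb, e1, mvfderiv_const] at h
  have hd : ∀ z : EK, mvfderiv 𝓘(ℝ, EK) (fun g : K ↦ adE EK g z) 1 u = lieE EK K u z :=
    fun z ↦ mvfderiv_adE (K := K) u z
  rw [← hd v, ← hd w]
  exact h.symm

end Adjoint

/-! ### The strong maximum principle in Euclidean space -/

section MaximumPrinciple

variable {E : Type*} [NormedAddCommGroup E] [InnerProductSpace ℝ E] [FiniteDimensional ℝ E]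

/-- The second derivative of a function is nonpositive at a local maximum. -/
theorem IsLocalMax.fderiv_fderiv_nonpos {v : E → ℝ} {x : E} (hm : IsLocalMax v x)
    (hv : ContDiffAt ℝ 2 v x) (h : E) : fderiv ℝ (fderiv ℝ v) x h h ≤ 0 := by
  by_contra! hpos
  let l : ℝ → E := fun t ↦ x + t • h
  have hl : ∀ t, HasDerivAt l h t := fun t ↦ by
    simpa [l] using ((hasDerivAt_id t).smul_const h).const_add x
  have l0 : l 0 = x := by simp [l]
  have lc : Tendsto l (𝓝 0) (𝓝 x) := by
    have := (hl 0).continuousAt.tendsto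
    rwa [l0] at this
  have hd : ∀ᶠ y in 𝓝 x, DifferentiableAt ℝ v y :=
    ((hv.of_le (m := 1) (by norm_num)).eventually (by simp)).mono
      fun y hy ↦ hy.differentiableAt (by simp)
  have h1 : deriv (v ∘ l) =ᶠ[𝓝 0] fun t ↦ fderiv ℝ v (l t) h := by
    filter_upwards [lc.eventually hd] with t ht
    exact (ht.hasFDerivAt.comp_hasDerivAt t (hl t)).deriv
  have dd : DifferentiableAt ℝ (fderiv ℝ v) x :=
    (hv.fderiv_right (m := 1) (by norm_num)).differentiableAt (by simp)
  have h2 : HasDerivAt (fun t ↦ fderiv ℝ v (l t) h) (fderiv ℝ (fderiv ℝ v) x h h) 0 := by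
    have h3 : HasFDerivAt (fderiv ℝ v) (fderiv ℝ (fderiv ℝ v) x) (l 0) := by
      rw [l0]
      exact dd.hasFDerivAt
    have h4 := h3.comp_hasDerivAt (0 : ℝ) (hl 0)
    exact ((ContinuousLinearMap.apply ℝ ℝ h).hasFDerivAt.comp_hasDerivAt (0 : ℝ) h4)
  have h3 : deriv (deriv (v ∘ l)) 0 = fderiv ℝ (fderiv ℝ v) x h h := by
    rw [h1.deriv_eq, h2.deriv]
  have hmax : IsLocalMax (v ∘ l) 0 := by
    have : ∀ᶠ t in 𝓝 (0 : ℝ), v (l t) ≤ v (l 0) := by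
      rw [l0]
      exact lc.eventually hm
    exact this
  -- a positive second derivative along a line would also make the point a local minimum, so that
  -- the function is constant on the line near the point
  have hmin : IsLocalMin (v ∘ l) 0 := by
    refine isLocalMin_of_deriv_deriv_pos (by rw [h3]; exact hpos) hmax.deriv_eq_zero ?_
    have : ContinuousAt v (l 0) := by rw [l0]; exact hv.continuousAt
    exact this.comp (hl 0).continuousAt
  have hc : v ∘ l =ᶠ[𝓝 0] fun _ ↦ (v ∘ l) 0 := by
    filter_upwards [hmax, hmin] with t h1 h2 using le_antisymm h1 h2
  have h5 : deriv (v ∘ l) =ᶠ[𝓝 0] fun _ ↦ 0 := by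
    filter_upwards [hc.deriv] with t ht
    rw [ht]
    simp
  rw [h5.deriv_eq] at h3
  simp at h3
  linarith

variable {ι : Type*} [Fintype ι]

/-- A second order differential operator `∑ aᵢⱼ ∂ᵢ∂ⱼ + ∑ cᵢ ∂ᵢ`, with `∂ᵢ` the derivative along
`e i`. -/
def diffOp (e : ι → E) (a : ι → ι → E → ℝ) (c : ι → E → ℝ) (u : E → ℝ) (x : E) : ℝ :=
  ∑ i, ∑ j, a i j x * fderiv ℝ (fderiv ℝ u) x (e i) (e j) + ∑ i, c i x * fderiv ℝ u x (e i)

/-- Ellipticity at `x`: the leading coefficient is a sum of squares of vectors on which no nonzero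
covector vanishes. -/
def IsEllipticAt (e : ι → E) (a : ι → ι → E → ℝ) (x : E) : Prop :=
  ∃ (κ : Type) (_ : Fintype κ) (W : κ → E), (∀ l : E →L[ℝ] ℝ, (∀ k, l (W k) = 0) → l = 0) ∧
    ∀ H : E →L[ℝ] E →L[ℝ] ℝ, ∑ i, ∑ j, a i j x * H (e i) (e j) = ∑ k, H (W k) (W k)

variable {e : ι → E} {a : ι → ι → E → ℝ} {c : ι → E → ℝ} {u v : E → ℝ} {x : E}

theorem diffOp_nonpos_of_isLocalMax (ha : IsEllipticAt e a x) (hm : IsLocalMax u x)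
    (hu : ContDiffAt ℝ 2 u x) : diffOp e a c u x ≤ 0 := by
  obtain ⟨κ, _, W, -, hW⟩ := ha
  rw [diffOp, hW, hm.fderiv_eq_zero]
  simp only [zero_apply, mul_zero, Finset.sum_const_zero, add_zero]
  exact Finset.sum_nonpos fun k _ ↦ IsLocalMax.fderiv_fderiv_nonpos hm hu (W k)

theorem diffOp_add_smul (hu : ContDiffAt ℝ 2 u x) (hv : ContDiffAt ℝ 2 v x) (t : ℝ) :
    diffOp e a c (fun y ↦ u y + t * v y) x = diffOp e a c u x + t * diffOp e a c v x := by
  have hd : ∀ {w : E → ℝ}, ContDiffAt ℝ 2 w x → ∀ᶠ y in 𝓝 x, DifferentiableAt ℝ w y := fun hw ↦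
    ((hw.of_le (m := 1) (by norm_num)).eventually (by simp)).mono
      fun y hy ↦ hy.differentiableAt (by simp)
  have dd : ∀ {w : E → ℝ}, ContDiffAt ℝ 2 w x → DifferentiableAt ℝ (fderiv ℝ w) x := fun hw ↦
    (hw.fderiv_right (m := 1) (by norm_num)).differentiableAt (by simp)
  have h1 : fderiv ℝ (fun y ↦ u y + t * v y) =ᶠ[𝓝 x] fun y ↦ fderiv ℝ u y + t • fderiv ℝ v y := by
    filter_upwards [hd hu, hd hv] with y hy hy'
    exact (hy.hasFDerivAt.add (hy'.hasFDerivAt.const_mul t)).fderiv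
  have h2 : fderiv ℝ (fderiv ℝ (fun y ↦ u y + t * v y)) x =
      fderiv ℝ (fderiv ℝ u) x + t • fderiv ℝ (fderiv ℝ v) x := by
    rw [h1.fderiv_eq]
    exact ((dd hu).hasFDerivAt.add ((dd hv).hasFDerivAt.const_smul t)).fderiv
  simp only [diffOp, h2, h1.self_of_nhds, add_apply, smul_apply, smul_eq_mul, mul_add,
    Finset.sum_add_distrib, Finset.mul_sum]
  have e1 : ∀ i j, a i j x * (t * fderiv ℝ (fderiv ℝ v) x (e i) (e j)) =
      t * (a i j x * fderiv ℝ (fderiv ℝ v) x (e i) (e j)) := fun i j ↦ by ring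
  have e2 : ∀ i, c i x * (t * fderiv ℝ v x (e i)) = t * (c i x * fderiv ℝ v x (e i)) :=
    fun i ↦ by ring
  simp only [e1, e2]
  ring

/-- The comparison function `q + K q²` with `q = r² - |x - y|²`, which is positive inside the
sphere of radius `r` about `y` and negative just outside it. -/
def barrier (y : E) (r K : ℝ) (x : E) : ℝ :=
  (r ^ 2 - ‖x - y‖ ^ 2) + K * (r ^ 2 - ‖x - y‖ ^ 2) ^ 2

theorem contDiff_barrier (y : E) (r K : ℝ) : ContDiff ℝ ∞ (barrier y r K) := by
  unfold barrier
  have : ContDiff ℝ ∞ (fun x : E ↦ r ^ 2 - ‖x - y‖ ^ 2) :=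
    contDiff_const.sub ((contDiff_id.sub contDiff_const).norm_sq ℝ)
  exact this.add (contDiff_const.mul (this.pow 2))

theorem fderiv_barrier (y : E) (r K : ℝ) (x : E) :
    fderiv ℝ (barrier y r K) x =
      (-2 * (1 + 2 * K * (r ^ 2 - ‖x - y‖ ^ 2))) • innerSL ℝ (x - y) := by
  have h0 : HasFDerivAt (fun x : E ↦ x - y) (ContinuousLinearMap.id ℝ E) x :=
    (hasFDerivAt_id x).sub_const y
  have h1 := h0.norm_sq.const_sub (r ^ 2)
  have h2 := h1.add ((h1.pow 2).const_mul K)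
  refine h2.fderiv.trans ?_
  ext h
  simp
  ring

theorem fderiv_fderiv_barrier (y : E) (r K : ℝ) (x h k : E) :
    fderiv ℝ (fderiv ℝ (barrier y r K)) x h k =
      8 * K * inner ℝ (x - y) h * inner ℝ (x - y) k -
        2 * (1 + 2 * K * (r ^ 2 - ‖x - y‖ ^ 2)) * inner ℝ h k := by
  have e0 : fderiv ℝ (barrier y r K) = fun x ↦
      (-2 * (1 + 2 * K * (r ^ 2 - ‖x - y‖ ^ 2))) • innerSL ℝ (x - y) := by
    ext1 x
    exact fderiv_barrier y r K x
  rw [e0]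
  have h0 : HasFDerivAt (fun x : E ↦ x - y) (ContinuousLinearMap.id ℝ E) x :=
    (hasFDerivAt_id x).sub_const y
  have h1 := (((h0.norm_sq.const_sub (r ^ 2)).const_mul (2 * K)).const_add 1).const_mul (-2)
  have h2 : HasFDerivAt (fun x : E ↦ innerSL ℝ (x - y)) (innerSL ℝ) x :=
    (innerSL ℝ (E := E)).hasFDerivAt.comp x h0
  have h3 := (h1.smul h2).fderiv
  refine (congrArg (fun T : E →L[ℝ] E →L[ℝ] ℝ ↦ T h k) h3).trans ?_
  have e1 : innerSL ℝ h k = inner ℝ h k := rfl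
  simp only [neg_smul, smul_neg, neg_neg, map_sub, add_apply, smul_apply, e1,
    ContinuousLinearMap.smulRight_apply, ContinuousLinearMap.comp_id, sub_apply, smul_eq_mul,
    inner_sub_left, innerSL_apply_apply]
  ring

theorem continuousOn_diffOp_barrier {Ω : Set E} (ha : ∀ i j, ContinuousOn (a i j) Ω)
    (hc : ∀ i, ContinuousOn (c i) Ω) (y : E) (r K : ℝ) :
    ContinuousOn (diffOp e a c (barrier y r K)) Ω := by
  have e1 : diffOp e a c (barrier y r K) = fun x ↦
      ∑ i, ∑ j, a i j x * (8 * K * inner ℝ (x - y) (e i) * inner ℝ (x - y) (e j) -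
        2 * (1 + 2 * K * (r ^ 2 - ‖x - y‖ ^ 2)) * inner ℝ (e i) (e j)) +
      ∑ i, c i x * ((-2 * (1 + 2 * K * (r ^ 2 - ‖x - y‖ ^ 2))) * inner ℝ (x - y) (e i)) := by
    ext x
    simp only [diffOp, fderiv_fderiv_barrier, fderiv_barrier, smul_apply, innerSL_apply_apply,
      smul_eq_mul]
  rw [e1]
  refine ContinuousOn.add (continuousOn_finsetSum _ fun i _ ↦ continuousOn_finsetSum _ fun j _ ↦
    (ha i j).mul ?_) (continuousOn_finsetSum _ fun i _ ↦ (hc i).mul ?_)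
  · exact Continuous.continuousOn (by fun_prop)
  · exact Continuous.continuousOn (by fun_prop)

/-- For large `K` the operator is positive on the comparison function at a point of the sphere. -/
theorem exists_diffOp_barrier_pos {z y : E} {r : ℝ} (ha : IsEllipticAt e a z) (hr : 0 < r)
    (hz : ‖z - y‖ = r) : ∃ K, 0 < K ∧ 0 < diffOp e a c (barrier y r K) z := by
  obtain ⟨κ, _, W, hspan, hW⟩ := ha
  set s := ∑ k, (inner ℝ (z - y) (W k) : ℝ) ^ 2 with hs
  have hspos : 0 < s := by
    refine lt_of_le_of_ne (Finset.sum_nonneg fun k _ ↦ sq_nonneg _) fun h ↦ ?_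
    have h1 : ∀ k, innerSL ℝ (z - y) (W k) = 0 := fun k ↦ by
      have := (Finset.sum_eq_zero_iff_of_nonneg (fun k _ ↦ sq_nonneg _)).1 h.symm k
        (Finset.mem_univ k)
      exact pow_eq_zero_iff (two_ne_zero) |>.1 this
    have h2 := congrArg (fun T ↦ T (z - y)) (hspan _ h1)
    simp only [innerSL_apply_apply, zero_apply, real_inner_self_eq_norm_sq, hz] at h2
    exact hr.ne' (pow_eq_zero_iff (two_ne_zero) |>.1 h2)
  set b := ∑ k, (2 * inner ℝ (W k) (W k) : ℝ) + ∑ i, c i z * (2 * inner ℝ (z - y) (e i)) with hb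
  have key : ∀ K, diffOp e a c (barrier y r K) z = 8 * K * s - b := by
    intro K
    rw [diffOp, hW]
    simp only [fderiv_fderiv_barrier, fderiv_barrier, hz, smul_apply, innerSL_apply_apply,
      smul_eq_mul, sub_self, mul_zero, add_zero, mul_one, hs, hb, Finset.sum_sub_distrib,
      Finset.mul_sum]
    have e1 : ∀ k, 8 * K * (inner ℝ (z - y) (W k)) * (inner ℝ (z - y) (W k) : ℝ) =
        8 * K * (inner ℝ (z - y) (W k) : ℝ) ^ 2 := fun k ↦ by ring
    have e2 : ∀ i, c i z * (-2 * inner ℝ (z - y) (e i)) =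
      -(c i z * (2 * inner ℝ (z - y) (e i)) : ℝ) := fun i ↦ by ring
    simp only [e1, e2, Finset.sum_neg_distrib]
    ring
  refine ⟨(|b| + 1) / (8 * s), by positivity, ?_⟩
  rw [key]
  have : 8 * ((|b| + 1) / (8 * s)) * s = |b| + 1 := by field_simp
  rw [this]
  linarith [le_abs_self b]

/-- The strong maximum principle of Hopf, near an interior maximum. -/
theorem strong_maximum_principle {Ω : Set E} (hΩ : IsOpen Ω)
    (ha : ∀ i j, ContinuousOn (a i j) Ω) (hc : ∀ i, ContinuousOn (c i) Ω)
    (hell : ∀ x ∈ Ω, IsEllipticAt e a x) (hu : ContDiffOn ℝ 2 u Ω)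
    (hL : ∀ x ∈ Ω, 0 ≤ diffOp e a c u x) {y₀ : E} (hy₀ : y₀ ∈ Ω) (hmax : ∀ x ∈ Ω, u x ≤ u y₀) :
    ∀ᶠ x in 𝓝 y₀, u x = u y₀ := by
  obtain ⟨R, hR, hball⟩ := Metric.isOpen_iff.1 hΩ y₀ hy₀
  have hcu : ContinuousOn u Ω := hu.continuousOn
  refine Metric.eventually_nhds_iff.2 ⟨R / 4, by positivity, fun x₁ hx₁ ↦ ?_⟩
  by_contra hne
  -- the point `z` of the maximum set closest to `x₁`
  let Z : Set E := {x | u x = u y₀} ∩ Metric.closedBall y₀ (R / 2)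
  have hsub : Metric.closedBall y₀ (R / 2) ⊆ Ω :=
    (Metric.closedBall_subset_ball (by linarith)).trans hball
  have hZ : IsCompact Z := by
    have h1 : IsClosed (Metric.closedBall y₀ (R / 2) ∩ u ⁻¹' {u y₀}) :=
      (hcu.mono hsub).preimage_isClosed_of_isClosed Metric.isClosed_closedBall isClosed_singleton
    have h2 : Z = Metric.closedBall y₀ (R / 2) ∩ u ⁻¹' {u y₀} := Set.inter_comm _ _
    rw [h2]
    exact (isCompact_closedBall y₀ (R / 2)).of_isClosed_subset h1 Set.inter_subset_left
  have hy₀Z : y₀ ∈ Z := ⟨rfl, Metric.mem_closedBall_self (by positivity)⟩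
  obtain ⟨z, hzZ, hzmin⟩ := hZ.exists_isMinOn ⟨y₀, hy₀Z⟩
    (continuous_id.dist (continuous_const (y := x₁))).continuousOn
  have hzmin' : ∀ x ∈ Z, dist z x₁ ≤ dist x x₁ := fun x hx ↦ hzmin hx
  have hd : dist z x₁ < R / 4 := by
    refine (hzmin' y₀ hy₀Z).trans_lt ?_
    rwa [dist_comm]
  have hd0 : 0 < dist z x₁ := dist_pos.2 fun h ↦ hne (h ▸ hzZ.1)
  have hlt : ∀ x, dist x x₁ < dist z x₁ → u x < u y₀ := by
    intro x hx
    have hx2 : x ∈ Metric.closedBall y₀ (R / 2) := by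
      rw [Metric.mem_closedBall]
      linarith [dist_triangle x x₁ y₀]
    refine lt_of_le_of_ne (hmax x (hsub hx2)) fun h ↦ ?_
    exact absurd (hzmin' x ⟨h, hx2⟩) (not_le.2 hx)
  have hzΩ : z ∈ Ω := hsub hzZ.2
  -- the ball with half the radius which touches the maximum set only at `z`
  set y : E := midpoint ℝ z x₁ with hy
  set r : ℝ := dist z x₁ / 2 with hr
  have hr0 : 0 < r := by positivity
  have hzy : ‖z - y‖ = r := by
    rw [← dist_eq_norm, hy, dist_left_midpoint (𝕜 := ℝ), hr]
    simp
    ring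
  have hyx : dist y x₁ = r := by
    rw [hy, dist_midpoint_right (𝕜 := ℝ), hr]
    simp
    ring
  have hin : ∀ x, ‖x - y‖ ≤ r → x ≠ z → u x < u y₀ := by
    intro x hx hxz
    refine hlt x ?_
    have h1 : dist x x₁ ≤ dist x y + dist y x₁ := dist_triangle _ _ _
    rw [hyx, dist_eq_norm x y] at h1
    have h2 : dist z x₁ = r + r := by rw [hr]; ring
    refine lt_of_le_of_ne (by linarith) fun h3 ↦ hxz ?_
    -- equality in the triangle inequality forces `x = z`
    have h4 : dist x y = dist x x₁ / 2 := by rw [dist_eq_norm x y]; linarith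
    have h5 : dist y x₁ = dist x x₁ / 2 := by linarith
    have h6 := eq_midpoint_of_dist_eq_half h4 h5
    rw [hy] at h6
    have h7 := congrArg (fun p ↦ (2 : ℝ) • p - x₁) h6
    simp only [midpoint_eq_smul_add, smul_smul] at h7
    norm_num at h7
    exact h7.symm
  obtain ⟨K, hK, hpos⟩ := exists_diffOp_barrier_pos (c := c) (hell z hzΩ) hr0 hzy
  set w := barrier y r K with hw
  -- a small ball about `z` on which the comparison function is useful
  have ev1 : ∀ᶠ x in 𝓝 z, 0 < diffOp e a c w x :=
    ((continuousOn_diffOp_barrier ha hc y r K).continuousAt (hΩ.mem_nhds hzΩ)).eventually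
      (lt_mem_nhds hpos)
  have ev2 : ∀ᶠ x in 𝓝 z, -1 < K * (r ^ 2 - ‖x - y‖ ^ 2) := by
    have : Continuous fun x : E ↦ K * (r ^ 2 - ‖x - y‖ ^ 2) := by fun_prop
    refine this.continuousAt.eventually (lt_mem_nhds ?_)
    simp [hzy]
  obtain ⟨ρ, hρ, hρball⟩ := Metric.nhds_basis_closedBall.eventually_iff.1
    ((ev1.and ev2).and (hΩ.mem_nhds hzΩ))
  have hwcont : Continuous w := (contDiff_barrier y r K).continuous
  have hρΩ : Metric.closedBall z ρ ⊆ Ω := fun x hx ↦ (hρball hx).2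
  have hwneg : ∀ x ∈ Metric.closedBall z ρ, r < ‖x - y‖ → w x < 0 := by
    intro x hx hrx
    have h1 := (hρball hx).1.2
    have h2 : r ^ 2 - ‖x - y‖ ^ 2 < 0 := by nlinarith
    have h3 : w x = (r ^ 2 - ‖x - y‖ ^ 2) * (1 + K * (r ^ 2 - ‖x - y‖ ^ 2)) := by
      rw [hw, barrier]
      ring
    rw [h3]
    exact mul_neg_of_neg_of_pos h2 (by linarith)
  -- a multiple of the comparison function which keeps the sum below the maximum on the sphere
  obtain ⟨t, ht, hsphere⟩ : ∃ t : ℝ, 0 < t ∧ ∀ x ∈ Metric.sphere z ρ, u x + t * w x < u y₀ := by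
    let T : Set E := Metric.sphere z ρ ∩ Metric.closedBall y r
    have hT : IsCompact T := (isCompact_sphere z ρ).inter_right Metric.isClosed_closedBall
    have hout : ∀ t, 0 < t → ∀ x ∈ Metric.sphere z ρ, x ∉ T → u x + t * w x < u y₀ := by
      intro t ht x hx hxT
      have h1 : r < ‖x - y‖ := by
        by_contra! h
        exact hxT ⟨hx, by rwa [Metric.mem_closedBall, dist_eq_norm]⟩
      have h2 := hwneg x (Metric.sphere_subset_closedBall hx) h1
      have h3 := hmax x (hρΩ (Metric.sphere_subset_closedBall hx))
      nlinarith
    rcases T.eq_empty_or_nonempty with hTe | hTn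
    · exact ⟨1, one_pos, fun x hx ↦ hout 1 one_pos x hx (by rw [hTe]; exact Set.notMem_empty x)⟩
    · have hTΩ : T ⊆ Ω := fun x hx ↦ hρΩ (Metric.sphere_subset_closedBall hx.1)
      obtain ⟨p, hpT, hp⟩ := hT.exists_isMaxOn hTn (hcu.mono hTΩ)
      obtain ⟨q, hqT, hq⟩ := hT.exists_isMaxOn hTn hwcont.continuousOn
      have hp1 : u p < u y₀ := by
        refine hin p ?_ ?_
        · have := hpT.2
          rwa [Metric.mem_closedBall, dist_eq_norm] at this
        · rintro rfl
          have := hpT.1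
          rw [Metric.mem_sphere, dist_self] at this
          exact hρ.ne this
      refine ⟨(u y₀ - u p) / (|w q| + 1), by have := abs_nonneg (w q); apply div_pos <;> linarith,
        fun x hx ↦ ?_⟩
      have ht0 : 0 < (u y₀ - u p) / (|w q| + 1) := by
        have := abs_nonneg (w q)
        apply div_pos <;> linarith
      by_cases hxT : x ∈ T
      · have h1 : u x ≤ u p := hp hxT
        have h2 : w x ≤ w q := hq hxT
        have h3 : (u y₀ - u p) / (|w q| + 1) * w x < u y₀ - u p := by
          rw [div_mul_eq_mul_div, div_lt_iff₀ (by positivity)]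
          have := le_abs_self (w q)
          nlinarith
        linarith
      · exact hout _ ht0 x hx hxT
  -- the sum attains its maximum in the interior, where the operator is positive
  have hvc : ContinuousOn (fun x ↦ u x + t * w x) (Metric.closedBall z ρ) :=
    (hcu.mono hρΩ).add (continuousOn_const.mul hwcont.continuousOn)
  obtain ⟨p, hpB, hp⟩ := (isCompact_closedBall z ρ).exists_isMaxOn
    ⟨z, Metric.mem_closedBall_self hρ.le⟩ hvc
  have hwz : w z = 0 := by
    rw [hw, barrier, hzy]
    ring
  have hpz : u y₀ ≤ u p + t * w p := by
    have h1 : u z + t * w z ≤ u p + t * w p := hp (Metric.mem_closedBall_self hρ.le)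
    rwa [hwz, mul_zero, add_zero, hzZ.1] at h1
  have hpball : p ∈ Metric.ball z ρ := by
    rcases (Metric.mem_closedBall.1 hpB).lt_or_eq with h | h
    · exact h
    · exact absurd hpz (not_le.2 (hsphere p h))
  have hloc : IsLocalMax (fun x ↦ u x + t * w x) p := by
    filter_upwards [Metric.isOpen_ball.mem_nhds hpball] with x hx
    exact hp (Metric.ball_subset_closedBall hx)
  have hpΩ : p ∈ Ω := hρΩ hpB
  have hup : ContDiffAt ℝ 2 u p := hu.contDiffAt (hΩ.mem_nhds hpΩ)
  have hwp : ContDiffAt ℝ 2 w p := ((contDiff_barrier y r K).of_le (by norm_cast)).contDiffAt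
  have h1 := diffOp_nonpos_of_isLocalMax (c := c) (hell p hpΩ) hloc
    (hup.add (contDiffAt_const.mul hwp))
  rw [diffOp_add_smul hup hwp] at h1
  have h2 := hL p hpΩ
  have h3 := mul_pos ht (hρball hpB).1.1
  linarith

end MaximumPrinciple

/-! ### Dual bases -/

section DualBasis

variable {V : Type*} [NormedAddCommGroup V] [InnerProductSpace ℝ V]
  {ι : Type*} [Fintype ι] [DecidableEq ι] [Nonempty ι]

/-- The basis dual to a basis `v` of a Euclidean space, with respect to the inner product. -/
def dualOf (v : ι → V) (i : ι) : V := ∑ j, (Matrix.gram ℝ v)⁻¹ i j • v j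

variable {v : ι → V} (hv : LinearIndependent ℝ v)

include hv

theorem isUnit_det_gram : IsUnit (Matrix.gram ℝ v).det :=
  (Matrix.det_gram_ne_zero_iff_linearIndependent.2 hv).isUnit

theorem inner_dualOf (i j : ι) : inner ℝ (dualOf v i) (v j) = if i = j then (1 : ℝ) else 0 := by
  simp only [dualOf, sum_inner, inner_smul_left]
  have h := congrFun (congrFun (Matrix.nonsing_inv_mul _ (isUnit_det_gram hv)) i) j
  rw [Matrix.mul_apply, Matrix.one_apply] at h
  rw [← h]
  rfl

theorem inner_dualOf_dualOf (i j : ι) :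
    inner ℝ (dualOf v i) (dualOf v j) = (Matrix.gram ℝ v)⁻¹ j i := by
  conv_lhs => rw [dualOf.eq_1 v j]
  simp only [inner_sum, inner_smul_right, inner_dualOf hv]
  simp

theorem sum_inner_dualOf_smul (hcard : Fintype.card ι = Module.finrank ℝ V) (w : V) :
    ∑ i, (inner ℝ (dualOf v i) w : ℝ) • v i = w := by
  have h := (basisOfLinearIndependentOfCardEqFinrank hv hcard).sum_repr w
  simp only [coe_basisOfLinearIndependentOfCardEqFinrank] at h
  set c := (basisOfLinearIndependentOfCardEqFinrank hv hcard).repr w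
  have h2 : ∀ i, inner ℝ (dualOf v i) w = c i := fun i ↦ by
    rw [← h]
    simp only [inner_sum, inner_smul_right, inner_dualOf hv]
    simp
  simp only [h2]
  exact h

/-- A vector is determined by its inner products with the elements of a basis. -/
theorem ext_inner_basis (hcard : Fintype.card ι = Module.finrank ℝ V) {w w' : V}
    (h : ∀ i, inner ℝ w (v i) = (inner ℝ w' (v i) : ℝ)) : w = w' := by
  have h2 : ∀ u, inner ℝ w u = (inner ℝ w' u : ℝ) := fun u ↦ by
    rw [← sum_inner_dualOf_smul hv hcard u]
    simp only [inner_sum, inner_smul_right, h]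
  exact ext_inner_right ℝ h2

/-- The trace of a bilinear map, in an orthonormal basis and in a pair of dual bases. -/
theorem sum_onb_eq_sum_dualOf (hcard : Fintype.card ι = Module.finrank ℝ V)
    {W : Type*} [AddCommGroup W] [Module ℝ W] (β : V →ₗ[ℝ] V →ₗ[ℝ] W)
    {κ : Type*} [Fintype κ] (e : OrthonormalBasis κ ℝ V) :
    ∑ k, β (e k) (e k) = ∑ i, β (dualOf v i) (v i) := by
  have h : ∀ i, β (dualOf v i) (v i) = ∑ k, (inner ℝ (dualOf v i) (e k) : ℝ) • β (e k) (v i) := by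
    intro i
    conv_lhs => rw [← e.sum_repr (dualOf v i)]
    simp only [map_sum, map_smul, LinearMap.sum_apply, LinearMap.smul_apply,
      OrthonormalBasis.repr_apply_apply]
    simp only [real_inner_comm]
  simp only [h]
  rw [Finset.sum_comm]
  refine Finset.sum_congr rfl fun k _ ↦ ?_
  conv_lhs => rw [← sum_inner_dualOf_smul hv hcard (e k)]
  rw [map_sum]
  simp only [map_smul]
  rw [sum_inner_dualOf_smul hv hcard (e k)]

end DualBasis

section Calculus

variable {E : Type*} [NormedAddCommGroup E] [NormedSpace ℝ E]
  {M : Type*} [TopologicalSpace M] [ChartedSpace E M]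
  {F : Type*} [NormedAddCommGroup F] [NormedSpace ℝ F] {x : M}

theorem MDifferentiableAt.finsetSum {ι : Type*} (s : Finset ι) {f : ι → M → F}
    (hf : ∀ i, MDifferentiableAt 𝓘(ℝ, E) 𝓘(ℝ, F) (f i) x) :
    MDifferentiableAt 𝓘(ℝ, E) 𝓘(ℝ, F) (fun y ↦ ∑ i ∈ s, f i y) x := by
  classical
  induction s using Finset.induction_on with
  | empty => simpa using mdifferentiableAt_const
  | insert i s hi ih =>
    simp only [Finset.sum_insert hi]
    exact (hf i).add ih

theorem mvfderiv_finsetSum {ι : Type*} (s : Finset ι) {f : ι → M → F}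
    (hf : ∀ i, MDifferentiableAt 𝓘(ℝ, E) 𝓘(ℝ, F) (f i) x) (v : TangentSpace 𝓘(ℝ, E) x) :
    mvfderiv 𝓘(ℝ, E) (fun y ↦ ∑ i ∈ s, f i y) x v = ∑ i ∈ s, mvfderiv 𝓘(ℝ, E) (f i) x v := by
  classical
  induction s using Finset.induction_on with
  | empty => simp [mvfderiv_const]
  | insert i s hi ih =>
    simp only [Finset.sum_insert hi]
    rw [← ih]
    exact congrArg (fun T ↦ T v) (mvfderiv_add (hf i) (MDifferentiableAt.finsetSum s hf))

theorem mvfderiv_smul_apply {f : M → ℝ} {g : M → F} (hf : MDifferentiableAt 𝓘(ℝ, E) 𝓘(ℝ, ℝ) f x)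
    (hg : MDifferentiableAt 𝓘(ℝ, E) 𝓘(ℝ, F) g x) (v : TangentSpace 𝓘(ℝ, E) x) :
    mvfderiv 𝓘(ℝ, E) (fun y ↦ f y • g y) x v =
      mvfderiv 𝓘(ℝ, E) f x v • g x + f x • mvfderiv 𝓘(ℝ, E) g x v :=
  mvfderiv_bilin (ContinuousLinearMap.lsmul ℝ ℝ) hf hg v

theorem mdifferentiableAt_mul {f g : M → ℝ} (hf : MDifferentiableAt 𝓘(ℝ, E) 𝓘(ℝ, ℝ) f x)
    (hg : MDifferentiableAt 𝓘(ℝ, E) 𝓘(ℝ, ℝ) g x) :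
    MDifferentiableAt 𝓘(ℝ, E) 𝓘(ℝ, ℝ) (fun y ↦ f y * g y) x :=
  MDifferentiableAt.bilin (ContinuousLinearMap.lsmul ℝ ℝ) hf hg

theorem mvfderiv_mul_apply {f g : M → ℝ} (hf : MDifferentiableAt 𝓘(ℝ, E) 𝓘(ℝ, ℝ) f x)
    (hg : MDifferentiableAt 𝓘(ℝ, E) 𝓘(ℝ, ℝ) g x) (v : TangentSpace 𝓘(ℝ, E) x) :
    mvfderiv 𝓘(ℝ, E) (fun y ↦ f y * g y) x v =
      mvfderiv 𝓘(ℝ, E) f x v * g x + f x * mvfderiv 𝓘(ℝ, E) g x v :=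
  mvfderiv_smul_apply hf hg v

end Calculus

/-! ### Regularity of sections -/

section Regularity

variable {M : Type*} [TopologicalSpace M] [ChartedSpace R6 M] [IsManifold (𝓡 6) ∞ M]

/-- A vector field is of class `C^n` at `x`. -/
abbrev VFieldAt (n : ℕ∞ω) (X : Π y : M, TangentSpace (𝓡 6) y) (x : M) : Prop :=
  ContMDiffAt (𝓡 6) ((𝓡 6).prod 𝓘(ℝ, R6)) n (fun y ↦ TotalSpace.mk' R6 y (X y)) x

/-- A vector field is differentiable at `x`. -/
abbrev VFieldDiffAt (X : Π y : M, TangentSpace (𝓡 6) y) (x : M) : Prop :=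
  MDifferentiableAt (𝓡 6) ((𝓡 6).prod 𝓘(ℝ, R6)) (fun y ↦ TotalSpace.mk' R6 y (X y)) x

variable {S : M → Type*} [TopologicalSpace (TotalSpace R8 S)]
    [∀ x, NormedAddCommGroup (S x)] [∀ x, InnerProductSpace ℝ (S x)] [FiberBundle R8 S]

/-- A spinor field is of class `C^n` at `x`. -/
abbrev SpinorAt (n : ℕ∞ω) (s : Π y : M, S y) (x : M) : Prop :=
  ContMDiffAt (𝓡 6) ((𝓡 6).prod 𝓘(ℝ, R8)) n (fun y ↦ TotalSpace.mk' R8 y (s y)) x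

/-- A spinor field is differentiable at `x`. -/
abbrev SpinorDiffAt (s : Π y : M, S y) (x : M) : Prop :=
  MDifferentiableAt (𝓡 6) ((𝓡 6).prod 𝓘(ℝ, R8)) (fun y ↦ TotalSpace.mk' R8 y (s y)) x

end Regularity

/-! ### Coordinate frames -/

section Frames

variable {M : Type*} [TopologicalSpace M] [ChartedSpace R6 M] [IsManifold (𝓡 6) ∞ M]

/-- A frame of commuting smooth vector fields on an open set, such as a coordinate frame. -/
structure IsCoordFrame (E : Fin 6 → Π x : M, TangentSpace (𝓡 6) x) (U : Set M) : Prop where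
  isOpen : IsOpen U
  contMDiffAt : ∀ i, ∀ x ∈ U, VFieldAt ∞ (E i) x
  linearIndependent : ∀ x ∈ U, LinearIndependent ℝ fun i ↦ E i x
  bracket : ∀ i j, ∀ x ∈ U, VectorField.mlieBracket (𝓡 6) (E i) (E j) x = 0

/-- The coordinate fields of the chart at `x₀` form a coordinate frame: the chart maps them to
constant fields, so that their brackets vanish. -/
theorem exists_isCoordFrame (x₀ : M) :
    ∃ E : Fin 6 → Π x : M, TangentSpace (𝓡 6) x, IsCoordFrame E (chartAt R6 x₀).source ∧
      ∀ x ∈ (chartAt R6 x₀).source, ∀ i, mfderiv (𝓡 6) 𝓘(ℝ, R6) (extChartAt (𝓡 6) x₀) x (E i x) =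
        EuclideanSpace.single i (1 : ℝ) := by
  let T := trivializationAt R6 (fun x : M ↦ TangentSpace (𝓡 6) x) x₀
  let b : Module.Basis (Fin 6) ℝ R6 := (EuclideanSpace.basisFun (Fin 6) ℝ).toBasis
  have hT : T.baseSet = (chartAt R6 x₀).source := rfl
  have hd : ∀ x ∈ (chartAt R6 x₀).source, ∀ i,
      mfderiv (𝓡 6) 𝓘(ℝ, R6) (extChartAt (𝓡 6) x₀) x (T.localFrame b i x) =
        EuclideanSpace.single i (1 : ℝ) := by
    intro x hx i
    rw [T.localFrame_apply_of_mem_baseSet b hx]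
    have h1 := TangentBundle.continuousLinearMapAt_trivializationAt (I := 𝓡 6) hx
    rw [← h1]
    refine (congrArg (fun L : TangentSpace (𝓡 6) x →ₗ[ℝ] R6 ↦ L (T.basisAt b hx i))
      (T.linearMapAt_def_of_mem hx)).trans ?_
    refine ((T.linearEquivAt ℝ x hx).apply_symm_apply (b i)).trans ?_
    simp [b]
  have hs : ∀ i, ∀ x ∈ (chartAt R6 x₀).source, VFieldAt ∞ (T.localFrame b i) x := fun i x hx ↦
    contMDiffAt_localFrame_of_mem (I := 𝓡 6) ∞ T b i hx
  refine ⟨T.localFrame b, ⟨(chartAt R6 x₀).open_source, hs, fun x hx ↦ ?_, fun i j x hx ↦ ?_⟩, hd⟩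
  · exact (T.isLocalFrameOn_localFrame_baseSet (𝓡 6) ∞ b).linearIndependent hx
  · have hx' : x ∈ (extChartAt (𝓡 6) x₀).source := by rwa [extChartAt_source]
    have hinj : Function.Injective (mfderiv (𝓡 6) 𝓘(ℝ, R6) (extChartAt (𝓡 6) x₀) x) :=
      (isInvertible_mfderiv_extChartAt hx').bijective.injective
    apply hinj
    rw [map_zero]
    have hφ : ContMDiffAt (𝓡 6) 𝓘(ℝ, R6) ∞ (extChartAt (𝓡 6) x₀) x := contMDiffAt_extChartAt' hx
    have h := mvfderiv_mlieBracket (E := R6) hφ ((hs i x hx).of_le (by norm_cast))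
      ((hs j x hx).of_le (by norm_cast))
    have hev : ∀ k, (fun y ↦ mvfderiv (𝓡 6) (extChartAt (𝓡 6) x₀) y (T.localFrame b k y)) =ᶠ[𝓝 x]
        fun _ ↦ (EuclideanSpace.single k (1 : ℝ) : R6) := fun k ↦ by
      filter_upwards [(chartAt R6 x₀).open_source.mem_nhds hx] with y hy
      exact hd y hy k
    rw [mvfderiv_congr (hev j), mvfderiv_congr (hev i), mvfderiv_const, mvfderiv_const] at h
    refine h.trans ?_
    exact sub_self _

namespace IsCoordFrame

variable {E : Fin 6 → Π x : M, TangentSpace (𝓡 6) x} {U : Set M} (hE : IsCoordFrame E U) {x : M}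
  (hx : x ∈ U)

include hE hx

theorem mem_nhds : U ∈ 𝓝 x := hE.isOpen.mem_nhds hx

theorem diffAt (i : Fin 6) : VFieldDiffAt (E i) x := (hE.contMDiffAt i x hx).mdifferentiableAt
  (by simp)

theorem contMDiffAt_deriv {F : Type*} [NormedAddCommGroup F] [NormedSpace ℝ F] {f : M → F}
    (hf : ContMDiffAt (𝓡 6) 𝓘(ℝ, F) ∞ f x) (i : Fin 6) :
    ContMDiffAt (𝓡 6) 𝓘(ℝ, F) ∞ (fun y ↦ mvfderiv (𝓡 6) f y (E i y)) x :=
  ContMDiffAt.mvfderiv_apply le_rfl hf (hE.contMDiffAt i x hx)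

/-- Derivatives along the fields of a coordinate frame commute. -/
theorem deriv_comm {F : Type*} [NormedAddCommGroup F] [NormedSpace ℝ F] {f : M → F}
    (hf : ContMDiffAt (𝓡 6) 𝓘(ℝ, F) ∞ f x) (i j : Fin 6) :
    mvfderiv (𝓡 6) (fun y ↦ mvfderiv (𝓡 6) f y (E j y)) x (E i x) =
      mvfderiv (𝓡 6) (fun y ↦ mvfderiv (𝓡 6) f y (E i y)) x (E j x) := by
  have h := mvfderiv_mlieBracket (E := R6) hf ((hE.contMDiffAt i x hx).of_le (by norm_cast))
    ((hE.contMDiffAt j x hx).of_le (by norm_cast))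
  rw [hE.bracket i j x hx, map_zero] at h
  exact (sub_eq_zero.1 h.symm)

end IsCoordFrame

theorem contMDiffAt_finsetSum {F : Type*} [NormedAddCommGroup F] [NormedSpace ℝ F]
    {ι : Type*} (s : Finset ι) {f : ι → M → F} {x : M} {n : ℕ∞ω}
    (hf : ∀ i ∈ s, ContMDiffAt (𝓡 6) 𝓘(ℝ, F) n (f i) x) :
    ContMDiffAt (𝓡 6) 𝓘(ℝ, F) n (fun y ↦ ∑ i ∈ s, f i y) x := by
  classical
  induction s using Finset.induction_on with
  | empty => simpa using contMDiffAt_const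
  | insert i s hi ih =>
    simp only [Finset.sum_insert hi]
    exact (hf i (Finset.mem_insert_self i s)).add
      (ih fun j hj ↦ hf j (Finset.mem_insert_of_mem hj))

theorem contMDiffAt_det {n : ℕ} {A : M → Matrix (Fin n) (Fin n) ℝ} {x : M}
    (hA : ∀ i j, ContMDiffAt (𝓡 6) 𝓘(ℝ, ℝ) ∞ (fun y ↦ A y i j) x) :
    ContMDiffAt (𝓡 6) 𝓘(ℝ, ℝ) ∞ (fun y ↦ (A y).det) x := by
  simp only [Matrix.det_apply']
  refine contMDiffAt_finsetSum _ fun σ _ ↦ contMDiffAt_const.mul ?_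
  exact contMDiffAt_finsetProd fun i _ ↦ hA _ _

theorem contMDiffAt_inv {n : ℕ} {A : M → Matrix (Fin n) (Fin n) ℝ} {x : M}
    (hA : ∀ i j, ContMDiffAt (𝓡 6) 𝓘(ℝ, ℝ) ∞ (fun y ↦ A y i j) x) (hx : (A x).det ≠ 0)
    (i j : Fin n) : ContMDiffAt (𝓡 6) 𝓘(ℝ, ℝ) ∞ (fun y ↦ (A y)⁻¹ i j) x := by
  -- Cramer's rule: the entries of the inverse are quotients of determinants.
  have h1 : (fun y ↦ (A y)⁻¹ i j) =
      fun y ↦ ((A y).det)⁻¹ * ((A y).updateRow j (Pi.single i 1)).det := by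
    ext y
    rw [Matrix.inv_def, Ring.inverse_eq_inv', Matrix.smul_apply, Matrix.adjugate_apply, smul_eq_mul]
  rw [h1]
  have h2 : ContMDiffAt (𝓡 6) 𝓘(ℝ, ℝ) ∞ (fun y ↦ ((A y).det)⁻¹) x :=
    (contMDiffAt_det hA).inv₀ hx
  refine h2.mul (contMDiffAt_det fun k l ↦ ?_)
  by_cases hk : k = j
  · subst hk
    simp only [Matrix.updateRow_self]
    exact contMDiffAt_const
  · simp only [Matrix.updateRow_ne hk]
    exact hA k l

variable [RiemannianBundle (fun x : M ↦ TangentSpace (𝓡 6) x)]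

theorem card_eq_finrank_tangentSpace (x : M) :
    Fintype.card (Fin 6) = Module.finrank ℝ (TangentSpace (𝓡 6) x) := by
  have : Module.finrank ℝ (TangentSpace (𝓡 6) x) = Module.finrank ℝ R6 := rfl
  rw [this]
  simp

/-- The frame dual to a frame with respect to the Riemannian metric. -/
def dualFrame (E : Fin 6 → Π x : M, TangentSpace (𝓡 6) x) (i : Fin 6) (x : M) :
    TangentSpace (𝓡 6) x := dualOf (fun j ↦ E j x) i

/-- The matrix of the metric in a frame. -/
def metricMatrix (E : Fin 6 → Π x : M, TangentSpace (𝓡 6) x) (x : M) :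
    Matrix (Fin 6) (Fin 6) ℝ := Matrix.gram ℝ fun j ↦ E j x

/-- The coefficients `θ_l = ½ g^{ij} ∂_l g_{ij}` of the logarithmic derivative of the Riemannian
volume density in a coordinate frame. -/
def logVol (E : Fin 6 → Π x : M, TangentSpace (𝓡 6) x) (l : Fin 6) (x : M) : ℝ :=
  (1 / 2 : ℝ) * ∑ i, ∑ j, (metricMatrix E x)⁻¹ i j *
    mvfderiv (𝓡 6) (fun y ↦ metricMatrix E y i j) x (E l x)

variable [IsContMDiffRiemannianBundle (𝓡 6) ∞ R6 (fun x : M ↦ TangentSpace (𝓡 6) x)]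

theorem contMDiffAt_inner {X Y : Π x : M, TangentSpace (𝓡 6) x} {x : M} (hX : VFieldAt ∞ X x)
    (hY : VFieldAt ∞ Y x) : ContMDiffAt (𝓡 6) 𝓘(ℝ, ℝ) ∞ (fun y ↦ inner ℝ (X y) (Y y)) x :=
  ContMDiffAt.inner_bundle (E := fun x : M ↦ TangentSpace (𝓡 6) x) hX hY

theorem mdifferentiableAt_inner {X Y : Π x : M, TangentSpace (𝓡 6) x} {x : M}
    (hX : VFieldDiffAt X x) (hY : VFieldDiffAt Y x) :
    MDifferentiableAt (𝓡 6) 𝓘(ℝ, ℝ) (fun y ↦ inner ℝ (X y) (Y y)) x :=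
  have : IsContMDiffRiemannianBundle (𝓡 6) 1 R6 (fun x : M ↦ TangentSpace (𝓡 6) x) :=
    IsContMDiffRiemannianBundle.of_le (n := ∞) (by simp)
  MDifferentiableAt.inner_bundle (E := fun x : M ↦ TangentSpace (𝓡 6) x) hX hY

namespace IsCoordFrame

variable {E : Fin 6 → Π x : M, TangentSpace (𝓡 6) x} {U : Set M} (hE : IsCoordFrame E U) {x : M}
  (hx : x ∈ U)

include hE hx

theorem contMDiffAt_metric (i j : Fin 6) :
    ContMDiffAt (𝓡 6) 𝓘(ℝ, ℝ) ∞ (fun y ↦ metricMatrix E y i j) x :=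
  contMDiffAt_inner (hE.contMDiffAt i x hx) (hE.contMDiffAt j x hx)

theorem isUnit_det : IsUnit (metricMatrix E x).det := isUnit_det_gram (hE.linearIndependent x hx)

theorem contMDiffAt_metric_inv (i j : Fin 6) :
    ContMDiffAt (𝓡 6) 𝓘(ℝ, ℝ) ∞ (fun y ↦ (metricMatrix E y)⁻¹ i j) x :=
  contMDiffAt_inv (hE.contMDiffAt_metric hx) (hE.isUnit_det hx).ne_zero i j

theorem contMDiffAt_dualFrame (i : Fin 6) : VFieldAt ∞ (dualFrame E i) x := by
  refine ContMDiffAt.sum_section (I := 𝓡 6) (F := R6) (V := fun x : M ↦ TangentSpace (𝓡 6) x)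
    (s := Finset.univ) (t := fun j y ↦ (metricMatrix E y)⁻¹ i j • E j y) fun j _ ↦ ?_
  exact ContMDiffAt.smul_section (V := fun x : M ↦ TangentSpace (𝓡 6) x)
    (hE.contMDiffAt_metric_inv hx i j) (hE.contMDiffAt j x hx)

theorem dualFrame_diffAt (i : Fin 6) : VFieldDiffAt (dualFrame E i) x :=
  (hE.contMDiffAt_dualFrame hx i).mdifferentiableAt (by simp)

theorem contMDiffAt_logVol (l : Fin 6) : ContMDiffAt (𝓡 6) 𝓘(ℝ, ℝ) ∞ (logVol E l) x := by
  refine contMDiffAt_const.mul (contMDiffAt_finsetSum _ fun i _ ↦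
    contMDiffAt_finsetSum _ fun j _ ↦ (hE.contMDiffAt_metric_inv hx i j).mul ?_)
  exact hE.contMDiffAt_deriv hx (hE.contMDiffAt_metric hx i j) l

theorem inner_dualFrame (i j : Fin 6) :
    inner ℝ (dualFrame E i x) (E j x) = if i = j then (1 : ℝ) else 0 :=
  inner_dualOf (hE.linearIndependent x hx) i j

theorem sum_inner_dualFrame_smul (w : TangentSpace (𝓡 6) x) :
    ∑ i, (inner ℝ (dualFrame E i x) w : ℝ) • E i x = w :=
  sum_inner_dualOf_smul (hE.linearIndependent x hx) (card_eq_finrank_tangentSpace x) w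

theorem sum_frame_eq {W : Type*} [AddCommGroup W] [Module ℝ W]
    (β : TangentSpace (𝓡 6) x →ₗ[ℝ] TangentSpace (𝓡 6) x →ₗ[ℝ] W) :
    ∑ k, β (frame M x k) (frame M x k) = ∑ i, β (dualFrame E i x) (E i x) :=
  sum_onb_eq_sum_dualOf (hE.linearIndependent x hx) (card_eq_finrank_tangentSpace x) β (frame M x)

/-- The coefficients `θ_l` form a closed one-form. -/
theorem deriv_logVol_comm (i k : Fin 6) :
    mvfderiv (𝓡 6) (logVol E k) x (E i x) = mvfderiv (𝓡 6) (logVol E i) x (E k x) := by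
  have hm : ∀ a b, MDifferentiableAt (𝓡 6) 𝓘(ℝ, ℝ) (fun y ↦ metricMatrix E y a b) x := fun a b ↦
    (hE.contMDiffAt_metric hx a b).mdifferentiableAt (by simp)
  have hi : ∀ a b, MDifferentiableAt (𝓡 6) 𝓘(ℝ, ℝ) (fun y ↦ (metricMatrix E y)⁻¹ a b) x :=
    fun a b ↦ (hE.contMDiffAt_metric_inv hx a b).mdifferentiableAt (by simp)
  have hd : ∀ a b l, MDifferentiableAt (𝓡 6) 𝓘(ℝ, ℝ)
      (fun y ↦ mvfderiv (𝓡 6) (fun y ↦ metricMatrix E y a b) y (E l y)) x := fun a b l ↦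
    (hE.contMDiffAt_deriv hx (hE.contMDiffAt_metric hx a b) l).mdifferentiableAt (by simp)
  let dG : Fin 6 → Matrix (Fin 6) (Fin 6) ℝ := fun l ↦ Matrix.of fun a b ↦
    mvfderiv (𝓡 6) (fun y ↦ metricMatrix E y a b) x (E l x)
  let dI : Fin 6 → Matrix (Fin 6) (Fin 6) ℝ := fun l ↦ Matrix.of fun a b ↦
    mvfderiv (𝓡 6) (fun y ↦ (metricMatrix E y)⁻¹ a b) x (E l x)
  set G := metricMatrix E x with hG
  have hu := hE.isUnit_det hx
  have hsym : ∀ l, (dG l).transpose = dG l := by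
    intro l
    ext a b
    have : (fun y ↦ metricMatrix E y b a) = fun y ↦ metricMatrix E y a b := by
      ext y
      exact real_inner_comm (E a y) (E b y)
    simp only [dG, Matrix.transpose_apply, Matrix.of_apply, this]
  -- the derivative of the inverse matrix
  have hinv : ∀ l, dI l = -(G⁻¹ * dG l * G⁻¹) := by
    intro l
    have h1 : dI l * G + G⁻¹ * dG l = 0 := by
      ext a c
      have h2 : (fun y ↦ ∑ b, (metricMatrix E y)⁻¹ a b * metricMatrix E y b c) =ᶠ[𝓝 x]
          fun _ ↦ (1 : Matrix (Fin 6) (Fin 6) ℝ) a c := by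
        filter_upwards [hE.mem_nhds hx] with y hy
        rw [← Matrix.mul_apply, Matrix.nonsing_inv_mul _ (hE.isUnit_det hy)]
      have h3 := congrArg (fun T ↦ T (E l x)) (mvfderiv_congr h2)
      rw [mvfderiv_finsetSum _ fun b ↦ mdifferentiableAt_mul (hi a b) (hm b c),
        mvfderiv_const] at h3
      simp only [mvfderiv_mul_apply (hi _ _) (hm _ _), Finset.sum_add_distrib] at h3
      rw [Matrix.zero_apply, Matrix.add_apply, Matrix.mul_apply, Matrix.mul_apply]
      exact h3.trans (zero_apply _)
    have h2 : dI l = dI l * G * G⁻¹ := by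
      rw [Matrix.mul_assoc, Matrix.mul_nonsing_inv _ hu, Matrix.mul_one]
    rw [h2, eq_neg_of_add_eq_zero_left h1, Matrix.neg_mul]
  -- Both terms are symmetric in `i` and `k`: the first because the trace is cyclic, the second
  -- because derivatives along a coordinate frame commute.
  have key : ∀ i k, mvfderiv (𝓡 6) (logVol E k) x (E i x) = (1 / 2 : ℝ) *
      (-(G⁻¹ * dG i * G⁻¹ * dG k).trace + ∑ a, ∑ b, G⁻¹ a b *
        mvfderiv (𝓡 6) (fun y ↦ mvfderiv (𝓡 6) (fun y ↦ metricMatrix E y a b) y (E k y)) x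
          (E i x)) := by
    intro i k
    have h1 : (G⁻¹ * dG i * G⁻¹ * dG k).trace = -∑ a, ∑ b, dI i a b * dG k a b := by
      rw [← neg_neg (G⁻¹ * dG i * G⁻¹), ← hinv i, Matrix.neg_mul, Matrix.trace_neg]
      have h2 : ∀ a b, dG k a b = dG k b a := fun a b ↦ congrFun (congrFun (hsym k) b) a
      simp only [Matrix.trace, Matrix.diag_apply, Matrix.mul_apply, h2]
    rw [h1, neg_neg, ← Finset.sum_add_distrib]
    simp only [← Finset.sum_add_distrib]
    have h2 := mvfderiv_mul_apply (f := fun _ : M ↦ (1 / 2 : ℝ)) (x := x) mdifferentiableAt_const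
      (MDifferentiableAt.finsetSum Finset.univ fun a ↦ MDifferentiableAt.finsetSum Finset.univ
        fun b ↦ mdifferentiableAt_mul (hi a b) (hd a b k)) (E i x)
    refine h2.trans ?_
    rw [mvfderiv_const]
    simp only [zero_apply, zero_mul, zero_add]
    congr 1
    rw [mvfderiv_finsetSum _ fun a ↦ MDifferentiableAt.finsetSum Finset.univ
      fun b ↦ mdifferentiableAt_mul (hi a b) (hd a b k)]
    refine Finset.sum_congr rfl fun a _ ↦ ?_
    rw [mvfderiv_finsetSum _ fun b ↦ mdifferentiableAt_mul (hi a b) (hd a b k)]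
    refine Finset.sum_congr rfl fun b _ ↦ ?_
    exact mvfderiv_mul_apply (hi a b) (hd a b k) (E i x)
  rw [key, key, Matrix.mul_assoc _ (G⁻¹) (dG k), Matrix.trace_mul_comm, ← Matrix.mul_assoc]
  congr 2
  refine Finset.sum_congr rfl fun a _ ↦ Finset.sum_congr rfl fun b _ ↦ ?_
  rw [hE.deriv_comm hx (hE.contMDiffAt_metric hx a b) i k]

section LeviCivita

variable {LC : CovariantDerivative (𝓡 6) R6 (fun x : M ↦ TangentSpace (𝓡 6) x)}
  (hLC : IsLeviCivita LC)

include hLC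

/-- The fields of a coordinate frame commute, hence `∇_i E_j = ∇_j E_i`. -/
theorem cov_comm (i j : Fin 6) : LC (E j) x (E i x) = LC (E i) x (E j x) := by
  have h := CovariantDerivative.torsion_eq_zero_iff _ |>.1 hLC.torsion_eq_zero (hE.diffAt hx i)
    (hE.diffAt hx j)
  rw [hE.bracket i j x hx] at h
  exact sub_eq_zero.1 h

/-- The covariant derivative of the dual frame. -/
theorem cov_dualFrame (k : Fin 6) (v : TangentSpace (𝓡 6) x) :
    LC (dualFrame E k) x v = -∑ l, (inner ℝ (LC (E l) x v) (dualFrame E k x) : ℝ) •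
      dualFrame E l x := by
  refine ext_inner_basis (hE.linearIndependent x hx) (card_eq_finrank_tangentSpace x) fun m ↦ ?_
  have h1 := hLC.metric x _ _ (hE.dualFrame_diffAt hx k) (hE.diffAt hx m) v
  have h2 : (fun y ↦ inner ℝ (dualFrame E k y) (E m y)) =ᶠ[𝓝 x]
      fun _ ↦ if k = m then (1 : ℝ) else 0 := by
    filter_upwards [hE.mem_nhds hx] with y hy
    exact hE.inner_dualFrame hy k m
  rw [mvfderiv_congr h2, mvfderiv_const, zero_apply] at h1
  simp only [inner_neg_left, sum_inner, inner_smul_left, hE.inner_dualFrame hx]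
  simp only [mul_ite, mul_one, mul_zero, Finset.sum_ite_eq', Finset.mem_univ, if_true]
  simp only [conj_trivial]
  linarith [real_inner_comm (LC (E m) x v) (dualFrame E k x)]

/-- The coefficients `θ_l` are the traces `Γ^j_{lj}` of the Christoffel symbols. -/
theorem logVol_eq (l : Fin 6) :
    logVol E l x = ∑ j, (inner ℝ (LC (E j) x (E l x)) (dualFrame E j x) : ℝ) := by
  have h1 : ∀ i j, mvfderiv (𝓡 6) (fun y ↦ metricMatrix E y i j) x (E l x) =
      inner ℝ (LC (E i) x (E l x)) (E j x) + inner ℝ (E i x) (LC (E j) x (E l x)) := fun i j ↦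
    hLC.metric x _ _ (hE.diffAt hx i) (hE.diffAt hx j) _
  have hs : ∀ i j, (metricMatrix E x)⁻¹ i j = (metricMatrix E x)⁻¹ j i := fun i j ↦ by
    have h2 := inner_dualOf_dualOf (hE.linearIndependent x hx)
    exact (h2 j i).symm.trans ((real_inner_comm _ _).trans (h2 i j))
  have h2 : ∑ i, ∑ j, (metricMatrix E x)⁻¹ i j * (inner ℝ (LC (E i) x (E l x)) (E j x) : ℝ) =
      ∑ i, (inner ℝ (LC (E i) x (E l x)) (dualFrame E i x) : ℝ) := by
    refine Finset.sum_congr rfl fun i _ ↦ ?_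
    simp only [dualFrame, dualOf, inner_sum, inner_smul_right]
    rfl
  have h3 : ∑ i, ∑ j, (metricMatrix E x)⁻¹ i j * (inner ℝ (E i x) (LC (E j) x (E l x)) : ℝ) =
      ∑ i, (inner ℝ (LC (E i) x (E l x)) (dualFrame E i x) : ℝ) := by
    rw [Finset.sum_comm, ← h2]
    refine Finset.sum_congr rfl fun i _ ↦ Finset.sum_congr rfl fun j _ ↦ ?_
    rw [hs, real_inner_comm]
  simp only [logVol, h1, mul_add, Finset.sum_add_distrib]
  rw [h2, h3]
  ring

end LeviCivita

end IsCoordFrame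

end Frames

/-! ### Pairing a spinor with a Lie algebra valued spinor -/

section Pair

variable {V : Type*} [NormedAddCommGroup V] [InnerProductSpace ℝ V]
  {W : Type*} [AddCommGroup W] [Module ℝ W]

/-- The contraction `⟨φ, s⟩ κ` of `s ⊗ κ ∈ V ⊗ W` with `φ ∈ V`. -/
def pair : V →ₗ[ℝ] V ⊗[ℝ] W →ₗ[ℝ] W :=
  LinearMap.mk₂ ℝ (fun φ z ↦ TensorProduct.lid ℝ W (LinearMap.rTensor W (innerₗ V φ) z))
    (fun φ φ' z ↦ by rw [map_add, LinearMap.rTensor_add, LinearMap.add_apply, map_add])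
    (fun c φ z ↦ by rw [map_smul, LinearMap.rTensor_smul, LinearMap.smul_apply, map_smul])
    (fun φ z z' ↦ by rw [map_add, map_add]) (fun c φ z ↦ by rw [map_smul, map_smul])

@[simp]
theorem pair_tmul (φ s : V) (κ : W) : pair φ (s ⊗ₜ[ℝ] κ) = (inner ℝ φ s : ℝ) • κ := by
  simp [pair]

theorem pair_lTensor {W' : Type*} [AddCommGroup W'] [Module ℝ W'] (L : W →ₗ[ℝ] W') (φ : V)
    (z : V ⊗[ℝ] W) : pair φ (LinearMap.lTensor V L z) = L (pair φ z) := by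
  induction z using TensorProduct.induction_on with
  | zero => simp
  | tmul s κ => simp
  | add z z' h h' => simp only [map_add, h, h']

theorem pair_rTensor {T T' : V →ₗ[ℝ] V} (hT : ∀ s s', inner ℝ s (T s') = (inner ℝ (T' s) s' : ℝ))
    (φ : V) (z : V ⊗[ℝ] W) : pair φ (LinearMap.rTensor W T z) = pair (T' φ) z := by
  induction z using TensorProduct.induction_on with
  | zero => simp
  | tmul s κ => simp [hT]
  | add z z' h h' => simp only [map_add, h, h']

theorem sum_tmul_pair_onb {ι : Type*} [Fintype ι] (b : OrthonormalBasis ι ℝ V) (z : V ⊗[ℝ] W) :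
    ∑ i, b i ⊗ₜ[ℝ] pair (b i) z = z := by
  induction z using TensorProduct.induction_on with
  | zero => simp
  | tmul s κ =>
    simp only [pair_tmul, ← TensorProduct.smul_tmul, ← TensorProduct.sum_tmul]
    rw [b.sum_repr' s]
  | add z z' h h' => simp only [map_add, TensorProduct.tmul_add, Finset.sum_add_distrib, h, h']

/-- The pairings determine an element of the tensor product. -/
theorem ext_pair [FiniteDimensional ℝ V] {z z' : V ⊗[ℝ] W} (h : ∀ φ, pair φ z = pair φ z') :
    z = z' := by
  rw [← sum_tmul_pair_onb (stdOrthonormalBasis ℝ V) z,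
    ← sum_tmul_pair_onb (stdOrthonormalBasis ℝ V) z']
  simp only [h]

end Pair

/-! ### Lie algebra valued functions -/

section LieFun

variable {M : Type*} [TopologicalSpace M] [ChartedSpace R6 M] [IsManifold (𝓡 6) ∞ M]
  {EK : Type*} [NormedAddCommGroup EK] [NormedSpace ℝ EK] [FiniteDimensional ℝ EK]
  {K : Type*} [TopologicalSpace K] [Group K] [ChartedSpace EK K] [LieGroup 𝓘(ℝ, EK) ∞ K]

/-- A Lie algebra valued function is of class `C^n` at `x`. -/
abbrev LieAt (n : ℕ∞ω) (f : M → LieAlg EK K) (x : M) : Prop :=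
  ContMDiffAt (M' := EK) (𝓡 6) 𝓘(ℝ, EK) n f x

/-- A Lie algebra valued function is differentiable at `x`. -/
abbrev LieDiffAt (f : M → LieAlg EK K) (x : M) : Prop :=
  MDifferentiableAt (M' := EK) (𝓡 6) 𝓘(ℝ, EK) f x

/-- A Lie algebra valued one-form is smooth at `x`. -/
abbrev FormAt (a : Π x : M, TangentSpace (𝓡 6) x →L[ℝ] LieAlg EK K) (x : M) : Prop :=
  ContMDiffAt (𝓡 6) ((𝓡 6).prod 𝓘(ℝ, R6 →L[ℝ] EK)) ∞
    (fun y ↦ TotalSpace.mk' (R6 →L[ℝ] EK)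
      (E := fun y : M ↦ TangentSpace (𝓡 6) y →L[ℝ] Bundle.Trivial M EK y) y (a y)) x

variable {a : Π x : M, TangentSpace (𝓡 6) x →L[ℝ] LieAlg EK K} {x : M} {f g : M → LieAlg EK K}

theorem LieAt.lieDiffAt {n : ℕ∞ω} (hn : n ≠ 0) (hf : LieAt n f x) : LieDiffAt f x :=
  ContMDiffAt.mdifferentiableAt (M' := EK) hf hn

theorem FormAt.formDiffAt (h : FormAt a x) : FormDiffAt a x := h.mdifferentiableAt (by simp)

theorem FormAt.apply (h : FormAt a x) {X : Π y : M, TangentSpace (𝓡 6) y} (hX : VFieldAt ∞ X x) :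
    LieAt ∞ (fun y ↦ a y (X y)) x := by
  have h1 := ContMDiffAt.clm_bundle_apply (F₁ := R6) (F₂ := EK)
    (E₁ := fun y : M ↦ TangentSpace (𝓡 6) y) (E₂ := Bundle.Trivial M EK)
    (b := id) (IB := 𝓡 6) h hX
  exact (contMDiffAt_section x).1 h1

theorem FormDiffAt.apply (h : FormDiffAt a x) {X : Π y : M, TangentSpace (𝓡 6) y}
    (hX : VFieldDiffAt X x) : LieDiffAt (fun y ↦ a y (X y)) x := by
  have h1 := MDifferentiableAt.clm_bundle_apply (F₁ := R6) (F₂ := EK)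
    (E₁ := fun y : M ↦ TangentSpace (𝓡 6) y) (E₂ := Bundle.Trivial M EK)
    (b := id) (IB := 𝓡 6) h hX
  exact ((mdifferentiableAt_section (𝓡 6) _).1 h1)

theorem lieDiff_congr (h : f =ᶠ[𝓝 x] g) (v : TangentSpace (𝓡 6) x) :
    lieDiff f x v = lieDiff g x v :=
  congrArg (fun T ↦ T v) (mvfderiv_congr (F := EK) h)

theorem lieDiff_fun_smul {c : M → ℝ} (hc : MDifferentiableAt (𝓡 6) 𝓘(ℝ, ℝ) c x)
    (hf : LieDiffAt f x) (v : TangentSpace (𝓡 6) x) :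
    lieDiff (fun y ↦ c y • f y) x v = mvfderiv (𝓡 6) c x v • f x + c x • lieDiff f x v :=
  mvfderiv_smul_apply (F := EK) hc hf v

theorem lieDiff_sum {ι : Type*} (s : Finset ι) {f : ι → M → LieAlg EK K}
    (hf : ∀ i, LieDiffAt (f i) x) (v : TangentSpace (𝓡 6) x) :
    lieDiff (fun y ↦ ∑ i ∈ s, f i y) x v = ∑ i ∈ s, lieDiff (f i) x v :=
  mvfderiv_finsetSum (F := EK) s hf v

theorem lieDiff_lie (hf : LieDiffAt f x) (hg : LieDiffAt g x) (v : TangentSpace (𝓡 6) x) :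
    lieDiff (fun y ↦ ⁅f y, g y⁆) x v = ⁅lieDiff f x v, g x⁆ + ⁅f x, lieDiff g x v⁆ :=
  mvfderiv_bilin (F := EK) (F' := EK) (F'' := EK) (lieE EK K) hf hg v

theorem LieAt.add {n : ℕ∞ω} (hf : LieAt n f x) (hg : LieAt n g x) :
    LieAt n (fun y ↦ f y + g y) x :=
  ContMDiffAt.add (G := EK) hf hg

theorem LieAt.smul {n : ℕ∞ω} {c : M → ℝ} (hc : ContMDiffAt (𝓡 6) 𝓘(ℝ, ℝ) n c x)
    (hf : LieAt n f x) : LieAt n (fun y ↦ c y • f y) x :=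
  ContMDiffAt.bilin (F' := EK) (F'' := EK) (ContinuousLinearMap.lsmul ℝ ℝ) hc hf

theorem LieDiffAt.add (hf : LieDiffAt f x) (hg : LieDiffAt g x) :
    LieDiffAt (fun y ↦ f y + g y) x :=
  MDifferentiableAt.add (E' := EK) hf hg

theorem LieDiffAt.smul {c : M → ℝ} (hc : MDifferentiableAt (𝓡 6) 𝓘(ℝ, ℝ) c x)
    (hf : LieDiffAt f x) : LieDiffAt (fun y ↦ c y • f y) x :=
  MDifferentiableAt.bilin (F' := EK) (F'' := EK) (ContinuousLinearMap.lsmul ℝ ℝ) hc hf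

theorem LieDiffAt.sum {ι : Type*} (s : Finset ι) {f : ι → M → LieAlg EK K}
    (hf : ∀ i, LieDiffAt (f i) x) : LieDiffAt (fun y ↦ ∑ i ∈ s, f i y) x :=
  MDifferentiableAt.finsetSum (F := EK) s hf

theorem lieDiffAt_const (w : LieAlg EK K) : LieDiffAt (fun _ : M ↦ w) x :=
  mdifferentiableAt_const

theorem LieAt.sum {n : ℕ∞ω} {ι : Type*} (s : Finset ι) {f : ι → M → LieAlg EK K}
    (hf : ∀ i, LieAt n (f i) x) : LieAt n (fun y ↦ ∑ i ∈ s, f i y) x :=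
  contMDiffAt_finsetSum (F := EK) s fun i _ ↦ hf i

theorem LieAt.lie {n : ℕ∞ω} (hf : LieAt n f x) (hg : LieAt n g x) :
    LieAt n (fun y ↦ ⁅f y, g y⁆) x :=
  ContMDiffAt.bilin (F := EK) (F' := EK) (F'' := EK) (lieE EK K) hf hg

/-- The covariant derivative `df + [a, f]` of a Lie algebra valued function. -/
def lieCov (a : Π x : M, TangentSpace (𝓡 6) x →L[ℝ] LieAlg EK K) (f : M → LieAlg EK K) (x : M) :
    TangentSpace (𝓡 6) x →ₗ[ℝ] LieAlg EK K where
  toFun v := lieDiff f x v + ⁅a x v, f x⁆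
  map_add' v w := by
    have : lieDiff f x (v + w) = lieDiff f x v + lieDiff f x w :=
      map_add (mvfderiv (𝓡 6) (F := EK) f x) v w
    rw [this, map_add, add_lie]
    abel
  map_smul' c v := by
    have : lieDiff f x (c • v) = c • lieDiff f x v := map_smul (mvfderiv (𝓡 6) (F := EK) f x) c v
    rw [this, map_smul, smul_lie, smul_add]
    rfl

theorem lieCov_apply (v : TangentSpace (𝓡 6) x) :
    lieCov a f x v = lieDiff f x v + ⁅a x v, f x⁆ := rfl

theorem lieCov_congr (h : f =ᶠ[𝓝 x] g) (v : TangentSpace (𝓡 6) x) :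
    lieCov a f x v = lieCov a g x v := by
  rw [lieCov_apply, lieCov_apply, lieDiff_congr h, h.eq_of_nhds]

theorem lieCov_add (hf : LieDiffAt f x) (hg : LieDiffAt g x) (v : TangentSpace (𝓡 6) x) :
    lieCov a (fun y ↦ f y + g y) x v = lieCov a f x v + lieCov a g x v := by
  rw [lieCov_apply, lieCov_apply, lieCov_apply, lieDiff_add hf hg, lie_add]
  abel

theorem lieCov_smul {c : M → ℝ} (hc : MDifferentiableAt (𝓡 6) 𝓘(ℝ, ℝ) c x)
    (hf : LieDiffAt f x) (v : TangentSpace (𝓡 6) x) :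
    lieCov a (fun y ↦ c y • f y) x v = mvfderiv (𝓡 6) c x v • f x + c x • lieCov a f x v := by
  rw [lieCov_apply, lieCov_apply, lieDiff_fun_smul hc hf, lie_smul, smul_add]
  abel

theorem lieCov_sum {ι : Type*} (s : Finset ι) {f : ι → M → LieAlg EK K}
    (hf : ∀ i, LieDiffAt (f i) x) (v : TangentSpace (𝓡 6) x) :
    lieCov a (fun y ↦ ∑ i ∈ s, f i y) x v = ∑ i ∈ s, lieCov a (f i) x v := by
  simp only [lieCov_apply, lieDiff_sum s hf, Finset.sum_add_distrib, lie_sum]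

end LieFun

/-! ### Spinor fields -/

section SpinorFields

variable {M : Type*} [TopologicalSpace M] [ChartedSpace R6 M] [IsManifold (𝓡 6) ∞ M]
  [RiemannianBundle (fun x : M ↦ TangentSpace (𝓡 6) x)]
  {S : M → Type*} [TopologicalSpace (TotalSpace R8 S)]
    [∀ x, NormedAddCommGroup (S x)] [∀ x, InnerProductSpace ℝ (S x)] [FiberBundle R8 S]
    [VectorBundle ℝ R8 S]

variable (S) in
theorem finrank_spinor (x : M) : Module.finrank ℝ (S x) = 8 := by
  have e := (trivializationAt R8 S x).continuousLinearEquivAt ℝ x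
    (FiberBundle.mem_baseSet_trivializationAt' x)
  rw [e.toLinearEquiv.finrank_eq]
  simp

instance instFiniteDimensionalSpinor (x : M) : FiniteDimensional ℝ (S x) :=
  Module.finite_of_finrank_pos (by rw [finrank_spinor S x]; norm_num)

variable [ContMDiffVectorBundle ∞ R8 S (𝓡 6)]
    [IsContMDiffRiemannianBundle (𝓡 6) ∞ R8 S]

theorem SpinorDiffAt.inner {s s' : Π x : M, S x} {x : M}
    (hs : SpinorDiffAt s x) (hs' : SpinorDiffAt s' x) :
    MDifferentiableAt (𝓡 6) 𝓘(ℝ, ℝ) (fun y ↦ inner ℝ (s y) (s' y)) x :=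
  have : IsContMDiffRiemannianBundle (𝓡 6) 1 R8 S :=
    IsContMDiffRiemannianBundle.of_le (n := ∞) (by simp)
  MDifferentiableAt.inner_bundle hs hs'

theorem SpinorAt.inner {s s' : Π x : M, S x} {x : M}
    (hs : SpinorAt ∞ s x) (hs' : SpinorAt ∞ s' x) :
    ContMDiffAt (𝓡 6) 𝓘(ℝ, ℝ) ∞ (fun y ↦ inner ℝ (s y) (s' y)) x :=
  ContMDiffAt.inner_bundle hs hs'

theorem SpinorAt.diffAt {s : Π x : M, S x} {x : M} (hs : SpinorAt ∞ s x) : SpinorDiffAt s x :=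
  hs.mdifferentiableAt (by simp)

namespace NearlyKahlerStructure

variable (N : NearlyKahlerStructure M S)

theorem isSpinFibre (x : M) : IsSpinFibre (N.cliff x) (N.vol x) (N.psi x) := by
  have hc : IsClifford (N.cliff x) := ⟨N.cliff_cliff x, N.cliff_skew x⟩
  obtain ⟨e, he⟩ := N.vol_eq x
  have he' : N.vol x = IsClifford.volOf (N.cliff x) e := he
  refine { hc with vol_sq := ?_, vol_mul := ?_, vol_skew := ?_, unit := ?_ }
  · rw [he']; exact hc.vol_sq e
  · rw [he']; exact hc.vol_mul e
  · rw [he']; exact hc.vol_skew e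
  · rw [real_inner_self_eq_norm_sq, N.norm_psi]; norm_num

include N in
theorem finrank_eq (x : M) : Module.finrank ℝ (S x) =
    Fintype.card (Fin (Module.finrank ℝ (TangentSpace (𝓡 6) x))) + 2 := by
  rw [finrank_spinor S x, Fintype.card_fin, ← card_eq_finrank_tangentSpace x]
  rfl

variable {N} {X : Π x : M, TangentSpace (𝓡 6) x} {s s' : Π x : M, S x} {x : M}

theorem cliff_diffAt (hX : VFieldDiffAt X x) (hs : SpinorDiffAt s x) :
    SpinorDiffAt (fun y ↦ N.cliff y (X y) (s y)) x :=
  MDifferentiableAt.clm_bundle_apply₂ (IB := 𝓡 6) (b := id)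
    ((N.contMDiff_cliff x).mdifferentiableAt (by simp)) hX hs

theorem cliff_contMDiffAt (hX : VFieldAt ∞ X x) (hs : SpinorAt ∞ s x) :
    SpinorAt ∞ (fun y ↦ N.cliff y (X y) (s y)) x :=
  ContMDiffAt.clm_bundle_apply₂ (IB := 𝓡 6) (b := id) (N.contMDiff_cliff x) hX hs

theorem vol_contMDiffAt (hs : SpinorAt ∞ s x) : SpinorAt ∞ (fun y ↦ N.vol y (s y)) x :=
  ContMDiffAt.clm_bundle_apply (IB := 𝓡 6) (b := id) (N.contMDiff_vol x) hs

theorem mvfderiv_inner (hs : SpinorDiffAt s x) (hs' : SpinorDiffAt s' x)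
    (v : TangentSpace (𝓡 6) x) :
    mvfderiv (𝓡 6) (fun y ↦ inner ℝ (s y) (s' y)) x v =
      inner ℝ (N.nabla s x v) (s' x) + inner ℝ (s x) (N.nabla s' x v) := by
  have : IsContMDiffRiemannianBundle (𝓡 6) 1 R8 S :=
    IsContMDiffRiemannianBundle.of_le (n := ∞) (by simp)
  have h := CovariantDerivative.IsMetricCompatible.mvfderiv_inner_eq N.metric_nabla
    (FiberBundle.extend R6 v) hs hs'
  simp only [FiberBundle.extend_apply_self] at h
  exact h

/-- The spinor `vol ψ` satisfies the Killing equation with the opposite constant. -/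
theorem killing_vol (x : M) (v : TangentSpace (𝓡 6) x) :
    N.nabla (fun y ↦ N.vol y (N.psi y)) x v = (-1 / 2 : ℝ) • N.cliff x v (N.vol x (N.psi x)) := by
  have hF := N.isSpinFibre
  have dψ : SpinorDiffAt N.psi x := (N.contMDiff_psi x).mdifferentiableAt (by simp)
  have dν : SpinorDiffAt (fun y ↦ N.vol y (N.psi y)) x :=
    SpinorAt.diffAt (vol_contMDiffAt (N.contMDiff_psi x))
  -- A spinor is determined by its inner products with `ψ`, `vol ψ` and the `w ψ`. Those of
  -- `∇ vol ψ` follow by differentiating the constant inner products of these spinors with `vol ψ`.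
  refine (hF x).ext_inner (frame M x) (N.finrank_eq x) ?_ ?_ fun w ↦ ?_
  · have h := mvfderiv_inner (N := N) dψ dν v
    have e : (fun y ↦ inner ℝ (N.psi y) (N.vol y (N.psi y))) = fun _ ↦ (0 : ℝ) :=
      funext fun y ↦ (hF y).inner_psi_vol
    rw [e, mvfderiv_const, zero_apply, N.killing, inner_smul_left, (hF x).inner_mul_psi_vol] at h
    rw [inner_smul_right, real_inner_comm (N.cliff x v (N.vol x (N.psi x))) (N.psi x),
      (hF x).inner_mul_vol_psi]
    simpa using h.symm
  · have h := mvfderiv_inner (N := N) dν dν v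
    have e : (fun y ↦ inner ℝ (N.vol y (N.psi y)) (N.vol y (N.psi y))) = fun _ ↦ (1 : ℝ) :=
      funext fun y ↦ (hF y).inner_vol_unit
    rw [e, mvfderiv_const, zero_apply, real_inner_comm] at h
    rw [inner_smul_right,
      real_inner_comm (N.cliff x v (N.vol x (N.psi x))) (N.vol x (N.psi x)),
      (hF x).inner_mul_vol_vol]
    linarith
  · have dX : VFieldDiffAt (FiberBundle.extend R6 w) x :=
      FiberBundle.mdifferentiableAt_extend (𝓡 6) R6 w
    have h := mvfderiv_inner (N := N) (cliff_diffAt (N := N) dX dψ) dν v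
    have e : (fun y ↦ inner ℝ (N.cliff y (FiberBundle.extend R6 w y) (N.psi y))
        (N.vol y (N.psi y))) = fun _ ↦ (0 : ℝ) := funext fun y ↦ (hF y).inner_mul_psi_vol _
    rw [e, mvfderiv_const, zero_apply, N.nabla_cliff x _ _ dX dψ, FiberBundle.extend_apply_self,
      inner_add_left, (hF x).inner_mul_psi_vol, N.killing, map_smul, inner_smul_left,
      zero_add] at h
    rw [inner_smul_right]
    have h2 := (hF x).inner_mul_vol_mul v w
    have h3 := real_inner_comm (N.cliff x w (N.vol x (N.psi x))) (N.cliff x v (N.psi x))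
    simp only [conj_trivial] at h
    have h4 : inner ℝ (N.cliff x w (N.cliff x v (N.psi x))) (N.vol x (N.psi x)) =
      -(inner ℝ (N.cliff x v (N.psi x)) (N.cliff x w (N.vol x (N.psi x))) : ℝ) := (hF x).skew _ _ _
    linarith

end NearlyKahlerStructure

end SpinorFields

/-! ### Sections of the twisted spinor bundle -/

section GaugeCov

variable {M : Type*} [TopologicalSpace M] [ChartedSpace R6 M] [IsManifold (𝓡 6) ∞ M]
  [RiemannianBundle (fun x : M ↦ TangentSpace (𝓡 6) x)]
  {EK : Type*} [NormedAddCommGroup EK] [NormedSpace ℝ EK] [FiniteDimensional ℝ EK]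
  {K : Type*} [TopologicalSpace K] [Group K] [ChartedSpace EK K] [LieGroup 𝓘(ℝ, EK) ∞ K]
  {S : M → Type*} [TopologicalSpace (TotalSpace R8 S)]
    [∀ x, NormedAddCommGroup (S x)] [∀ x, InnerProductSpace ℝ (S x)] [FiberBundle R8 S]
    [VectorBundle ℝ R8 S]

/-- The contraction `contr l` of the Lie algebra factor is adjoint to the pairing with a spinor. -/
theorem inner_contr {x : M} (l : Module.Dual ℝ (LieAlg EK K)) (φ : S x)
    (z : S x ⊗[ℝ] LieAlg EK K) : inner ℝ φ (contr l z) = l (pair φ z) := by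
  induction z using TensorProduct.induction_on with
  | zero => simp
  | tmul s κ => simp [contr, inner_smul_right, mul_comm]
  | add z z' h h' => simp only [map_add, inner_add_right, h, h']

theorem pair_eq_sum {x : M} (φ : S x) (z : S x ⊗[ℝ] LieAlg EK K) :
    pair φ z = ∑ i, (inner ℝ φ (contr ((Module.finBasis ℝ (LieAlg EK K)).coord i) z) : ℝ) •
      Module.finBasis ℝ (LieAlg EK K) i := by
  simp only [inner_contr]
  exact ((Module.finBasis ℝ (LieAlg EK K)).sum_repr (pair φ z)).symm

theorem sum_contr_tmul {x : M} (z : S x ⊗[ℝ] LieAlg EK K) :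
    ∑ i, contr ((Module.finBasis ℝ (LieAlg EK K)).coord i) z ⊗ₜ[ℝ]
      Module.finBasis ℝ (LieAlg EK K) i = z := by
  refine ext_pair fun φ ↦ ?_
  rw [map_sum, pair_eq_sum]
  simp only [pair_tmul]

/-- A section of `S ⊗ 𝔨` is smooth at `x`. -/
abbrev AdSpinorAt (ξ : Π x : M, S x ⊗[ℝ] LieAlg EK K) (x : M) : Prop :=
  ∀ l : Module.Dual ℝ (LieAlg EK K), SpinorAt ∞ (fun y ↦ contr l (ξ y)) x

/-- A section of `S ⊗ 𝔨` is differentiable at `x`. -/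
abbrev AdSpinorDiffAt (ξ : Π x : M, S x ⊗[ℝ] LieAlg EK K) (x : M) : Prop :=
  ∀ l : Module.Dual ℝ (LieAlg EK K), SpinorDiffAt (fun y ↦ contr l (ξ y)) x

variable [ContMDiffVectorBundle ∞ R8 S (𝓡 6)]
    [IsContMDiffRiemannianBundle (𝓡 6) ∞ R8 S]

variable {a : Π x : M, TangentSpace (𝓡 6) x →L[ℝ] LieAlg EK K}
  {ξ : Π x : M, S x ⊗[ℝ] LieAlg EK K} {φ : Π x : M, S x} {x : M}

theorem AdSpinorAt.diffAt (h : AdSpinorAt ξ x) : AdSpinorDiffAt ξ x := fun l ↦ (h l).diffAt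

theorem AdSpinorAt.pair (hξ : AdSpinorAt ξ x) (hφ : SpinorAt ∞ φ x) :
    LieAt ∞ (fun y ↦ pair (φ y) (ξ y)) x := by
  simp only [pair_eq_sum]
  exact LieAt.sum Finset.univ fun i ↦ LieAt.smul (hφ.inner (hξ _)) contMDiffAt_const

theorem AdSpinorDiffAt.pair (hξ : AdSpinorDiffAt ξ x) (hφ : SpinorDiffAt φ x) :
    LieDiffAt (fun y ↦ pair (φ y) (ξ y)) x := by
  simp only [pair_eq_sum]
  exact LieDiffAt.sum Finset.univ fun i ↦ LieDiffAt.smul (hφ.inner (hξ _)) (lieDiffAt_const _)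

namespace NearlyKahlerStructure

variable (N : NearlyKahlerStructure M S)

/-- The covariant derivative of a section of `S ⊗ 𝔨` built from the spin connection and `a`, as a
linear map of the direction. -/
def spinCov (a : Π x : M, TangentSpace (𝓡 6) x →L[ℝ] LieAlg EK K)
    (ξ : Π x : M, S x ⊗[ℝ] LieAlg EK K) (x : M) :
    TangentSpace (𝓡 6) x →ₗ[ℝ] S x ⊗[ℝ] LieAlg EK K where
  toFun := gaugeCov (fun s x v ↦ N.nabla s x v) a ξ x
  map_add' v w := by
    simp only [gaugeCov, map_add, TensorProduct.add_tmul, Finset.sum_add_distrib,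
      LinearMap.lTensor_add, LinearMap.add_apply]
    abel
  map_smul' c v := by
    simp only [gaugeCov, map_smul, ← TensorProduct.smul_tmul', ← Finset.smul_sum,
      LinearMap.lTensor_smul, LinearMap.smul_apply, smul_add, RingHom.id_apply]

theorem spinCov_apply (v : TangentSpace (𝓡 6) x) :
    N.spinCov a ξ x v = gaugeCov (fun s x v ↦ N.nabla s x v) a ξ x v := rfl

/-- The product rule for the pairing of a spinor field with a section of `S ⊗ 𝔨`. Since `φ` is
arbitrary, this characterises the covariant derivative of `ξ`. -/
theorem pair_spinCov (hφ : SpinorDiffAt φ x) (hξ : AdSpinorDiffAt ξ x)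
    (v : TangentSpace (𝓡 6) x) :
    pair (φ x) (N.spinCov a ξ x v) =
      lieCov a (fun y ↦ pair (φ y) (ξ y)) x v - pair (N.nabla φ x v) (ξ x) := by
  have h1 : lieDiff (fun y ↦ pair (φ y) (ξ y)) x v = pair (N.nabla φ x v) (ξ x) +
      ∑ i, pair (φ x) (N.nabla (fun y ↦ contr ((Module.finBasis ℝ (LieAlg EK K)).coord i) (ξ y)) x v
        ⊗ₜ[ℝ] (Module.finBasis ℝ (LieAlg EK K) i)) := by
    have e : (fun y ↦ pair (φ y) (ξ y)) = fun y ↦ ∑ i,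
      (inner ℝ (φ y) (contr ((Module.finBasis ℝ (LieAlg EK K)).coord i) (ξ y)) : ℝ) •
        Module.finBasis ℝ (LieAlg EK K) i := funext fun y ↦ pair_eq_sum _ _
    have hc : ∀ w : LieAlg EK K, LieDiffAt (fun _ : M ↦ w) x := lieDiffAt_const
    have hc' : ∀ w : LieAlg EK K, lieDiff (fun _ : M ↦ w) x v = 0 := fun w ↦
      congrArg (fun T : R6 →L[ℝ] EK ↦ T v) (mvfderiv_const (I := 𝓡 6) (M := M) (F := EK) w)
    have hi : ∀ i, MDifferentiableAt (𝓡 6) 𝓘(ℝ, ℝ) (fun y ↦ (inner ℝ (φ y)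
      (contr ((Module.finBasis ℝ (LieAlg EK K)).coord i) (ξ y)) : ℝ)) x := fun i ↦
        hφ.inner (hξ _)
    rw [e, lieDiff_sum _ fun i ↦ LieDiffAt.smul (hi i) (hc _), pair_eq_sum,
      ← Finset.sum_add_distrib]
    refine Finset.sum_congr rfl fun i _ ↦ ?_
    rw [lieDiff_fun_smul (hi i) (hc _), hc', smul_zero, add_zero,
      mvfderiv_inner (N := N) hφ (hξ _), pair_tmul, add_smul]
  rw [lieCov_apply, h1]
  rw [spinCov_apply, gaugeCov, map_add, map_sum, pair_lTensor, LieAlgebra.ad_apply]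
  abel

theorem pair_cliff (v : TangentSpace (𝓡 6) x) (s : S x) (z : S x ⊗[ℝ] LieAlg EK K) :
    pair s (LinearMap.rTensor (LieAlg EK K) (N.cliff x v).toLinearMap z) =
      -pair (N.cliff x v s) z := by
  rw [pair_rTensor (T' := -(N.cliff x v).toLinearMap)]
  · simp
  · intro s s'
    have := N.cliff_skew x v s s'
    simp only [LinearMap.neg_apply, inner_neg_left, ContinuousLinearMap.coe_coe]
    linarith

/-- The Dirac operator of the Levi-Civita connection, coupled to `a`. -/
def dirac (a : Π x : M, TangentSpace (𝓡 6) x →L[ℝ] LieAlg EK K)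
    (ξ : Π x : M, S x ⊗[ℝ] LieAlg EK K) (x : M) : S x ⊗[ℝ] LieAlg EK K :=
  ∑ j, LinearMap.rTensor (LieAlg EK K) (N.cliff x (frame M x j)).toLinearMap
    (N.spinCov a ξ x (frame M x j))

/-- The torsion term of the Dirac operator for `t = 1/3` acts as the difference of the projections
onto `ψ` and `vol ψ`. -/
theorem gaugeDirac_third (x : M) :
    N.gaugeDirac (1 / 3) a ξ x = N.dirac a ξ x + N.psi x ⊗ₜ[ℝ] pair (N.psi x) (ξ x) -
      N.vol x (N.psi x) ⊗ₜ[ℝ] pair (N.vol x (N.psi x)) (ξ x) := by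
  let C : TangentSpace (𝓡 6) x → S x →ₗ[ℝ] S x := fun v ↦ (1 / 2 : ℝ) • ∑ j, ∑ k,
    N.P x v (frame M x j) (frame M x k) •
      (N.cliff x (frame M x j) ∘L N.cliff x (frame M x k)).toLinearMap
  have hC : ∀ v s, N.contractP x v s = C v s := fun v s ↦ by
    simp [C, contractP, LinearMap.sum_apply]
  have h1 : ∀ v, gaugeCov (N.nablaT (1 / 3)) a ξ x v = N.spinCov a ξ x v +
      (1 / 12 : ℝ) • LinearMap.rTensor (LieAlg EK K) (C v) (ξ x) := by
    intro v
    have h2 : ∑ i, C v (contr ((Module.finBasis ℝ (LieAlg EK K)).coord i) (ξ x)) ⊗ₜ[ℝ]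
        Module.finBasis ℝ (LieAlg EK K) i = LinearMap.rTensor (LieAlg EK K) (C v) (ξ x) := by
      conv_rhs => rw [← sum_contr_tmul (ξ x)]
      simp
    rw [← h2]
    simp only [spinCov_apply, gaugeCov, nablaT, hC, TensorProduct.add_tmul, Finset.sum_add_distrib,
      Finset.smul_sum, TensorProduct.smul_tmul']
    norm_num
    abel
  -- The three-form acts by `24` times the difference of the projections, and `C` carries a factor
  -- `1 / 2`; the resulting `12` cancels the coefficient `t / 4 = 1 / 12`.
  have h3 : ∀ s, ∑ j, N.cliff x (frame M x j) (C (frame M x j) s) =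
      (12 : ℝ) • ((inner ℝ (N.psi x) s : ℝ) • N.psi x -
        (inner ℝ (N.vol x (N.psi x)) s : ℝ) • N.vol x (N.psi x)) := by
    intro s
    have h4 := (N.isSpinFibre x).three_form (frame M x)
      (by rw [Fintype.card_fin, ← card_eq_finrank_tangentSpace x]; rfl) (finrank_spinor S x) s
    have h5 : ∑ j, N.cliff x (frame M x j) (C (frame M x j) s) = (1 / 2 : ℝ) •
        ∑ j, ∑ k, ∑ l, (inner ℝ (N.psi x) (N.cliff x (frame M x j) (N.cliff x (frame M x k)
          (N.cliff x (frame M x l) (N.psi x)))) : ℝ) • N.cliff x (frame M x j)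
            (N.cliff x (frame M x k) (N.cliff x (frame M x l) s)) := by
      simp only [← hC, contractP, map_smul, map_sum, ← Finset.smul_sum]
      rfl
    rw [h5, h4, smul_smul]
    norm_num
  have h6 : ∑ j, LinearMap.rTensor (LieAlg EK K) (N.cliff x (frame M x j)).toLinearMap
      (LinearMap.rTensor (LieAlg EK K) (C (frame M x j)) (ξ x)) =
      (12 : ℝ) • (N.psi x ⊗ₜ[ℝ] pair (N.psi x) (ξ x) -
      N.vol x (N.psi x) ⊗ₜ[ℝ] pair (N.vol x (N.psi x)) (ξ x)) := by
    induction ξ x using TensorProduct.induction_on with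
    | zero => simp
    | tmul s κ =>
      have h7 := congrArg (fun t ↦ t ⊗ₜ[ℝ] κ) (h3 s)
      simp only [LinearMap.rTensor_tmul, ← TensorProduct.sum_tmul, pair_tmul,
        ← TensorProduct.smul_tmul, TensorProduct.smul_tmul', ← TensorProduct.sub_tmul]
      exact h7
    | add z z' h h' =>
      simp only [map_add, Finset.sum_add_distrib, h, h', TensorProduct.tmul_add]
      module
  simp only [gaugeDirac, dirac, h1, map_add, map_smul, Finset.sum_add_distrib, ← Finset.smul_sum]
  rw [h6, smul_smul]
  norm_num
  abel

/-- The components of the Dirac operator, in an arbitrary pair of dual frames. -/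
theorem pair_dirac {E : Fin 6 → Π x : M, TangentSpace (𝓡 6) x}
    (hE : LinearIndependent ℝ fun i ↦ E i x) (s : S x) :
    pair s (N.dirac a ξ x) =
      -∑ i, pair (N.cliff x (dualFrame E i x) s) (N.spinCov a ξ x (E i x)) := by
  let β : TangentSpace (𝓡 6) x →ₗ[ℝ] TangentSpace (𝓡 6) x →ₗ[ℝ] LieAlg EK K :=
    LinearMap.mk₂ ℝ (fun v w ↦ pair (N.cliff x v s) (N.spinCov a ξ x w))
      (fun v v' w ↦ by simp) (fun c v w ↦ by simp) (fun v w w' ↦ by simp) (fun c v w ↦ by simp)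
  have h : ∑ k, β (frame M x k) (frame M x k) = ∑ i, β (dualFrame E i x) (E i x) :=
    sum_onb_eq_sum_dualOf hE (card_eq_finrank_tangentSpace x) β (frame M x)
  rw [dirac, map_sum]
  simp only [pair_cliff, Finset.sum_neg_distrib]
  exact congrArg Neg.neg h

end NearlyKahlerStructure

end GaugeCov

/-! ### One-forms with values in the Lie algebra -/

section Forms

variable {M : Type*} [TopologicalSpace M] [ChartedSpace R6 M] [IsManifold (𝓡 6) ∞ M]
  [RiemannianBundle (fun x : M ↦ TangentSpace (𝓡 6) x)]
  {EK : Type*} [NormedAddCommGroup EK] [NormedSpace ℝ EK] [FiniteDimensional ℝ EK]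
  {K : Type*} [TopologicalSpace K] [Group K] [ChartedSpace EK K] [LieGroup 𝓘(ℝ, EK) ∞ K]
  (LC : CovariantDerivative (𝓡 6) R6 (fun x : M ↦ TangentSpace (𝓡 6) x))
  (a ε : Π x : M, TangentSpace (𝓡 6) x →L[ℝ] LieAlg EK K)

/-- The covariant derivative `(∇_v ε)(w)` of a one-form, computed with an arbitrary extension
of `w`. -/
def formCov (x : M) (v w : TangentSpace (𝓡 6) x) : LieAlg EK K :=
  lieDiff (fun y ↦ ε y (FiberBundle.extend R6 w y)) x v -
    ε x (LC (FiberBundle.extend R6 w) x v) + ⁅a x v, ε x w⁆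

variable {LC a ε} {x : M}

/-- The expression `v(ε Y) - ε (∇_v Y)` depends only on the value of `Y` at the point. -/
theorem tensorialAt_formCov (hε : FormDiffAt ε x) (v : TangentSpace (𝓡 6) x) :
    TensorialAt (V := fun x : M ↦ TangentSpace (𝓡 6) x) (𝓡 6) R6
      (fun Y ↦ lieDiff (fun y ↦ ε y (Y y)) x v - ε x (LC Y x v)) x where
  smul {f Y} hf hY := by
    have h1 : lieDiff (fun y ↦ ε y ((f • Y) y)) x v =
        mvfderiv (𝓡 6) f x v • ε x (Y x) + f x • lieDiff (fun y ↦ ε y (Y y)) x v := by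
      rw [← lieDiff_fun_smul hf (hε.apply hY)]
      simp only [Pi.smul_apply', map_smul]
    have h2 := congrArg (fun T ↦ T v) (LC.isCovariantDerivativeOn.leibniz hY hf)
    simp only [_root_.add_apply, _root_.smul_apply, ContinuousLinearMap.smulRight_apply] at h2
    rw [h1, h2, map_add, map_smul, map_smul, smul_sub]
    abel
  add {Y Y'} hY hY' := by
    have h1 : lieDiff (fun y ↦ ε y ((Y + Y') y)) x v =
        lieDiff (fun y ↦ ε y (Y y)) x v + lieDiff (fun y ↦ ε y (Y' y)) x v := by
      rw [← lieDiff_add (hε.apply hY) (hε.apply hY')]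
      simp only [Pi.add_apply, map_add]
    have h2 := congrArg (fun T ↦ T v) (LC.isCovariantDerivativeOn.add hY hY')
    simp only [_root_.add_apply] at h2
    rw [h1, h2, map_add]
    abel

theorem formCov_eq (hε : FormDiffAt ε x) {Y : Π y : M, TangentSpace (𝓡 6) y}
    (hY : VFieldDiffAt Y x) (v : TangentSpace (𝓡 6) x) :
    formCov LC a ε x v (Y x) =
      lieCov a (fun y ↦ ε y (Y y)) x v - ε x (LC Y x v) := by
  have h := (tensorialAt_formCov (LC := LC) hε v).pointwise
    (FiberBundle.mdifferentiableAt_extend (𝓡 6) R6 (Y x)) hY (FiberBundle.extend_apply_self _ _)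
  rw [formCov, h, lieCov_apply]
  abel

theorem formCov_add_right (hε : FormDiffAt ε x) (v w w' : TangentSpace (𝓡 6) x) :
    formCov LC a ε x v (w + w') = formCov LC a ε x v w + formCov LC a ε x v w' := by
  have h := tensorialAt_formCov (LC := LC) hε v
  have d : ∀ w : TangentSpace (𝓡 6) x, VFieldDiffAt (FiberBundle.extend R6 w) x := fun w ↦
    FiberBundle.mdifferentiableAt_extend (𝓡 6) R6 w
  have h1 := h.pointwise (d (w + w')) (mdifferentiableAt_add_section (d w) (d w'))
    (by simp)
  have h2 := h1.trans (h.add (d w) (d w'))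
  simp only [formCov, map_add, lie_add]
  rw [h2]
  abel

theorem formCov_smul_right (hε : FormDiffAt ε x) (c : ℝ) (v w : TangentSpace (𝓡 6) x) :
    formCov LC a ε x v (c • w) = c • formCov LC a ε x v w := by
  have h := tensorialAt_formCov (LC := LC) hε v
  have d : ∀ w : TangentSpace (𝓡 6) x, VFieldDiffAt (FiberBundle.extend R6 w) x := fun w ↦
    FiberBundle.mdifferentiableAt_extend (𝓡 6) R6 w
  have h1 := h.pointwise (d (c • w)) (MDifferentiableAt.smul_section (f := fun _ ↦ c)
    (s := FiberBundle.extend R6 w) mdifferentiableAt_const (d w)) (by simp)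
  have h2 := h1.trans (h.smul (f := fun _ ↦ c) mdifferentiableAt_const (d w))
  simp only [formCov, map_smul, lie_smul, smul_add]
  rw [h2]

/-- The exterior derivative is the antisymmetrised covariant derivative of a torsion-free
connection. -/
theorem covExtD_eq (hLC : IsLeviCivita LC) (v w : TangentSpace (𝓡 6) x) :
    covExtD a ε x v w = formCov LC a ε x v w - formCov LC a ε x w v := by
  have d : ∀ w : TangentSpace (𝓡 6) x, VFieldDiffAt (FiberBundle.extend R6 w) x := fun w ↦
    FiberBundle.mdifferentiableAt_extend (𝓡 6) R6 w
  have h := CovariantDerivative.torsion_eq_zero_iff _ |>.1 hLC.torsion_eq_zero (d v) (d w)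
  simp only [FiberBundle.extend_apply_self] at h
  rw [covExtD, extD, ← h, map_sub, formCov, formCov]
  abel

theorem covCodiff_eq : covCodiff LC a ε x = -∑ j, formCov LC a ε x (frame M x j) (frame M x j) :=
  rfl

/-- In a coordinate frame the exterior derivative is the commutator of covariant derivatives. -/
theorem IsCoordFrame.covExtD_eq
    [IsContMDiffRiemannianBundle (𝓡 6) ∞ R6 (fun x : M ↦ TangentSpace (𝓡 6) x)]
    (hLC : IsLeviCivita LC)
    {E : Fin 6 → Π x : M, TangentSpace (𝓡 6) x} {U : Set M} (hE : IsCoordFrame E U) (hx : x ∈ U)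
    (hε : FormDiffAt ε x) (i j : Fin 6) :
    covExtD a ε x (E i x) (E j x) =
      lieCov a (fun y ↦ ε y (E j y)) x (E i x) - lieCov a (fun y ↦ ε y (E i y)) x (E j x) := by
  rw [NearlyKahler.covExtD_eq hLC, formCov_eq hε (hE.diffAt hx j), formCov_eq hε (hE.diffAt hx i),
    hE.cov_comm hx hLC i j]
  abel

end Forms

/-! ### The Clifford product of a one-form with the Killing spinor -/

section OneFormPsi

variable {M : Type*} [TopologicalSpace M] [ChartedSpace R6 M] [IsManifold (𝓡 6) ∞ M]
  [RiemannianBundle (fun x : M ↦ TangentSpace (𝓡 6) x)]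
  [IsContMDiffRiemannianBundle (𝓡 6) ∞ R6 (fun x : M ↦ TangentSpace (𝓡 6) x)]
  {EK : Type*} [NormedAddCommGroup EK] [NormedSpace ℝ EK] [FiniteDimensional ℝ EK]
  {K : Type*} [TopologicalSpace K] [Group K] [ChartedSpace EK K] [LieGroup 𝓘(ℝ, EK) ∞ K]
  {S : M → Type*} [TopologicalSpace (TotalSpace R8 S)]
    [∀ x, NormedAddCommGroup (S x)] [∀ x, InnerProductSpace ℝ (S x)] [FiberBundle R8 S]
    [VectorBundle ℝ R8 S] [ContMDiffVectorBundle ∞ R8 S (𝓡 6)]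
    [IsContMDiffRiemannianBundle (𝓡 6) ∞ R8 S]
  {a ε : Π x : M, TangentSpace (𝓡 6) x →L[ℝ] LieAlg EK K} {x : M}

namespace NearlyKahlerStructure

variable (N : NearlyKahlerStructure M S)

/-- `ε · ψ` in a pair of dual frames. -/
theorem oneFormPsi_eq {E : Fin 6 → Π x : M, TangentSpace (𝓡 6) x} {U : Set M}
    (hE : IsCoordFrame E U) (hx : x ∈ U) (L : TangentSpace (𝓡 6) x →L[ℝ] LieAlg EK K) :
    N.oneFormPsi x L = ∑ i, N.cliff x (dualFrame E i x) (N.psi x) ⊗ₜ[ℝ] L (E i x) := by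
  let β : TangentSpace (𝓡 6) x →ₗ[ℝ] TangentSpace (𝓡 6) x →ₗ[ℝ] S x ⊗[ℝ] LieAlg EK K :=
    LinearMap.mk₂ ℝ (fun v w ↦ N.cliff x v (N.psi x) ⊗ₜ[ℝ] L w)
      (fun v v' w ↦ by simp [TensorProduct.add_tmul])
      (fun c v w ↦ by simp [TensorProduct.smul_tmul'])
      (fun v w w' ↦ by simp [TensorProduct.tmul_add]) (fun c v w ↦ by simp)
  exact hE.sum_frame_eq hx β

theorem oneFormPsi_injective (x : M) :
    Function.Injective (N.oneFormPsi x : (TangentSpace (𝓡 6) x →L[ℝ] LieAlg EK K) → _) := by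
  intro L L' h
  have h1 : ∀ (L : TangentSpace (𝓡 6) x →L[ℝ] LieAlg EK K) (v : TangentSpace (𝓡 6) x),
      pair (N.cliff x v (N.psi x)) (N.oneFormPsi x L) = L v := by
    intro L v
    conv_rhs => rw [← (frame M x).sum_repr' v]
    simp only [oneFormPsi, map_sum, pair_tmul, map_smul]
    refine Finset.sum_congr rfl fun i _ ↦ ?_
    rw [(N.isSpinFibre x).inner_mul_mul _ _ _ (N.isSpinFibre x).unit, real_inner_comm]
  ext v
  rw [← h1 L, ← h1 L', h]

theorem pair_psi_oneFormPsi (L : TangentSpace (𝓡 6) x →L[ℝ] LieAlg EK K) :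
    pair (N.psi x) (N.oneFormPsi x L) = 0 := by
  simp only [oneFormPsi, map_sum, pair_tmul]
  refine Finset.sum_eq_zero fun i _ ↦ ?_
  rw [real_inner_comm, (N.isSpinFibre x).inner_mul_psi, zero_smul]

theorem pair_vol_oneFormPsi (L : TangentSpace (𝓡 6) x →L[ℝ] LieAlg EK K) :
    pair (N.vol x (N.psi x)) (N.oneFormPsi x L) = 0 := by
  simp only [oneFormPsi, map_sum, pair_tmul]
  refine Finset.sum_eq_zero fun i _ ↦ ?_
  rw [real_inner_comm, (N.isSpinFibre x).inner_mul_psi_vol, zero_smul]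

theorem adSpinorAt_oneFormPsi (hε : FormAt ε x) :
    AdSpinorAt (fun y ↦ N.oneFormPsi y (ε y)) x := by
  intro l
  obtain ⟨E, hE, -⟩ := exists_isCoordFrame x
  have hx : x ∈ (chartAt R6 x).source := mem_chart_source R6 x
  have h1 : SpinorAt ∞ (fun y ↦ ∑ i, l (ε y (E i y)) •
      N.cliff y (dualFrame E i y) (N.psi y)) x := by
    refine ContMDiffAt.sum_section (I := 𝓡 6) (F := R8) (V := S) (s := Finset.univ)
      (t := fun i y ↦ l (ε y (E i y)) • N.cliff y (dualFrame E i y) (N.psi y)) fun i _ ↦ ?_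
    refine ContMDiffAt.smul_section (V := S) ?_
      (cliff_contMDiffAt (N := N) (hE.contMDiffAt_dualFrame hx i) (N.contMDiff_psi x))
    exact ContMDiffAt.clm (F := EK) (LinearMap.toContinuousLinearMap (E := EK) l)
      (hε.apply (hE.contMDiffAt i x hx))
  refine h1.congr_of_eventuallyEq ?_
  filter_upwards [hE.mem_nhds hx] with y hy
  rw [N.oneFormPsi_eq hE hy, map_sum]
  refine congrArg _ (Finset.sum_congr rfl fun i _ ↦ ?_)
  simp [contr]

/-- The covariant derivative of `ε · ψ`; the second term comes from the Killing equation. -/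
theorem spinCov_oneFormPsi (hε : FormAt ε x) (v : TangentSpace (𝓡 6) x) :
    N.spinCov a (fun y ↦ N.oneFormPsi y (ε y)) x v =
      ∑ j, N.cliff x (frame M x j) (N.psi x) ⊗ₜ[ℝ] formCov N.LC a ε x v (frame M x j) +
      (1 / 2 : ℝ) • ∑ j, N.cliff x (frame M x j) (N.cliff x v (N.psi x)) ⊗ₜ[ℝ]
        ε x (frame M x j) := by
  obtain ⟨E, hE, -⟩ := exists_isCoordFrame x
  have hx : x ∈ (chartAt R6 x).source := mem_chart_source R6 x
  have dψ : SpinorDiffAt N.psi x := (N.contMDiff_psi x).mdifferentiableAt (by simp)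
  have dε := hε.formDiffAt
  refine ext_pair fun φ₀ ↦ ?_
  let φ := FiberBundle.extend R8 φ₀
  have dφ : SpinorDiffAt φ x := FiberBundle.mdifferentiableAt_extend (𝓡 6) R8 φ₀
  have hφ : φ x = φ₀ := FiberBundle.extend_apply_self _ _
  -- both sums over the orthonormal basis are rewritten in the coordinate frame
  let β : TangentSpace (𝓡 6) x →ₗ[ℝ] TangentSpace (𝓡 6) x →ₗ[ℝ] LieAlg EK K :=
    LinearMap.mk₂ ℝ (fun w w' ↦ (inner ℝ (φ x) (N.cliff x w (N.psi x)) : ℝ) •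
        formCov N.LC a ε x v w' +
        ((1 / 2 : ℝ) * inner ℝ (φ x) (N.cliff x w (N.cliff x v (N.psi x)))) • ε x w')
      (fun v v' w ↦ by simp only [map_add, _root_.add_apply, inner_add_right]; module)
      (fun c v w ↦ by simp only [map_smul, _root_.smul_apply, inner_smul_right]; module)
      (fun v w w' ↦ by rw [formCov_add_right dε, map_add]; module)
      (fun c v w ↦ by rw [formCov_smul_right dε, map_smul]; module)
  have h1 : pair φ₀ (∑ j, N.cliff x (frame M x j) (N.psi x) ⊗ₜ[ℝ]
        formCov N.LC a ε x v (frame M x j) +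
      (1 / 2 : ℝ) • ∑ j, N.cliff x (frame M x j) (N.cliff x v (N.psi x)) ⊗ₜ[ℝ]
        ε x (frame M x j)) = ∑ i, β (dualFrame E i x) (E i x) := by
    rw [← hE.sum_frame_eq hx β, ← hφ]
    simp only [map_add, map_sum, map_smul, pair_tmul, Finset.smul_sum, ← Finset.sum_add_distrib,
      smul_smul]
    rfl
  rw [h1, ← hφ, N.pair_spinCov dφ (N.adSpinorAt_oneFormPsi hε).diffAt]
  have dE := fun i ↦ cliff_diffAt (N := N) (hE.dualFrame_diffAt hx i) dψ
  have h2 : (fun y ↦ pair (φ y) (N.oneFormPsi y (ε y))) =ᶠ[𝓝 x] fun y ↦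
      ∑ i, (inner ℝ (φ y) (N.cliff y (dualFrame E i y) (N.psi y)) : ℝ) • ε y (E i y) := by
    filter_upwards [hE.mem_nhds hx] with y hy
    rw [N.oneFormPsi_eq hE hy, map_sum]
    simp only [pair_tmul]
  have h3 : ∀ i, lieCov a (fun y ↦ (inner ℝ (φ y) (N.cliff y (dualFrame E i y) (N.psi y)) : ℝ) •
      ε y (E i y)) x v = (inner ℝ (N.nabla φ x v) (N.cliff x (dualFrame E i x) (N.psi x)) : ℝ) •
        ε x (E i x) + (inner ℝ (φ x) (N.cliff x (N.LC (dualFrame E i) x v) (N.psi x)) : ℝ) •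
        ε x (E i x) + (inner ℝ (φ x) (N.cliff x (dualFrame E i x) (N.psi x)) : ℝ) •
        ε x (N.LC (E i) x v) + β (dualFrame E i x) (E i x) := by
    intro i
    rw [lieCov_smul (dφ.inner (dE i)) (dε.apply (hE.diffAt hx i)),
      mvfderiv_inner (N := N) dφ (dE i), N.nabla_cliff x _ _ (hE.dualFrame_diffAt hx i) dψ,
      N.killing]
    simp only [β, LinearMap.mk₂_apply]
    rw [formCov_eq dε (hE.diffAt hx i)]
    simp only [map_smul, inner_add_right, inner_smul_right]
    module
  rw [lieCov_congr h2, lieCov_sum _ fun i ↦ LieDiffAt.smul (dφ.inner (dE i))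
    (dε.apply (hE.diffAt hx i))]
  simp only [h3, Finset.sum_add_distrib]
  rw [N.oneFormPsi_eq hE hx, map_sum]
  simp only [pair_tmul]
  -- the derivatives of the frame and of its dual frame cancel
  have h4 : ∑ i, (inner ℝ (φ x) (N.cliff x (N.LC (dualFrame E i) x v) (N.psi x)) : ℝ) •
      ε x (E i x) + ∑ i, (inner ℝ (φ x) (N.cliff x (dualFrame E i x) (N.psi x)) : ℝ) •
        ε x (N.LC (E i) x v) = 0 := by
    have h5 : ∀ i, ε x (N.LC (E i) x v) = ∑ m, (inner ℝ (dualFrame E m x) (N.LC (E i) x v) : ℝ) •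
        ε x (E m x) := fun i ↦ by
      conv_lhs => rw [← hE.sum_inner_dualFrame_smul hx (N.LC (E i) x v)]
      simp only [map_sum, map_smul]
    simp only [h5, hE.cov_dualFrame hx N.isLeviCivita, map_neg, map_sum, map_smul, neg_apply,
      _root_.sum_apply, _root_.smul_apply, inner_neg_right, inner_sum, inner_smul_right,
      Finset.smul_sum, smul_smul, neg_smul, Finset.sum_smul, Finset.sum_neg_distrib]
    rw [neg_add_eq_zero, Finset.sum_comm]
    refine Finset.sum_congr rfl fun i _ ↦ Finset.sum_congr rfl fun j _ ↦ ?_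
    rw [mul_comm, real_inner_comm (dualFrame E j x)]
  rw [add_assoc (∑ i, _) (∑ i, _) (∑ i, _), h4, add_zero]
  abel

/-- The Weitzenböck-type identity behind the theorem: `D (ε · ψ) = 2 ε · ψ + dε · ψ + (d*ε) ψ`. -/
theorem dirac_oneFormPsi (hε : FormAt ε x) :
    N.dirac a (fun y ↦ N.oneFormPsi y (ε y)) x = (2 : ℝ) • N.oneFormPsi x (ε x) +
      N.twoFormPsi x (covExtD a ε x) + N.psi x ⊗ₜ[ℝ] covCodiff N.LC a ε x := by
  have hF := N.isSpinFibre x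
  let e := frame M x
  set β := formCov N.LC a ε x with hβ
  have ho : ∀ i j, inner ℝ (e i) (e j) = if i = j then (1 : ℝ) else 0 :=
    orthonormal_iff_ite.1 e.orthonormal
  -- `∑ e_k v e_k = 4 v`: moving `e_k` past `v` gives `6 v - 2 v`. With the Killing constant `1 / 2`
  -- this accounts for the eigenvalue `2`.
  have h1 : ∀ j, ∑ k, N.cliff x (e k) (N.cliff x (e j) (N.cliff x (e k) (N.psi x))) =
      (4 : ℝ) • N.cliff x (e j) (N.psi x) := by
    intro j
    have h2 : ∀ k, N.cliff x (e k) (N.cliff x (e j) (N.cliff x (e k) (N.psi x))) =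
        -N.cliff x (e k) (N.cliff x (e k) (N.cliff x (e j) (N.psi x))) -
          (2 * inner ℝ (e j) (e k) : ℝ) • N.cliff x (e k) (N.psi x) := fun k ↦ by
      rw [hF.toIsClifford.anticomm (e j) (e k), map_sub, map_neg, map_smul]
    simp only [h2, Finset.sum_sub_distrib, Finset.sum_neg_distrib, hF.sum_sq e, ho, mul_ite,
      mul_one, mul_zero, ite_smul, zero_smul, Finset.sum_ite_eq, Finset.mem_univ, if_true]
    have h7 : (Fintype.card (Fin (Module.finrank ℝ (TangentSpace (𝓡 6) x))) : ℝ) = 6 := by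
      rw [Fintype.card_fin, ← card_eq_finrank_tangentSpace x]
      norm_num
    rw [h7]
    module
  -- the part of `e_k e_j ψ` symmetric in `j` and `k` is `-δ_{jk} ψ`
  have h3 : ∑ k, ∑ j, N.cliff x (e k) (N.cliff x (e j) (N.psi x)) ⊗ₜ[ℝ] β (e k) (e j) =
      N.twoFormPsi x (covExtD a ε x) + N.psi x ⊗ₜ[ℝ] covCodiff N.LC a ε x := by
    have h4 : N.twoFormPsi x (covExtD a ε x) = (1 / 2 : ℝ) •
        (∑ k, ∑ j, N.cliff x (e k) (N.cliff x (e j) (N.psi x)) ⊗ₜ[ℝ] β (e k) (e j) -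
        ∑ k, ∑ j, N.cliff x (e j) (N.cliff x (e k) (N.psi x)) ⊗ₜ[ℝ] β (e k) (e j)) := by
      rw [twoFormPsi]
      simp only [covExtD_eq N.isLeviCivita, TensorProduct.tmul_sub, Finset.sum_sub_distrib]
      congr 2
      exact Finset.sum_comm
    have h5 : ∑ k, ∑ j, N.cliff x (e k) (N.cliff x (e j) (N.psi x)) ⊗ₜ[ℝ] β (e k) (e j) +
        ∑ k, ∑ j, N.cliff x (e j) (N.cliff x (e k) (N.psi x)) ⊗ₜ[ℝ] β (e k) (e j) =
        (2 : ℝ) • (N.psi x ⊗ₜ[ℝ] covCodiff N.LC a ε x) := by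
      rw [← Finset.sum_add_distrib]
      simp only [← Finset.sum_add_distrib, ← TensorProduct.add_tmul]
      have h6 : ∀ k j, N.cliff x (e k) (N.cliff x (e j) (N.psi x)) +
          N.cliff x (e j) (N.cliff x (e k) (N.psi x)) =
          if k = j then (-2 : ℝ) • N.psi x else 0 := fun k j ↦ by
        rw [hF.toIsClifford.anticomm (e k) (e j), ho]
        split_ifs <;> module
      simp only [h6, TensorProduct.ite_tmul, Finset.sum_ite_eq, Finset.mem_univ, if_true]
      rw [covCodiff_eq, TensorProduct.tmul_neg, TensorProduct.tmul_sum, smul_neg, Finset.smul_sum,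
        ← Finset.sum_neg_distrib]
      refine Finset.sum_congr rfl fun k _ ↦ ?_
      rw [← TensorProduct.smul_tmul', ← neg_smul]
    have h7 := congrArg (fun z ↦ (1 / 2 : ℝ) • z) h5
    simp only [smul_smul] at h7
    norm_num at h7
    rw [h4, ← h7]
    module
  have h8 : ∀ k, LinearMap.rTensor (LieAlg EK K) (N.cliff x (e k)).toLinearMap
      (N.spinCov a (fun y ↦ N.oneFormPsi y (ε y)) x (e k)) =
      ∑ j, N.cliff x (e k) (N.cliff x (e j) (N.psi x)) ⊗ₜ[ℝ] β (e k) (e j) +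
      (1 / 2 : ℝ) • ∑ j, N.cliff x (e k) (N.cliff x (e j) (N.cliff x (e k) (N.psi x))) ⊗ₜ[ℝ]
        ε x (e j) := fun k ↦ by
    rw [N.spinCov_oneFormPsi hε, map_add, map_smul, map_sum, map_sum]
    rfl
  change ∑ k, LinearMap.rTensor (LieAlg EK K) (N.cliff x (e k)).toLinearMap
      (N.spinCov a (fun y ↦ N.oneFormPsi y (ε y)) x (e k)) = _
  simp only [h8, Finset.sum_add_distrib, h3, ← Finset.smul_sum]
  rw [Finset.sum_comm]
  simp only [← TensorProduct.sum_tmul, h1, ← TensorProduct.smul_tmul', ← Finset.smul_sum, smul_smul]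
  rw [oneFormPsi]
  norm_num
  abel

end NearlyKahlerStructure

end OneFormPsi

/-! ### The divergence identity -/

section Commutator

variable {M : Type*} [TopologicalSpace M] [ChartedSpace R6 M] [IsManifold (𝓡 6) ∞ M]
  {EK : Type*} [NormedAddCommGroup EK] [NormedSpace ℝ EK] [FiniteDimensional ℝ EK]
  {K : Type*} [TopologicalSpace K] [Group K] [ChartedSpace EK K] [LieGroup 𝓘(ℝ, EK) ∞ K]
  {a : Π x : M, TangentSpace (𝓡 6) x →L[ℝ] LieAlg EK K} {f : M → LieAlg EK K} {x : M}
  {E : Fin 6 → Π x : M, TangentSpace (𝓡 6) x} {U : Set M}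

theorem LieAt.lieCov (ha : FormAt a x) (hf : LieAt ∞ f x) {X : Π x : M, TangentSpace (𝓡 6) x}
    (hX : VFieldAt ∞ X x) : LieAt ∞ (fun y ↦ lieCov a f y (X y)) x :=
  LieAt.add (ContMDiffAt.mvfderiv_apply (F := EK) le_rfl hf hX) ((ha.apply hX).lie hf)

variable [RiemannianBundle (fun x : M ↦ TangentSpace (𝓡 6) x)]
  [IsContMDiffRiemannianBundle (𝓡 6) ∞ R6 (fun x : M ↦ TangentSpace (𝓡 6) x)]
  {LC : CovariantDerivative (𝓡 6) R6 (fun x : M ↦ TangentSpace (𝓡 6) x)}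

theorem IsCoordFrame.curvature_eq (hLC : IsLeviCivita LC) (hE : IsCoordFrame E U) (hx : x ∈ U)
    (ha : FormAt a x) (i j : Fin 6) :
    curvature a x (E i x) (E j x) = lieDiff (fun y ↦ a y (E j y)) x (E i x) -
      lieDiff (fun y ↦ a y (E i y)) x (E j x) + ⁅a x (E i x), a x (E j x)⁆ := by
  have h := hE.covExtD_eq (a := 0) hLC hx ha.formDiffAt i j
  simp only [covExtD, lieCov_apply, Pi.zero_apply, zero_apply, zero_lie, add_zero, sub_zero] at h
  rw [curvature, h]

/-- The curvature is the commutator of the covariant derivatives along a coordinate frame. -/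
theorem IsCoordFrame.lieCov_comm (hLC : IsLeviCivita LC) (hE : IsCoordFrame E U) (hx : x ∈ U)
    (ha : FormAt a x) (hf : LieAt ∞ f x) (i j : Fin 6) :
    lieCov a (fun y ↦ lieCov a f y (E j y)) x (E i x) -
      lieCov a (fun y ↦ lieCov a f y (E i y)) x (E j x) =
      ⁅curvature a x (E i x) (E j x), f x⁆ := by
  have h1 : ∀ i j, lieCov a (fun y ↦ lieCov a f y (E j y)) x (E i x) =
      lieDiff (fun y ↦ lieDiff f y (E j y)) x (E i x) +
        (⁅lieDiff (fun y ↦ a y (E j y)) x (E i x), f x⁆ + ⁅a x (E j x), lieDiff f x (E i x)⁆) +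
        ⁅a x (E i x), lieDiff f x (E j x) + ⁅a x (E j x), f x⁆⁆ := by
    intro i j
    have hd : LieDiffAt (fun y ↦ lieDiff f y (E j y)) x :=
      LieAt.lieDiffAt (n := ∞) (by simp) (hE.contMDiffAt_deriv (F := EK) hx hf j)
    have haj : LieAt ∞ (fun y ↦ a y (E j y)) x := ha.apply (hE.contMDiffAt j x hx)
    rw [lieCov_apply]
    simp only [lieCov_apply]
    rw [lieDiff_add hd (LieAt.lieDiffAt (n := ∞) (by simp) (haj.lie hf)),
      lieDiff_lie (haj.lieDiffAt (by simp)) (hf.lieDiffAt (by simp))]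
  have h2 : lieDiff (fun y ↦ lieDiff f y (E j y)) x (E i x) =
      lieDiff (fun y ↦ lieDiff f y (E i y)) x (E j x) := hE.deriv_comm (F := EK) hx hf i j
  rw [h1, h1, h2, hE.curvature_eq hLC hx ha]
  simp only [lie_add, add_lie, sub_lie, lie_lie]
  abel

/-- The double divergence of a skew-symmetric bivector only sees the curvature. The divergence is
written in a coordinate frame, with the coefficients `θ_l` in place of the volume density. -/
theorem IsCoordFrame.div_div (hLC : IsLeviCivita LC) (hE : IsCoordFrame E U) (hx : x ∈ U)
    (ha : ∀ y ∈ U, FormAt a y) {Q : Fin 6 → Fin 6 → M → LieAlg EK K}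
    (hQ : ∀ i j, ∀ y ∈ U, LieAt ∞ (Q i j) y) (hskew : ∀ i j, ∀ y ∈ U, Q i j y = -Q j i y) :
    ∑ i, (lieCov a (fun y ↦ ∑ j, (lieCov a (Q j i) y (E j y) + logVol E j y • Q j i y)) x (E i x) +
      logVol E i x • ∑ j, (lieCov a (Q j i) x (E j x) + logVol E j x • Q j i x)) =
      (1 / 2 : ℝ) • ∑ i, ∑ j, ⁅curvature a x (E i x) (E j x), Q j i x⁆ := by
  have hdQ : ∀ i j, LieDiffAt (Q i j) x := fun i j ↦ (hQ i j x hx).lieDiffAt (by simp)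
  have hdC : ∀ i j k, LieDiffAt (fun y ↦ lieCov a (Q j i) y (E k y)) x := fun i j k ↦
    LieAt.lieDiffAt (n := ∞) (by simp)
      (LieAt.lieCov (ha x hx) (hQ j i x hx) (hE.contMDiffAt k x hx))
  have hdθ : ∀ j, MDifferentiableAt (𝓡 6) 𝓘(ℝ, ℝ) (logVol E j) x := fun j ↦
    (hE.contMDiffAt_logVol hx j).mdifferentiableAt (by simp)
  have hneg : ∀ i j k, lieCov a (Q i j) x (E k x) = -lieCov a (Q j i) x (E k x) := by
    intro i j k
    have h1 : Q i j =ᶠ[𝓝 x] fun y ↦ (-1 : ℝ) • Q j i y := by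
      filter_upwards [hE.mem_nhds hx] with y hy
      rw [hskew i j y hy, neg_smul, one_smul]
    rw [lieCov_congr h1, lieCov_smul mdifferentiableAt_const (hdQ j i), mvfderiv_const]
    simp
  have hneg2 : ∀ i j k l, lieCov a (fun y ↦ lieCov a (Q i j) y (E k y)) x (E l x) =
      -lieCov a (fun y ↦ lieCov a (Q j i) y (E k y)) x (E l x) := by
    intro i j k l
    have h1 : (fun y ↦ lieCov a (Q i j) y (E k y)) =ᶠ[𝓝 x]
        fun y ↦ (-1 : ℝ) • lieCov a (Q j i) y (E k y) := by
      filter_upwards [hE.mem_nhds hx] with y hy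
      have h2 : Q i j =ᶠ[𝓝 y] fun y ↦ (-1 : ℝ) • Q j i y := by
        filter_upwards [hE.mem_nhds hy] with z hz
        rw [hskew i j z hz, neg_smul, one_smul]
      rw [lieCov_congr h2, lieCov_smul mdifferentiableAt_const
        ((hQ j i y hy).lieDiffAt (by simp)), mvfderiv_const]
      simp
    rw [lieCov_congr h1, lieCov_smul mdifferentiableAt_const (hdC _ _ _), mvfderiv_const]
    simp
  have h1 : ∀ i, lieCov a (fun y ↦ ∑ j, (lieCov a (Q j i) y (E j y) + logVol E j y • Q j i y)) x
      (E i x) = ∑ j, (lieCov a (fun y ↦ lieCov a (Q j i) y (E j y)) x (E i x) +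
        (mvfderiv (𝓡 6) (logVol E j) x (E i x) • Q j i x +
          logVol E j x • lieCov a (Q j i) x (E i x))) := by
    intro i
    rw [lieCov_sum _ fun j ↦ (hdC i j j).add ((hdQ j i).smul (hdθ j))]
    refine Finset.sum_congr rfl fun j _ ↦ ?_
    rw [lieCov_add (hdC i j j) ((hdQ j i).smul (hdθ j)), lieCov_smul (hdθ j) (hdQ j i)]
  -- contractions of a symmetric with a skew-symmetric expression vanish
  have hsym : ∀ T : Fin 6 → Fin 6 → LieAlg EK K, (∀ i j, T i j = -T j i) →
      ∑ i, ∑ j, T i j = 0 := by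
    intro T hT
    have h2 : ∑ i, ∑ j, T i j = -∑ i, ∑ j, T i j := by
      conv_lhs => rw [Finset.sum_comm]
      rw [← Finset.sum_neg_distrib]
      refine Finset.sum_congr rfl fun i _ ↦ ?_
      rw [← Finset.sum_neg_distrib]
      exact Finset.sum_congr rfl fun j _ ↦ hT j i
    have h3 : (2 : ℝ) • ∑ i, ∑ j, T i j = 0 := by
      rw [two_smul]
      nth_rewrite 1 [h2]
      exact neg_add_cancel _
    exact (smul_eq_zero.1 h3).resolve_left two_ne_zero
  -- The double divergence expands into the derivatives of `θ`, symmetric because `θ` is closed, the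
  -- squares of `θ`, symmetric as well, mixed terms, which cancel, and second derivatives of `Q`.
  have hA : ∑ i, ∑ j, mvfderiv (𝓡 6) (logVol E j) x (E i x) • Q j i x = 0 :=
    hsym _ fun i j ↦ by rw [hE.deriv_logVol_comm hx i j, hskew j i x hx, smul_neg]
  have hB : ∑ i, ∑ j, (logVol E i x * logVol E j x) • Q j i x = 0 :=
    hsym _ fun i j ↦ by rw [mul_comm, hskew j i x hx, smul_neg]
  have hC : ∑ i, ∑ j, logVol E j x • lieCov a (Q j i) x (E i x) +
      ∑ i, ∑ j, logVol E i x • lieCov a (Q j i) x (E j x) = 0 := by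
    rw [Finset.sum_comm, ← Finset.sum_add_distrib]
    refine Finset.sum_eq_zero fun i _ ↦ ?_
    rw [← Finset.sum_add_distrib]
    refine Finset.sum_eq_zero fun j _ ↦ ?_
    rw [hneg j i, smul_neg, add_neg_cancel]
  have hD : ∑ i, ∑ j, lieCov a (fun y ↦ lieCov a (Q j i) y (E j y)) x (E i x) =
      (1 / 2 : ℝ) • ∑ i, ∑ j, ⁅curvature a x (E i x) (E j x), Q j i x⁆ := by
    have h2 : ∑ i, ∑ j, lieCov a (fun y ↦ lieCov a (Q j i) y (E j y)) x (E i x) =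
        -∑ i, ∑ j, lieCov a (fun y ↦ lieCov a (Q j i) y (E i y)) x (E j x) := by
      conv_lhs => rw [Finset.sum_comm]
      rw [← Finset.sum_neg_distrib]
      refine Finset.sum_congr rfl fun i _ ↦ ?_
      rw [← Finset.sum_neg_distrib]
      exact Finset.sum_congr rfl fun j _ ↦ hneg2 _ _ _ _
    have h3 : ∑ i, ∑ j, ⁅curvature a x (E i x) (E j x), Q j i x⁆ =
        (2 : ℝ) • ∑ i, ∑ j, lieCov a (fun y ↦ lieCov a (Q j i) y (E j y)) x (E i x) := by
      rw [two_smul]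
      nth_rewrite 2 [h2]
      rw [← sub_eq_add_neg, ← Finset.sum_sub_distrib]
      refine Finset.sum_congr rfl fun i _ ↦ ?_
      rw [← Finset.sum_sub_distrib]
      exact Finset.sum_congr rfl fun j _ ↦ (hE.lieCov_comm hLC hx (ha x hx) (hQ j i x hx) i j).symm
    rw [h3, smul_smul]
    norm_num
  rw [← hD]
  simp only [h1]
  simp only [Finset.smul_sum, smul_add, smul_smul, Finset.sum_add_distrib]
  rw [hA, hB, zero_add, add_zero, add_assoc, hC, add_zero]

end Commutator

section Divergence

variable {M : Type*} [TopologicalSpace M] [ChartedSpace R6 M] [IsManifold (𝓡 6) ∞ M]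
  [RiemannianBundle (fun x : M ↦ TangentSpace (𝓡 6) x)]
  [IsContMDiffRiemannianBundle (𝓡 6) ∞ R6 (fun x : M ↦ TangentSpace (𝓡 6) x)]
  {EK : Type*} [NormedAddCommGroup EK] [NormedSpace ℝ EK] [FiniteDimensional ℝ EK]
  {K : Type*} [TopologicalSpace K] [Group K] [ChartedSpace EK K] [LieGroup 𝓘(ℝ, EK) ∞ K]
  {S : M → Type*} [TopologicalSpace (TotalSpace R8 S)]
    [∀ x, NormedAddCommGroup (S x)] [∀ x, InnerProductSpace ℝ (S x)] [FiberBundle R8 S]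
    [VectorBundle ℝ R8 S] [ContMDiffVectorBundle ∞ R8 S (𝓡 6)]
    [IsContMDiffRiemannianBundle (𝓡 6) ∞ R8 S]
  {a : Π x : M, TangentSpace (𝓡 6) x →L[ℝ] LieAlg EK K}
  {ξ : Π x : M, S x ⊗[ℝ] LieAlg EK K} {φ : Π x : M, S x} {c : ℝ}
  {E : Fin 6 → Π x : M, TangentSpace (𝓡 6) x} {U : Set M} {x : M}

namespace NearlyKahlerStructure

variable (N : NearlyKahlerStructure M S)

/-- A smooth spinor field with `∇_v φ = c v · φ`. -/
structure IsKillingSpinor (c : ℝ) (φ : Π x : M, S x) : Prop where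
  contMDiffAt : ∀ x, SpinorAt ∞ φ x
  nabla_eq : ∀ x v, N.nabla φ x v = c • N.cliff x v (φ x)

theorem isKillingSpinor_psi : N.IsKillingSpinor (1 / 2) N.psi := ⟨N.contMDiff_psi, N.killing⟩

theorem isKillingSpinor_vol : N.IsKillingSpinor (-1 / 2) (fun x ↦ N.vol x (N.psi x)) :=
  ⟨fun x ↦ vol_contMDiffAt (N.contMDiff_psi x), fun x v ↦ killing_vol x v⟩

variable {N} (hφ : N.IsKillingSpinor c φ) (hE : IsCoordFrame E U) (hx : x ∈ U)
  (hξ : AdSpinorAt ξ x)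

include hE hx in
/-- The divergence of the dual frame is minus its volume coefficient: `∑_i ∇_i E^i = -θ_l E^l`. -/
theorem sum_LC_dualFrame :
    ∑ i, N.LC (dualFrame E i) x (E i x) = -∑ l, logVol E l x • dualFrame E l x := by
  simp only [hE.cov_dualFrame hx N.isLeviCivita, hE.logVol_eq hx N.isLeviCivita,
    Finset.sum_neg_distrib, Finset.sum_smul]
  rw [Finset.sum_comm]
  simp only [hE.cov_comm hx N.isLeviCivita]

include hE hx in
theorem sum_cliff_dual_cliff (s : S x) :
    ∑ i, N.cliff x (dualFrame E i x) (N.cliff x (E i x) s) = (-6 : ℝ) • s := by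
  let β : TangentSpace (𝓡 6) x →ₗ[ℝ] TangentSpace (𝓡 6) x →ₗ[ℝ] S x :=
    LinearMap.mk₂ ℝ (fun v w ↦ N.cliff x v (N.cliff x w s))
      (fun v v' w ↦ by simp) (fun c v w ↦ by simp) (fun v w w' ↦ by simp) (fun c v w ↦ by simp)
  refine (hE.sum_frame_eq hx β).symm.trans (((N.isSpinFibre x).sum_sq (frame M x) s).trans ?_)
  rw [Fintype.card_fin, ← card_eq_finrank_tangentSpace x]
  norm_num

include hφ hE hx hξ in
/-- The divergence of the vector part of a section of `S ⊗ 𝔨`. -/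
theorem div_pair_cliff :
    ∑ i, (lieCov a (fun y ↦ pair (N.cliff y (dualFrame E i y) (φ y)) (ξ y)) x (E i x) +
      logVol E i x • pair (N.cliff x (dualFrame E i x) (φ x)) (ξ x)) =
      (-6 * c) • pair (φ x) (ξ x) - pair (φ x) (N.dirac a ξ x) := by
  have dφ := (hφ.contMDiffAt x).diffAt
  have h1 : ∀ i, lieCov a (fun y ↦ pair (N.cliff y (dualFrame E i y) (φ y)) (ξ y)) x (E i x) =
      pair (N.cliff x (dualFrame E i x) (φ x)) (N.spinCov a ξ x (E i x)) +
      (pair (N.cliff x (N.LC (dualFrame E i) x (E i x)) (φ x)) (ξ x) +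
        c • pair (N.cliff x (dualFrame E i x) (N.cliff x (E i x) (φ x))) (ξ x)) := by
    intro i
    rw [N.pair_spinCov (cliff_diffAt (N := N) (hE.dualFrame_diffAt hx i) dφ) hξ.diffAt,
      N.nabla_cliff x _ _ (hE.dualFrame_diffAt hx i) dφ, hφ.nabla_eq]
    simp only [map_smul, map_add, LinearMap.add_apply, LinearMap.smul_apply]
    abel
  have h2 : ∑ i, pair (N.cliff x (N.LC (dualFrame E i) x (E i x)) (φ x)) (ξ x) =
      -∑ i, logVol E i x • pair (N.cliff x (dualFrame E i x) (φ x)) (ξ x) := by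
    have h3 := congrArg (fun v ↦ pair (N.cliff x v (φ x)) (ξ x)) (sum_LC_dualFrame (N := N) hE hx)
    simpa only [map_sum, map_neg, map_smul, _root_.sum_apply, neg_apply, _root_.smul_apply,
      LinearMap.sum_apply, LinearMap.neg_apply, LinearMap.smul_apply] using h3
  have h4 : ∑ i, c • pair (N.cliff x (dualFrame E i x) (N.cliff x (E i x) (φ x))) (ξ x) =
      (-6 * c) • pair (φ x) (ξ x) := by
    have h3 := congrArg (fun s ↦ c • pair s (ξ x)) (sum_cliff_dual_cliff (N := N) hE hx (φ x))
    simp only [map_sum, map_smul, LinearMap.sum_apply, LinearMap.smul_apply, Finset.smul_sum,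
      smul_smul] at h3
    rw [h3, mul_comm]
  rw [N.pair_dirac (hE.linearIndependent x hx)]
  simp only [h1, Finset.sum_add_distrib, h2, h4]
  abel

/-- The bivector part `E^i E^j φ + g^{ij} φ` of a product of two dual frame fields on `φ`. -/
def bivector (N : NearlyKahlerStructure M S) (E : Fin 6 → Π x : M, TangentSpace (𝓡 6) x)
    (φ : Π x : M, S x) (i j : Fin 6) (x : M) : S x :=
  N.cliff x (dualFrame E i x) (N.cliff x (dualFrame E j x) (φ x)) +
    (inner ℝ (dualFrame E i x) (dualFrame E j x) : ℝ) • φ x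

theorem bivector_skew (i j : Fin 6) : bivector N E φ i j x = -bivector N E φ j i x := by
  rw [bivector, bivector, (N.isSpinFibre x).toIsClifford.anticomm (dualFrame E i x),
    real_inner_comm (dualFrame E j x)]
  module

include hφ hE hx in
theorem contMDiffAt_bivector (i j : Fin 6) : SpinorAt ∞ (bivector N E φ i j) x := by
  have d := fun i ↦ hE.contMDiffAt_dualFrame hx i
  refine ContMDiffAt.add_section (V := S)
    (s := fun y ↦ N.cliff y (dualFrame E i y) (N.cliff y (dualFrame E j y) (φ y)))
    (t := fun y ↦ (inner ℝ (dualFrame E i y) (dualFrame E j y) : ℝ) • φ y)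
    (cliff_contMDiffAt (N := N) (d i) (cliff_contMDiffAt (N := N) (d j) (hφ.contMDiffAt x))) ?_
  exact ContMDiffAt.smul_section (V := S) (contMDiffAt_inner (d i) (d j)) (hφ.contMDiffAt x)

include hφ hE hx in
/-- The divergence of the bivectors: the Christoffel symbols combine to the logarithmic
derivative of the volume density. -/
theorem sum_nabla_bivector (i : Fin 6) :
    ∑ j, N.nabla (bivector N E φ j i) x (E j x) = -∑ l, logVol E l x • bivector N E φ l i x +
      (5 * c) • N.cliff x (dualFrame E i x) (φ x) := by
  have dφ := (hφ.contMDiffAt x).diffAt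
  have d := fun i ↦ hE.dualFrame_diffAt hx i
  have hN := N.isLeviCivita
  have h1 : ∀ j, N.nabla (bivector N E φ j i) x (E j x) =
      N.cliff x (N.LC (dualFrame E j) x (E j x)) (N.cliff x (dualFrame E i x) (φ x)) +
      N.cliff x (dualFrame E j x) (N.cliff x (N.LC (dualFrame E i) x (E j x)) (φ x)) +
      c • N.cliff x (dualFrame E j x) (N.cliff x (dualFrame E i x) (N.cliff x (E j x) (φ x))) +
      ((inner ℝ (N.LC (dualFrame E j) x (E j x)) (dualFrame E i x) : ℝ) • φ x +
      (inner ℝ (dualFrame E j x) (N.LC (dualFrame E i) x (E j x)) : ℝ) • φ x) +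
      c • (inner ℝ (dualFrame E i x) (dualFrame E j x) : ℝ) • N.cliff x (E j x) (φ x) := by
    intro j
    have h2 := N.nabla.isCovariantDerivativeOn.add (x := x)
      (σ := fun y ↦ N.cliff y (dualFrame E j y) (N.cliff y (dualFrame E i y) (φ y)))
      (σ' := (fun y ↦ (inner ℝ (dualFrame E j y) (dualFrame E i y) : ℝ)) • φ)
      (cliff_diffAt (N := N) (d j) (cliff_diffAt (N := N) (d i) dφ))
      (MDifferentiableAt.smul_section (mdifferentiableAt_inner (d j) (d i)) dφ)
    have h3 := N.nabla.isCovariantDerivativeOn.leibniz (x := x) dφ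
      (mdifferentiableAt_inner (d j) (d i))
    have h4 := congrArg (fun T ↦ T (E j x)) h2
    rw [h3] at h4
    simp only [_root_.add_apply, _root_.smul_apply, ContinuousLinearMap.smulRight_apply] at h4
    refine Eq.trans ?_ (h4.trans ?_)
    · rfl
    · rw [N.nabla_cliff x _ _ (d j) (cliff_diffAt (N := N) (d i) dφ), N.nabla_cliff x _ _ (d i) dφ,
        hφ.nabla_eq, hN.metric x _ _ (d j) (d i), real_inner_comm (dualFrame E j x)]
      simp only [map_add, map_smul]
      module
  have hg : ∀ j l, inner ℝ (dualFrame E j x) (dualFrame E l x) =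
      (inner ℝ (dualFrame E l x) (dualFrame E j x) : ℝ) := fun j l ↦ real_inner_comm _ _
  -- terms with the trace of the derivative of the dual frame
  have hA := sum_LC_dualFrame (N := N) hE hx
  have hA1 : ∑ j, N.cliff x (N.LC (dualFrame E j) x (E j x)) (N.cliff x (dualFrame E i x) (φ x)) =
      -∑ l, logVol E l x • N.cliff x (dualFrame E l x) (N.cliff x (dualFrame E i x) (φ x)) := by
    have h3 := congrArg (fun v ↦ N.cliff x v (N.cliff x (dualFrame E i x) (φ x))) hA
    simpa only [map_sum, map_neg, map_smul, _root_.sum_apply, neg_apply, _root_.smul_apply] using h3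
  have hA2 : ∑ j, (inner ℝ (N.LC (dualFrame E j) x (E j x)) (dualFrame E i x) : ℝ) • φ x =
      -∑ l, logVol E l x • (inner ℝ (dualFrame E l x) (dualFrame E i x) : ℝ) • φ x := by
    have h3 := congrArg (fun v ↦ (inner ℝ v (dualFrame E i x) : ℝ) • φ x) hA
    simp only [sum_inner, inner_neg_left, inner_smul_left, neg_smul, Finset.sum_smul, mul_smul,
      conj_trivial] at h3
    exact h3
  -- the derivative of `E^i` is symmetric, so only the metric part of the product contributes
  have hB : ∑ j, N.cliff x (dualFrame E j x) (N.cliff x (N.LC (dualFrame E i) x (E j x)) (φ x)) =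
      -∑ j, (inner ℝ (dualFrame E j x) (N.LC (dualFrame E i) x (E j x)) : ℝ) • φ x := by
    set γ : Fin 6 → Fin 6 → ℝ := fun j l ↦ inner ℝ (N.LC (E l) x (E j x)) (dualFrame E i x) with hγ
    have hs : ∀ j l, γ j l = γ l j := fun j l ↦ by
      simp only [hγ]
      rw [hE.cov_comm hx hN]
    have h3 : ∀ j, N.LC (dualFrame E i) x (E j x) = -∑ l, γ j l • dualFrame E l x := fun j ↦
      hE.cov_dualFrame hx hN i _
    simp only [h3, map_neg, map_sum, map_smul, neg_apply, _root_.sum_apply, _root_.smul_apply,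
      inner_neg_right, inner_sum, inner_smul_right, neg_smul, Finset.sum_neg_distrib, neg_neg,
      Finset.sum_smul]
    rw [neg_eq_iff_add_eq_zero]
    have h4 : ∑ j, ∑ l, γ j l • (N.cliff x (dualFrame E j x) (N.cliff x (dualFrame E l x) (φ x)) +
        (inner ℝ (dualFrame E j x) (dualFrame E l x) : ℝ) • φ x) = 0 := by
      have h5 : ∑ j, ∑ l, γ j l • bivector N E φ j l x =
          -∑ j, ∑ l, γ j l • bivector N E φ j l x := by
        conv_lhs => rw [Finset.sum_comm]
        rw [← Finset.sum_neg_distrib]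
        refine Finset.sum_congr rfl fun j _ ↦ ?_
        rw [← Finset.sum_neg_distrib]
        refine Finset.sum_congr rfl fun l _ ↦ ?_
        rw [bivector_skew, hs, smul_neg]
      have h6 : (2 : ℝ) • ∑ j, ∑ l, γ j l • bivector N E φ j l x = 0 := by
        rw [two_smul]
        nth_rewrite 1 [h5]
        exact neg_add_cancel _
      exact (smul_eq_zero.1 h6).resolve_left two_ne_zero
    rw [← h4]
    simp only [smul_add, Finset.sum_add_distrib, smul_smul]
  -- `∑ E^j v E_j φ = 4 v φ`, where `4 = 6 - 2`; together with the metric term `hD` this gives `5`.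
  have hC : ∑ j, N.cliff x (dualFrame E j x) (N.cliff x (dualFrame E i x)
      (N.cliff x (E j x) (φ x))) = (4 : ℝ) • N.cliff x (dualFrame E i x) (φ x) := by
    have h3 : ∀ j, N.cliff x (dualFrame E j x) (N.cliff x (dualFrame E i x)
        (N.cliff x (E j x) (φ x))) = -N.cliff x (dualFrame E j x) (N.cliff x (E j x)
          (N.cliff x (dualFrame E i x) (φ x))) -
          (2 * (if i = j then 1 else 0) : ℝ) • N.cliff x (dualFrame E j x) (φ x) := fun j ↦ by
      rw [(N.isSpinFibre x).toIsClifford.anticomm (dualFrame E i x), map_sub, map_neg, map_smul,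
        hE.inner_dualFrame hx]
    simp only [h3, Finset.sum_sub_distrib, Finset.sum_neg_distrib, sum_cliff_dual_cliff hE hx,
      mul_ite, mul_one, mul_zero, ite_smul, zero_smul, Finset.sum_ite_eq, Finset.mem_univ, if_true]
    module
  have hD : ∑ j, (inner ℝ (dualFrame E i x) (dualFrame E j x) : ℝ) • N.cliff x (E j x) (φ x) =
      N.cliff x (dualFrame E i x) (φ x) := by
    have h3 := congrArg (fun v ↦ N.cliff x v (φ x))
      (hE.sum_inner_dualFrame_smul hx (dualFrame E i x))
    simp only [map_sum, map_smul, _root_.sum_apply, _root_.smul_apply] at h3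
    rw [← h3]
    exact Finset.sum_congr rfl fun j _ ↦ by rw [hg]
  simp only [h1, Finset.sum_add_distrib, ← Finset.smul_sum, hA1, hA2, hB, hC, hD, bivector,
    smul_add]
  module

include hφ hE hx hξ in
/-- The gradient of the scalar part of a section of `S ⊗ 𝔨`, expressed by the divergence of the
bivector part, the Dirac operator and the vector part. -/
theorem lieCov_pair_dualFrame (i : Fin 6) :
    lieCov a (fun y ↦ pair (φ y) (ξ y)) x (dualFrame E i x) =
      ∑ j, (lieCov a (fun y ↦ pair (bivector N E φ j i y) (ξ y)) x (E j x) +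
        logVol E j x • pair (bivector N E φ j i x) (ξ x)) +
      pair (N.cliff x (dualFrame E i x) (φ x)) (N.dirac a ξ x) -
      (4 * c) • pair (N.cliff x (dualFrame E i x) (φ x)) (ξ x) := by
  have dφ := (hφ.contMDiffAt x).diffAt
  have h1 : ∀ j, pair (N.cliff x (dualFrame E j x) (N.cliff x (dualFrame E i x) (φ x)))
      (N.spinCov a ξ x (E j x)) =
      lieCov a (fun y ↦ pair (bivector N E φ j i y) (ξ y)) x (E j x) -
        pair (N.nabla (bivector N E φ j i) x (E j x)) (ξ x) -
        (inner ℝ (dualFrame E j x) (dualFrame E i x) : ℝ) •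
          pair (φ x) (N.spinCov a ξ x (E j x)) := by
    intro j
    rw [← N.pair_spinCov (contMDiffAt_bivector hφ hE hx j i).diffAt hξ.diffAt]
    simp only [bivector, map_add, map_smul, LinearMap.add_apply, LinearMap.smul_apply]
    abel
  have h2 : ∑ j, (inner ℝ (dualFrame E j x) (dualFrame E i x) : ℝ) •
      pair (φ x) (N.spinCov a ξ x (E j x)) =
        lieCov a (fun y ↦ pair (φ y) (ξ y)) x (dualFrame E i x) -
        c • pair (N.cliff x (dualFrame E i x) (φ x)) (ξ x) := by
    have h3 := congrArg (fun v ↦ pair (φ x) (N.spinCov a ξ x v))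
      (hE.sum_inner_dualFrame_smul hx (dualFrame E i x))
    simp only [map_sum, map_smul] at h3
    rw [h3, N.pair_spinCov dφ hξ.diffAt, hφ.nabla_eq, map_smul, LinearMap.smul_apply]
  have h4 : ∑ j, pair (N.nabla (bivector N E φ j i) x (E j x)) (ξ x) =
      -∑ l, logVol E l x • pair (bivector N E φ l i x) (ξ x) +
      (5 * c) • pair (N.cliff x (dualFrame E i x) (φ x)) (ξ x) := by
    have h3 := congrArg (fun s ↦ pair s (ξ x)) (sum_nabla_bivector hφ hE hx i)
    simpa only [map_sum, map_add, map_neg, map_smul, LinearMap.sum_apply, LinearMap.add_apply,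
      LinearMap.neg_apply, LinearMap.smul_apply] using h3
  rw [N.pair_dirac (hE.linearIndependent x hx)]
  simp only [h1, Finset.sum_sub_distrib, h2, h4, Finset.sum_add_distrib]
  module

end NearlyKahlerStructure

end Divergence

/-! ### Bochner's formula -/

section Bochner

variable {M : Type*} [TopologicalSpace M] [ChartedSpace R6 M] [IsManifold (𝓡 6) ∞ M]
  [RiemannianBundle (fun x : M ↦ TangentSpace (𝓡 6) x)]
  [IsContMDiffRiemannianBundle (𝓡 6) ∞ R6 (fun x : M ↦ TangentSpace (𝓡 6) x)]
  {EK : Type*} [NormedAddCommGroup EK] [NormedSpace ℝ EK] [FiniteDimensional ℝ EK]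
  {K : Type*} [TopologicalSpace K] [Group K] [ChartedSpace EK K] [LieGroup 𝓘(ℝ, EK) ∞ K]
  {LC : CovariantDerivative (𝓡 6) R6 (fun x : M ↦ TangentSpace (𝓡 6) x)}
  {a : Π x : M, TangentSpace (𝓡 6) x →L[ℝ] LieAlg EK K} {f g : M → LieAlg EK K}
  {E : Fin 6 → Π x : M, TangentSpace (𝓡 6) x} {U : Set M} {x : M}

omit [IsContMDiffRiemannianBundle (𝓡 6) ∞ R6 (fun x : M ↦ TangentSpace (𝓡 6) x)] in
theorem curvature_eq_formCov (hLC : IsLeviCivita LC) (v w : TangentSpace (𝓡 6) x) :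
    curvature a x v w = formCov LC 0 a x v w - formCov LC 0 a x w v + ⁅a x v, a x w⁆ := by
  have h := covExtD_eq (a := 0) (ε := a) hLC v w
  simp only [covExtD, Pi.zero_apply, zero_apply, zero_lie, add_zero, sub_zero] at h
  rw [curvature, h]

omit [IsContMDiffRiemannianBundle (𝓡 6) ∞ R6 (fun x : M ↦ TangentSpace (𝓡 6) x)] in
theorem curvature_skew (hLC : IsLeviCivita LC) (v w : TangentSpace (𝓡 6) x) :
    curvature a x v w = -curvature a x w v := by
  rw [curvature_eq_formCov hLC, curvature_eq_formCov hLC, ← lie_skew (a x v)]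
  abel

omit [IsContMDiffRiemannianBundle (𝓡 6) ∞ R6 (fun x : M ↦ TangentSpace (𝓡 6) x)] in
theorem formCov_add_left (ε : Π x : M, TangentSpace (𝓡 6) x →L[ℝ] LieAlg EK K)
    (v v' w : TangentSpace (𝓡 6) x) :
    formCov LC a ε x (v + v') w = formCov LC a ε x v w + formCov LC a ε x v' w := by
  have h : lieDiff (fun y ↦ ε y (FiberBundle.extend R6 w y)) x (v + v') =
    lieDiff (fun y ↦ ε y (FiberBundle.extend R6 w y)) x v +
      lieDiff (fun y ↦ ε y (FiberBundle.extend R6 w y)) x v' :=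
    map_add (mvfderiv (𝓡 6) (F := EK) (fun y ↦ ε y (FiberBundle.extend R6 w y)) x) v v'
  simp only [formCov, h, map_add, add_lie]
  abel

omit [IsContMDiffRiemannianBundle (𝓡 6) ∞ R6 (fun x : M ↦ TangentSpace (𝓡 6) x)] in
theorem formCov_smul_left (ε : Π x : M, TangentSpace (𝓡 6) x →L[ℝ] LieAlg EK K)
    (c : ℝ) (v w : TangentSpace (𝓡 6) x) :
    formCov LC a ε x (c • v) w = c • formCov LC a ε x v w := by
  have h : lieDiff (fun y ↦ ε y (FiberBundle.extend R6 w y)) x (c • v) =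
    c • lieDiff (fun y ↦ ε y (FiberBundle.extend R6 w y)) x v :=
    map_smul (mvfderiv (𝓡 6) (F := EK) (fun y ↦ ε y (FiberBundle.extend R6 w y)) x) c v
  simp only [formCov, h, map_smul, smul_lie, smul_add, smul_sub]

/-- The curvature as a bilinear map. -/
def curvatureForm (hLC : IsLeviCivita LC) (ha : FormDiffAt a x) :
    TangentSpace (𝓡 6) x →ₗ[ℝ] TangentSpace (𝓡 6) x →ₗ[ℝ] LieAlg EK K :=
  LinearMap.mk₂ ℝ (curvature a x)
    (fun v v' w ↦ by
      simp only [curvature_eq_formCov hLC, formCov_add_left, formCov_add_right ha, map_add, add_lie]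
      abel)
    (fun c v w ↦ by
      simp only [curvature_eq_formCov hLC, formCov_smul_left, formCov_smul_right ha, map_smul,
        smul_lie, smul_add, smul_sub])
    (fun v w w' ↦ by
      simp only [curvature_eq_formCov hLC, formCov_add_left, formCov_add_right ha, map_add, lie_add]
      abel)
    (fun c v w ↦ by
      simp only [curvature_eq_formCov hLC, formCov_smul_left, formCov_smul_right ha, map_smul,
        lie_smul, smul_add, smul_sub])

/-- The covariant derivative is compatible with every infinitesimally invariant bilinear form. -/
theorem mvfderiv_form (b : EK →L[ℝ] EK →L[ℝ] ℝ)
    (hb : ∀ u v w : EK, b (lieE EK K u v) w + b v (lieE EK K u w) = 0)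
    (hf : LieDiffAt f x) (hg : LieDiffAt g x) (v : TangentSpace (𝓡 6) x) :
    mvfderiv (𝓡 6) (fun y ↦ b (f y) (g y)) x v =
      b (lieCov a f x v) (g x) + b (f x) (lieCov a g x v) := by
  have h1 := mvfderiv_bilin (F := EK) (F' := EK) b hf hg v
  have h2 := hb (a x v) (f x) (g x)
  have h3 : b (lieCov a f x v) (g x) =
      b (lieDiff f x v) (g x) + b (lieE EK K (a x v) (f x)) (g x) :=
    congrArg (fun L : EK →L[ℝ] ℝ ↦ L (g x)) (map_add b (lieDiff f x v) _)
  have h4 : b (f x) (lieCov a g x v) =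
      b (f x) (lieDiff g x v) + b (f x) (lieE EK K (a x v) (g x)) :=
    map_add (b (f x)) (lieDiff g x v) _
  rw [h3, h4]
  refine h1.trans ?_
  change b (lieDiff f x v) (g x) + b (f x) (lieDiff g x v) = _
  linarith

/-- Bochner's formula: if `f` is harmonic for the connection `a`, then the Laplacian of `|f|²` is
`2 |∇f|²`. -/
theorem IsCoordFrame.laplacian_form (hE : IsCoordFrame E U) (hx : x ∈ U)
    (ha : ∀ y ∈ U, FormAt a y) (hf : ∀ y ∈ U, LieAt ∞ f y) (b : EK →L[ℝ] EK →L[ℝ] ℝ)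
    (hsymm : ∀ v w, b v w = b w v)
    (hb : ∀ u v w : EK, b (lieE EK K u v) w + b v (lieE EK K u w) = 0)
    (hharm : ∑ i, (lieCov a (fun y ↦ lieCov a f y (dualFrame E i y)) x (E i x) +
      logVol E i x • lieCov a f x (dualFrame E i x)) = 0) :
    ∑ i, (mvfderiv (𝓡 6) (fun y ↦ mvfderiv (𝓡 6) (fun z ↦ b (f z) (f z)) y (dualFrame E i y)) x
      (E i x) + logVol E i x * mvfderiv (𝓡 6) (fun z ↦ b (f z) (f z)) x (dualFrame E i x)) =
      2 * ∑ k, b (lieCov a f x (frame M x k)) (lieCov a f x (frame M x k)) := by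
  have h1 : ∀ y ∈ U, ∀ v, mvfderiv (𝓡 6) (fun z ↦ b (f z) (f z)) y v =
      (2 : ℝ) * b (lieCov a f y v) (f y) := fun y hy v ↦ by
    have hd := (hf y hy).lieDiffAt (by simp)
    rw [mvfderiv_form (a := a) b hb hd hd, two_mul]
    exact congrArg _ (hsymm _ _)
  have hdV : ∀ i, LieAt ∞ (fun y ↦ lieCov a f y (dualFrame E i y)) x := fun i ↦
    LieAt.lieCov (ha x hx) (hf x hx) (hE.contMDiffAt_dualFrame hx i)
  have h2 : ∀ i, mvfderiv (𝓡 6) (fun y ↦ mvfderiv (𝓡 6) (fun z ↦ b (f z) (f z)) y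
      (dualFrame E i y)) x (E i x) =
      2 * (b (lieCov a (fun y ↦ lieCov a f y (dualFrame E i y)) x (E i x)) (f x) +
        b (lieCov a f x (dualFrame E i x)) (lieCov a f x (E i x))) := by
    intro i
    have h3 : (fun y ↦ mvfderiv (𝓡 6) (fun z ↦ b (f z) (f z)) y (dualFrame E i y)) =ᶠ[𝓝 x]
        fun y ↦ (2 : ℝ) * b (lieCov a f y (dualFrame E i y)) (f y) := by
      filter_upwards [hE.mem_nhds hx] with y hy
      exact h1 y hy _
    have hdb : MDifferentiableAt (𝓡 6) 𝓘(ℝ, ℝ)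
        (fun y ↦ b (lieCov a f y (dualFrame E i y)) (f y)) x :=
      MDifferentiableAt.bilin (F := EK) (F' := EK) b ((hdV i).lieDiffAt (by simp))
        ((hf x hx).lieDiffAt (by simp))
    rw [mvfderiv_congr h3, mvfderiv_mul_apply (f := fun _ ↦ (2 : ℝ)) mdifferentiableAt_const hdb,
      mvfderiv_const, zero_apply, zero_mul, zero_add,
      mvfderiv_form (a := a) b hb ((hdV i).lieDiffAt (by simp)) ((hf x hx).lieDiffAt (by simp))]
  let β : TangentSpace (𝓡 6) x →ₗ[ℝ] TangentSpace (𝓡 6) x →ₗ[ℝ] ℝ :=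
    LinearMap.mk₂ ℝ (fun v w ↦ b (lieCov a f x v) (lieCov a f x w))
      (fun v v' w ↦ by
        rw [map_add]
        exact congrArg (fun L : EK →L[ℝ] ℝ ↦ L (lieCov a f x w)) (map_add b _ _))
      (fun c v w ↦ by
        rw [map_smul]
        exact congrArg (fun L : EK →L[ℝ] ℝ ↦ L (lieCov a f x w)) (map_smul b c _))
      (fun v w w' ↦ by
        rw [map_add]
        exact map_add (b (lieCov a f x v)) _ _)
      (fun c v w ↦ by
        rw [map_smul]
        exact map_smul (b (lieCov a f x v)) c _)
  have h4 : ∑ k, b (lieCov a f x (frame M x k)) (lieCov a f x (frame M x k)) =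
      ∑ i, b (lieCov a f x (dualFrame E i x)) (lieCov a f x (E i x)) := hE.sum_frame_eq hx β
  have h5 : ∑ i, (b (lieCov a (fun y ↦ lieCov a f y (dualFrame E i y)) x (E i x)) (f x) +
      logVol E i x * b (lieCov a f x (dualFrame E i x)) (f x)) = 0 := by
    let L₀ : EK →ₗ[ℝ] ℝ := (b.flip (f x)).toLinearMap
    let L : LieAlg EK K →ₗ[ℝ] ℝ := L₀
    have h7 : L (∑ i, (lieCov a (fun y ↦ lieCov a f y (dualFrame E i y)) x (E i x) +
      logVol E i x • lieCov a f x (dualFrame E i x))) = 0 := by rw [hharm, map_zero]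
    simp only [map_sum, map_add, map_smul] at h7
    exact h7
  rw [h4, Finset.mul_sum, ← add_zero (∑ i, 2 * _), ← mul_zero (2 : ℝ), ← h5, Finset.mul_sum,
    ← Finset.sum_add_distrib]
  refine Finset.sum_congr rfl fun i _ ↦ ?_
  rw [h2, h1 x hx]
  ring

end Bochner

/-! ### Harmonicity of the scalar parts -/

section Harmonic

variable {M : Type*} [TopologicalSpace M] [ChartedSpace R6 M] [IsManifold (𝓡 6) ∞ M]
  [RiemannianBundle (fun x : M ↦ TangentSpace (𝓡 6) x)]
  [IsContMDiffRiemannianBundle (𝓡 6) ∞ R6 (fun x : M ↦ TangentSpace (𝓡 6) x)]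
  {EK : Type*} [NormedAddCommGroup EK] [NormedSpace ℝ EK] [FiniteDimensional ℝ EK]
  {K : Type*} [TopologicalSpace K] [Group K] [ChartedSpace EK K] [LieGroup 𝓘(ℝ, EK) ∞ K]
  {S : M → Type*} [TopologicalSpace (TotalSpace R8 S)]
    [∀ x, NormedAddCommGroup (S x)] [∀ x, InnerProductSpace ℝ (S x)] [FiberBundle R8 S]
    [VectorBundle ℝ R8 S] [ContMDiffVectorBundle ∞ R8 S (𝓡 6)]
    [IsContMDiffRiemannianBundle (𝓡 6) ∞ R8 S]
  {a : Π x : M, TangentSpace (𝓡 6) x →L[ℝ] LieAlg EK K}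
  {ξ : Π x : M, S x ⊗[ℝ] LieAlg EK K} {φ : Π x : M, S x} {c : ℝ}
  {E : Fin 6 → Π x : M, TangentSpace (𝓡 6) x} {U : Set M} {x : M}

namespace NearlyKahlerStructure

variable {N : NearlyKahlerStructure M S}

/-- The instanton equation in a pair of dual frames. -/
theorem twoFormPsi_curvature_eq (hE : IsCoordFrame E U) (hx : x ∈ U) (ha : FormDiffAt a x) :
    N.twoFormPsi x (curvature a x) = (1 / 2 : ℝ) • ∑ i, ∑ j,
      N.cliff x (dualFrame E i x) (N.cliff x (dualFrame E j x) (N.psi x)) ⊗ₜ[ℝ]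
        curvature a x (E i x) (E j x) := by
  let F := curvatureForm N.isLeviCivita ha
  have h1 : ∀ v w, ∑ k, N.cliff x v (N.cliff x (frame M x k) (N.psi x)) ⊗ₜ[ℝ] F w (frame M x k) =
      ∑ j, N.cliff x v (N.cliff x (dualFrame E j x) (N.psi x)) ⊗ₜ[ℝ] F w (E j x) := fun v w ↦
    hE.sum_frame_eq hx (LinearMap.mk₂ ℝ
      (fun u u' ↦ N.cliff x v (N.cliff x u (N.psi x)) ⊗ₜ[ℝ] F w u')
      (fun v v' w ↦ by simp [TensorProduct.add_tmul])
      (fun c v w ↦ by simp [TensorProduct.smul_tmul'])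
      (fun v w w' ↦ by simp [TensorProduct.tmul_add]) (fun c v w ↦ by simp))
  have h2 : ∑ k, ∑ j, N.cliff x (frame M x k) (N.cliff x (dualFrame E j x) (N.psi x)) ⊗ₜ[ℝ]
      F (frame M x k) (E j x) = ∑ i, ∑ j, N.cliff x (dualFrame E i x)
        (N.cliff x (dualFrame E j x) (N.psi x)) ⊗ₜ[ℝ] F (E i x) (E j x) :=
    hE.sum_frame_eq hx (LinearMap.mk₂ ℝ
      (fun u u' ↦ ∑ j, N.cliff x u (N.cliff x (dualFrame E j x) (N.psi x)) ⊗ₜ[ℝ] F u' (E j x))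
      (fun v v' w ↦ by simp [TensorProduct.add_tmul, Finset.sum_add_distrib])
      (fun c v w ↦ by simp [← TensorProduct.smul_tmul', Finset.smul_sum])
      (fun v w w' ↦ by simp [TensorProduct.tmul_add, Finset.sum_add_distrib])
      (fun c v w ↦ by simp [Finset.smul_sum]))
  rw [twoFormPsi]
  congr 1
  refine Eq.trans ?_ h2
  exact Finset.sum_congr rfl fun k _ ↦ h1 _ _

/-- The scalar part `⟨φ, ξ⟩` along a Killing spinor `φ` of a section `ξ` of `S ⊗ 𝔨` is harmonic if
the curvature annihilates `φ` (`hF`) and the Dirac equation holds in the components `v · φ`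
(`hvec`). The latter makes the gradient of `⟨φ, ξ⟩` the divergence of the bivector part plus
`2 - 4c` times the vector part. The double divergence of the bivector part only involves the
curvature and vanishes by `hF`, and `hsc` says that the divergence of the vector part does not
contribute. -/
theorem harmonic_pair (hφ : N.IsKillingSpinor c φ) (hE : IsCoordFrame E U) (hx : x ∈ U)
    (ha : ∀ y ∈ U, FormAt a y) (hξ : ∀ y ∈ U, AdSpinorAt ξ y)
    (hF : ∑ i, ∑ j, N.cliff x (dualFrame E i x) (N.cliff x (dualFrame E j x) (φ x)) ⊗ₜ[ℝ]
        curvature a x (E i x) (E j x) = 0)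
    (hvec : ∀ y ∈ U, ∀ v, pair (N.cliff y v (φ y)) (N.dirac a ξ y) =
      (2 : ℝ) • pair (N.cliff y v (φ y)) (ξ y))
    (hsc : (2 - 4 * c) • ((-6 * c) • pair (φ x) (ξ x) - pair (φ x) (N.dirac a ξ x)) = 0) :
    ∑ i, (lieCov a (fun y ↦ lieCov a (fun z ↦ pair (φ z) (ξ z)) y (dualFrame E i y)) x (E i x) +
      logVol E i x • lieCov a (fun z ↦ pair (φ z) (ξ z)) x (dualFrame E i x)) = 0 := by
  let Q : Fin 6 → Fin 6 → M → LieAlg EK K := fun i j y ↦ pair (bivector N E φ i j y) (ξ y)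
  let h : Fin 6 → M → LieAlg EK K := fun i y ↦ pair (N.cliff y (dualFrame E i y) (φ y)) (ξ y)
  let T : Fin 6 → M → LieAlg EK K := fun i y ↦
    ∑ j, (lieCov a (Q j i) y (E j y) + logVol E j y • Q j i y)
  have hQ : ∀ i j, ∀ y ∈ U, LieAt ∞ (Q i j) y := fun i j y hy ↦
    (hξ y hy).pair (contMDiffAt_bivector hφ hE hy i j)
  have hh : ∀ i, LieAt ∞ (h i) x := fun i ↦ (hξ x hx).pair
    (cliff_contMDiffAt (N := N) (hE.contMDiffAt_dualFrame hx i) (hφ.contMDiffAt x))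
  have hT : ∀ i, LieAt ∞ (T i) x := fun i ↦ LieAt.sum _ fun j ↦
    (LieAt.lieCov (ha x hx) (hQ j i x hx) (hE.contMDiffAt j x hx)).add
      (LieAt.smul (hE.contMDiffAt_logVol hx j) (hQ j i x hx))
  have hV : ∀ i, ∀ y ∈ U, lieCov a (fun z ↦ pair (φ z) (ξ z)) y (dualFrame E i y) =
      T i y + (2 - 4 * c) • h i y := fun i y hy ↦ by
    rw [lieCov_pair_dualFrame hφ hE hy (hξ y hy), hvec y hy]
    simp only [T, h, Q]
    module
  have h1 : ∀ i, lieCov a (fun y ↦ lieCov a (fun z ↦ pair (φ z) (ξ z)) y (dualFrame E i y)) x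
      (E i x) = lieCov a (T i) x (E i x) + (2 - 4 * c) • lieCov a (h i) x (E i x) := by
    intro i
    have h2 : (fun y ↦ lieCov a (fun z ↦ pair (φ z) (ξ z)) y (dualFrame E i y)) =ᶠ[𝓝 x]
        fun y ↦ T i y + (2 - 4 * c) • h i y := by
      filter_upwards [hE.mem_nhds hx] with y hy
      exact hV i y hy
    rw [lieCov_congr h2, lieCov_add ((hT i).lieDiffAt (by simp))
      (LieDiffAt.smul mdifferentiableAt_const ((hh i).lieDiffAt (by simp))),
      lieCov_smul mdifferentiableAt_const ((hh i).lieDiffAt (by simp)), mvfderiv_const]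
    simp
  have h3 := hE.div_div N.isLeviCivita hx ha hQ fun i j y _ ↦ by
    simp only [Q, bivector_skew i j, map_neg, LinearMap.neg_apply]
  -- the curvature term vanishes by the instanton equation
  have h4 : ∑ i, ∑ j, ⁅curvature a x (E i x) (E j x), Q j i x⁆ = 0 := by
    let τ : S x ⊗[ℝ] LieAlg EK K →ₗ[ℝ] LieAlg EK K := TensorProduct.lift
      (LinearMap.mk₂ ℝ (fun s κ ↦ ⁅κ, pair s (ξ x)⁆)
        (fun s s' κ ↦ by simp) (fun c s κ ↦ by simp) (fun s κ κ' ↦ by simp) (fun c s κ ↦ by simp))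
    have h5 := congrArg τ hF
    simp only [map_sum, map_zero, τ, TensorProduct.lift.tmul, LinearMap.mk₂_apply] at h5
    have h6 : ∑ i, ∑ j, (inner ℝ (dualFrame E i x) (dualFrame E j x) : ℝ) •
        ⁅curvature a x (E i x) (E j x), pair (φ x) (ξ x)⁆ = 0 := by
      have h7 : ∑ i, ∑ j, (inner ℝ (dualFrame E i x) (dualFrame E j x) : ℝ) •
          ⁅curvature a x (E i x) (E j x), pair (φ x) (ξ x)⁆ =
          -∑ i, ∑ j, (inner ℝ (dualFrame E i x) (dualFrame E j x) : ℝ) •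
          ⁅curvature a x (E i x) (E j x), pair (φ x) (ξ x)⁆ := by
        conv_lhs => rw [Finset.sum_comm]
        rw [← Finset.sum_neg_distrib]
        refine Finset.sum_congr rfl fun i _ ↦ ?_
        rw [← Finset.sum_neg_distrib]
        refine Finset.sum_congr rfl fun j _ ↦ ?_
        rw [curvature_skew N.isLeviCivita, neg_lie, smul_neg, real_inner_comm]
      have h8 : (2 : ℝ) • ∑ i, ∑ j, (inner ℝ (dualFrame E i x) (dualFrame E j x) : ℝ) •
          ⁅curvature a x (E i x) (E j x), pair (φ x) (ξ x)⁆ = 0 := by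
        rw [two_smul]
        nth_rewrite 1 [h7]
        exact neg_add_cancel _
      exact (smul_eq_zero.1 h8).resolve_left two_ne_zero
    have h9 : ∀ i j, ⁅curvature a x (E i x) (E j x), Q j i x⁆ =
        -(⁅curvature a x (E i x) (E j x), pair (N.cliff x (dualFrame E i x)
          (N.cliff x (dualFrame E j x) (φ x))) (ξ x)⁆ +
        (inner ℝ (dualFrame E i x) (dualFrame E j x) : ℝ) •
          ⁅curvature a x (E i x) (E j x), pair (φ x) (ξ x)⁆) := fun i j ↦ by
      simp only [Q, bivector_skew j i, map_neg, LinearMap.neg_apply, lie_neg]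
      simp only [bivector, map_add, map_smul, LinearMap.add_apply, LinearMap.smul_apply, lie_add,
        lie_smul]
    simp only [h9, Finset.sum_neg_distrib, Finset.sum_add_distrib, h5, h6, add_zero, neg_zero]
  rw [h4, smul_zero] at h3
  have h5 := congrArg (fun w ↦ (2 - 4 * c) • w) (div_pair_cliff (a := a) hφ hE hx (hξ x hx))
  simp only [hsc] at h5
  rw [Finset.smul_sum] at h5
  rw [← add_zero (0 : LieAlg EK K)]
  nth_rewrite 2 [← h3]
  rw [← h5, ← Finset.sum_add_distrib]
  refine Finset.sum_congr rfl fun i _ ↦ ?_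
  rw [h1, hV i x hx]
  simp only [T, h, Q]
  module

end NearlyKahlerStructure

end Harmonic

/-! ### The maximum principle on a manifold -/

section MaximumPrinciple

variable {M : Type*} [TopologicalSpace M] [ChartedSpace R6 M] [IsManifold (𝓡 6) ∞ M]
  [RiemannianBundle (fun x : M ↦ TangentSpace (𝓡 6) x)]
  [IsContMDiffRiemannianBundle (𝓡 6) ∞ R6 (fun x : M ↦ TangentSpace (𝓡 6) x)]
  {E : Fin 6 → Π x : M, TangentSpace (𝓡 6) x} {x₀ : M}

theorem metricMatrix_inv_comm {U : Set M} {x : M} (hE : IsCoordFrame E U) (hx : x ∈ U)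
    (i j : Fin 6) : (metricMatrix E x)⁻¹ i j = (metricMatrix E x)⁻¹ j i := by
  have h := inner_dualOf_dualOf (hE.linearIndependent x hx)
  exact (h j i).symm.trans ((real_inner_comm _ _).trans (h i j))

/-- The strong maximum principle for the Laplacian of the metric, written in the coordinate frame
of a chart. -/
theorem eventually_eq_of_laplacian_nonneg (hE : IsCoordFrame E (chartAt R6 x₀).source)
    (hchart : ∀ x ∈ (chartAt R6 x₀).source, ∀ i,
      mfderiv (𝓡 6) 𝓘(ℝ, R6) (extChartAt (𝓡 6) x₀) x (E i x) = EuclideanSpace.single i (1 : ℝ))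
    {Ω : Set M} (hΩ : IsOpen Ω) (hΩs : Ω ⊆ (chartAt R6 x₀).source) (hx₀ : x₀ ∈ Ω) {u : M → ℝ}
    (hu : ∀ x ∈ Ω, ContMDiffAt (𝓡 6) 𝓘(ℝ, ℝ) ∞ u x)
    (hL : ∀ x ∈ Ω, 0 ≤ ∑ i, (mvfderiv (𝓡 6) (fun y ↦ mvfderiv (𝓡 6) u y (dualFrame E i y)) x
      (E i x) + logVol E i x * mvfderiv (𝓡 6) u x (dualFrame E i x)))
    (hmax : ∀ x ∈ Ω, u x ≤ u x₀) : ∀ᶠ x in 𝓝 x₀, u x = u x₀ := by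
  let χ := extChartAt (𝓡 6) x₀
  have hs : χ.source = (chartAt R6 x₀).source := extChartAt_source (𝓡 6) x₀
  have hct : ContinuousOn χ.symm χ.target := continuousOn_extChartAt_symm x₀
  let Ω' : Set R6 := χ.target ∩ χ.symm ⁻¹' Ω
  have hΩ' : IsOpen Ω' := hct.isOpen_inter_preimage (isOpen_extChartAt_target x₀) hΩ
  have hback : ∀ z ∈ Ω', χ.symm z ∈ Ω ∧ χ (χ.symm z) = z := fun z hz ↦ ⟨hz.2, χ.right_inv hz.1⟩
  have hforth : ∀ x ∈ Ω, χ x ∈ Ω' ∧ χ.symm (χ x) = x := fun x hx ↦ by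
    have h1 : x ∈ χ.source := hs ▸ hΩs hx
    exact ⟨⟨χ.map_source h1, by rw [Set.mem_preimage, χ.left_inv h1]; exact hx⟩, χ.left_inv h1⟩
  have hsymm : ∀ z ∈ Ω', ContMDiffAt 𝓘(ℝ, R6) (𝓡 6) ∞ χ.symm z := fun z hz ↦
    (contMDiffOn_extChartAt_symm x₀).contMDiffAt ((isOpen_extChartAt_target x₀).mem_nhds hz.1)
  have hpull : ∀ {f : M → ℝ}, (∀ x ∈ Ω, ContMDiffAt (𝓡 6) 𝓘(ℝ, ℝ) ∞ f x) →
      ∀ z ∈ Ω', ContDiffAt ℝ ∞ (f ∘ χ.symm) z := fun hf z hz ↦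
    (ContMDiffAt.comp z (hf _ hz.2) (hsymm z hz)).contDiffAt
  have hder : ∀ {f : M → ℝ} {x : M}, x ∈ Ω → MDifferentiableAt (𝓡 6) 𝓘(ℝ, ℝ) f x → ∀ i,
      mvfderiv (𝓡 6) f x (E i x) =
        fderiv ℝ (f ∘ χ.symm) (χ x) (EuclideanSpace.single i (1 : ℝ)) := fun {f x} hx hf i ↦ by
    rw [mvfderiv_eq_fderiv_chart (hΩs hx) hf]
    exact congrArg _ (hchart x (hΩs hx) i)
  let ũ : R6 → ℝ := u ∘ χ.symm
  have hũ : ∀ z ∈ Ω', ContDiffAt ℝ ∞ ũ z := hpull hu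
  -- the coefficients of the Laplacian in the chart
  let G : Fin 6 → Fin 6 → M → ℝ := fun i j y ↦ (metricMatrix E y)⁻¹ i j
  have hG : ∀ i j, ∀ x ∈ Ω, ContMDiffAt (𝓡 6) 𝓘(ℝ, ℝ) ∞ (G i j) x := fun i j x hx ↦
    hE.contMDiffAt_metric_inv (hΩs hx) i j
  let C : Fin 6 → M → ℝ := fun j y ↦
    ∑ i, (mvfderiv (𝓡 6) (G i j) y (E i y) + logVol E i y * G i j y)
  have hC : ∀ j, ∀ x ∈ Ω, ContMDiffAt (𝓡 6) 𝓘(ℝ, ℝ) ∞ (C j) x := fun j x hx ↦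
    contMDiffAt_finsetSum _ fun i _ ↦ (hE.contMDiffAt_deriv (hΩs hx) (hG i j x hx) i).add
      ((hE.contMDiffAt_logVol (hΩs hx) i).mul (hG i j x hx))
  have hdual : ∀ x i, mvfderiv (𝓡 6) u x (dualFrame E i x) =
      ∑ j, G i j x * mvfderiv (𝓡 6) u x (E j x) := fun x i ↦ by
    simp only [dualFrame, dualOf, map_sum, map_smul, smul_eq_mul]
    rfl
  have hLu : ∀ x ∈ Ω, ∑ i, (mvfderiv (𝓡 6) (fun y ↦ mvfderiv (𝓡 6) u y (dualFrame E i y)) x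
      (E i x) + logVol E i x * mvfderiv (𝓡 6) u x (dualFrame E i x)) =
      diffOp (fun i ↦ EuclideanSpace.single i (1 : ℝ)) (fun i j ↦ G i j ∘ χ.symm)
        (fun i ↦ C i ∘ χ.symm) ũ (χ x) := by
    intro x hx
    have hd : ∀ {f : M → ℝ}, ContMDiffAt (𝓡 6) 𝓘(ℝ, ℝ) ∞ f x →
        MDifferentiableAt (𝓡 6) 𝓘(ℝ, ℝ) f x := fun hf ↦ hf.mdifferentiableAt (by simp)
    have hdu : ∀ j, MDifferentiableAt (𝓡 6) 𝓘(ℝ, ℝ) (fun y ↦ mvfderiv (𝓡 6) u y (E j y)) x :=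
      fun j ↦ hd (hE.contMDiffAt_deriv (hΩs hx) (hu x hx) j)
    have h2 : ∀ i j, mvfderiv (𝓡 6) (fun y ↦ mvfderiv (𝓡 6) u y (E j y)) x (E i x) =
        fderiv ℝ (fderiv ℝ ũ) (χ x) (EuclideanSpace.single i (1 : ℝ))
          (EuclideanSpace.single j (1 : ℝ)) := by
      intro i j
      rw [hder hx (hdu j)]
      have h3 : (fun y ↦ mvfderiv (𝓡 6) u y (E j y)) ∘ χ.symm =ᶠ[𝓝 (χ x)]
          fun z ↦ fderiv ℝ ũ z (EuclideanSpace.single j (1 : ℝ)) := by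
        filter_upwards [hΩ'.mem_nhds (hforth x hx).1] with z hz
        have h4 := hder (hback z hz).1 ((hu _ hz.2).mdifferentiableAt (by simp)) j
        rw [(hback z hz).2] at h4
        exact h4
      rw [h3.fderiv_eq]
      have h5 : DifferentiableAt ℝ (fderiv ℝ ũ) (χ x) :=
        ((hũ _ (hforth x hx).1).fderiv_right (m := 1) (by norm_cast)).differentiableAt (by simp)
      rw [fderiv_clm_apply h5 (differentiableAt_const _)]
      simp
    have h3 : ∀ i, mvfderiv (𝓡 6) (fun y ↦ mvfderiv (𝓡 6) u y (dualFrame E i y)) x (E i x) =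
        ∑ j, (mvfderiv (𝓡 6) (G i j) x (E i x) * mvfderiv (𝓡 6) u x (E j x) +
          G i j x * mvfderiv (𝓡 6) (fun y ↦ mvfderiv (𝓡 6) u y (E j y)) x (E i x)) := by
      intro i
      simp only [hdual]
      rw [mvfderiv_finsetSum _ fun j ↦ mdifferentiableAt_mul (hd (hG i j x hx)) (hdu j)]
      exact Finset.sum_congr rfl fun j _ ↦ mvfderiv_mul_apply (hd (hG i j x hx)) (hdu j) _
    have h4 : ∀ j, mvfderiv (𝓡 6) u x (E j x) =
        fderiv ℝ ũ (χ x) (EuclideanSpace.single j (1 : ℝ)) := hder hx (hd (hu x hx))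
    have hGx : ∀ i j, (G i j ∘ χ.symm) (χ x) = G i j x := fun i j ↦ congrArg (G i j) (hforth x hx).2
    have hCx : ∀ j, (C j ∘ χ.symm) (χ x) = C j x := fun j ↦ congrArg (C j) (hforth x hx).2
    simp only [diffOp, hGx, hCx, ← h2, ← h4, h3]
    simp only [hdual, C, Finset.sum_add_distrib, Finset.mul_sum, Finset.sum_mul, add_mul]
    rw [Finset.sum_comm (f := fun j i ↦ mvfderiv (𝓡 6) (G i j) x (E i x) * _),
      Finset.sum_comm (f := fun j i ↦ logVol E i x * G i j x * _)]
    simp only [mul_assoc]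
    ring
  have hmain := strong_maximum_principle (e := fun i : Fin 6 ↦ EuclideanSpace.single i (1 : ℝ))
    (a := fun i j ↦ G i j ∘ χ.symm) (c := fun i ↦ C i ∘ χ.symm) (u := ũ) hΩ'
    (fun i j z hz ↦ (hpull (hG i j) z hz).continuousAt.continuousWithinAt)
    (fun i z hz ↦ (hpull (hC i) z hz).continuousAt.continuousWithinAt) ?_
    (fun z hz ↦ ((hũ z hz).of_le (by norm_cast)).contDiffWithinAt) ?_ (hforth x₀ hx₀).1 ?_
  · have h1 : ContinuousAt χ x₀ := continuousAt_extChartAt x₀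
    filter_upwards [h1.eventually hmain, hΩ.mem_nhds hx₀] with x hx hxΩ
    simp only [ũ, Function.comp_apply, (hforth x hxΩ).2, (hforth x₀ hx₀).2] at hx
    exact hx
  -- The symbol is the sum of the squares of the images of an orthonormal basis under the chart.
  · intro z hz
    obtain ⟨hx, hz'⟩ := hback z hz
    set x := χ.symm z with hxdef
    let A : TangentSpace (𝓡 6) x →L[ℝ] R6 := mfderiv (𝓡 6) 𝓘(ℝ, R6) χ x
    have hA : ∀ i, A (E i x) = EuclideanSpace.single i (1 : ℝ) := hchart x (hΩs hx)
    refine ⟨_, inferInstance, fun k ↦ A (frame M x k), fun l hl ↦ ?_, fun H ↦ ?_⟩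
    · have h1 : ∀ v, l (A v) = 0 := fun v ↦ by
        rw [← (frame M x).sum_repr v]
        simp only [map_sum, map_smul, hl, smul_zero, Finset.sum_const_zero]
      ext v
      rw [← (EuclideanSpace.basisFun (Fin 6) ℝ).sum_repr v]
      simp only [map_sum, map_smul, EuclideanSpace.basisFun_apply, ← hA, h1, smul_zero,
        Finset.sum_const_zero, zero_apply]
    · let β : TangentSpace (𝓡 6) x →ₗ[ℝ] TangentSpace (𝓡 6) x →ₗ[ℝ] ℝ :=
        LinearMap.mk₂ ℝ (fun v w ↦ H (A v) (A w)) (fun v v' w ↦ by simp) (fun c v w ↦ by simp)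
          (fun v w w' ↦ by simp) (fun c v w ↦ by simp)
      refine Eq.trans ?_ (hE.sum_frame_eq (hΩs hx) β).symm
      have h1 : ∀ i, β (dualFrame E i x) (E i x) = ∑ j, G i j x *
          H (EuclideanSpace.single j (1 : ℝ)) (EuclideanSpace.single i (1 : ℝ)) := fun i ↦ by
        change H (A (dualFrame E i x)) (A (E i x)) = _
        rw [hA]
        simp only [dualFrame, dualOf, map_sum, map_smul, hA,
          _root_.sum_apply, _root_.smul_apply, smul_eq_mul]
        rfl
      simp only [h1]
      rw [Finset.sum_comm]
      refine Finset.sum_congr rfl fun i _ ↦ Finset.sum_congr rfl fun j _ ↦ ?_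
      change G j i x * _ = G i j x * _
      rw [show G j i x = G i j x from metricMatrix_inv_comm hE (hΩs hx) j i]
  · intro z hz
    obtain ⟨hx, hz'⟩ := hback z hz
    have h1 := hL _ hx
    rw [hLu _ hx, hz'] at h1
    exact h1
  · intro z hz
    simp only [ũ, Function.comp_apply, (hforth x₀ hx₀).2]
    exact hmax _ hz.2

end MaximumPrinciple

/-! ### Gauges and gauge transformations -/

section Gauges

variable {M : Type*} [TopologicalSpace M] [ChartedSpace R6 M] [IsManifold (𝓡 6) ∞ M]
  {EK : Type*} [NormedAddCommGroup EK] [NormedSpace ℝ EK] [FiniteDimensional ℝ EK]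
  {K : Type*} [TopologicalSpace K] [Group K] [ChartedSpace EK K] [LieGroup 𝓘(ℝ, EK) ∞ K]
  {EP : Type*} [NormedAddCommGroup EP] [NormedSpace ℝ EP]
  {P : Type*} [TopologicalSpace P] [ChartedSpace EP P] [IsManifold 𝓘(ℝ, EP) ∞ P]

namespace PrincipalBundle

variable {B : PrincipalBundle EK K M EP P} {s s' : M → P} {U U' : Set M} {x : M}

theorem IsGauge.contMDiffAt (hs : B.IsGauge s U) (hx : x ∈ U) :
    ContMDiffAt (𝓡 6) 𝓘(ℝ, EP) ∞ s x :=
  hs.contMDiffOn.contMDiffAt (hs.isOpen.mem_nhds hx)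

/-- The value of `η` in a gauge is its value at the point of the fibre met by the gauge. -/
theorem inGauge_eq {W : M → Type*} [∀ x, Zero (W x)] (η : Π x : M, B.Fib x → W x) (p : B.Fib x)
    (hp : s x = p.1) : B.inGauge η s x = η x p := by
  have h : B.proj (s x) = x := by rw [hp, p.2]
  have e : (⟨s x, h⟩ : B.Fib x) = p := Subtype.ext hp
  exact (dif_pos h).trans (congrArg (η x) e)

/-- The point of the fibre over `x` which is the value of a gauge. -/
def IsGauge.point (hs : B.IsGauge s U) (hx : x ∈ U) : B.Fib x := ⟨s x, hs.proj_eq x hx⟩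

theorem IsGauge.inGauge_eq (hs : B.IsGauge s U) (hx : x ∈ U) {W : M → Type*} [∀ x, Zero (W x)]
    (η : Π x : M, B.Fib x → W x) : B.inGauge η s x = η x (hs.point hx) :=
  PrincipalBundle.inGauge_eq η (hs.point hx) rfl

/-- Through every point of the principal bundle there is a gauge. -/
theorem exists_isGauge (x : M) (p : B.Fib x) : ∃ s U, B.IsGauge s U ∧ x ∈ U ∧ s x = p.1 := by
  obtain ⟨U, hU, hx, s, hs, hp, τ, -, hτ, -⟩ := B.locallyTrivial x
  refine ⟨fun y ↦ B.act (s y) (τ p.1), U, ⟨hU, ?_, ?_⟩, hx, ?_⟩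
  · exact B.contMDiff_act.comp_contMDiffOn (hs.prodMk contMDiffOn_const)
  · intro y hy
    rw [B.proj_act, hp y hy]
  · have h := hτ p.1 (by rw [Set.mem_preimage, p.2]; exact hx)
    rwa [p.2] at h

/-- Two gauges differ, near a point, by a smooth function with values in the group. -/
theorem IsGauge.exists_transition (hs : B.IsGauge s U) (hs' : B.IsGauge s' U') (hx : x ∈ U)
    (hx' : x ∈ U') : ∃ h : M → K, ContMDiffAt (𝓡 6) 𝓘(ℝ, EK) ∞ h x ∧
      ∀ᶠ y in 𝓝 x, s' y = B.act (s y) (h y) := by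
  obtain ⟨V, hV, hxV, s₀, hs₀, hp, τ, hτs, hτ, -⟩ := B.locallyTrivial x
  have hVp : IsOpen (B.proj ⁻¹' V) := hV.preimage B.contMDiff_proj.continuous
  have key : ∀ {σ : M → P} {W : Set M}, B.IsGauge σ W → x ∈ W →
      ContMDiffAt (𝓡 6) 𝓘(ℝ, EK) ∞ (fun y ↦ τ (σ y)) x := fun hσ hxW ↦
    ContMDiffAt.comp x (hτs.contMDiffAt (hVp.mem_nhds (by
      rw [Set.mem_preimage, hσ.proj_eq x hxW]; exact hxV))) (hσ.contMDiffAt hxW)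
  refine ⟨fun y ↦ (τ (s y))⁻¹ * τ (s' y), (key hs hx).inv.mul (key hs' hx'), ?_⟩
  filter_upwards [hs.isOpen.mem_nhds hx, hs'.isOpen.mem_nhds hx', hV.mem_nhds hxV] with y h1 h2 h3
  have e1 := hτ (s y) (by rw [Set.mem_preimage, hs.proj_eq y h1]; exact h3)
  have e2 := hτ (s' y) (by rw [Set.mem_preimage, hs'.proj_eq y h2]; exact h3)
  rw [hs.proj_eq y h1] at e1
  rw [hs'.proj_eq y h2] at e2
  calc s' y = B.act (s₀ y) (τ (s y) * ((τ (s y))⁻¹ * τ (s' y))) := by rw [mul_inv_cancel_left, e2]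
    _ = _ := by rw [B.act_mul, e1]

namespace Connection

variable {B : PrincipalBundle EK K M EP P} (A : B.Connection)

/-- The connection form as a map into a fixed vector space: the tangent spaces of the total space
are identified with its model space. -/
def formE (p : P) : EP →L[ℝ] EK := A.form p

section Act

variable {E : Type*} [NormedAddCommGroup E] [NormedSpace ℝ E]
  {Q : Type*} [TopologicalSpace Q] [ChartedSpace E Q] {σ : Q → P} {h : Q → K} {q : Q}

/-- The pullback of the connection form by a map which is translated by a group valued function
involves the adjoint action and the logarithmic derivative of that function. -/
theorem exists_hasMFDerivAt_act {σ' : TangentSpace 𝓘(ℝ, E) q →L[ℝ] EP}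
    {k' : TangentSpace 𝓘(ℝ, E) q →L[ℝ] EK} (hσ : HasMFDerivAt 𝓘(ℝ, E) 𝓘(ℝ, EP) σ q σ')
    (hk : HasMFDerivAt 𝓘(ℝ, E) 𝓘(ℝ, EK) (fun y ↦ (h q)⁻¹ * h y) q k') :
    ∃ d : TangentSpace 𝓘(ℝ, E) q →L[ℝ] EP,
      HasMFDerivAt 𝓘(ℝ, E) 𝓘(ℝ, EP) (fun y ↦ B.act (σ y) (h y)) q d ∧
      ∀ w, A.formE (B.act (σ q) (h q)) (d w) =
        adE EK (h q)⁻¹ (A.formE (σ q) (σ' w)) + k' w := by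
  set g := h q with hg
  let k : Q → K := fun y ↦ g⁻¹ * h y
  have hk1 : k q = 1 := inv_mul_cancel _
  let τ : Q → P := fun y ↦ B.act (σ y) g
  have hR : ∀ g : K, ContMDiff 𝓘(ℝ, EP) 𝓘(ℝ, EP) ∞ (fun q : P ↦ B.act q g) := fun g ↦
    B.contMDiff_act.comp (contMDiff_id.prodMk contMDiff_const)
  let R' : EP →L[ℝ] EP := mfderiv 𝓘(ℝ, EP) 𝓘(ℝ, EP) (fun q : P ↦ B.act q g) (σ q)
  let V' : EK →L[ℝ] EP := mfderiv 𝓘(ℝ, EK) 𝓘(ℝ, EP) (fun g : K ↦ B.act (τ q) g) 1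
  have hτ : HasMFDerivAt 𝓘(ℝ, E) 𝓘(ℝ, EP) τ q (R' ∘L σ') :=
    HasMFDerivAt.comp q ((hR g).mdifferentiable (by simp) _).hasMFDerivAt hσ
  have hA : MDifferentiableAt (𝓘(ℝ, EP).prod 𝓘(ℝ, EK)) 𝓘(ℝ, EP) (fun p : P × K ↦ B.act p.1 p.2)
      (τ q, k q) := B.contMDiff_act.mdifferentiable (by simp) _
  have e : (fun y ↦ B.act (σ y) (h y)) = (fun p : P × K ↦ B.act p.1 p.2) ∘ fun y ↦ (τ y, k y) := by
    ext y
    simp [τ, k, ← B.act_mul]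
  refine ⟨R' ∘L σ' + V' ∘L k', ?_, fun w ↦ ?_⟩
  · rw [e]
    have h1 := HasMFDerivAt.comp q hA.hasMFDerivAt (hτ.prodMk hk)
    refine h1.congr_mfderiv (ContinuousLinearMap.ext fun w ↦ ?_)
    refine (mfderiv_prod_eq_add_apply hA).trans ?_
    have e2 : (fun z : P ↦ B.act z (k q)) = id := by
      ext z
      rw [hk1, B.act_one]
      rfl
    have h2 : mfderiv 𝓘(ℝ, EP) 𝓘(ℝ, EP) (fun z : P ↦ B.act z (k q)) (τ q) =
        ContinuousLinearMap.id ℝ EP := by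
      rw [e2]
      exact mfderiv_id
    have h3 : (mfderiv 𝓘(ℝ, EK) 𝓘(ℝ, EP) (fun g : K ↦ B.act (τ q) g) (k q) : EK →L[ℝ] EP) = V' := by
      rw [hk1]
    exact congrArg₂ (· + ·) (congrArg (fun T : EP →L[ℝ] EP ↦ T (R' (σ' w))) h2)
      (congrArg (fun T : EK →L[ℝ] EP ↦ T (k' w)) h3)
  · have h2 : A.formE (B.act (τ q) 1) (V' (k' w)) = k' w := A.vertical (τ q) (k' w)
    have h3 : A.formE (τ q) (R' (σ' w)) = adE EK g⁻¹ (A.formE (σ q) (σ' w)) :=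
      A.equivariant (σ q) g (σ' w)
    rw [B.act_one] at h2
    rw [_root_.add_apply, map_add]
    exact congrArg₂ (· + ·) h3 h2

end Act

end Connection

end PrincipalBundle

end Gauges

/-! ### The local connection forms -/

section GaugeForms

variable {M : Type*} [TopologicalSpace M] [ChartedSpace R6 M] [IsManifold (𝓡 6) ∞ M]
  {EK : Type*} [NormedAddCommGroup EK] [NormedSpace ℝ EK] [FiniteDimensional ℝ EK]
  {K : Type*} [TopologicalSpace K] [Group K] [ChartedSpace EK K] [LieGroup 𝓘(ℝ, EK) ∞ K]
  {EP : Type*} [NormedAddCommGroup EP] [NormedSpace ℝ EP]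
  {P : Type*} [TopologicalSpace P] [ChartedSpace EP P] [IsManifold 𝓘(ℝ, EP) ∞ P]

/-- A one-form is smooth if its components in a coordinate frame are smooth. -/
theorem formAt_of_frame {a : Π x : M, TangentSpace (𝓡 6) x →L[ℝ] LieAlg EK K}
    {E : Fin 6 → Π x : M, TangentSpace (𝓡 6) x} {x₀ : M}
    (hchart : ∀ x ∈ (chartAt R6 x₀).source, ∀ i,
      mfderiv (𝓡 6) 𝓘(ℝ, R6) (extChartAt (𝓡 6) x₀) x (E i x) = EuclideanSpace.single i (1 : ℝ))
    (h : ∀ i, LieAt ∞ (fun y ↦ a y (E i y)) x₀) : FormAt a x₀ := by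
  refine contMDiffAt_hom_bundle _ |>.2 ⟨contMDiffAt_id, ?_⟩
  have h1 : ContMDiffAt (𝓡 6) 𝓘(ℝ, R6 →L[ℝ] EK) ∞ (fun y ↦ ∑ i : Fin 6,
      ContinuousLinearMap.smulRightL ℝ R6 EK (EuclideanSpace.proj i) (a y (E i y))) x₀ :=
    contMDiffAt_finsetSum _ fun i _ ↦ ContMDiffAt.clm (F := EK)
      (ContinuousLinearMap.smulRightL ℝ R6 EK (EuclideanSpace.proj i)) (h i)
  refine h1.congr_of_eventuallyEq ?_
  filter_upwards [(chartAt R6 x₀).open_source.mem_nhds (mem_chart_source R6 x₀)] with y hy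
  let T := trivializationAt R6 (fun x : M ↦ TangentSpace (𝓡 6) x) x₀
  have hT : y ∈ T.baseSet := hy
  have e1 : ∀ i, T.symmL ℝ y (EuclideanSpace.single i (1 : ℝ)) = E i y := fun i ↦ by
    rw [← hchart y hy i, ← TangentBundle.continuousLinearMapAt_trivializationAt hy]
    exact T.symmL_continuousLinearMapAt hT (E i y)
  refine ContinuousLinearMap.ext fun v ↦ ?_
  have e2 : v = ∑ i, v i • (EuclideanSpace.single i (1 : ℝ) : R6) := by
    ext j
    simp [Finset.sum_apply, Pi.single_apply]
  have e3 : a y (T.symmL ℝ y v) = ∑ i, v i • a y (E i y) := by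
    conv_lhs => rw [e2]
    simp only [map_sum, map_smul, e1]
  refine Eq.trans (b := a y (T.symmL ℝ y v)) ?_ (e3.trans ?_)
  · have e4 := Bundle.Trivial.continuousLinearMapAt_trivialization ℝ M EK y
    exact congrArg (fun L : EK →L[ℝ] EK ↦ L (a y (T.symmL ℝ y v))) e4
  · exact (map_sum (ContinuousLinearMap.apply ℝ EK v)
      (fun i ↦ ContinuousLinearMap.smulRightL ℝ R6 EK (EuclideanSpace.proj i) (a y (E i y)))
      Finset.univ).symm

namespace PrincipalBundle

variable {B : PrincipalBundle EK K M EP P} {s s' : M → P} {U U' : Set M} {x : M}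

namespace Connection

variable (A : B.Connection)

theorem formAt_gaugeForm (hs : B.IsGauge s U) (hx : x ∈ U) : FormAt (A.gaugeForm s) x := by
  obtain ⟨E, hE, hchart⟩ := exists_isCoordFrame x
  refine formAt_of_frame hchart fun i ↦ ?_
  have hsx := hs.contMDiffAt hx
  have h := hsx.mfderiv_const (m := ∞) (by simp)
  have h2 : ContMDiffAt (𝓡 6) (𝓘(ℝ, EP).prod 𝓘(ℝ, EP)) ∞
      (fun y ↦ (TotalSpace.mk' EP (s y) (mfderiv (𝓡 6) 𝓘(ℝ, EP) s y (E i y)) :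
        TotalSpace EP (TangentSpace 𝓘(ℝ, EP) : P → Type _))) x :=
    ContMDiffAt.clm_apply_of_inCoordinates (b₁ := id) h
      (hE.contMDiffAt i x (mem_chart_source R6 x)) hsx
  have h3 := ContMDiffAt.clm_bundle_apply (F₁ := EP) (F₂ := EK)
    (E₁ := fun p : P ↦ TangentSpace 𝓘(ℝ, EP) p) (E₂ := Bundle.Trivial P EK)
    (b := s) (IB := 𝓘(ℝ, EP)) ((A.contMDiff_form (s x)).comp x hsx) h2
  exact (contMDiffAt_totalSpace.1 h3).2

/-- The transformation of the local connection form under a change of gauge. -/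
theorem gaugeForm_act {h : M → K} (hs : MDifferentiableAt (𝓡 6) 𝓘(ℝ, EP) s x)
    (hh : MDifferentiableAt (𝓡 6) 𝓘(ℝ, EK) h x) (hs' : ∀ᶠ y in 𝓝 x, s' y = B.act (s y) (h y)) :
    ∃ k' : TangentSpace (𝓡 6) x →L[ℝ] EK,
      HasMFDerivAt (𝓡 6) 𝓘(ℝ, EK) (fun y ↦ (h x)⁻¹ * h y) x k' ∧
      ∀ v, A.gaugeForm s' x v = adE EK (h x)⁻¹ (A.gaugeForm s x v) + k' v := by
  have hk : MDifferentiableAt (𝓡 6) 𝓘(ℝ, EK) (fun y ↦ (h x)⁻¹ * h y) x :=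
    MDifferentiableAt.comp x (((contMDiff_mul_left (I := 𝓘(ℝ, EK)) (n := ∞)
      (a := (h x)⁻¹)).mdifferentiable (by simp)) _) hh
  obtain ⟨k', hk'⟩ : ∃ k' : TangentSpace (𝓡 6) x →L[ℝ] EK,
    HasMFDerivAt (𝓡 6) 𝓘(ℝ, EK) (fun y ↦ (h x)⁻¹ * h y) x k' := ⟨_, hk.hasMFDerivAt⟩
  obtain ⟨d, hd, hd'⟩ := A.exists_hasMFDerivAt_act hs.hasMFDerivAt hk'
  refine ⟨k', hk', fun v ↦ (Eq.trans ?_ (hd' v))⟩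
  have h1 : mfderiv (𝓡 6) 𝓘(ℝ, EP) s' x = (d : R6 →L[ℝ] EP) :=
    (hd.congr_of_eventuallyEq hs').mfderiv
  have h2 : A.gaugeForm s' x v = A.formE (s' x) (mfderiv (𝓡 6) 𝓘(ℝ, EP) s' x v) := rfl
  rw [h2, h1, hs'.self_of_nhds]
  rfl

end Connection

end PrincipalBundle

end GaugeForms

/-! ### Regularity of the Dirac operator -/

section Regularity

variable {M : Type*} [TopologicalSpace M] [ChartedSpace R6 M] [IsManifold (𝓡 6) ∞ M]
  [RiemannianBundle (fun x : M ↦ TangentSpace (𝓡 6) x)]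
  [IsContMDiffRiemannianBundle (𝓡 6) ∞ R6 (fun x : M ↦ TangentSpace (𝓡 6) x)]
  {EK : Type*} [NormedAddCommGroup EK] [NormedSpace ℝ EK] [FiniteDimensional ℝ EK]
  {K : Type*} [TopologicalSpace K] [Group K] [ChartedSpace EK K] [LieGroup 𝓘(ℝ, EK) ∞ K]
  {S : M → Type*} [TopologicalSpace (TotalSpace R8 S)]
    [∀ x, NormedAddCommGroup (S x)] [∀ x, InnerProductSpace ℝ (S x)] [FiberBundle R8 S]
    [VectorBundle ℝ R8 S] [ContMDiffVectorBundle ∞ R8 S (𝓡 6)]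
    [IsContMDiffRiemannianBundle (𝓡 6) ∞ R8 S]
  {a : Π x : M, TangentSpace (𝓡 6) x →L[ℝ] LieAlg EK K} {ξ : Π x : M, S x ⊗[ℝ] LieAlg EK K}
  {U : Set M} {x : M}

theorem contr_tmul (l : Module.Dual ℝ (LieAlg EK K)) (s : S x) (κ : LieAlg EK K) :
    contr l (s ⊗ₜ[ℝ] κ) = l κ • s := by
  simp [contr]

theorem LieAt.dual {n : ℕ∞ω} (l : Module.Dual ℝ (LieAlg EK K)) {f : M → LieAlg EK K}
    (hf : LieAt n f x) : ContMDiffAt (𝓡 6) 𝓘(ℝ, ℝ) n (fun y ↦ l (f y)) x :=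
  ContMDiffAt.clm (F := EK) (LinearMap.toContinuousLinearMap (show EK →ₗ[ℝ] ℝ from l)) hf

namespace NearlyKahlerStructure

variable {N : NearlyKahlerStructure M S}

/-- Smoothness of `∇_X s` for sections which are only smooth on an open set: near a point, `s`
agrees with a global smooth section, obtained by means of a bump function. -/
theorem contMDiffAt_nabla [T2Space M] {s : Π x : M, S x} (hU : IsOpen U)
    (hs : ∀ y ∈ U, SpinorAt ∞ s y) (hx : x ∈ U) {X : Π x : M, TangentSpace (𝓡 6) x}
    (hX : VFieldAt ∞ X x) : SpinorAt ∞ (fun y ↦ N.nabla s y (X y)) x := by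
  obtain ⟨ψ, -, hψ⟩ := (SmoothBumpFunction.nhds_basis_tsupport (I := 𝓡 6) x).mem_iff.1
    (hU.mem_nhds hx)
  have h1 : ContMDiff (𝓡 6) ((𝓡 6).prod 𝓘(ℝ, R8)) ∞
      (fun y ↦ TotalSpace.mk' R8 y ((⇑ψ • s) y)) :=
    ContMDiffOn.smul_section_of_tsupport ψ.contMDiff.contMDiffOn hU hψ
      fun y hy ↦ (hs y hy).contMDiffWithinAt
  have h2 := (N.contMDiff_nabla.contMDiff.contMDiff (σ := ⇑ψ • s) h1.contMDiffOn).contMDiffAt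
    (x := x) Filter.univ_mem
  have h3 : SpinorAt ∞ (fun y ↦ N.nabla (⇑ψ • s) y (X y)) x :=
    ContMDiffAt.clm_bundle_apply (IB := 𝓡 6) (b := id) h2 hX
  refine h3.congr_of_eventuallyEq ?_
  filter_upwards [ψ.eventuallyEq_one.eventually_nhds, hU.mem_nhds hx] with y hy hyU
  have h4 : N.nabla s y = N.nabla (⇑ψ • s) y :=
    N.nabla.isCovariantDerivativeOn.congr_of_eventuallyEq (hs y hyU).diffAt
      ((h1 y).mdifferentiableAt (by simp)) Filter.univ_mem (by
        filter_upwards [hy] with z hz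
        simp [hz])
  simp only [h4]

theorem contr_spinCov (l : Module.Dual ℝ (LieAlg EK K)) (v : TangentSpace (𝓡 6) x) :
    contr l (N.spinCov a ξ x v) = ∑ i,
      (l (Module.finBasis ℝ (LieAlg EK K) i) •
        N.nabla (fun y ↦ contr ((Module.finBasis ℝ (LieAlg EK K)).coord i) (ξ y)) x v +
      l ⁅a x v, Module.finBasis ℝ (LieAlg EK K) i⁆ •
        contr ((Module.finBasis ℝ (LieAlg EK K)).coord i) (ξ x)) := by
  rw [spinCov_apply, gaugeCov, map_add, map_sum, Finset.sum_add_distrib]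
  simp only [contr_tmul]
  congr 1
  conv_lhs => rw [← sum_contr_tmul (ξ x)]
  simp only [map_sum, LinearMap.lTensor_tmul, contr_tmul, LieAlgebra.ad_apply]

theorem contr_dirac {E : Fin 6 → Π x : M, TangentSpace (𝓡 6) x}
    (hE : LinearIndependent ℝ fun i ↦ E i x) (l : Module.Dual ℝ (LieAlg EK K)) :
    contr l (N.dirac a ξ x) =
      ∑ i, N.cliff x (dualFrame E i x) (contr l (N.spinCov a ξ x (E i x))) := by
  refine ext_inner_left ℝ fun φ ↦ ?_
  rw [inner_contr, N.pair_dirac hE, inner_sum, map_neg, map_sum, ← Finset.sum_neg_distrib]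
  refine Finset.sum_congr rfl fun i _ ↦ ?_
  rw [← inner_contr, N.cliff_skew, neg_neg]

theorem adSpinorAt_dirac [T2Space M] (hU : IsOpen U) (hx : x ∈ U) (ha : FormAt a x)
    (hξ : ∀ y ∈ U, AdSpinorAt ξ y) : AdSpinorAt (N.dirac a ξ) x := by
  intro l
  obtain ⟨E, hE, -⟩ := exists_isCoordFrame x
  have hx' := mem_chart_source R6 x
  have h1 : SpinorAt ∞ (fun y ↦ ∑ i, N.cliff y (dualFrame E i y)
      (contr l (N.spinCov a ξ y (E i y)))) x := by
    refine ContMDiffAt.sum_section (I := 𝓡 6) (F := R8) (V := S) (s := Finset.univ)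
      (t := fun i y ↦ N.cliff y (dualFrame E i y) (contr l (N.spinCov a ξ y (E i y)))) fun i _ ↦ ?_
    refine cliff_contMDiffAt (hE.contMDiffAt_dualFrame hx' i) ?_
    simp only [contr_spinCov]
    refine ContMDiffAt.sum_section (I := 𝓡 6) (F := R8) (V := S) (s := Finset.univ)
      (t := fun j y ↦ l (Module.finBasis ℝ (LieAlg EK K) j) •
        N.nabla (fun y ↦ contr ((Module.finBasis ℝ (LieAlg EK K)).coord j) (ξ y)) y (E i y) +
      l ⁅a y (E i y), Module.finBasis ℝ (LieAlg EK K) j⁆ •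
        contr ((Module.finBasis ℝ (LieAlg EK K)).coord j) (ξ y)) fun j _ ↦ ?_
    refine ContMDiffAt.add_section (V := S)
      (s := fun y ↦ l (Module.finBasis ℝ (LieAlg EK K) j) •
        N.nabla (fun y ↦ contr ((Module.finBasis ℝ (LieAlg EK K)).coord j) (ξ y)) y (E i y))
      (t := fun y ↦ l ⁅a y (E i y), Module.finBasis ℝ (LieAlg EK K) j⁆ •
        contr ((Module.finBasis ℝ (LieAlg EK K)).coord j) (ξ y)) ?_ ?_
    · exact ContMDiffAt.smul_section (V := S) contMDiffAt_const
        (contMDiffAt_nabla hU (fun y hy ↦ hξ y hy _) hx (hE.contMDiffAt i x hx'))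
    · exact ContMDiffAt.smul_section (V := S)
        (LieAt.dual l ((ha.apply (hE.contMDiffAt i x hx')).lie contMDiffAt_const)) (hξ x hx _)
  refine h1.congr_of_eventuallyEq ?_
  filter_upwards [hE.mem_nhds hx'] with y hy
  rw [contr_dirac (hE.linearIndependent y hy)]

theorem adSpinorAt_gaugeDirac [T2Space M] (hU : IsOpen U) (hx : x ∈ U) (ha : FormAt a x)
    (hξ : ∀ y ∈ U, AdSpinorAt ξ y) : AdSpinorAt (N.gaugeDirac (1 / 3) a ξ) x := by
  intro l
  have hψ := N.contMDiff_psi x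
  have hν := vol_contMDiffAt (N := N) hψ
  have h1 : SpinorAt ∞ (fun y ↦ (contr l (N.dirac a ξ y) + l (pair (N.psi y) (ξ y)) • N.psi y) -
      l (pair (N.vol y (N.psi y)) (ξ y)) • N.vol y (N.psi y)) x := by
    refine ContMDiffAt.sub_section (V := S)
      (s := fun y ↦ contr l (N.dirac a ξ y) + l (pair (N.psi y) (ξ y)) • N.psi y)
      (t := fun y ↦ l (pair (N.vol y (N.psi y)) (ξ y)) • N.vol y (N.psi y)) ?_ ?_
    · exact ContMDiffAt.add_section (V := S) (s := fun y ↦ contr l (N.dirac a ξ y))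
        (t := fun y ↦ l (pair (N.psi y) (ξ y)) • N.psi y)
        (adSpinorAt_dirac hU hx ha hξ l)
        (ContMDiffAt.smul_section (V := S) (LieAt.dual l ((hξ x hx).pair hψ)) hψ)
    · exact ContMDiffAt.smul_section (V := S) (LieAt.dual l ((hξ x hx).pair hν)) hν
  simpa only [gaugeDirac_third, map_sub, map_add, contr_tmul] using h1

end NearlyKahlerStructure

end Regularity

/-! ### Gauge covariance of the Dirac operator -/

theorem rTensor_lTensor_comm {V W : Type*} [AddCommGroup V] [Module ℝ V] [AddCommGroup W]
    [Module ℝ W] (T : V →ₗ[ℝ] V) (L : W →ₗ[ℝ] W) (z : V ⊗[ℝ] W) :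
    LinearMap.rTensor W T (LinearMap.lTensor V L z) =
      LinearMap.lTensor V L (LinearMap.rTensor W T z) := by
  rw [← LinearMap.comp_apply, ← LinearMap.comp_apply, LinearMap.rTensor_comp_lTensor,
    LinearMap.lTensor_comp_rTensor]

section Covariance

variable {M : Type*} [TopologicalSpace M] [ChartedSpace R6 M] [IsManifold (𝓡 6) ∞ M]
  {EK : Type*} [NormedAddCommGroup EK] [NormedSpace ℝ EK] [FiniteDimensional ℝ EK]
  {K : Type*} [TopologicalSpace K] [Group K] [ChartedSpace EK K] [LieGroup 𝓘(ℝ, EK) ∞ K]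
  {a a' : Π x : M, TangentSpace (𝓡 6) x →L[ℝ] LieAlg EK K} {x : M} {h : M → K}
  {k' : TangentSpace (𝓡 6) x →L[ℝ] EK}

/-- The covariant derivative of a Lie algebra valued function is gauge covariant. -/
theorem lieCov_gauge (hh : MDifferentiableAt (𝓡 6) 𝓘(ℝ, EK) h x)
    (hk : HasMFDerivAt (𝓡 6) 𝓘(ℝ, EK) (fun y ↦ (h x)⁻¹ * h y) x k')
    (ha : ∀ v, a' x v = adE EK (h x)⁻¹ (a x v) + k' v) {f : M → LieAlg EK K}
    (hf : LieDiffAt f x) (v : TangentSpace (𝓡 6) x) :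
    lieCov a' (fun y ↦ Ad (h y)⁻¹ (f y)) x v = Ad (h x)⁻¹ (lieCov a f x v) := by
  have h1 : MDifferentiableAt (𝓡 6) 𝓘(ℝ, EK →L[ℝ] EK) (fun y ↦ adE EK (h y)⁻¹) x :=
    MDifferentiableAt.comp x (I' := 𝓘(ℝ, EK)) (g := fun g : K ↦ adE EK g⁻¹)
      ((contMDiff_adE.comp (contMDiff_inv 𝓘(ℝ, EK) ∞)).mdifferentiable (by simp) _) hh
  have h2 := mvfderiv_bilin (F' := EK) (F'' := EK) (ContinuousLinearMap.id ℝ (EK →L[ℝ] EK)) h1 hf v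
  have h3 := mvfderiv_clm_apply (F' := EK) (ContinuousLinearMap.apply ℝ EK (show EK from f x)) h1 v
  have h4 := mvfderiv_adE_inv_comp_logDeriv hk (f x) v
  let κ : LieAlg EK K := k' v
  have h5 : lieDiff (fun y ↦ Ad (h y)⁻¹ (f y)) x v =
      -⁅κ, Ad (h x)⁻¹ (f x)⁆ + Ad (h x)⁻¹ (lieDiff f x v) :=
    h2.trans (congrArg₂ (· + ·) (h3.symm.trans h4) rfl)
  have h6 : a' x v = Ad (h x)⁻¹ (a x v) + κ := ha v
  rw [lieCov_apply, lieCov_apply, h5, h6, map_add, Ad_lie, add_lie]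
  abel

variable [RiemannianBundle (fun x : M ↦ TangentSpace (𝓡 6) x)]
  {S : M → Type*} [TopologicalSpace (TotalSpace R8 S)]
    [∀ x, NormedAddCommGroup (S x)] [∀ x, InnerProductSpace ℝ (S x)] [FiberBundle R8 S]
    [VectorBundle ℝ R8 S] [ContMDiffVectorBundle ∞ R8 S (𝓡 6)]
    [IsContMDiffRiemannianBundle (𝓡 6) ∞ R8 S]
  {ξ ξ' : Π x : M, S x ⊗[ℝ] LieAlg EK K}

namespace NearlyKahlerStructure

variable (N : NearlyKahlerStructure M S)

theorem spinCov_gauge (hh : MDifferentiableAt (𝓡 6) 𝓘(ℝ, EK) h x)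
    (hk : HasMFDerivAt (𝓡 6) 𝓘(ℝ, EK) (fun y ↦ (h x)⁻¹ * h y) x k')
    (ha : ∀ v, a' x v = adE EK (h x)⁻¹ (a x v) + k' v) (hξ : AdSpinorDiffAt ξ x)
    (hξ' : AdSpinorDiffAt ξ' x)
    (he : ∀ᶠ y in 𝓝 x, ξ' y = LinearMap.lTensor (S y) (Ad (h y)⁻¹).toLinearMap (ξ y))
    (v : TangentSpace (𝓡 6) x) : N.spinCov a' ξ' x v =
      LinearMap.lTensor (S x) (Ad (h x)⁻¹).toLinearMap (N.spinCov a ξ x v) := by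
  refine ext_pair fun φ₀ ↦ ?_
  set φ := FiberBundle.extend (E := S) R8 φ₀ with hφ
  have dφ : SpinorDiffAt φ x := FiberBundle.mdifferentiableAt_extend (𝓡 6) R8 φ₀
  have eφ : φ x = φ₀ := FiberBundle.extend_apply_self _ _
  rw [← eφ, N.pair_spinCov dφ hξ', pair_lTensor, N.pair_spinCov dφ hξ, he.self_of_nhds,
    pair_lTensor, map_sub]
  congr 1
  have h1 : (fun y ↦ pair (φ y) (ξ' y)) =ᶠ[𝓝 x] fun y ↦ Ad (h y)⁻¹ (pair (φ y) (ξ y)) := by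
    filter_upwards [he] with y hy
    rw [hy, pair_lTensor]
    rfl
  rw [lieCov_congr h1]
  exact lieCov_gauge hh hk ha (hξ.pair dφ) v

/-- The Dirac operator is gauge covariant. -/
theorem gaugeDirac_gauge (hh : MDifferentiableAt (𝓡 6) 𝓘(ℝ, EK) h x)
    (hk : HasMFDerivAt (𝓡 6) 𝓘(ℝ, EK) (fun y ↦ (h x)⁻¹ * h y) x k')
    (ha : ∀ v, a' x v = adE EK (h x)⁻¹ (a x v) + k' v) (hξ : AdSpinorDiffAt ξ x)
    (hξ' : AdSpinorDiffAt ξ' x)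
    (he : ∀ᶠ y in 𝓝 x, ξ' y = LinearMap.lTensor (S y) (Ad (h y)⁻¹).toLinearMap (ξ y)) :
    N.gaugeDirac (1 / 3) a' ξ' x =
      LinearMap.lTensor (S x) (Ad (h x)⁻¹).toLinearMap (N.gaugeDirac (1 / 3) a ξ x) := by
  simp only [gaugeDirac_third, map_sub, map_add, LinearMap.lTensor_tmul, dirac, map_sum,
    N.spinCov_gauge hh hk ha hξ hξ' he, he.self_of_nhds, pair_lTensor]
  simp only [rTensor_lTensor_comm]

end NearlyKahlerStructure

end Covariance

/-! ### The Dirac operator on sections of the associated bundle -/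

section Leibniz

variable {M : Type*} [TopologicalSpace M] [ChartedSpace R6 M] [IsManifold (𝓡 6) ∞ M]
  [RiemannianBundle (fun x : M ↦ TangentSpace (𝓡 6) x)]
  {EK : Type*} [NormedAddCommGroup EK] [NormedSpace ℝ EK] [FiniteDimensional ℝ EK]
  {K : Type*} [TopologicalSpace K] [Group K] [ChartedSpace EK K] [LieGroup 𝓘(ℝ, EK) ∞ K]
  {S : M → Type*} [TopologicalSpace (TotalSpace R8 S)]
    [∀ x, NormedAddCommGroup (S x)] [∀ x, InnerProductSpace ℝ (S x)] [FiberBundle R8 S]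
    [VectorBundle ℝ R8 S] [ContMDiffVectorBundle ∞ R8 S (𝓡 6)]
    [IsContMDiffRiemannianBundle (𝓡 6) ∞ R8 S]
  {a : Π x : M, TangentSpace (𝓡 6) x →L[ℝ] LieAlg EK K}
  {ξ ξ' : Π x : M, S x ⊗[ℝ] LieAlg EK K} {f : M → ℝ} {x : M}

theorem AdSpinorDiffAt.add (hξ : AdSpinorDiffAt ξ x) (hξ' : AdSpinorDiffAt ξ' x) :
    AdSpinorDiffAt (fun y ↦ ξ y + ξ' y) x := fun l ↦ by
  simp only [map_add]
  exact mdifferentiableAt_add_section (hξ l) (hξ' l)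

theorem AdSpinorDiffAt.smul (hf : MDifferentiableAt (𝓡 6) 𝓘(ℝ, ℝ) f x) (hξ : AdSpinorDiffAt ξ x) :
    AdSpinorDiffAt (fun y ↦ f y • ξ y) x := fun l ↦ by
  simp only [map_smul]
  exact MDifferentiableAt.smul_section (f := f) (s := fun y ↦ contr l (ξ y)) hf (hξ l)

namespace NearlyKahlerStructure

variable (N : NearlyKahlerStructure M S)

theorem spinCov_add (hξ : AdSpinorDiffAt ξ x) (hξ' : AdSpinorDiffAt ξ' x)
    (v : TangentSpace (𝓡 6) x) :
    N.spinCov a (fun y ↦ ξ y + ξ' y) x v = N.spinCov a ξ x v + N.spinCov a ξ' x v := by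
  refine ext_pair fun φ₀ ↦ ?_
  set φ := FiberBundle.extend (E := S) R8 φ₀ with hφ
  have dφ : SpinorDiffAt φ x := FiberBundle.mdifferentiableAt_extend (𝓡 6) R8 φ₀
  have eφ : φ x = φ₀ := FiberBundle.extend_apply_self _ _
  rw [← eφ, map_add, N.pair_spinCov dφ hξ, N.pair_spinCov dφ hξ', N.pair_spinCov dφ (hξ.add hξ')]
  simp only [map_add]
  rw [lieCov_add (hξ.pair dφ) (hξ'.pair dφ)]
  abel

theorem spinCov_smul (hf : MDifferentiableAt (𝓡 6) 𝓘(ℝ, ℝ) f x) (hξ : AdSpinorDiffAt ξ x)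
    (v : TangentSpace (𝓡 6) x) :
    N.spinCov a (fun y ↦ f y • ξ y) x v =
      mvfderiv (𝓡 6) f x v • ξ x + f x • N.spinCov a ξ x v := by
  refine ext_pair fun φ₀ ↦ ?_
  set φ := FiberBundle.extend (E := S) R8 φ₀ with hφ
  have dφ : SpinorDiffAt φ x := FiberBundle.mdifferentiableAt_extend (𝓡 6) R8 φ₀
  have eφ : φ x = φ₀ := FiberBundle.extend_apply_self _ _
  rw [← eφ, map_add, map_smul, map_smul, N.pair_spinCov dφ hξ, N.pair_spinCov dφ (hξ.smul hf)]
  simp only [map_smul]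
  rw [lieCov_smul hf (hξ.pair dφ)]
  module

theorem gaugeDirac_add (hξ : AdSpinorDiffAt ξ x) (hξ' : AdSpinorDiffAt ξ' x) :
    N.gaugeDirac (1 / 3) a (fun y ↦ ξ y + ξ' y) x =
      N.gaugeDirac (1 / 3) a ξ x + N.gaugeDirac (1 / 3) a ξ' x := by
  simp only [gaugeDirac_third, dirac, N.spinCov_add hξ hξ', map_add, Finset.sum_add_distrib,
    TensorProduct.tmul_add]
  abel

/-- The gradient of a function. -/
def grad (f : M → ℝ) (x : M) : TangentSpace (𝓡 6) x :=
  ∑ j, mvfderiv (𝓡 6) f x (frame M x j) • frame M x j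

/-- The principal symbol of the Dirac operator is Clifford multiplication. -/
theorem gaugeDirac_smul (hf : MDifferentiableAt (𝓡 6) 𝓘(ℝ, ℝ) f x) (hξ : AdSpinorDiffAt ξ x) :
    N.gaugeDirac (1 / 3) a (fun y ↦ f y • ξ y) x =
      LinearMap.rTensor (LieAlg EK K) (N.cliff x (grad f x)).toLinearMap (ξ x) +
        f x • N.gaugeDirac (1 / 3) a ξ x := by
  have h : N.dirac a (fun y ↦ f y • ξ y) x =
      LinearMap.rTensor (LieAlg EK K) (N.cliff x (grad f x)).toLinearMap (ξ x) +
        f x • N.dirac a ξ x := by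
    refine ext_pair fun φ ↦ ?_
    have hg : N.cliff x (grad f x) φ =
        ∑ j, mvfderiv (𝓡 6) f x (frame M x j) • N.cliff x (frame M x j) φ := by
      rw [grad, map_sum, _root_.sum_apply]
      simp only [map_smul, _root_.smul_apply]
    simp only [dirac, N.spinCov_smul hf hξ, map_add, map_smul, map_sum, Finset.sum_add_distrib,
      N.pair_cliff, Finset.smul_sum, smul_neg, Finset.sum_neg_distrib]
    rw [hg]
    simp only [map_sum, map_smul, LinearMap.sum_apply, LinearMap.smul_apply]
  rw [gaugeDirac_third, gaugeDirac_third, h]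
  simp only [map_smul, TensorProduct.tmul_smul]
  module

theorem bijective_rTensor_cliff {w : TangentSpace (𝓡 6) x} (hw : w ≠ 0) :
    Function.Bijective (LinearMap.rTensor (LieAlg EK K) (N.cliff x w).toLinearMap) := by
  set T := LinearMap.rTensor (LieAlg EK K) (N.cliff x w).toLinearMap with hT
  have hc : (inner ℝ w w : ℝ) ≠ 0 := inner_self_ne_zero.2 hw
  have h : ∀ z, T (T z) = (-(inner ℝ w w : ℝ)) • z := fun z ↦ by
    refine ext_pair fun φ ↦ ?_
    rw [hT, N.pair_cliff, N.pair_cliff, N.cliff_cliff, map_smul, map_smul, neg_neg]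
    rfl
  constructor
  · intro z z' hz
    have h1 := (h z).symm.trans ((congrArg T hz).trans (h z'))
    exact smul_right_injective _ (neg_ne_zero.2 hc) h1
  · intro z
    refine ⟨(-(inner ℝ w w : ℝ))⁻¹ • T z, ?_⟩
    rw [map_smul, h, smul_smul, inv_mul_cancel₀ (neg_ne_zero.2 hc), one_smul]

theorem grad_ne_zero (hf : mfderiv (𝓡 6) 𝓘(ℝ, ℝ) f x ≠ 0) : grad f x ≠ 0 := by
  intro h
  refine hf ?_
  have h1 : mvfderiv (𝓡 6) f x = 0 := by
    refine ContinuousLinearMap.coe_injective ((frame M x).toBasis.ext fun k ↦ ?_)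
    have h2 : inner ℝ (frame M x k) (grad f x) = mvfderiv (𝓡 6) f x (frame M x k) := by
      rw [grad, inner_sum]
      simp only [inner_smul_right, orthonormal_iff_ite.1 (frame M x).orthonormal]
      simp
    rw [h, inner_zero_right] at h2
    simpa using h2.symm
  exact h1

end NearlyKahlerStructure

end Leibniz

section Operator

variable {M : Type*} [TopologicalSpace M] [ChartedSpace R6 M] [IsManifold (𝓡 6) ∞ M]
  {EK : Type*} [NormedAddCommGroup EK] [NormedSpace ℝ EK] [FiniteDimensional ℝ EK]
  {K : Type*} [TopologicalSpace K] [Group K] [ChartedSpace EK K] [LieGroup 𝓘(ℝ, EK) ∞ K]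
  {EP : Type*} [NormedAddCommGroup EP] [NormedSpace ℝ EP]
  {P : Type*} [TopologicalSpace P] [ChartedSpace EP P] [IsManifold 𝓘(ℝ, EP) ∞ P]
  {B : PrincipalBundle EK K M EP P} {s s' : M → P} {U U' : Set M} {x : M}

namespace PrincipalBundle

theorem act_injective (p : P) : Function.Injective (B.act p) := by
  intro g g' h
  obtain ⟨U, hU, hx, s, -, hp, τ, -, hτ, hτ'⟩ := B.locallyTrivial (B.proj p)
  have e := hτ p hx
  rw [← e, ← B.act_mul, ← B.act_mul] at h
  have h1 := congrArg τ h
  rw [hτ' _ hx, hτ' _ hx] at h1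
  exact mul_left_cancel h1

variable {S : M → Type*} [TopologicalSpace (TotalSpace R8 S)]
    [∀ x, NormedAddCommGroup (S x)] [∀ x, InnerProductSpace ℝ (S x)] [FiberBundle R8 S]
    [VectorBundle ℝ R8 S] {η : Π x : M, B.Fib x → S x ⊗[ℝ] LieAlg EK K}

theorem adSpinorAt_inGauge (hη : η ∈ B.adSpinors S) (hs : B.IsGauge s U) (hx : x ∈ U) :
    AdSpinorAt (B.inGauge η s) x := fun l ↦
  (hη.2 s U hs l).contMDiffAt (hs.isOpen.mem_nhds hx)

theorem inGauge_act (hη : η ∈ B.adSpinors S) (hs : B.IsGauge s U) (hx : x ∈ U) {g : K}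
    (h : s' x = B.act (s x) g) :
    B.inGauge η s' x = LinearMap.lTensor (S x) (Ad g⁻¹).toLinearMap (B.inGauge η s x) := by
  rw [hs.inGauge_eq hx, ← hη.1]
  exact PrincipalBundle.inGauge_eq η (B.fibAct (hs.point hx) g) h

end PrincipalBundle

variable [RiemannianBundle (fun x : M ↦ TangentSpace (𝓡 6) x)]
  [IsContMDiffRiemannianBundle (𝓡 6) ∞ R6 (fun x : M ↦ TangentSpace (𝓡 6) x)]
  {S : M → Type*} [TopologicalSpace (TotalSpace R8 S)]
    [∀ x, NormedAddCommGroup (S x)] [∀ x, InnerProductSpace ℝ (S x)] [FiberBundle R8 S]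
    [VectorBundle ℝ R8 S] [ContMDiffVectorBundle ∞ R8 S (𝓡 6)]
    [IsContMDiffRiemannianBundle (𝓡 6) ∞ R8 S]
  {η : Π x : M, B.Fib x → S x ⊗[ℝ] LieAlg EK K}

namespace NearlyKahlerStructure

variable (N : NearlyKahlerStructure M S) (A : B.Connection)

/-- The expressions of the Dirac operator in two gauges define the same section of the bundle. -/
theorem gaugeDirac_act (hη : η ∈ B.adSpinors S) (hs : B.IsGauge s U) (hx : x ∈ U)
    (hs' : B.IsGauge s' U') (hx' : x ∈ U') {g : K} (hg : s' x = B.act (s x) g) :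
    N.gaugeDirac (1 / 3) (A.gaugeForm s') (B.inGauge η s') x =
      LinearMap.lTensor (S x) (Ad g⁻¹).toLinearMap
        (N.gaugeDirac (1 / 3) (A.gaugeForm s) (B.inGauge η s) x) := by
  obtain ⟨h, hh, he⟩ := hs.exists_transition hs' hx hx'
  obtain rfl : h x = g := B.act_injective (s x) (he.self_of_nhds.symm.trans hg)
  have dh := hh.mdifferentiableAt (by simp)
  obtain ⟨k', hk, ha⟩ := A.gaugeForm_act ((hs.contMDiffAt hx).mdifferentiableAt (by simp)) dh he
  refine N.gaugeDirac_gauge dh hk ha (B.adSpinorAt_inGauge hη hs hx).diffAt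
    (B.adSpinorAt_inGauge hη hs' hx').diffAt ?_
  filter_upwards [he, hs.isOpen.mem_nhds hx] with y hy hyU
  exact B.inGauge_act hη hs hyU hy

/-- The Dirac operator at a point of the principal bundle, computed in a gauge through this
point. -/
def diracAt (η : Π x : M, B.Fib x → S x ⊗[ℝ] LieAlg EK K) (x : M) (p : B.Fib x) :
    S x ⊗[ℝ] LieAlg EK K :=
  N.gaugeDirac (1 / 3) (A.gaugeForm (B.exists_isGauge x p).choose)
    (B.inGauge η (B.exists_isGauge x p).choose) x

theorem diracAt_eq (hη : η ∈ B.adSpinors S) (hs : B.IsGauge s U) (hx : x ∈ U) (p : B.Fib x) {g : K}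
    (hg : p.1 = B.act (s x) g) : N.diracAt A η x p = LinearMap.lTensor (S x) (Ad g⁻¹).toLinearMap
      (N.gaugeDirac (1 / 3) (A.gaugeForm s) (B.inGauge η s) x) := by
  obtain ⟨U', hs', hx', hp⟩ := (B.exists_isGauge x p).choose_spec
  exact N.gaugeDirac_act A hη hs hx hs' hx' (hp.trans hg)

theorem diracAt_gauge (hη : η ∈ B.adSpinors S) (hs : B.IsGauge s U) (hx : x ∈ U) (p : B.Fib x)
    (hp : p.1 = s x) :
    N.diracAt A η x p = N.gaugeDirac (1 / 3) (A.gaugeForm s) (B.inGauge η s) x := by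
  rw [N.diracAt_eq A hη hs hx p (g := 1) (by rw [B.act_one, hp]), inv_one, Ad_one]
  exact LinearMap.congr_fun (LinearMap.lTensor_id (R := ℝ) (S x) (LieAlg EK K)) _

theorem diracAt_mem [T2Space M] (hη : η ∈ B.adSpinors S) : N.diracAt A η ∈ B.adSpinors S := by
  refine ⟨fun x p g ↦ ?_, fun s U hs l x hx ↦ ?_⟩
  · obtain ⟨s, U, hs, hx, hp⟩ := B.exists_isGauge x p
    rw [N.diracAt_gauge A hη hs hx p hp.symm]
    exact N.diracAt_eq A hη hs hx (B.fibAct p g) (by rw [hp]; rfl)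
  · have h := adSpinorAt_gaugeDirac (N := N) hs.isOpen hx (A.formAt_gaugeForm hs hx)
      (fun y hy ↦ B.adSpinorAt_inGauge hη hs hy) l
    refine ContMDiffAt.contMDiffWithinAt (h.congr_of_eventuallyEq ?_)
    filter_upwards [hs.isOpen.mem_nhds hx] with y hy
    rw [hs.inGauge_eq hy, N.diracAt_gauge A hη hs hy (hs.point hy) rfl]

/-- The Dirac operator `D^{1/3,A}` on the sections of `SM ⊗ Ad_P`. -/
def diracOp [T2Space M] : B.adSpinors S →ₗ[ℝ] B.adSpinors S where
  toFun η := ⟨N.diracAt A η.1, N.diracAt_mem A η.2⟩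
  map_add' η η' := by
    refine Subtype.ext (funext₂ fun x p ↦ ?_)
    obtain ⟨s, U, hs, hx, hp⟩ := B.exists_isGauge x p
    have h := N.gaugeDirac_add (a := A.gaugeForm s) (B.adSpinorAt_inGauge η.2 hs hx).diffAt
      (B.adSpinorAt_inGauge η'.2 hs hx).diffAt
    have e : B.inGauge (η + η').1 s = fun y ↦ B.inGauge η.1 s y + B.inGauge η'.1 s y :=
      B.inGauge_add η.1 η'.1 s
    show N.diracAt A (η + η').1 x p = N.diracAt A η.1 x p + N.diracAt A η'.1 x p
    rw [N.diracAt_gauge A (η + η').2 hs hx p hp.symm, N.diracAt_gauge A η.2 hs hx p hp.symm,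
      N.diracAt_gauge A η'.2 hs hx p hp.symm, e, h]
  map_smul' c η := by
    refine Subtype.ext (funext₂ fun x p ↦ ?_)
    obtain ⟨s, U, hs, hx, hp⟩ := B.exists_isGauge x p
    have h := N.gaugeDirac_smul (a := A.gaugeForm s) (f := fun _ ↦ c) mdifferentiableAt_const
      (B.adSpinorAt_inGauge η.2 hs hx).diffAt
    have e : B.inGauge (c • η).1 s = fun y ↦ c • B.inGauge η.1 s y := B.inGauge_smul c η.1 s
    show N.diracAt A (c • η).1 x p = c • N.diracAt A η.1 x p
    rw [N.diracAt_gauge A (c • η).2 hs hx p hp.symm, N.diracAt_gauge A η.2 hs hx p hp.symm, e, h]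
    simp [grad, mvfderiv_const]

theorem diracOp_isDiracOperator [T2Space M] : N.IsDiracOperator A (1 / 3) (N.diracOp A) := by
  intro η s U hs x hx
  rw [hs.inGauge_eq hx]
  exact N.diracAt_gauge A η.2 hs hx (hs.point hx) rfl

theorem isEllipticFirstOrder_diracOp [T2Space M] (c : ℝ) :
    IsEllipticFirstOrder (N.diracOp A - c • LinearMap.id) := by
  intro f hf x p
  refine ⟨LinearMap.rTensor (LieAlg EK K) (N.cliff x (grad f x)).toLinearMap, fun η fη h ↦ ?_,
    fun hd ↦ N.bijective_rTensor_cliff (grad_ne_zero hd)⟩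
  obtain ⟨s, U, hs, hx, hp⟩ := B.exists_isGauge x p
  have h1 := N.gaugeDirac_smul (a := A.gaugeForm s) (hf.mdifferentiable (by simp) x)
    (B.adSpinorAt_inGauge η.2 hs hx).diffAt
  have e : B.inGauge fη.1 s = fun y ↦ f y • B.inGauge η.1 s y := by
    ext y
    by_cases hy : B.proj (s y) = y
    · obtain ⟨q, hq⟩ : ∃ q : B.Fib y, s y = q.1 := ⟨⟨s y, hy⟩, rfl⟩
      rw [PrincipalBundle.inGauge_eq fη.1 q hq, PrincipalBundle.inGauge_eq η.1 q hq, h]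
    · simp [PrincipalBundle.inGauge, hy]
  show N.diracAt A fη.1 x p - c • fη.1 x p - f x • (N.diracAt A η.1 x p - c • η.1 x p) = _
  have e2 : B.inGauge η.1 s x = η.1 x p := PrincipalBundle.inGauge_eq η.1 p hp
  rw [N.diracAt_gauge A fη.2 hs hx p hp.symm, N.diracAt_gauge A η.2 hs hx p hp.symm, e, h1, e2, h]
  module

end NearlyKahlerStructure

end Operator

/-! ### Parallel sections of the adjoint bundle -/

section Parallel

variable {M : Type*} [TopologicalSpace M] [ChartedSpace R6 M] [IsManifold (𝓡 6) ∞ M]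
  {EK : Type*} [NormedAddCommGroup EK] [NormedSpace ℝ EK] [FiniteDimensional ℝ EK]
  {K : Type*} [TopologicalSpace K] [Group K] [ChartedSpace EK K] [LieGroup 𝓘(ℝ, EK) ∞ K]
  {EP : Type*} [NormedAddCommGroup EP] [NormedSpace ℝ EP]
  {P : Type*} [TopologicalSpace P] [ChartedSpace EP P] [IsManifold 𝓘(ℝ, EP) ∞ P]

namespace PrincipalBundle

variable {B : PrincipalBundle EK K M EP P} {f : P → LieAlg EK K}

variable (B) in
/-- A smooth section of the adjoint bundle, as an equivariant map on the total space of the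
principal bundle. -/
structure IsAdSection (f : P → LieAlg EK K) : Prop where
  act : ∀ p g, f (B.act p g) = Ad g⁻¹ (f p)
  lieAt : ∀ {s : M → P} {U : Set M}, B.IsGauge s U → ∀ {x}, x ∈ U → LieAt ∞ (fun y ↦ f (s y)) x

variable (A : B.Connection)

/-- The derivative of a parallel section of the adjoint bundle along the total space: it is
`w ↦ -[A w, f]`, and so vanishes on horizontal vectors. -/
theorem IsAdSection.hasMFDerivAt_of_parallel (hf : B.IsAdSection f)
    (hpar : ∀ (s : M → P) (U : Set M), B.IsGauge s U → ∀ x ∈ U, ∀ v,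
      lieCov (A.gaugeForm s) (fun y ↦ f (s y)) x v = 0) (q : P) :
    HasMFDerivAt 𝓘(ℝ, EP) 𝓘(ℝ, EK) (M' := EK) f q
      (-((lieE EK K).flip (f q) : EK →L[ℝ] EK) ∘L A.formE q) := by
  obtain ⟨U, hU, hx, s, hs, hp, τ, hτs, hτ, -⟩ := B.locallyTrivial (B.proj q)
  have hUp : IsOpen (B.proj ⁻¹' U) := hU.preimage B.contMDiff_proj.continuous
  have hg : B.IsGauge s U := ⟨hU, hs, hp⟩
  have dτ : MDifferentiableAt 𝓘(ℝ, EP) 𝓘(ℝ, EK) τ q :=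
    (hτs.contMDiffAt (hUp.mem_nhds hx)).mdifferentiableAt (by simp)
  have hk : MDifferentiableAt 𝓘(ℝ, EP) 𝓘(ℝ, EK) (fun y ↦ (τ q)⁻¹ * τ y) q :=
    MDifferentiableAt.comp q (((contMDiff_mul_left (I := 𝓘(ℝ, EK)) (n := ∞)
      (a := (τ q)⁻¹)).mdifferentiable (by simp)) _) dτ
  obtain ⟨k', hk'⟩ : ∃ k' : TangentSpace 𝓘(ℝ, EP) q →L[ℝ] EK,
    HasMFDerivAt 𝓘(ℝ, EP) 𝓘(ℝ, EK) (fun y ↦ (τ q)⁻¹ * τ y) q k' := ⟨_, hk.hasMFDerivAt⟩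
  let π' : EP →L[ℝ] R6 := mfderiv 𝓘(ℝ, EP) (𝓡 6) B.proj q
  let s' : R6 →L[ℝ] EP := mfderiv (𝓡 6) 𝓘(ℝ, EP) s (B.proj q)
  have dπ : HasMFDerivAt 𝓘(ℝ, EP) (𝓡 6) B.proj q π' :=
    (B.contMDiff_proj.mdifferentiable (by simp) q).hasMFDerivAt
  have ds : HasMFDerivAt (𝓡 6) 𝓘(ℝ, EP) s (B.proj q) s' :=
    ((hg.contMDiffAt hx).mdifferentiableAt (by simp)).hasMFDerivAt
  have dσ : HasMFDerivAt 𝓘(ℝ, EP) 𝓘(ℝ, EP) (fun y ↦ s (B.proj y)) q (s' ∘L π') :=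
    HasMFDerivAt.comp q ds dπ
  -- Near `q` the identity is `y ↦ s (π y) · τ y`; this expresses the connection form at `q` by the
  -- local connection form and the logarithmic derivative of `τ`.
  obtain ⟨d, hd, hd'⟩ := A.exists_hasMFDerivAt_act dσ hk'
  have hid : (fun y ↦ B.act (s (B.proj y)) (τ y)) =ᶠ[𝓝 q] id := by
    filter_upwards [hUp.mem_nhds hx] with y hy using hτ y hy
  have hd1 : d = ContinuousLinearMap.id ℝ EP :=
    hd.mfderiv.symm.trans ((hid.mfderiv_eq).trans mfderiv_id)
  -- the section in the gauge
  let F : M → EK := fun y ↦ f (s y)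
  have hF : MDifferentiableAt (𝓡 6) 𝓘(ℝ, EK) F (B.proj q) :=
    LieAt.lieDiffAt (n := ∞) (by simp) (hf.lieAt hg hx)
  have hFd : ∀ v, mvfderiv (𝓡 6) F (B.proj q) v = -⁅A.gaugeForm s (B.proj q) v, f (s (B.proj q))⁆ :=
    fun v ↦ eq_neg_of_add_eq_zero_left (hpar s U hg _ hx v)
  have dF : MDifferentiableAt 𝓘(ℝ, EP) 𝓘(ℝ, EK) (fun y ↦ F (B.proj y)) q :=
    hF.comp q dπ.mdifferentiableAt
  have hτ' : MDifferentiableAt 𝓘(ℝ, EP) 𝓘(ℝ, EK →L[ℝ] EK) (fun y ↦ adE EK (τ y)⁻¹) q :=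
    MDifferentiableAt.comp q (I' := 𝓘(ℝ, EK)) (g := fun g : K ↦ adE EK g⁻¹)
      ((contMDiff_adE.comp (contMDiff_inv 𝓘(ℝ, EK) ∞)).mdifferentiable (by simp) _) dτ
  let fE : P → EK := f
  have he : fE =ᶠ[𝓝 q] fun y ↦ adE EK (τ y)⁻¹ (F (B.proj y)) := by
    filter_upwards [hUp.mem_nhds hx] with y hy
    have h := hf.act (s (B.proj y)) (τ y)
    rw [hτ y hy] at h
    exact h
  have hm : MDifferentiableAt 𝓘(ℝ, EP) 𝓘(ℝ, EK) fE q :=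
    (MDifferentiableAt.bilin (F' := EK) (F'' := EK) (ContinuousLinearMap.id ℝ (EK →L[ℝ] EK)) hτ'
      dF).congr_of_eventuallyEq he
  refine hm.hasMFDerivAt.congr_mfderiv (ContinuousLinearMap.ext fun w ↦ ?_)
  have h1 : mvfderiv 𝓘(ℝ, EP) fE q w =
      mvfderiv 𝓘(ℝ, EP) (fun y ↦ adE EK (τ y)⁻¹ (F (B.proj y))) q w :=
    congrArg (fun T ↦ T w) (mvfderiv_congr (F := EK) he)
  have h2 := mvfderiv_bilin (F' := EK) (F'' := EK) (ContinuousLinearMap.id ℝ (EK →L[ℝ] EK)) hτ' dF w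
  have h3 := mvfderiv_clm_apply (F' := EK) (ContinuousLinearMap.apply ℝ EK (F (B.proj q))) hτ' w
  have h4 := mvfderiv_adE_inv_comp_logDeriv hk' (F (B.proj q)) w
  have h5 : mvfderiv 𝓘(ℝ, EP) (fun y ↦ F (B.proj y)) q w = mvfderiv (𝓡 6) F (B.proj q) (π' w) :=
    congrArg (fun T : EP →L[ℝ] EK ↦ T w) (HasMFDerivAt.comp q hF.hasMFDerivAt dπ).mfderiv
  have h6 : A.formE q w = adE EK (τ q)⁻¹ (A.gaugeForm s (B.proj q) (π' w)) + k' w := by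
    have h := hd' w
    rw [hd1, hτ q hx] at h
    exact h
  have h7 : Ad (τ q)⁻¹ (f (s (B.proj q))) = f q := he.self_of_nhds.symm
  have h8 : adE EK (τ q)⁻¹ (mvfderiv 𝓘(ℝ, EP) (fun y ↦ F (B.proj y)) q w) =
      -lieE EK K (adE EK (τ q)⁻¹ (A.gaugeForm s (B.proj q) (π' w))) (f q) := by
    refine (congrArg (adE EK (τ q)⁻¹) (h5.trans (hFd _))).trans ?_
    refine (map_neg (adE EK (τ q)⁻¹) _).trans (congrArg Neg.neg ?_)
    refine (Ad_lie _ _ _).trans ?_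
    rw [h7]
    rfl
  refine Eq.trans (b := -lieE EK K (A.formE q w) (f q)) ?_ rfl
  have hadd : ∀ u u' v : EK, -lieE EK K (u + u') v = -lieE EK K u' v + -lieE EK K u v :=
    fun u u' v ↦ by
      rw [map_add, _root_.add_apply]
      abel
  refine h1.trans (h2.trans (Eq.trans ?_
    ((congrArg (fun z : EK ↦ -lieE EK K z (f q)) h6).trans (hadd _ _ _)).symm))
  refine congrArg₂ (· + ·) (h3.symm.trans (h4.trans ?_)) h8
  exact congrArg (fun z : EK ↦ -lieE EK K (k' w) z) h7

/-- A parallel section is constant along horizontal paths. -/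
theorem IsAdSection.eq_of_horizontalStep (hf : B.IsAdSection f)
    (hpar : ∀ (s : M → P) (U : Set M), B.IsGauge s U → ∀ x ∈ U, ∀ v,
      lieCov (A.gaugeForm s) (fun y ↦ f (s y)) x v = 0) {p q : P} (h : A.HorizontalStep p q) :
    f q = f p := by
  obtain ⟨γ, hγ, h0, h1, hor⟩ := h
  let fE : P → EK := f
  have key : ∀ t ∈ Set.Icc (0 : ℝ) 1, HasDerivWithinAt (fun t ↦ fE (γ t)) 0 (Set.Icc 0 1) t := by
    intro t ht
    have h2 : HasMFDerivAt 𝓘(ℝ, EP) 𝓘(ℝ, EK) fE (γ t)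
      (-((lieE EK K).flip (f (γ t)) : EK →L[ℝ] EK) ∘L A.formE (γ t)) :=
      hf.hasMFDerivAt_of_parallel A hpar (γ t)
    have h3 := HasMFDerivAt.comp_hasMFDerivWithinAt t h2
      ((hγ.mdifferentiableOn (by simp) t ht).hasMFDerivWithinAt)
    let L : ℝ →L[ℝ] EK := (-((lieE EK K).flip (f (γ t)) : EK →L[ℝ] EK) ∘L A.formE (γ t)) ∘L
      (show ℝ →L[ℝ] EP from mfderivWithin 𝓘(ℝ, ℝ) 𝓘(ℝ, EP) γ (Set.Icc 0 1) t)
    have h4 : HasFDerivWithinAt (fun t ↦ fE (γ t)) L (Set.Icc 0 1) t :=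
      hasMFDerivWithinAt_iff_hasFDerivWithinAt.1 h3
    refine h4.hasDerivWithinAt.congr_deriv ?_
    have h5 : A.formE (γ t) (mfderivWithin 𝓘(ℝ, ℝ) 𝓘(ℝ, EP) γ (Set.Icc 0 1) t (1 : ℝ)) = 0 :=
      hor t ht
    refine Eq.trans (b := -lieE EK K (A.formE (γ t)
      (mfderivWithin 𝓘(ℝ, ℝ) 𝓘(ℝ, EP) γ (Set.Icc 0 1) t (1 : ℝ))) (f (γ t))) rfl ?_
    rw [h5, map_zero]
    exact neg_zero
  have h2 := constant_of_derivWithin_zero (fun t ht ↦ (key t ht).differentiableWithinAt)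
    (fun t ht ↦ (key t (Set.Ico_subset_Icc_self ht)).derivWithin
      (uniqueDiffOn_Icc zero_lt_one t (Set.Ico_subset_Icc_self ht))) 1 (by simp)
  rw [h0, h1] at h2
  exact h2

/-- A parallel section of the adjoint bundle vanishes if the connection is irreducible. -/
theorem IsAdSection.eq_zero_of_parallel (hf : B.IsAdSection f)
    (hss : LieAlgebra.IsSemisimple ℝ (LieAlg EK K)) (hirr : A.IsIrreducible)
    (hpar : ∀ (s : M → P) (U : Set M), B.IsGauge s U → ∀ x ∈ U, ∀ v,
      lieCov (A.gaugeForm s) (fun y ↦ f (s y)) x v = 0) (p : P) : f p = 0 := by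
  have h1 : ∀ q, Relation.ReflTransGen A.HorizontalStep p q → f q = f p := fun q hq ↦ by
    induction hq with
    | refl => rfl
    | tail _ h ih => exact (hf.eq_of_horizontalStep A hpar h).trans ih
  have h2 : ∀ g : K, Ad g (f p) = f p := fun g ↦ by
    have h : g ∈ A.holonomy p := by rw [hirr p]; trivial
    conv_lhs => rw [← h1 _ h, hf.act]
    exact Ad_apply_Ad_inv g _
  -- a vector fixed by the adjoint action is central, since the derivative of `Ad` is the bracket
  have h3 : f p ∈ LieAlgebra.center ℝ (LieAlg EK K) := by
    rw [LieModule.mem_maxTrivSubmodule]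
    exact fun v ↦ lie_eq_zero_of_Ad_eq h2 v
  rw [LieAlgebra.center_eq_bot] at h3
  exact (LieSubmodule.mem_bot _).1 h3

end PrincipalBundle

end Parallel

/-! ### Harmonic sections of the adjoint bundle are parallel -/

section Harmonic

variable {M : Type*} [TopologicalSpace M] [ChartedSpace R6 M] [IsManifold (𝓡 6) ∞ M]
  [RiemannianBundle (fun x : M ↦ TangentSpace (𝓡 6) x)]
  [IsContMDiffRiemannianBundle (𝓡 6) ∞ R6 (fun x : M ↦ TangentSpace (𝓡 6) x)]
  {EK : Type*} [NormedAddCommGroup EK] [NormedSpace ℝ EK] [FiniteDimensional ℝ EK]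
  {K : Type*} [TopologicalSpace K] [Group K] [ChartedSpace EK K] [LieGroup 𝓘(ℝ, EK) ∞ K]
  {EP : Type*} [NormedAddCommGroup EP] [NormedSpace ℝ EP]
  {P : Type*} [TopologicalSpace P] [ChartedSpace EP P] [IsManifold 𝓘(ℝ, EP) ∞ P]

theorem IsCoordFrame.mono {E : Fin 6 → Π x : M, TangentSpace (𝓡 6) x} {U V : Set M}
    (hE : IsCoordFrame E U) (hV : IsOpen V) (h : V ⊆ U) : IsCoordFrame E V where
  isOpen := hV
  contMDiffAt i x hx := hE.contMDiffAt i x (h hx)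
  linearIndependent x hx := hE.linearIndependent x (h hx)
  bracket i j x hx := hE.bracket i j x (h hx)

namespace PrincipalBundle

variable {B : PrincipalBundle EK K M EP P} {f : P → LieAlg EK K}

/-- The group acts transitively on the fibres. -/
theorem exists_act_eq {p q : P} (h : B.proj p = B.proj q) : ∃ g, q = B.act p g := by
  obtain ⟨U, hU, hx, s, -, hp, τ, -, hτ, -⟩ := B.locallyTrivial (B.proj p)
  have e1 := hτ p hx
  have e2 := hτ q (by rw [Set.mem_preimage, ← h]; exact hx)
  rw [← h] at e2
  refine ⟨(τ p)⁻¹ * τ q, ?_⟩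
  calc q = B.act (s (B.proj p)) (τ p * ((τ p)⁻¹ * τ q)) := by rw [mul_inv_cancel_left, e2]
    _ = _ := by rw [B.act_mul, e1]

variable (B) in
/-- A section of the adjoint bundle which is annihilated by the connection Laplacian. The Laplacian
is written in a gauge and a coordinate frame. -/
def IsHarmonic (A : B.Connection) (f : P → LieAlg EK K) : Prop :=
  ∀ (s : M → P) (U : Set M), B.IsGauge s U → ∀ (E : Fin 6 → Π x : M, TangentSpace (𝓡 6) x)
    (V : Set M), IsCoordFrame E V → V ⊆ U → ∀ x ∈ V,
    ∑ i, (lieCov (A.gaugeForm s) (fun y ↦ lieCov (A.gaugeForm s) (fun z ↦ f (s z)) y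
        (dualFrame E i y)) x (E i x) +
      logVol E i x • lieCov (A.gaugeForm s) (fun z ↦ f (s z)) x (dualFrame E i x)) = 0

/-- On a compact manifold, harmonic sections of the adjoint bundle are parallel: by the Bochner
formula their pointwise norm is subharmonic, hence locally constant by the maximum principle. -/
theorem IsAdSection.parallel_of_isHarmonic [T2Space M] [CompactSpace M] {A : B.Connection}
    (hf : B.IsAdSection f) (hharm : B.IsHarmonic A f)
    (b : EK →L[ℝ] EK →L[ℝ] ℝ) (hsymm : ∀ v w, b v w = b w v) (hpos : ∀ v, v ≠ 0 → 0 < b v v)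
    (hb : ∀ (g : K) v w, b (adE EK g v) (adE EK g w) = b v w) {s : M → P} {U : Set M}
    (hs : B.IsGauge s U) {x : M} (hx : x ∈ U) (v : TangentSpace (𝓡 6) x) :
    lieCov (A.gaugeForm s) (fun y ↦ f (s y)) x v = 0 := by
  have hlie := form_lie_of_Ad_invariant b hb
  have hnn : ∀ v, 0 ≤ b v v := fun v ↦ by
    by_cases h : v = 0
    · simp [h]
    · exact (hpos v h).le
  -- the squared norm as a function on the base
  have hfib : ∀ x : M, ∃ p : P, B.proj p = x := fun x ↦ by
    obtain ⟨U, -, hx, s, -, hp, -⟩ := B.locallyTrivial x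
    exact ⟨s x, hp x hx⟩
  choose σ hσ using hfib
  let u : M → ℝ := fun x ↦ b (f (σ x)) (f (σ x))
  have hu : ∀ (s : M → P) (U : Set M), B.IsGauge s U → ∀ y ∈ U, u y = b (f (s y)) (f (s y)) := by
    intro s U hs y hy
    obtain ⟨g, hg⟩ := B.exists_act_eq (p := s y) (q := σ y) (by rw [hs.proj_eq y hy, hσ])
    show b (f (σ y)) (f (σ y)) = _
    rw [hg, hf.act]
    exact hb g⁻¹ _ _
  have hud : ∀ y, ContMDiffAt (𝓡 6) 𝓘(ℝ, ℝ) ∞ u y := by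
    intro y
    obtain ⟨s, U, hs, hy, -⟩ := B.exists_isGauge y ⟨σ y, hσ y⟩
    have h := ContMDiffAt.bilin (F := EK) (F' := EK) b (hf.lieAt hs hy) (hf.lieAt hs hy)
    refine h.congr_of_eventuallyEq ?_
    filter_upwards [hs.isOpen.mem_nhds hy] with z hz using hu s U hs z hz
  have hcont : Continuous u := continuous_iff_continuousAt.2 fun y ↦ (hud y).continuousAt
  -- the Bochner formula
  have hboch : ∀ (s : M → P) (U : Set M), B.IsGauge s U →
      ∀ (E : Fin 6 → Π x : M, TangentSpace (𝓡 6) x) (V : Set M), IsCoordFrame E V → V ⊆ U →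
      ∀ x ∈ V, ∑ i, (mvfderiv (𝓡 6) (fun y ↦ mvfderiv (𝓡 6) u y (dualFrame E i y)) x (E i x) +
        logVol E i x * mvfderiv (𝓡 6) u x (dualFrame E i x)) =
        2 * ∑ k, b (lieCov (A.gaugeForm s) (fun y ↦ f (s y)) x (frame M x k))
          (lieCov (A.gaugeForm s) (fun y ↦ f (s y)) x (frame M x k)) := by
    intro s U hs E V hE hV x hx
    rw [← hE.laplacian_form hx (fun y hy ↦ A.formAt_gaugeForm hs (hV hy))
      (fun y hy ↦ hf.lieAt hs (hV hy)) b hsymm hlie (hharm s U hs E V hE hV x hx)]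
    have h1 : ∀ y ∈ V, mvfderiv (𝓡 6) u y = mvfderiv (𝓡 6) (fun z ↦ b (f (s z)) (f (s z))) y := by
      intro y hy
      refine mvfderiv_congr ?_
      filter_upwards [hE.isOpen.mem_nhds hy] with z hz using hu s U hs z (hV hz)
    refine Finset.sum_congr rfl fun i _ ↦ ?_
    rw [h1 x hx]
    congr 1
    refine congrArg (fun T : TangentSpace (𝓡 6) x →L[ℝ] ℝ ↦ T (E i x)) (mvfderiv_congr ?_)
    filter_upwards [hE.isOpen.mem_nhds hx] with y hy
    rw [h1 y hy]
  -- the squared norm is constant on the component of `x`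
  have hconst : ∀ᶠ y in 𝓝 x, u y = u x := by
    have := ChartedSpace.locallyConnectedSpace R6 M
    set C := connectedComponent x with hC
    have hCo : IsOpen C := isOpen_connectedComponent
    have hxC : x ∈ C := mem_connectedComponent
    obtain ⟨x₀, hx₀, hmax⟩ := isClosed_connectedComponent.isCompact.exists_isMaxOn ⟨x, hxC⟩
      hcont.continuousOn
    let Z : Set M := {y | y ∈ C ∧ u y = u x₀}
    -- the set where the maximum over the component is attained is closed, and open by the maximum
    -- principle
    have hZ : IsClopen Z := by
      refine ⟨isClosed_connectedComponent.inter (isClosed_eq hcont continuous_const), ?_⟩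
      refine isOpen_iff_mem_nhds.2 fun y hy ↦ ?_
      obtain ⟨s, U, hs, hyU, -⟩ := B.exists_isGauge y ⟨σ y, hσ y⟩
      obtain ⟨E, hE, hchart⟩ := exists_isCoordFrame y
      let Ω : Set M := (chartAt R6 y).source ∩ (C ∩ U)
      have hΩ : IsOpen Ω := (chartAt R6 y).open_source.inter (hCo.inter hs.isOpen)
      have h := eventually_eq_of_laplacian_nonneg hE hchart hΩ Set.inter_subset_left
        ⟨mem_chart_source R6 y, hy.1, hyU⟩ (fun z _ ↦ hud z) (fun z hz ↦ by
          rw [hboch s U hs E Ω (hE.mono hΩ Set.inter_subset_left) (fun w hw ↦ hw.2.2) z hz]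
          exact mul_nonneg two_pos.le (Finset.sum_nonneg fun k _ ↦ hnn _))
        (fun z hz ↦ by
          rw [hy.2]
          exact hmax hz.2.1)
      filter_upwards [h, hCo.mem_nhds hy.1] with z hz hzC
      exact ⟨hzC, hz.trans hy.2⟩
    have hsub := isPreconnected_connectedComponent.subset_isClopen hZ ⟨x₀, hx₀, hx₀, rfl⟩
    filter_upwards [hCo.mem_nhds hxC] with y hy
    rw [(hsub hy).2, (hsub hxC).2]
  -- now the left-hand side of the Bochner formula vanishes at `x`
  obtain ⟨E, hE, -⟩ := exists_isCoordFrame x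
  let V : Set M := (chartAt R6 x).source ∩ U
  have hV : IsOpen V := (chartAt R6 x).open_source.inter hs.isOpen
  have h1 := hboch s U hs E V (hE.mono hV Set.inter_subset_left) Set.inter_subset_right x
    ⟨mem_chart_source R6 x, hx⟩
  have h2 : ∀ᶠ y in 𝓝 x, mvfderiv (𝓡 6) u y = 0 := by
    filter_upwards [hconst.eventually_nhds] with y hy
    have h : u =ᶠ[𝓝 y] fun _ ↦ u x := hy
    rw [mvfderiv_congr h, mvfderiv_const]
  have h3 : ∀ i, mvfderiv (𝓡 6) (fun y ↦ mvfderiv (𝓡 6) u y (dualFrame E i y)) x = 0 := fun i ↦ by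
    have h : (fun y ↦ mvfderiv (𝓡 6) u y (dualFrame E i y)) =ᶠ[𝓝 x] fun _ ↦ (0 : ℝ) := by
      filter_upwards [h2] with y hy
      rw [hy, zero_apply]
    rw [mvfderiv_congr h, mvfderiv_const]
  simp only [h3, h2.self_of_nhds, zero_apply, mul_zero, add_zero, Finset.sum_const_zero] at h1
  have h4 := (Finset.sum_eq_zero_iff_of_nonneg fun k _ ↦ hnn _).1
    ((mul_eq_zero.1 h1.symm).resolve_left two_ne_zero)
  have h5 : lieCov (A.gaugeForm s) (fun y ↦ f (s y)) x = 0 := by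
    refine (frame M x).toBasis.ext fun k ↦ ?_
    by_contra hne
    rw [LinearMap.zero_apply, OrthonormalBasis.coe_toBasis] at hne
    exact (hpos _ hne).ne' (h4 k (Finset.mem_univ k))
  rw [h5, LinearMap.zero_apply]

end PrincipalBundle

end Harmonic

/-! ### The kernel of the Dirac operator -/

section Kernel

variable {M : Type*} [TopologicalSpace M] [ChartedSpace R6 M] [IsManifold (𝓡 6) ∞ M]
  [RiemannianBundle (fun x : M ↦ TangentSpace (𝓡 6) x)]
  [IsContMDiffRiemannianBundle (𝓡 6) ∞ R6 (fun x : M ↦ TangentSpace (𝓡 6) x)]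
  {EK : Type*} [NormedAddCommGroup EK] [NormedSpace ℝ EK] [FiniteDimensional ℝ EK]
  {K : Type*} [TopologicalSpace K] [Group K] [ChartedSpace EK K] [LieGroup 𝓘(ℝ, EK) ∞ K]
  {EP : Type*} [NormedAddCommGroup EP] [NormedSpace ℝ EP]
  {P : Type*} [TopologicalSpace P] [ChartedSpace EP P] [IsManifold 𝓘(ℝ, EP) ∞ P]
  {S : M → Type*} [TopologicalSpace (TotalSpace R8 S)]
    [∀ x, NormedAddCommGroup (S x)] [∀ x, InnerProductSpace ℝ (S x)] [FiberBundle R8 S]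
    [VectorBundle ℝ R8 S] [ContMDiffVectorBundle ∞ R8 S (𝓡 6)]
    [IsContMDiffRiemannianBundle (𝓡 6) ∞ R8 S]
  {B : PrincipalBundle EK K M EP P} {η : Π x : M, B.Fib x → S x ⊗[ℝ] LieAlg EK K}
  {φ : Π x : M, S x}

/-- The pairing of a spinor field with a section of `SM ⊗ Ad_P`, a section of the adjoint bundle. -/
def pairSection (φ : Π x : M, S x) (η : Π x : M, B.Fib x → S x ⊗[ℝ] LieAlg EK K) (p : P) :
    LieAlg EK K :=
  pair (φ (B.proj p)) (η (B.proj p) ⟨p, rfl⟩)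

theorem pairSection_eq (x : M) (p : B.Fib x) : pairSection φ η p.1 = pair (φ x) (η x p) := by
  obtain ⟨p, rfl⟩ := p
  rfl

theorem pairSection_gauge {s : M → P} {U : Set M} (hs : B.IsGauge s U) {x : M} (hx : x ∈ U) :
    pairSection φ η (s x) = pair (φ x) (B.inGauge η s x) := by
  rw [hs.inGauge_eq hx]
  exact pairSection_eq x (hs.point hx)

theorem isAdSection_pairSection (hη : η ∈ B.adSpinors S) (hφ : ∀ x, SpinorAt ∞ φ x) :
    B.IsAdSection (pairSection φ η) where
  act p g := by
    let q : B.Fib (B.proj p) := ⟨p, rfl⟩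
    have h1 : pairSection φ η (B.act p g) = pair (φ (B.proj p)) (η (B.proj p) (B.fibAct q g)) :=
      pairSection_eq _ (B.fibAct q g)
    rw [h1, hη.1, pair_lTensor]
    rfl
  lieAt {s U} hs {x} hx := by
    refine ((B.adSpinorAt_inGauge hη hs hx).pair (hφ x)).congr_of_eventuallyEq ?_
    filter_upwards [hs.isOpen.mem_nhds hx] with y hy using pairSection_gauge hs hy

namespace NearlyKahlerStructure

variable (N : NearlyKahlerStructure M S) (A : B.Connection)

/-- Sections of `SM ⊗ Ad_P` with `D^{1/3,A} η = 2 η`. -/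
structure IsEigen (η : Π x : M, B.Fib x → S x ⊗[ℝ] LieAlg EK K) : Prop where
  mem : η ∈ B.adSpinors S
  eq : ∀ (s : M → P) (U : Set M), B.IsGauge s U → ∀ x ∈ U,
    N.gaugeDirac (1 / 3) (A.gaugeForm s) (B.inGauge η s) x = (2 : ℝ) • B.inGauge η s x

variable {N A}

/-- The eigenvalue equation for `D^{1/3,A}` in terms of the spin connection. -/
theorem IsEigen.dirac_eq (h : N.IsEigen A η) {s : M → P} {U : Set M} (hs : B.IsGauge s U) {x : M}
    (hx : x ∈ U) : N.dirac (A.gaugeForm s) (B.inGauge η s) x = (2 : ℝ) • B.inGauge η s x -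
      N.psi x ⊗ₜ[ℝ] pair (N.psi x) (B.inGauge η s x) +
      N.vol x (N.psi x) ⊗ₜ[ℝ] pair (N.vol x (N.psi x)) (B.inGauge η s x) := by
  rw [← h.eq s U hs x hx, gaugeDirac_third]
  abel

/-- The component of a solution of `D^{1/3,A} η = 2 η` along a Killing spinor `φ` is harmonic, if
the spinors `v · φ` are orthogonal to `ψ` and `vol ψ`, so that the extra terms of `D^{1/3,A}` do not
enter the vector part of the equation. -/
theorem IsEigen.isHarmonic {c : ℝ} (h : N.IsEigen A η) (hφ : N.IsKillingSpinor c φ)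
    (hF : ∀ (s : M → P) (U : Set M), B.IsGauge s U →
      ∀ (E : Fin 6 → Π x : M, TangentSpace (𝓡 6) x) (V : Set M), IsCoordFrame E V → V ⊆ U → ∀ x ∈ V,
      ∑ i, ∑ j, N.cliff x (dualFrame E i x) (N.cliff x (dualFrame E j x) (φ x)) ⊗ₜ[ℝ]
        curvature (A.gaugeForm s) x (E i x) (E j x) = 0)
    (h1 : ∀ x v, inner ℝ (N.cliff x v (φ x)) (N.psi x) = (0 : ℝ))
    (h2 : ∀ x v, inner ℝ (N.cliff x v (φ x)) (N.vol x (N.psi x)) = (0 : ℝ))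
    (hsc : ∀ (s : M → P) (U : Set M), B.IsGauge s U → ∀ x ∈ U,
      (2 - 4 * c) • ((-6 * c) • pair (φ x) (B.inGauge η s x) -
        pair (φ x) (N.dirac (A.gaugeForm s) (B.inGauge η s) x)) = 0) :
    B.IsHarmonic A (pairSection φ η) := by
  intro s U hs E V hE hV x hx
  have h3 := harmonic_pair hφ hE hx (fun y hy ↦ A.formAt_gaugeForm hs (hV hy))
    (fun y hy ↦ B.adSpinorAt_inGauge h.mem hs (hV hy)) (hF s U hs E V hE hV x hx)
    (fun y hy v ↦ by
      rw [h.dirac_eq hs (hV hy)]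
      simp only [map_add, map_sub, map_smul, pair_tmul, h1, h2, zero_smul, sub_zero, add_zero])
    (hsc s U hs x (hV hx))
  have h4 : ∀ y ∈ V, lieCov (A.gaugeForm s) (fun z ↦ pairSection φ η (s z)) y =
      lieCov (A.gaugeForm s) (fun z ↦ pair (φ z) (B.inGauge η s z)) y := fun y hy ↦ by
    refine LinearMap.ext fun v ↦ lieCov_congr ?_ v
    filter_upwards [hE.isOpen.mem_nhds hy] with z hz using pairSection_gauge hs (hV hz)
  rw [← h3]
  refine Finset.sum_congr rfl fun i _ ↦ ?_
  rw [h4 x hx]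
  congr 1
  refine lieCov_congr ?_ _
  filter_upwards [hE.isOpen.mem_nhds hx] with y hy
  rw [h4 y hy]

/-- The instanton equation also holds for the second Killing spinor. -/
theorem sum_curvature_vol_eq_zero {a : Π x : M, TangentSpace (𝓡 6) x →L[ℝ] LieAlg EK K}
    {E : Fin 6 → Π x : M, TangentSpace (𝓡 6) x} {x : M}
    (h : ∑ i, ∑ j, N.cliff x (dualFrame E i x) (N.cliff x (dualFrame E j x) (N.psi x)) ⊗ₜ[ℝ]
      curvature a x (E i x) (E j x) = 0) :
    ∑ i, ∑ j, N.cliff x (dualFrame E i x) (N.cliff x (dualFrame E j x) (N.vol x (N.psi x))) ⊗ₜ[ℝ]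
      curvature a x (E i x) (E j x) = 0 := by
  have h1 := congrArg (LinearMap.rTensor (LieAlg EK K) (N.vol x).toLinearMap) h
  simpa only [map_sum, map_zero, LinearMap.rTensor_tmul, ContinuousLinearMap.coe_coe,
    (N.isSpinFibre x).vol_mul, map_neg, neg_neg] using h1

/-- For an irreducible instanton, the components along `ψ` and `vol ψ` of a section in the kernel of
`D^{1/3,A} - 2` vanish. -/
theorem IsEigen.pair_eq_zero [T2Space M] [CompactSpace M] (h : N.IsEigen A η)
    (hss : LieAlgebra.IsSemisimple ℝ (LieAlg EK K))
    (hAd : ∃ b : LieAlg EK K →ₗ[ℝ] LieAlg EK K →ₗ[ℝ] ℝ,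
      (∀ v w, b v w = b w v) ∧ (∀ v, v ≠ 0 → 0 < b v v) ∧
      ∀ (g : K) v w, b (Ad g v) (Ad g w) = b v w)
    (hinst : N.IsInstanton A) (hirr : A.IsIrreducible) (x : M) (p : B.Fib x) :
    pair (N.psi x) (η x p) = 0 ∧ pair (N.vol x (N.psi x)) (η x p) = 0 := by
  obtain ⟨b, hsymm, hpos, hb⟩ := hAd
  let b' : EK →L[ℝ] EK →L[ℝ] ℝ :=
    LinearMap.toContinuousBilinearMap (show EK →ₗ[ℝ] EK →ₗ[ℝ] ℝ from b)
  have hsymm' : ∀ v w : EK, b' v w = b' w v := fun v w ↦ hsymm v w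
  have hpos' : ∀ v : EK, v ≠ 0 → 0 < b' v v := fun v hv ↦ hpos v hv
  have hb' : ∀ (g : K) (v w : LieAlg EK K), b' (Ad g v) (Ad g w) = b' v w := fun g v w ↦ hb g v w
  have hF : ∀ (s : M → P) (U : Set M), B.IsGauge s U →
      ∀ (E : Fin 6 → Π x : M, TangentSpace (𝓡 6) x) (V : Set M), IsCoordFrame E V → V ⊆ U → ∀ x ∈ V,
      ∑ i, ∑ j, N.cliff x (dualFrame E i x) (N.cliff x (dualFrame E j x) (N.psi x)) ⊗ₜ[ℝ]
        curvature (A.gaugeForm s) x (E i x) (E j x) = 0 := by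
    intro s U hs E V hE hV x hx
    have h1 := hinst s U hs x (hV hx)
    rw [N.twoFormPsi_curvature_eq hE hx (A.formAt_gaugeForm hs (hV hx)).formDiffAt] at h1
    exact (smul_eq_zero.1 h1).resolve_left (by norm_num)
  have key : ∀ φ : Π x : M, S x, (∀ x, SpinorAt ∞ φ x) → B.IsHarmonic A (pairSection φ η) →
      pair (φ x) (η x p) = 0 := by
    intro φ hφ hharm
    have hf := isAdSection_pairSection h.mem hφ
    rw [← pairSection_eq x p]
    exact hf.eq_zero_of_parallel A hss hirr (fun s U hs y hy v ↦
      hf.parallel_of_isHarmonic hharm b' hsymm' hpos' hb' hs hy v) p.1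
  have hS := N.isSpinFibre
  constructor
  -- For `ψ` the factor `2 - 4c` vanishes. For `vol ψ` the scalar part of the equation states that
  -- the component of `D^A η` is `2 + 1 = -6c` times that of `η`.
  · refine key _ N.contMDiff_psi (h.isHarmonic N.isKillingSpinor_psi hF
      (fun x v ↦ (hS x).inner_mul_psi v) (fun x v ↦ (hS x).inner_mul_psi_vol v)
      fun s U hs y hy ↦ ?_)
    norm_num
  · refine key (fun x ↦ N.vol x (N.psi x)) (fun x ↦ vol_contMDiffAt (N.contMDiff_psi x))
      (h.isHarmonic (φ := fun x ↦ N.vol x (N.psi x)) N.isKillingSpinor_vol ?_ ?_ ?_ ?_)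
    · exact fun s U hs E V hE hV x hx ↦ sum_curvature_vol_eq_zero (hF s U hs E V hE hV x hx)
    · exact fun x v ↦ (hS x).inner_mul_vol_psi v
    · exact fun x v ↦ (hS x).inner_mul_vol_vol v
    · intro s U hs y hy
      have h0 : inner ℝ (N.vol y (N.psi y)) (N.psi y) = (0 : ℝ) := by
        rw [real_inner_comm, (hS y).inner_psi_vol]
      rw [h.dirac_eq hs hy]
      simp only [map_add, map_sub, map_smul, pair_tmul, h0, (hS y).inner_vol_unit]
      module

end NearlyKahlerStructure

end Kernel

/-! ### Infinitesimal deformations and the kernel -/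

section Deformations

variable {M : Type*} [TopologicalSpace M] [ChartedSpace R6 M] [IsManifold (𝓡 6) ∞ M]
  [RiemannianBundle (fun x : M ↦ TangentSpace (𝓡 6) x)]
  [IsContMDiffRiemannianBundle (𝓡 6) ∞ R6 (fun x : M ↦ TangentSpace (𝓡 6) x)]
  {EK : Type*} [NormedAddCommGroup EK] [NormedSpace ℝ EK] [FiniteDimensional ℝ EK]
  {K : Type*} [TopologicalSpace K] [Group K] [ChartedSpace EK K] [LieGroup 𝓘(ℝ, EK) ∞ K]
  {EP : Type*} [NormedAddCommGroup EP] [NormedSpace ℝ EP]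
  {P : Type*} [TopologicalSpace P] [ChartedSpace EP P] [IsManifold 𝓘(ℝ, EP) ∞ P]
  {S : M → Type*} [TopologicalSpace (TotalSpace R8 S)]
    [∀ x, NormedAddCommGroup (S x)] [∀ x, InnerProductSpace ℝ (S x)] [FiberBundle R8 S]
    [VectorBundle ℝ R8 S] [ContMDiffVectorBundle ∞ R8 S (𝓡 6)]
    [IsContMDiffRiemannianBundle (𝓡 6) ∞ R8 S]

namespace NearlyKahlerStructure

variable (N : NearlyKahlerStructure M S)

section Pointwise

variable {x : M} {a ε : Π x : M, TangentSpace (𝓡 6) x →L[ℝ] LieAlg EK K}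

theorem oneFormPsi_add (L L' : TangentSpace (𝓡 6) x →L[ℝ] LieAlg EK K) :
    N.oneFormPsi x (L + L') = N.oneFormPsi x L + N.oneFormPsi x L' := by
  simp only [oneFormPsi, add_apply, TensorProduct.tmul_add, Finset.sum_add_distrib]

theorem oneFormPsi_smul (c : ℝ) (L : TangentSpace (𝓡 6) x →L[ℝ] LieAlg EK K) :
    N.oneFormPsi x (c • L) = c • N.oneFormPsi x L := by
  simp only [oneFormPsi, smul_apply, TensorProduct.tmul_smul, Finset.smul_sum]

theorem oneFormPsi_comp (T : LieAlg EK K →L[ℝ] LieAlg EK K)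
    (L : TangentSpace (𝓡 6) x →L[ℝ] LieAlg EK K) :
    N.oneFormPsi x (T ∘L L) = LinearMap.lTensor (S x) T.toLinearMap (N.oneFormPsi x L) := by
  simp only [oneFormPsi, map_sum, LinearMap.lTensor_tmul]
  rfl

/-- The one-form `v ↦ (v · ψ, z)` whose Clifford product with `ψ` is the component of `z` orthogonal
to `ψ` and `vol ψ`. -/
def formPart (z : S x ⊗[ℝ] LieAlg EK K) : TangentSpace (𝓡 6) x →L[ℝ] LieAlg EK K where
  toFun v := pair (N.cliff x v (N.psi x)) z
  map_add' v w := by simp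
  map_smul' c v := by simp
  cont := by
    have : FiniteDimensional ℝ (TangentSpace (𝓡 6) x) := inferInstanceAs (FiniteDimensional ℝ R6)
    let c : TangentSpace (𝓡 6) x →ₗ[ℝ] S x :=
      (LinearMap.flip (ContinuousLinearMap.coeLM ℝ ∘ₗ (N.cliff x).toLinearMap)) (N.psi x)
    let L : TangentSpace (𝓡 6) x →ₗ[ℝ] EK := pair.flip z ∘ₗ c
    exact L.continuous_of_finiteDimensional

theorem formPart_apply (z : S x ⊗[ℝ] LieAlg EK K) (v : TangentSpace (𝓡 6) x) :
    N.formPart z v = pair (N.cliff x v (N.psi x)) z := rfl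

theorem oneFormPsi_formPart {z : S x ⊗[ℝ] LieAlg EK K} (h : pair (N.psi x) z = 0)
    (h' : pair (N.vol x (N.psi x)) z = 0) : N.oneFormPsi x (N.formPart z) = z := by
  refine ext_pair fun φ ↦ ?_
  have e := congrArg (fun s ↦ pair s z) ((N.isSpinFibre x).expand (frame M x) (N.finrank_eq x) φ)
  simp only [map_add, map_sum, map_smul, LinearMap.add_apply, LinearMap.smul_apply,
    LinearMap.sum_apply, h, h', smul_zero, zero_add] at e
  rw [e]
  simp only [oneFormPsi, map_sum, pair_tmul, formPart_apply]
  exact Finset.sum_congr rfl fun j _ ↦ by rw [real_inner_comm]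

theorem formPart_lTensor (T : LieAlg EK K →L[ℝ] LieAlg EK K) (z : S x ⊗[ℝ] LieAlg EK K) :
    N.formPart (LinearMap.lTensor (S x) T.toLinearMap z) = T ∘L N.formPart z :=
  ContinuousLinearMap.ext fun _ ↦ pair_lTensor _ _ _

/-- Since `(ψ, v · w · ψ) = -(v, w)`, the Clifford product of a two-form with `ψ` is orthogonal to
`ψ`. -/
theorem pair_psi_twoFormPsi_covExtD :
    pair (N.psi x) (N.twoFormPsi x (covExtD a ε x)) = 0 := by
  have hF := N.isSpinFibre x
  simp only [twoFormPsi, map_smul, map_sum, pair_tmul]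
  refine smul_eq_zero_of_right _ (Finset.sum_eq_zero fun j _ ↦ ?_)
  have h1 : ∀ k, inner ℝ (N.psi x) (N.cliff x (frame M x j) (N.cliff x (frame M x k) (N.psi x))) =
      if j = k then (-1 : ℝ) else 0 := fun k ↦ by
    rw [← neg_neg (inner ℝ _ _ : ℝ), ← N.cliff_skew, hF.toIsClifford.inner_mul_mul _ _ _ hF.unit,
      orthonormal_iff_ite.1 (frame M x).orthonormal]
    split_ifs <;> simp
  simp only [h1, ite_smul, zero_smul, Finset.sum_ite_eq, Finset.mem_univ, if_true]
  rw [covExtD_eq N.isLeviCivita, sub_self, smul_zero]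

/-- `D^{1/3,A} (ε · ψ) - 2 ε · ψ` vanishes exactly if `ε` satisfies the linearised instanton
equation and the gauge fixing condition. -/
theorem gaugeDirac_oneFormPsi_eq_iff (hε : FormAt ε x) :
    N.gaugeDirac (1 / 3) a (fun y ↦ N.oneFormPsi y (ε y)) x = (2 : ℝ) • N.oneFormPsi x (ε x) ↔
      N.twoFormPsi x (covExtD a ε x) = 0 ∧ covCodiff N.LC a ε x = 0 := by
  have h : N.gaugeDirac (1 / 3) a (fun y ↦ N.oneFormPsi y (ε y)) x =
      (2 : ℝ) • N.oneFormPsi x (ε x) + (N.twoFormPsi x (covExtD a ε x) +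
        N.psi x ⊗ₜ[ℝ] covCodiff N.LC a ε x) := by
    rw [gaugeDirac_third, N.dirac_oneFormPsi hε, pair_psi_oneFormPsi, pair_vol_oneFormPsi]
    simp only [TensorProduct.tmul_zero, add_zero, sub_zero, add_assoc]
  rw [h, add_eq_left]
  refine ⟨fun h1 ↦ ?_, fun ⟨h1, h2⟩ ↦ by rw [h1, h2, TensorProduct.tmul_zero, add_zero]⟩
  have h2 := congrArg (pair (N.psi x)) h1
  rw [map_add, pair_psi_twoFormPsi_covExtD, pair_tmul, (N.isSpinFibre x).unit, one_smul, zero_add,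
    map_zero] at h2
  rw [h2, TensorProduct.tmul_zero, add_zero] at h1
  exact ⟨h1, h2⟩

end Pointwise

variable {B : PrincipalBundle EK K M EP P} (A : B.Connection)

/-- `ε · ψ` as a section of `SM ⊗ Ad_P`. -/
def psiSection (ε : Π x : M, B.Fib x → TangentSpace (𝓡 6) x →L[ℝ] LieAlg EK K) (x : M)
    (p : B.Fib x) : S x ⊗[ℝ] LieAlg EK K := N.oneFormPsi x (ε x p)

theorem inGauge_psiSection (ε : Π x : M, B.Fib x → TangentSpace (𝓡 6) x →L[ℝ] LieAlg EK K)
    (s : M → P) : B.inGauge (N.psiSection ε) s = fun y ↦ N.oneFormPsi y (B.inGauge ε s y) := by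
  ext y
  by_cases hy : B.proj (s y) = y
  · obtain ⟨q, hq⟩ : ∃ q : B.Fib y, s y = q.1 := ⟨⟨s y, hy⟩, rfl⟩
    rw [PrincipalBundle.inGauge_eq ε q hq, PrincipalBundle.inGauge_eq _ q hq, psiSection]
  · simp [PrincipalBundle.inGauge, hy, oneFormPsi]

theorem formAt_inGauge (ε : B.adOneForms) {s : M → P} {U : Set M} (hs : B.IsGauge s U) {x : M}
    (hx : x ∈ U) : FormAt (B.inGauge ε.1 s) x :=
  (ε.2.2 s U hs).contMDiffAt (hs.isOpen.mem_nhds hx)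

theorem psiSection_mem (ε : B.adOneForms) : N.psiSection ε.1 ∈ B.adSpinors S := by
  refine ⟨fun x p g ↦ ?_, fun s U hs l x hx ↦ ?_⟩
  · rw [psiSection, ε.2.1, oneFormPsi_comp, psiSection]
  · rw [inGauge_psiSection]
    exact (N.adSpinorAt_oneFormPsi (formAt_inGauge ε hs hx) l).contMDiffWithinAt

/-- A one-form `ε` is an infinitesimal deformation if and only if `D^{1/3,A} (ε · ψ) = 2 ε · ψ`. -/
theorem isEigen_psiSection_iff (ε : B.adOneForms) :
    N.IsEigen A (N.psiSection ε.1) ↔ ε ∈ N.deformations A := by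
  have key : ∀ (s : M → P) (U : Set M), B.IsGauge s U → ∀ x ∈ U,
      (N.gaugeDirac (1 / 3) (A.gaugeForm s) (B.inGauge (N.psiSection ε.1) s) x =
        (2 : ℝ) • B.inGauge (N.psiSection ε.1) s x ↔
      N.twoFormPsi x (covExtD (A.gaugeForm s) (B.inGauge ε.1 s) x) = 0 ∧
        covCodiff N.LC (A.gaugeForm s) (B.inGauge ε.1 s) x = 0) := by
    intro s U hs x hx
    rw [← N.gaugeDirac_oneFormPsi_eq_iff (formAt_inGauge ε hs hx), inGauge_psiSection]
  exact ⟨fun h s U hs x hx ↦ (key s U hs x hx).1 (h.eq s U hs x hx),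
    fun h ↦ ⟨N.psiSection_mem ε, fun s U hs x hx ↦ (key s U hs x hx).2 (h s U hs x hx)⟩⟩

/-- The vector part of a section of `SM ⊗ Ad_P` is a smooth one-form with values in the adjoint
bundle. -/
theorem formPart_mem {η : Π x : M, B.Fib x → S x ⊗[ℝ] LieAlg EK K} (hη : η ∈ B.adSpinors S) :
    (fun x p ↦ N.formPart (η x p)) ∈ B.adOneForms := by
  refine ⟨fun x p g ↦ ?_, fun s U hs x hx ↦ ?_⟩
  · exact (congrArg N.formPart (hη.1 x p g)).trans (N.formPart_lTensor (Ad g⁻¹) _)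
  · obtain ⟨E, hE, hchart⟩ := exists_isCoordFrame x
    have h : FormAt (B.inGauge (fun x p ↦ N.formPart (η x p)) s) x := by
      refine formAt_of_frame hchart fun i ↦ ?_
      refine ((B.adSpinorAt_inGauge hη hs hx).pair (cliff_contMDiffAt (N := N)
        (hE.contMDiffAt i x (mem_chart_source R6 x))
        (N.contMDiff_psi x))).congr_of_eventuallyEq ?_
      filter_upwards [hs.isOpen.mem_nhds hx] with y hy
      rw [hs.inGauge_eq hy, hs.inGauge_eq hy, formPart_apply]
    exact h.contMDiffWithinAt

variable {A} in
theorem mem_ker_iff [T2Space M] (η : B.adSpinors S) :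
    η ∈ LinearMap.ker (N.diracOp A - (2 : ℝ) • LinearMap.id) ↔ N.IsEigen A η.1 := by
  rw [LinearMap.mem_ker, LinearMap.sub_apply, sub_eq_zero]
  constructor
  · intro h
    refine ⟨η.2, fun s U hs x hx ↦ ?_⟩
    rw [← N.diracOp_isDiracOperator A η s U hs x hx, h]
    exact congrFun (B.inGauge_smul (2 : ℝ) η.1 s) x
  · intro h
    refine Subtype.ext (funext₂ fun x p ↦ ?_)
    obtain ⟨s, U, hs, hx, hp⟩ := B.exists_isGauge x p
    have e := N.diracAt_gauge A η.2 hs hx p hp.symm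
    rw [h.eq s U hs x hx, PrincipalBundle.inGauge_eq η.1 p hp] at e
    exact e

/-- The map `ε ↦ ε · ψ` from the infinitesimal deformations to the kernel of `D^{1/3,A} - 2`. -/
def deformationsToKer [T2Space M] :
    N.deformations A →ₗ[ℝ] LinearMap.ker (N.diracOp A - (2 : ℝ) • LinearMap.id) where
  toFun ε := ⟨⟨N.psiSection ε.1.1, N.psiSection_mem ε.1⟩,
    (N.mem_ker_iff _).2 ((N.isEigen_psiSection_iff A ε.1).2 ε.2)⟩
  map_add' _ _ := Subtype.ext (Subtype.ext (funext₂ fun _ _ ↦ N.oneFormPsi_add _ _))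
  map_smul' c _ := Subtype.ext (Subtype.ext (funext₂ fun _ _ ↦ N.oneFormPsi_smul c _))

/-- Surjectivity: the components of `η` along `ψ` and `vol ψ` vanish, so `η = ε · ψ` with `ε` its
vector part, and the eigenvalue equation for `η` makes `ε` a deformation. -/
theorem bijective_deformationsToKer [T2Space M] [CompactSpace M]
    (hss : LieAlgebra.IsSemisimple ℝ (LieAlg EK K))
    (hAd : ∃ b : LieAlg EK K →ₗ[ℝ] LieAlg EK K →ₗ[ℝ] ℝ,
      (∀ v w, b v w = b w v) ∧ (∀ v, v ≠ 0 → 0 < b v v) ∧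
      ∀ (g : K) v w, b (Ad g v) (Ad g w) = b v w)
    (hinst : N.IsInstanton A) (hirr : A.IsIrreducible) :
    Function.Bijective (N.deformationsToKer A) := by
  constructor
  · intro ε ε' h
    refine Subtype.ext (Subtype.ext (funext₂ fun x p ↦ N.oneFormPsi_injective x ?_))
    exact congrArg (fun η : LinearMap.ker (N.diracOp A - (2 : ℝ) • LinearMap.id) ↦ η.1.1 x p) h
  · rintro ⟨η, hη⟩
    have h := (N.mem_ker_iff η).1 hη
    have hε : N.psiSection (fun x p ↦ N.formPart (η.1 x p)) = η.1 := funext₂ fun x p ↦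
      N.oneFormPsi_formPart (h.pair_eq_zero hss hAd hinst hirr x p).1
        (h.pair_eq_zero hss hAd hinst hirr x p).2
    let ε : B.adOneForms := ⟨fun x p ↦ N.formPart (η.1 x p), N.formPart_mem η.2⟩
    refine ⟨⟨ε, (N.isEigen_psiSection_iff A ε).1 ?_⟩, Subtype.ext (Subtype.ext hε)⟩
    show N.IsEigen A (N.psiSection fun x p ↦ N.formPart (η.1 x p))
    rw [hε]
    exact h

end NearlyKahlerStructure

end Deformations

end NearlyKahler

end

theorem mainTheorem3
    {M : Type*} [TopologicalSpace M] [T2Space M] [CompactSpace M] [ChartedSpace NearlyKahler.R6 M]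
    [IsManifold (𝓡 6) ∞ M]
    [RiemannianBundle (fun x : M ↦ TangentSpace (𝓡 6) x)]
    [IsContMDiffRiemannianBundle (𝓡 6) ∞ NearlyKahler.R6 (fun x : M ↦ TangentSpace (𝓡 6) x)]
    {S : M → Type*} [TopologicalSpace (TotalSpace NearlyKahler.R8 S)]
    [∀ x, NormedAddCommGroup (S x)] [∀ x, InnerProductSpace ℝ (S x)]
    [FiberBundle NearlyKahler.R8 S] [VectorBundle ℝ NearlyKahler.R8 S]
    [ContMDiffVectorBundle ∞ NearlyKahler.R8 S (𝓡 6)]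
    [IsContMDiffRiemannianBundle (𝓡 6) ∞ NearlyKahler.R8 S]
    (N : NearlyKahler.NearlyKahlerStructure M S)
    {EK : Type*} [NormedAddCommGroup EK] [NormedSpace ℝ EK] [FiniteDimensional ℝ EK]
    {K : Type*} [TopologicalSpace K] [Group K] [ChartedSpace EK K] [LieGroup 𝓘(ℝ, EK) ∞ K]
    {EP : Type*} [NormedAddCommGroup EP] [NormedSpace ℝ EP] [FiniteDimensional ℝ EP]
    {P : Type*} [TopologicalSpace P] [ChartedSpace EP P] [IsManifold 𝓘(ℝ, EP) ∞ P]
    (B : NearlyKahler.PrincipalBundle EK K M EP P) (A : B.Connection)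
    (hss : LieAlgebra.IsSemisimple ℝ (NearlyKahler.LieAlg EK K))
    (hAd : ∃ b : NearlyKahler.LieAlg EK K →ₗ[ℝ] NearlyKahler.LieAlg EK K →ₗ[ℝ] ℝ,
      (∀ v w, b v w = b w v) ∧ (∀ v, v ≠ 0 → 0 < b v v) ∧
      ∀ (g : K) v w, b (NearlyKahler.Ad g v) (NearlyKahler.Ad g w) = b v w)
    (hinst : N.IsInstanton A) (hirr : A.IsIrreducible) :
    ∃ D : B.adSpinors S →ₗ[ℝ] B.adSpinors S,
      N.IsDiracOperator A (1 / 3) D ∧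
      NearlyKahler.IsEllipticFirstOrder (D - (2 : ℝ) • LinearMap.id) ∧
      ∃ Φ : N.deformations A ≃ₗ[ℝ] LinearMap.ker (D - (2 : ℝ) • LinearMap.id),
        ∀ (ε : N.deformations A) (x : M) (p : B.Fib x),
          (Φ ε).1.1 x p = N.oneFormPsi x (ε.1.1 x p) := by
  let Φ := LinearEquiv.ofBijective (N.deformationsToKer A)
    (N.bijective_deformationsToKer A hss hAd hinst hirr)
  exact ⟨N.diracOp A, N.diracOp_isDiracOperator A, N.isEllipticFirstOrder_diracOp A 2, Φ,
    fun _ _ _ ↦ rfl⟩
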